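/- Let $\mathbb F=\mathbb Z/2$ and let $m>1$, $0\le k<m$ be integers. **Setup.** Let $G_m$ be the group of isometries of $\mathbb R$ generated by the reflections in $\tfrac12$ and $m-\tfrac12$; it acts on $\mathbb Z$ with fundamental domain $\{1,\dots,m-1\}$. A *lifted partial permutation* on $k$ letters is a $G_m$-equivariant map $\tilde f:\tilde S\to\mathbb Z$ on a $G_m$-invariant set $\tilde S\subset\mathbb Z$ such that $\tilde S/G_m$ has $k$ elements and the induced map $\tilde S/G_m\to\mathbb Z/G_m$ is injective. Its *weight* $\mathbf w(f)\in(\tfrac12\mathbb Z)^m$ has components $\mathbf w_i(f)=\tfrac12\#\{j\in\tilde S: i-\tfrac12 \text{ lies strictly between } j \text{ and } \tilde f(j)\}$. A *crossing* is a class $\langle i,j\rangle$, modulo $G_m$ and exchange of $i,j$, of pairs $(i,j)\in\tilde S\times\tilde S$ for which $i-j$ and $\tilde f(i)-\tilde f(j)$ have different signs; $\mathrm{cr}(f)$ is the number of crossings. The *resolution* $f_{\langle i,j\rangle}$ is obtained from $\tilde f$ by exchanging the values at $\gamma i$ and $\gamma j$ for all $\gamma\in G_m$. The *pong algebra* $P$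 is the free $\mathbb F[v_1,\dots,v_m]$-module on the lifted partial permutations, with the following operations, extended linearly, where $v(\cdot,\cdot)$ denotes the monomial that makes the operation preserve the weight, $v_i$ having weight the $i$-th basis vector. The product is $g\cdot f=v(f,g)\,(\tilde g\circ\tilde f)$ if the domain of $\tilde g$ is the image of $\tilde f$ and $\mathrm{cr}(\tilde g\circ \tilde f)=\mathrm{cr}(g)+\mathrm{cr}(f)$, and $g\cdot f=0$ otherwise. The differential is $df=\sum_c v(f,c)\,f_c$, the sum over the crossings $c$ of $f$ with $\mathrm{cr}(f_c)=\mathrm{cr}(f)-1$. Let $Q=P/(v_1,\dots,v_m)$. For $0<i<m$ let $\mathcal X_{0,i}$ (respectively $\mathcal X_{i,m}$) be the sum of all lifted partial permutations on $k$ letters with $i\mapsto 1-i$ (respectively $i\mapsto 2m-1-i$) that fix every other element of their domain in $\{1,\dots,m-1\}$. Let $\Omega=\sum_{0<i<m}[\mathcal X_{0,i},\mathcal X_{i,m}]$. Let $Q'=Q\oplus XQ$ be obtained from $Q$ by adjoining a central element $X$ with $X^2=0$ and $dX=\Omega$, the weight of $X$ being $(1,\dots,1)$. An *idempotent state* is a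 $k$-element subset $\mathbf x=\{x_1<\dots<x_k\}$ of $\{1,\dots,m-1\}$, and $I_{\mathbf x}$ is the identity map of the $G_m$-orbits of $\mathbf x$. For idempotent states $\mathbf x,\mathbf y$ and $w\in(\tfrac12\mathbb Z)^m$, let $Q'(\mathbf x,\mathbf y;w)$ be the subcomplex $I_{\mathbf x}\cdot Q'(w)\cdot I_{\mathbf y}$, where $Q'(w)$ is the part of weight $w$. The triple $(\mathbf x,\mathbf y;w)$ is *compatible* if $2w_i+\#\{t:x_t<i\}+\#\{t:y_t<i\}$ is an even integer for each $i=1,\dots,m$. **Theorem.** Let $(\mathbf x,\mathbf y;w)$ be a compatible triple. Then $H_*(Q'(\mathbf x,\mathbf y;w))=0$ unless all of the following conditions hold: 1. $\max(x_s,y_s)<\min(x_{s+1},y_{s+1})$ for each $s=1,\dots,k-1$; 2. $0\le w_i\le 1$ for each $i=1,\dots,m$; 3. $w_p=w_{p+1}$ for each $p\in\{1,\dots,m-1\}$ with $p\notin\mathbf x\cup\mathbf y$. If all of these conditions hold, then $H_*(Q'(\mathbf x,\mathbf y;w))\cong\mathbb F$, where $H_*$ denotes the total homology. -/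

import Mathlib

/-! # The pong algebra, its quotient `Q`, and the extension `Q'` -/

noncomputable section

namespace PongAlg

/-! ### The reflection group `G_m` acting on `ℤ` -/

/-- The reflection `x ↦ c - x` of `ℤ`, that is, the reflection `r_t` about the point `t = c / 2`. -/
def refl (c : ℤ) : Equiv.Perm ℤ := Equiv.subLeft c

/-- The group `G_m` generated by the reflections `r_{1/2}` and `r_{m - 1/2}`. -/
def G (m : ℕ) : Subgroup (Equiv.Perm ℤ) := Subgroup.closure {refl 1, refl (2 * (m : ℤ) - 1)}

theorem G_form {m : ℕ} {γ : Equiv.Perm ℤ} (h : γ ∈ G m) :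
    (∃ n : ℤ, ∀ i, γ i = i + n * (2 * (m : ℤ) - 2)) ∨
      (∃ n : ℤ, ∀ i, γ i = 1 - i + n * (2 * (m : ℤ) - 2)) := by
  induction h using Subgroup.closure_induction with
  | mem x hx =>
    rcases hx with rfl | rfl
    · exact Or.inr ⟨0, fun i => by simp [refl]⟩
    · exact Or.inr ⟨1, fun i => by simp [refl]; ring⟩
  | one => exact Or.inl ⟨0, fun i => by simp⟩
  | mul x y _ _ hx hy =>
    rcases hx with ⟨a, ha⟩ | ⟨a, ha⟩ <;> rcases hy with ⟨b, hb⟩ | ⟨b, hb⟩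
    · exact Or.inl ⟨a + b, fun i => by rw [Equiv.Perm.mul_apply, ha, hb]; ring⟩
    · exact Or.inr ⟨a + b, fun i => by rw [Equiv.Perm.mul_apply, ha, hb]; ring⟩
    · exact Or.inr ⟨a - b, fun i => by rw [Equiv.Perm.mul_apply, ha, hb]; ring⟩
    · exact Or.inl ⟨a - b, fun i => by rw [Equiv.Perm.mul_apply, ha, hb]; ring⟩
  | inv x _ hx =>
    rcases hx with ⟨a, ha⟩ | ⟨a, ha⟩
    · exact Or.inl ⟨-a, fun i => by rw [Equiv.Perm.inv_eq_iff_eq, ha]; ring⟩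
    · exact Or.inr ⟨a, fun i => by rw [Equiv.Perm.inv_eq_iff_eq, ha]; ring⟩

/-- The action of `G_m` on `ℤ` is free. -/
theorem G_free {m : ℕ} {γ δ : G m} {i : ℤ} (h : γ • i = δ • i) : γ = δ := by
  have h' : (γ : Equiv.Perm ℤ) i = (δ : Equiv.Perm ℤ) i := h
  apply Subtype.ext
  ext k
  rcases G_form γ.2 with ⟨a, ha⟩ | ⟨a, ha⟩ <;> rcases G_form δ.2 with ⟨b, hb⟩ | ⟨b, hb⟩ <;>
    rw [ha, hb] at *
  · linarith
  · exfalso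
    have : 2 * i = 2 * ((b - a) * ((m : ℤ) - 1)) + 1 := by linarith
    omega
  · exfalso
    have : 2 * i = 2 * ((a - b) * ((m : ℤ) - 1)) + 1 := by linarith
    omega
  · linarith

/-- `i` and `j` represent the same point of `ℤ / G_m`. -/
def Equivalent (m : ℕ) (i j : ℤ) : Prop := ∃ γ : G m, γ • i = j

theorem Equivalent.refl' {m : ℕ} (i : ℤ) : Equivalent m i i := ⟨1, one_smul _ i⟩

theorem Equivalent.symm {m : ℕ} {i j : ℤ} (h : Equivalent m i j) : Equivalent m j i := by
  obtain ⟨γ, rfl⟩ := h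
  exact ⟨γ⁻¹, inv_smul_smul γ i⟩

theorem Equivalent.trans {m : ℕ} {i j k : ℤ} (h : Equivalent m i j) (h' : Equivalent m j k) :
    Equivalent m i k := by
  obtain ⟨γ, rfl⟩ := h
  obtain ⟨δ, rfl⟩ := h'
  exact ⟨δ * γ, mul_smul δ γ i⟩

/-- The quotient `ℤ / G_m`. -/
abbrev Orbits (m : ℕ) : Type := MulAction.orbitRel.Quotient (G m) ℤ

/-- The class in `ℤ / G_m` of an integer. -/
def orb (m : ℕ) (i : ℤ) : Orbits m := Quotient.mk _ i

/-! ### Lifted partial permutations -/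

/-- A lifted partial permutation on `k` letters.  The map `f̃ : S̃ → ℤ` on a subset `S̃ ⊆ ℤ` is
recorded as a partial function: `S̃` is the set of `i` with `toFun i ≠ none`, and
`toFun i = some a` says that `i ∈ S̃` and `f̃ i = a`. -/
@[ext]
structure LPP (m k : ℕ) where
  toFun : ℤ → Option ℤ
  /-- `S̃` is `G_m`-invariant and `f̃` is `G_m`-equivariant. -/
  equivariant : ∀ (γ : G m) (i : ℤ), toFun (γ • i) = (toFun i).map (fun a => γ • a)
  /-- `S̃ / G_m` has `k` elements. -/
  card_orbits : (orb m '' {i | ∃ a, toFun i = some a}).ncard = k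
  /-- The induced map `S̃ / G_m → ℤ / G_m` is injective. -/
  inj : ∀ i j a b : ℤ, toFun i = some a → toFun j = some b → Equivalent m a b → Equivalent m i j

namespace LPP

variable {m k : ℕ}

/-- The domain `S̃`. -/
def dom (f : LPP m k) : Set ℤ := {i | ∃ a, f.toFun i = some a}

/-- The image `f̃(S̃)`. -/
def ran (f : LPP m k) : Set ℤ := {a | ∃ i, f.toFun i = some a}

/-- The composite `g̃ ∘ f̃`, defined when the domain of `g̃` is the image of `f̃`. -/
def comp (g f : LPP m k) (h : g.dom = f.ran) : LPP m k where
  toFun i := (f.toFun i).bind g.toFun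
  equivariant γ i := by
    rw [f.equivariant]
    cases f.toFun i with
    | none => rfl
    | some a => simpa using g.equivariant γ a
  card_orbits := by
    have : {i | ∃ a, (f.toFun i).bind g.toFun = some a} = {i | ∃ a, f.toFun i = some a} := by
      ext i
      constructor
      · rintro ⟨a, ha⟩
        obtain ⟨b, hb, -⟩ := Option.bind_eq_some_iff.1 ha
        exact ⟨b, hb⟩
      · rintro ⟨b, hb⟩
        have hb' : b ∈ g.dom := by rw [h]; exact ⟨i, hb⟩
        obtain ⟨a, ha⟩ := hb'
        exact ⟨a, Option.bind_eq_some_iff.2 ⟨b, hb, ha⟩⟩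
    rw [this]
    exact f.card_orbits
  inj i j a b hi hj hab := by
    obtain ⟨a', hi, ha⟩ := Option.bind_eq_some_iff.1 hi
    obtain ⟨b', hj, hb⟩ := Option.bind_eq_some_iff.1 hj
    exact f.inj i j a' b' hi hj (g.inj a' b' a b ha hb hab)

/-! ### Local multiplicities -/

/-- The local multiplicity at the half-integer `j - 1/2`:  half of the number of `i ∈ S̃` with
`i < j - 1/2 < f̃ i` or `f̃ i < j - 1/2 < i`. -/
def mult (f : LPP m k) (j : ℤ) : ℚ :=
  (({i | ∃ a, f.toFun i = some a ∧ ((i < j ∧ j ≤ a) ∨ (a < j ∧ j ≤ i))} : Set ℤ).ncard : ℚ) / 2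

/-- The vector of local multiplicities.  Its component with (zero-based) index `i : Fin m` is the
multiplicity at `(i + 1) - 1/2`; it is what is usually called the component number `i + 1`. -/
def weight (f : LPP m k) : Fin m → ℚ := fun i => f.mult ((i : ℕ) + 1 : ℤ)

/-! ### Crossings -/

/-- The pair `(i, j) ∈ S̃ × S̃` is a lifted crossing: `i - j` and `f̃ i - f̃ j` have different
signs. -/
def IsLiftedCrossing (f : LPP m k) (p : ℤ × ℤ) : Prop :=
  ∃ a b, f.toFun p.1 = some a ∧ f.toFun p.2 = some b ∧
    SignType.sign (p.1 - p.2) ≠ SignType.sign (a - b)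

end LPP

/-- The equivalence classes `⟨i, j⟩` of pairs of integers under the relation generated by
`(i, j) ∼ (j, i)` and `(i, j) ∼ (γ i, γ j)` for `γ ∈ G_m`. -/
def PairClass (m : ℕ) : Type :=
  Quot (fun p q : ℤ × ℤ => q = p.swap ∨ ∃ γ : G m, q = (γ • p.1, γ • p.2))

/-- The class `⟨i, j⟩`. -/
def PairClass.mk (m : ℕ) (p : ℤ × ℤ) : PairClass m := Quot.mk _ p

namespace LPP

variable {m k : ℕ}

/-- The set of crossings of `f`. -/
def Cross (f : LPP m k) : Set (PairClass m) := PairClass.mk m '' {p | f.IsLiftedCrossing p}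

/-- The crossing number of `f`. -/
def cross (f : LPP m k) : ℕ := f.Cross.ncard

end LPP

/-! ### Resolutions -/

open Classical in
/-- The map `T : ℤ → ℤ` with `T (γ i) = γ j` and `T (γ j) = γ i` for `γ ∈ G_m`, and `T k = k` if
`k` is equivalent neither to `i` nor to `j`.  (If `i` and `j` are equivalent and form a crossing,
then they are exchanged by an involution in `G_m`, and the two clauses agree.) -/
def swapOrbits (m : ℕ) (i j k : ℤ) : ℤ :=
  if h : ∃ γ : G m, γ • i = k then h.choose • j
  else if h : ∃ γ : G m, γ • j = k then h.choose • i
  else k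

theorem swapOrbits_left {m : ℕ} (i j : ℤ) (γ : G m) : swapOrbits m i j (γ • i) = γ • j := by
  have h : ∃ δ : G m, δ • i = γ • i := ⟨γ, rfl⟩
  rw [swapOrbits, dif_pos h, G_free h.choose_spec]

theorem swapOrbits_right {m : ℕ} (i j : ℤ) (γ : G m) (hij : ¬ Equivalent m i j) :
    swapOrbits m i j (γ • j) = γ • i := by
  have h : ∃ δ : G m, δ • j = γ • j := ⟨γ, rfl⟩
  have h' : ¬ ∃ δ : G m, δ • i = γ • j := fun hn =>
    hij (Equivalent.trans hn (Equivalent.symm ⟨γ, rfl⟩))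
  rw [swapOrbits, dif_neg h', dif_pos h, G_free h.choose_spec]

theorem swapOrbits_of_not {m : ℕ} {i j k : ℤ} (hi : ¬ Equivalent m i k) (hj : ¬ Equivalent m j k) :
    swapOrbits m i j k = k := by
  unfold Equivalent at hi hj
  rw [swapOrbits, dif_neg hi, dif_neg hj]

theorem swapOrbits_smul {m : ℕ} (i j k : ℤ) (γ : G m) :
    swapOrbits m i j (γ • k) = γ • swapOrbits m i j k := by
  by_cases hi : Equivalent m i k
  · obtain ⟨δ, rfl⟩ := hi
    rw [smul_smul, swapOrbits_left, swapOrbits_left, smul_smul]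
  · by_cases hj : Equivalent m j k
    · obtain ⟨δ, rfl⟩ := hj
      have hij : ¬ Equivalent m i j := fun h => hi (h.trans ⟨δ, rfl⟩)
      rw [smul_smul, swapOrbits_right _ _ _ hij, swapOrbits_right _ _ _ hij, smul_smul]
    · have hk : Equivalent m (γ • k) k := Equivalent.symm ⟨γ, rfl⟩
      rw [swapOrbits_of_not hi hj, swapOrbits_of_not (fun h => hi (h.trans hk))
        (fun h => hj (h.trans hk))]

theorem swapOrbits_inj {m : ℕ} {i j k l : ℤ}
    (h : Equivalent m (swapOrbits m i j k) (swapOrbits m i j l)) : Equivalent m k l := by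
  have key : ∀ k : ℤ, (Equivalent m i k ∧ Equivalent m j (swapOrbits m i j k)) ∨
      (Equivalent m j k ∧ Equivalent m i (swapOrbits m i j k) ∧ ¬ Equivalent m i k) ∨
      (¬ Equivalent m i k ∧ ¬ Equivalent m j k ∧ swapOrbits m i j k = k) := by
    intro k
    by_cases hi : Equivalent m i k
    · left
      refine ⟨hi, ?_⟩
      obtain ⟨δ, rfl⟩ := hi
      exact ⟨δ, (swapOrbits_left i j δ).symm⟩
    · right
      by_cases hj : Equivalent m j k
      · left
        refine ⟨hj, ?_, hi⟩
        obtain ⟨δ, rfl⟩ := hj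
        have hij : ¬ Equivalent m i j := fun h => hi (h.trans ⟨δ, rfl⟩)
        exact ⟨δ, (swapOrbits_right i j δ hij).symm⟩
      · exact Or.inr ⟨hi, hj, swapOrbits_of_not hi hj⟩
  rcases key k with ⟨h1, h2⟩ | ⟨h1, h2, h3⟩ | ⟨h1, h2, h3⟩ <;>
    rcases key l with ⟨g1, g2⟩ | ⟨g1, g2, g3⟩ | ⟨g1, g2, g3⟩
  · exact h1.symm.trans g1
  · exact absurd ((g2.trans (h2.trans h).symm).trans g1) g3
  · exact absurd (g3 ▸ h2.trans h) g2
  · exact absurd ((h2.trans (g2.trans h.symm).symm).trans h1) h3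
  · exact h1.symm.trans g1
  · exact absurd (g3 ▸ h2.trans h) g1
  · exact absurd (h3 ▸ g2.trans h.symm) h2
  · exact absurd (h3 ▸ g2.trans h.symm) h1
  · rwa [h3, g3] at h

namespace LPP

variable {m k : ℕ}

theorem mem_dom_of_equivalent (f : LPP m k) {i j : ℤ} (h : Equivalent m i j) (hi : i ∈ f.dom) :
    j ∈ f.dom := by
  obtain ⟨γ, rfl⟩ := h
  obtain ⟨a, ha⟩ := hi
  exact ⟨γ • a, by rw [f.equivariant, ha]; rfl⟩

theorem swapOrbits_mem_dom (f : LPP m k) {i j : ℤ} (hi : i ∈ f.dom) (hj : j ∈ f.dom) (l : ℤ) :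
    swapOrbits m i j l ∈ f.dom ↔ l ∈ f.dom := by
  by_cases hil : Equivalent m i l
  · have h1 := f.mem_dom_of_equivalent hil hi
    obtain ⟨δ, rfl⟩ := hil
    rw [swapOrbits_left]
    exact ⟨fun _ => h1, fun _ => f.mem_dom_of_equivalent ⟨δ, rfl⟩ hj⟩
  · by_cases hjl : Equivalent m j l
    · have h1 := f.mem_dom_of_equivalent hjl hj
      obtain ⟨δ, rfl⟩ := hjl
      have hij : ¬ Equivalent m i j := fun h => hil (h.trans ⟨δ, rfl⟩)
      rw [swapOrbits_right _ _ _ hij]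
      exact ⟨fun _ => h1, fun _ => f.mem_dom_of_equivalent ⟨δ, rfl⟩ hi⟩
    · rw [swapOrbits_of_not hil hjl]

/-- The map obtained from `f̃` by exchanging the values at `γ i` and `γ j`, for all `γ ∈ G_m`. -/
def resolveAt (f : LPP m k) (i j : ℤ) (hi : i ∈ f.dom) (hj : j ∈ f.dom) : LPP m k where
  toFun l := f.toFun (swapOrbits m i j l)
  equivariant γ l := by rw [swapOrbits_smul, f.equivariant]
  card_orbits := by
    have : {l | ∃ a, f.toFun (swapOrbits m i j l) = some a} = {i | ∃ a, f.toFun i = some a} :=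
      Set.ext (f.swapOrbits_mem_dom hi hj)
    rw [this]
    exact f.card_orbits
  inj a b c d ha hb hcd := swapOrbits_inj (f.inj _ _ c d ha hb hcd)

theorem IsLiftedCrossing.fst_mem {f : LPP m k} {p : ℤ × ℤ} (h : f.IsLiftedCrossing p) :
    p.1 ∈ f.dom := by
  obtain ⟨a, b, ha, -, -⟩ := h
  exact ⟨a, ha⟩

theorem IsLiftedCrossing.snd_mem {f : LPP m k} {p : ℤ × ℤ} (h : f.IsLiftedCrossing p) :
    p.2 ∈ f.dom := by
  obtain ⟨a, b, -, hb, -⟩ := h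
  exact ⟨b, hb⟩

/-- The resolution `f_c` of `f` at a crossing `c = ⟨i, j⟩` (it does not depend on which lifted
crossing `(i, j)` represents `c`). -/
def resolve (f : LPP m k) (c : f.Cross) : LPP m k :=
  f.resolveAt c.2.choose.1 c.2.choose.2 (IsLiftedCrossing.fst_mem c.2.choose_spec.1)
    (IsLiftedCrossing.snd_mem c.2.choose_spec.1)

end LPP

/-! ### The pong algebra -/

/-- The base ring `𝔽[v_1, …, v_m]` of the pong algebra, where `𝔽 = ℤ/2`. -/
abbrev Base (m : ℕ) : Type := MvPolynomial (Fin m) (ZMod 2)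

/-- The monomial `v_1^{a_1} ⋯ v_m^{a_m}`, for a vector `a` of non-negative integers. -/
def vMonomial {m : ℕ} (a : Fin m → ℚ) : Base m := ∏ i, MvPolynomial.X i ^ ⌊a i⌋₊

/-- The pong algebra, as a module: the free module over `𝔽[v_1, …, v_m]` on the lifted partial
permutations. -/
abbrev Pong (m k : ℕ) : Type := LPP m k →₀ Base m

namespace Pong

variable {m k : ℕ}

/-- The pure algebra element corresponding to a lifted partial permutation. -/
def pure (f : LPP m k) : Pong m k := Finsupp.single f 1

open Classical in
/-- The product `g · f` of pure algebra elements.  It is `v(f, g) · (g̃ ∘ f̃)` if `g̃` and `f̃` can be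
composed and the crossing numbers add up, and it is `0` otherwise; the monomial `v(f, g)` is the one
for which the weight of the product is the sum of the weights. -/
def mulPure (g f : LPP m k) : Pong m k :=
  if h : g.dom = f.ran then
    if (g.comp f h).cross = g.cross + f.cross then
      vMonomial (f.weight + g.weight - (g.comp f h).weight) • pure (g.comp f h)
    else 0
  else 0

/-- The multiplication of the pong algebra. -/
def mul : Pong m k →ₗ[Base m] Pong m k →ₗ[Base m] Pong m k :=
  Finsupp.linearCombination (Base m)
    (fun g => Finsupp.linearCombination (Base m) (fun f => mulPure g f))

open Classical in
/-- The contribution `∂_c f` of a crossing `c` of `f` to the differential of `f`: it is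
`v(f, c) · f_c` if the resolution drops the crossing number by exactly one, and `0` otherwise; the
monomial `v(f, c)` is the one for which the weight is preserved. -/
def dCrossing (f : LPP m k) (c : f.Cross) : Pong m k :=
  if (f.resolve c).cross + 1 = f.cross then
    vMonomial (f.weight - (f.resolve c).weight) • pure (f.resolve c)
  else 0

/-- The differential of the pong algebra: the sum of `∂_c f` over the (finitely many) crossings of
`f`, extended linearly. -/
def d : Pong m k →ₗ[Base m] Pong m k :=
  Finsupp.linearCombination (Base m) (fun f => ∑ᶠ c : f.Cross, dCrossing f c)

/-- The sum, over the (finitely many) lifted partial permutations on `k` letters that satisfy `p`,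
of the corresponding pure algebra elements. -/
def sumOf (p : LPP m k → Prop) : Pong m k := ∑ᶠ f : {f : LPP m k // p f}, pure f.1

/-- The idempotent `I_x` of a set `x ⊆ {1, …, m - 1}`: the lifted partial permutation with
`S = x` and `f̃ = id`. -/
def idem (m k : ℕ) (x : Finset ℤ) : Pong m k :=
  sumOf fun f => ∀ l ∈ Finset.Icc (1 : ℤ) (m - 1), f.toFun l = if l ∈ x then some l else none

/-- The element `𝒳_{0,j}`: one strand from `j` to itself with one left cusp, that is
`f j = r_{1/2}(j)`, and all other strands stationary. -/
def X0 (m k : ℕ) (j : ℤ) : Pong m k :=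
  sumOf fun f => f.toFun j = some (refl 1 j) ∧
    ∀ l ∈ Finset.Icc (1 : ℤ) (m - 1), l ≠ j → l ∈ f.dom → f.toFun l = some l

/-- The element `𝒳_{i,m}`: one strand from `i` to itself with one right cusp, that is
`f i = r_{m-1/2}(i)`, and all other strands stationary. -/
def Xm (m k : ℕ) (i : ℤ) : Pong m k :=
  sumOf fun f => f.toFun i = some (refl (2 * (m : ℤ) - 1) i) ∧
    ∀ l ∈ Finset.Icc (1 : ℤ) (m - 1), l ≠ i → l ∈ f.dom → f.toFun l = some l

/-- `Ω = ∑_{0 < i < m} [𝒳_{0,i}, 𝒳_{i,m}]`. -/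
def Omega (m k : ℕ) : Pong m k :=
  ∑ i ∈ Finset.Icc (1 : ℤ) (m - 1),
    (mul (X0 m k i) (Xm m k i) - mul (Xm m k i) (X0 m k i))

/-- The homogeneous part of weight `w`; the variable `v_i` has weight the `i`-th basis vector. -/
def weightPart (m k : ℕ) (w : Fin m → ℚ) : Submodule (ZMod 2) (Pong m k) :=
  Submodule.span (ZMod 2)
    {a | ∃ (n : Fin m →₀ ℕ) (f : LPP m k), (∀ i, (n i : ℚ) + f.weight i = w i) ∧
      a = MvPolynomial.monomial n (1 : ZMod 2) • pure f}

/-- The ideal of the pong algebra generated by the central elements `v_1, …, v_m`. -/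
def vIdeal (m k : ℕ) : Submodule (Base m) (Pong m k) :=
  Ideal.span (Set.range (MvPolynomial.X : Fin m → Base m)) • ⊤

theorem vIdeal_le_comap (φ : Pong m k →ₗ[Base m] Pong m k) :
    vIdeal m k ≤ (vIdeal m k).comap φ := by
  rw [← Submodule.map_le_iff_le_comap, vIdeal, Submodule.map_smul'']
  exact Submodule.smul_mono le_rfl le_top

end Pong

/-! ### The quotient `Q` -/

/-- The quotient `Q` of the pong algebra by the ideal generated by `v_1, …, v_m`. -/
abbrev Quo (m k : ℕ) : Type := Pong m k ⧸ Pong.vIdeal m k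

namespace Quo

variable {m k : ℕ}

/-- The projection from the pong algebra to `Q`. -/
def proj (m k : ℕ) : Pong m k →ₗ[Base m] Quo m k := (Pong.vIdeal m k).mkQ

/-- The differential of `Q`. -/
def d : Quo m k →ₗ[Base m] Quo m k :=
  (Pong.vIdeal m k).mapQ (Pong.vIdeal m k) Pong.d (Pong.vIdeal_le_comap _)

/-- The multiplication of `Q`. -/
def mul : Quo m k →ₗ[Base m] Quo m k →ₗ[Base m] Quo m k :=
  (Pong.vIdeal m k).liftQ
    { toFun := fun a => (Pong.vIdeal m k).mapQ (Pong.vIdeal m k) (Pong.mul a)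
        (Pong.vIdeal_le_comap _)
      map_add' := fun a b => by
        apply Submodule.linearMap_qext
        ext1 f
        ext
        simp
      map_smul' := fun r a => by
        apply Submodule.linearMap_qext
        ext1 f
        ext
        simp }
    (fun a ha => by
      rw [LinearMap.mem_ker]
      apply Submodule.linearMap_qext
      apply LinearMap.ext
      intro b
      simp only [LinearMap.coe_comp, Function.comp_apply, Submodule.mkQ_apply, LinearMap.coe_mk,
        AddHom.coe_mk, Submodule.mapQ_apply, LinearMap.zero_apply]
      rw [Submodule.Quotient.mk_eq_zero]
      exact Pong.vIdeal_le_comap (Pong.mul.flip b) ha)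

theorem mul_proj (a b : Pong m k) : mul (proj m k a) (proj m k b) = proj m k (Pong.mul a b) := rfl

/-- The part `Q(w)` of `Q` of weight `w`. -/
def weightPart (m k : ℕ) (w : Fin m → ℚ) : Submodule (ZMod 2) (Quo m k) :=
  (Pong.weightPart m k w).map ((proj m k).restrictScalars (ZMod 2))

/-- The idempotent `I_x` in `Q`. -/
def idem (m k : ℕ) (x : Finset ℤ) : Quo m k := proj m k (Pong.idem m k x)

/-- The element `Ω` of `Q`. -/
def Omega (m k : ℕ) : Quo m k := proj m k (Pong.Omega m k)

end Quo

/-! ### Adjoining `X` with `dX = Ω` -/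

/-- The complex `Q'` obtained from `Q` by adjoining a central element `X` with `X² = 0` and
`dX = Ω`: the pair `(a, b)` stands for `a + X b`. -/
abbrev QuoX (m k : ℕ) : Type := Quo m k × Quo m k

namespace QuoX

variable {m k : ℕ}

/-- The differential of `Q'`:  `d (a + X b) = (d a + Ω b) + X (d b)`. -/
def d (m k : ℕ) : QuoX m k →ₗ[ZMod 2] QuoX m k :=
  ((Quo.d ∘ₗ LinearMap.fst (Base m) (Quo m k) (Quo m k) +
      Quo.mul (Quo.Omega m k) ∘ₗ LinearMap.snd (Base m) (Quo m k) (Quo m k)).prod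
    (Quo.d ∘ₗ LinearMap.snd (Base m) (Quo m k) (Quo m k))).restrictScalars (ZMod 2)

/-- The part `Q'(w)` of `Q'` of weight `w`; the element `X` has the weight `(1, …, 1)` of `Ω`. -/
def weightPart (m k : ℕ) (w : Fin m → ℚ) : Submodule (ZMod 2) (QuoX m k) :=
  (Quo.weightPart m k w).prod (Quo.weightPart m k (w - 1))

/-- The map `c ↦ I_x · c · I_y` from `Q'` to itself. -/
def sandwich (m k : ℕ) (x y : Finset ℤ) : QuoX m k →ₗ[ZMod 2] QuoX m k :=
  let s : Quo m k →ₗ[Base m] Quo m k := Quo.mul.flip (Quo.idem m k y) ∘ₗ Quo.mul (Quo.idem m k x)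
  (s.prodMap s).restrictScalars (ZMod 2)

/-- `Q'(x, y; w) = I_x · Q'(w) · I_y`. -/
def part (m k : ℕ) (x y : Finset ℤ) (w : Fin m → ℚ) : Submodule (ZMod 2) (QuoX m k) :=
  (weightPart m k w).map (sandwich m k x y)

/-- The cycles in `Q'(x, y; w)`. -/
def cycles (m k : ℕ) (x y : Finset ℤ) (w : Fin m → ℚ) : Submodule (ZMod 2) (QuoX m k) :=
  part m k x y w ⊓ LinearMap.ker (d m k)

/-- The boundaries in `Q'(x, y; w)`. -/
def boundaries (m k : ℕ) (x y : Finset ℤ) (w : Fin m → ℚ) : Submodule (ZMod 2) (QuoX m k) :=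
  (part m k x y w).map (d m k)

/-- The (total) homology `H_*(Q'(x, y; w))`, a vector space over `𝔽`: cycles modulo boundaries.
(Since `d ∘ d = 0`, all boundaries are cycles; formally the quotient is by those that are.) -/
abbrev Homology (m k : ℕ) (x y : Finset ℤ) (w : Fin m → ℚ) : Type :=
  cycles m k x y w ⧸ (boundaries m k x y w).submoduleOf (cycles m k x y w)

end QuoX

/-! ### Idempotent states and compatible triples -/

/-- An idempotent state: a `k`-element subset of `{1, …, m - 1}`. -/
structure IdemState (m k : ℕ) where
  carrier : Finset ℤ
  subset : carrier ⊆ Finset.Icc (1 : ℤ) (m - 1)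
  card : carrier.card = k

/-- The elements `x_1 < ⋯ < x_k` of an idempotent state, in increasing order. -/
def IdemState.elt {m k : ℕ} (x : IdemState m k) (s : Fin k) : ℤ := x.carrier.orderEmbOfFin x.card s

/-- The triple `(x, y; w)` is compatible: `w ∈ (½ℤ)^m`, and `2 w_i + #{x_t < i} + #{y_t < i}` is an
even integer for `i = 1, …, m` (here `i` is replaced by `i + 1` for zero-based `i`). -/
def Compatible {m k : ℕ} (x y : IdemState m k) (w : Fin m → ℚ) : Prop :=
  ∀ i : Fin m, ∃ n : ℤ, 2 * w i = n ∧
    Even (n + ((x.carrier.filter (· < ((i : ℕ) + 1 : ℤ))).card : ℤ)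
      + ((y.carrier.filter (· < ((i : ℕ) + 1 : ℤ))).card : ℤ))

/-- `max(x_s, y_s) < min(x_{s+1}, y_{s+1})` for `s = 1, …, k - 1`. -/
def Interleaved {m k : ℕ} (x y : IdemState m k) : Prop :=
  ∀ s t : Fin k, (s : ℕ) + 1 = t → max (x.elt s) (y.elt s) < min (x.elt t) (y.elt t)

/-- `0 ≤ w_i ≤ 1` for all `i`. -/
def BoundedWeight {m : ℕ} (w : Fin m → ℚ) : Prop := ∀ i, 0 ≤ w i ∧ w i ≤ 1

/-- `w_p = w_{p+1}` for each position `p ∈ {1, …, m - 1}` that belongs neither to `x` nor to `y`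
(with one-based `p`; the two walls next to the position `p` have the zero-based indices `p - 1` and
`p`). -/
def ConstantOffStates {m k : ℕ} (x y : IdemState m k) (w : Fin m → ℚ) : Prop :=
  ∀ i j : Fin m, (i : ℕ) + 1 = j → (j : ℤ) ∉ x.carrier → (j : ℤ) ∉ y.carrier → w i = w j

end PongAlg

end

/-! A lifted partial permutation is pictured as a `G m`-equivariant family of strands on `ℤ`. The
mirror `l ↦ 1 - l` exchanges motion to the left and to the right, so it suffices to follow
right-moving strands. The level at `g` is the number of strands that pass `g - 1/2` from the left,
where `X` counts as one more strand passing everywhere. The weight gives the sum of the level at `g`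
and the level at the mirror point `2 - g`; the states `x` and `y` give the difference. Hence all
levels are determined by `(x, y; w)` (`up_of_mem_gens`, `level_eq`).

Setting the `v_i` to zero keeps exactly the terms whose weight is preserved without a monomial. A
crossing then contributes to the differential if and only if, up to the mirror, neither strand moves
left and the resolution is a Bruhat cover: no strand lies in the rectangle of the inversion, and an
affine condition holds (`contributes_iff`, `isCover_iff`). Multiplication by `Ω` prolongs by a full
turn a right-moving or stationary strand that is not overtaken (`coeff_Omega_mul_pure`). So `Q'(x,
y; w)` has a finite basis of elements `f` and `X b`, on which the differential is the relation
`Rel`.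

That this differential squares to zero is checked on injective periodic maps `ℤ → ℤ`, obtained by
choosing one strand from each mirror pair. Introducing an adjacent crossing is a homotopy from the
identity to zero for the resolution operator (`cov_adj`), and it commutes with full turns
(`ext_adj`). Induction from increasing maps gives `cov_cov` and `cov_ext`, hence `sqZero`.

The homology is computed by a form of discrete Morse theory. Its dimension is the number of
generators minus twice the rank of the differential, and a triangular matching bounds this rank from
below (`card_le_finrank_range`). A complete matching gives homology zero; a matching that misses one
generator gives `𝔽`.

If some level is at least two, the generators are paired by crossing or uncrossing the first two
strands that pass there. When these two are translates of one strand, the partner is a multiple of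
`X`. This matching is complete (`matching_of_two_le`).

If all levels are at most one, every term of the differential breaks a passing strand at a fixed
point (`exists_breakAt_of_rel`), and `X` plays the role of a loop without ends. At a common point of
`x` and `y` that is passed on both sides in both directions there are three local states: fixed,
broken on the right-moving strand, broken on the left-moving strand; the differential sends the
first to the other two. So the complex behaves like a tensor product of copies of `𝔽 → 𝔽²`. Matching
fixed with right-broken at the first site that is not left-broken (`Sites.matching`) leaves only the
generator in which every site is left-broken. Under the three conditions it exists and is unique
(`Flow.exists_lpp`, `eq_of_flat`); if nothing ever ends, it is `X` times the empty permutation.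

If interleaving fails while generators exist and all levels are at most one, some common point can
be broken in one direction only. The local factor is then the acyclic complex `𝔽 → 𝔽`, and the
matching is complete. The other two conditions hold automatically as soon as there is a generator
with levels at most one. -/

noncomputable section

namespace PongAlg

/-! ### The group `G_m` and its action -/

/-- The translation length of `G_m`. -/
def period (m : ℕ) : ℤ := 2 * (m : ℤ) - 2

theorem period_pos {m : ℕ} (hm : 1 < m) : 0 < period m := by
  unfold period; omega

theorem smul_cases {m : ℕ} (γ : G m) :
    (∃ n : ℤ, ∀ i : ℤ, γ • i = i + n * period m) ∨
      (∃ n : ℤ, ∀ i : ℤ, γ • i = 1 - i + n * period m) := G_form γ.2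

theorem exists_mirror_one (m : ℕ) : ∃ γ : G m, ∀ i : ℤ, γ • i = 1 - i :=
  ⟨⟨refl 1, Subgroup.subset_closure (by simp)⟩, fun _ => rfl⟩

theorem exists_transl (m : ℕ) (n : ℤ) : ∃ γ : G m, ∀ i : ℤ, γ • i = i + n * period m := by
  let a : G m := ⟨refl 1, Subgroup.subset_closure (by simp)⟩
  let b : G m := ⟨refl (2 * (m : ℤ) - 1), Subgroup.subset_closure (by simp)⟩
  have ha : ∀ i : ℤ, a • i = 1 - i := fun _ => rfl
  have hb : ∀ i : ℤ, b • i = 2 * (m : ℤ) - 1 - i := fun _ => rfl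
  have hba : ∀ i : ℤ, (b * a) • i = i + period m := fun i => by
    rw [mul_smul, ha, hb, period]; ring
  have hab : ∀ i : ℤ, (a * b) • i = i - period m := fun i => by
    rw [mul_smul, ha, hb, period]; ring
  induction n using Int.induction_on with
  | zero => exact ⟨1, fun i => by rw [one_smul]; ring⟩
  | succ n ih =>
    obtain ⟨γ, hγ⟩ := ih
    exact ⟨(b * a) * γ, fun i => by rw [mul_smul, hγ, hba]; ring⟩
  | pred n ih =>
    obtain ⟨γ, hγ⟩ := ih
    exact ⟨(a * b) * γ, fun i => by rw [mul_smul, hγ, hab]; ring⟩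

theorem exists_mirror (m : ℕ) (n : ℤ) : ∃ γ : G m, ∀ i : ℤ, γ • i = 1 - i + n * period m := by
  obtain ⟨a, ha⟩ := exists_mirror_one m
  obtain ⟨b, hb⟩ := exists_transl m n
  exact ⟨b * a, fun i => by rw [mul_smul, ha, hb]⟩

theorem equivalent_iff {m : ℕ} {i j : ℤ} :
    Equivalent m i j ↔ ∃ n : ℤ, j = i + n * period m ∨ j = 1 - i + n * period m := by
  constructor
  · rintro ⟨γ, rfl⟩
    rcases smul_cases γ with ⟨n, hn⟩ | ⟨n, hn⟩
    · exact ⟨n, Or.inl (hn i)⟩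
    · exact ⟨n, Or.inr (hn i)⟩
  · rintro ⟨n, rfl | rfl⟩
    · obtain ⟨γ, hγ⟩ := exists_transl m n
      exact ⟨γ, hγ i⟩
    · obtain ⟨γ, hγ⟩ := exists_mirror m n
      exact ⟨γ, hγ i⟩

theorem equivalent_smul {m : ℕ} (γ : G m) (i : ℤ) : Equivalent m i (γ • i) := ⟨γ, rfl⟩

theorem equivalent_smul_left_iff {m : ℕ} (γ : G m) {i j : ℤ} :
    Equivalent m (γ • i) j ↔ Equivalent m i j :=
  ⟨fun h => (equivalent_smul γ i).trans h, fun h => (equivalent_smul γ i).symm.trans h⟩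

theorem equivalent_smul_right_iff {m : ℕ} (γ : G m) {i j : ℤ} :
    Equivalent m i (γ • j) ↔ Equivalent m i j :=
  ⟨fun h => h.trans (equivalent_smul γ j).symm, fun h => h.trans (equivalent_smul γ j)⟩

theorem equivalent_comm {m : ℕ} {i j : ℤ} : Equivalent m i j ↔ Equivalent m j i :=
  ⟨Equivalent.symm, Equivalent.symm⟩

theorem orb_eq_iff {m : ℕ} {i j : ℤ} : orb m i = orb m j ↔ Equivalent m i j := by
  unfold orb
  rw [Quotient.eq]
  change i ∈ MulAction.orbit (G m) j ↔ _
  rw [equivalent_comm]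
  rfl

/-- The set `{1, …, m - 1}` meets every orbit. -/
theorem exists_rep {m : ℕ} (hm : 1 < m) (i : ℤ) :
    ∃ γ : G m, 1 ≤ γ • i ∧ γ • i ≤ (m : ℤ) - 1 := by
  have hp := period_pos hm
  have h1 := Int.emod_add_mul_ediv (i - 1) (period m)
  have h2 := Int.emod_nonneg (i - 1) hp.ne'
  have h3 := Int.emod_lt_of_pos (i - 1) hp
  set q := (i - 1) / period m
  set r := (i - 1) % period m
  by_cases h : r + 1 ≤ (m : ℤ) - 1
  · obtain ⟨γ, hγ⟩ := exists_transl m (-q)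
    have : γ • i = r + 1 := by rw [hγ]; linarith
    exact ⟨γ, by omega, by omega⟩
  · obtain ⟨γ, hγ⟩ := exists_mirror m (q + 1)
    have : γ • i = period m - r := by rw [hγ]; linarith
    have hd : period m = 2 * (m : ℤ) - 2 := rfl
    exact ⟨γ, by omega, by omega⟩

theorem eq_of_equivalent_of_mem {m : ℕ} (hm : 1 < m) {i j : ℤ} (h : Equivalent m i j)
    (hi : i ∈ Finset.Icc (1 : ℤ) (m - 1)) (hj : j ∈ Finset.Icc (1 : ℤ) (m - 1)) : i = j := by
  rw [Finset.mem_Icc] at hi hj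
  obtain ⟨n, h⟩ := equivalent_iff.1 h
  have hp := period_pos hm
  have hd : period m = 2 * (m : ℤ) - 2 := rfl
  rcases lt_trichotomy n 0 with hn | hn | hn
  · have : n * period m ≤ -1 * period m := mul_le_mul_of_nonneg_right (by omega) hp.le
    omega
  · subst hn; omega
  · have : 1 * period m ≤ n * period m := mul_le_mul_of_nonneg_right (by omega) hp.le
    omega

/-! ### Values of lifted partial permutations -/

namespace LPP

variable {m k : ℕ}

/-- The value `f̃ i`, with the convention `f̃ i = i` outside the domain. -/
def val (f : LPP m k) (i : ℤ) : ℤ := (f.toFun i).getD i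

theorem toFun_eq {f : LPP m k} {i : ℤ} (h : i ∈ f.dom) : f.toFun i = some (f.val i) := by
  obtain ⟨a, ha⟩ := h
  simp [val, ha]

theorem mem_dom_iff {f : LPP m k} {i : ℤ} : i ∈ f.dom ↔ f.toFun i ≠ none := by
  rw [Option.ne_none_iff_exists']; rfl

theorem val_of_toFun {f : LPP m k} {i a : ℤ} (h : f.toFun i = some a) : f.val i = a := by
  simp [val, h]

theorem toFun_eq_some {f : LPP m k} {i a : ℤ} : f.toFun i = some a ↔ i ∈ f.dom ∧ f.val i = a :=
  ⟨fun h => ⟨⟨a, h⟩, val_of_toFun h⟩, fun h => by rw [toFun_eq h.1, h.2]⟩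

theorem ext_val {f g : LPP m k} (hd : f.dom = g.dom) (hv : ∀ i ∈ f.dom, f.val i = g.val i) :
    f = g := by
  apply LPP.ext
  funext i
  by_cases h : i ∈ f.dom
  · rw [toFun_eq h, toFun_eq (hd ▸ h), hv i h]
  · have h' : i ∉ g.dom := hd ▸ h
    rw [mem_dom_iff, not_not] at h h'
    rw [h, h']

theorem mem_dom_congr (f : LPP m k) {i j : ℤ} (h : Equivalent m i j) : i ∈ f.dom ↔ j ∈ f.dom :=
  ⟨f.mem_dom_of_equivalent h, f.mem_dom_of_equivalent h.symm⟩

@[simp] theorem smul_mem_dom (f : LPP m k) (γ : G m) (i : ℤ) : γ • i ∈ f.dom ↔ i ∈ f.dom :=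
  (f.mem_dom_congr (equivalent_smul γ i)).symm

theorem val_smul (f : LPP m k) (γ : G m) (i : ℤ) : f.val (γ • i) = γ • f.val i := by
  unfold val
  rw [f.equivariant]
  cases f.toFun i <;> rfl

@[simp] theorem add_mem_dom (f : LPP m k) (i n : ℤ) : i + n * period m ∈ f.dom ↔ i ∈ f.dom := by
  obtain ⟨γ, hγ⟩ := exists_transl m n
  rw [← hγ, smul_mem_dom]

@[simp] theorem val_add (f : LPP m k) (i n : ℤ) :
    f.val (i + n * period m) = f.val i + n * period m := by
  obtain ⟨γ, hγ⟩ := exists_transl m n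
  rw [← hγ, val_smul, hγ]

@[simp] theorem mirror_mem_dom (f : LPP m k) (i : ℤ) : 1 - i ∈ f.dom ↔ i ∈ f.dom := by
  obtain ⟨γ, hγ⟩ := exists_mirror_one m
  rw [← hγ, smul_mem_dom]

@[simp] theorem val_mirror (f : LPP m k) (i : ℤ) : f.val (1 - i) = 1 - f.val i := by
  obtain ⟨γ, hγ⟩ := exists_mirror_one m
  rw [← hγ, val_smul, hγ]

@[simp] theorem add_period_mem_dom (f : LPP m k) (i : ℤ) : i + period m ∈ f.dom ↔ i ∈ f.dom := by
  simpa using f.add_mem_dom i 1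

@[simp] theorem val_add_period (f : LPP m k) (i : ℤ) :
    f.val (i + period m) = f.val i + period m := by
  simpa using f.val_add i 1

@[simp] theorem sub_period_mem_dom (f : LPP m k) (i : ℤ) : i - period m ∈ f.dom ↔ i ∈ f.dom := by
  have := f.add_mem_dom i (-1)
  rwa [show i + -1 * period m = i - period m by ring] at this

@[simp] theorem val_sub_period (f : LPP m k) (i : ℤ) :
    f.val (i - period m) = f.val i - period m := by
  have := f.val_add i (-1)
  rwa [show i + -1 * period m = i - period m by ring,
    show f.val i + -1 * period m = f.val i - period m by ring] at this

theorem equivalent_of_val (f : LPP m k) {i j : ℤ} (hi : i ∈ f.dom) (hj : j ∈ f.dom)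
    (h : Equivalent m (f.val i) (f.val j)) : Equivalent m i j :=
  f.inj i j _ _ (toFun_eq hi) (toFun_eq hj) h

theorem equivalent_val (f : LPP m k) {i j : ℤ} (h : Equivalent m i j) :
    Equivalent m (f.val i) (f.val j) := by
  obtain ⟨γ, rfl⟩ := h
  exact ⟨γ, (f.val_smul γ i).symm⟩

/-- Injectivity on orbits gives `j = γ • i`; by equivariance `γ` then fixes the common value, and
the action is free. -/
theorem val_inj (f : LPP m k) {i j : ℤ} (hi : i ∈ f.dom) (hj : j ∈ f.dom)
    (h : f.val i = f.val j) : i = j := by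
  obtain ⟨γ, rfl⟩ := f.equivalent_of_val hi hj (h ▸ Equivalent.refl' _)
  rw [val_smul] at h
  have : (1 : G m) = γ := G_free (i := f.val i) (by rw [one_smul]; exact h)
  rw [← this, one_smul]

theorem mem_ran_iff {f : LPP m k} {a : ℤ} : a ∈ f.ran ↔ ∃ i ∈ f.dom, f.val i = a := by
  simp only [ran, Set.mem_ofPred_eq, toFun_eq_some]

theorem val_mem_ran {f : LPP m k} {i : ℤ} (h : i ∈ f.dom) : f.val i ∈ f.ran :=
  mem_ran_iff.2 ⟨i, h, rfl⟩

theorem mem_ran_of_equivalent (f : LPP m k) {a b : ℤ} (h : Equivalent m a b) (ha : a ∈ f.ran) :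
    b ∈ f.ran := by
  obtain ⟨γ, rfl⟩ := h
  obtain ⟨i, hi, rfl⟩ := mem_ran_iff.1 ha
  exact mem_ran_iff.2 ⟨γ • i, by simpa, f.val_smul γ i⟩

theorem mem_ran_congr (f : LPP m k) {i j : ℤ} (h : Equivalent m i j) : i ∈ f.ran ↔ j ∈ f.ran :=
  ⟨f.mem_ran_of_equivalent h, f.mem_ran_of_equivalent h.symm⟩

@[simp] theorem mirror_mem_ran (f : LPP m k) (i : ℤ) : 1 - i ∈ f.ran ↔ i ∈ f.ran := by
  obtain ⟨γ, hγ⟩ := exists_mirror_one m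
  rw [← hγ]
  exact (f.mem_ran_congr (equivalent_smul γ i)).symm

theorem orb_dom_ncard (f : LPP m k) : (orb m '' f.dom).ncard = k := f.card_orbits

/-- The inverse image of a point of the image. -/
theorem exists_displacement_bound (hm : 1 < m) (f : LPP m k) :
    ∃ M : ℤ, 0 ≤ M ∧ ∀ i, |f.val i - i| ≤ M := by
  obtain ⟨M, hM⟩ := (Finset.Icc (1 : ℤ) (m - 1)).finite_toSet.image (fun i => |f.val i - i|)
    |>.bddAbove
  refine ⟨max M 0, le_max_right _ _, fun i => ?_⟩
  obtain ⟨γ, h1, h2⟩ := exists_rep hm i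
  have hle : |f.val (γ • i) - γ • i| ≤ M :=
    hM ⟨γ • i, by simp [h1, h2], rfl⟩
  refine le_max_of_le_left ?_
  rw [val_smul] at hle
  rcases smul_cases γ with ⟨n, hn⟩ | ⟨n, hn⟩ <;> rw [hn, hn] at hle
  · rwa [show f.val i + n * period m - (i + n * period m) = f.val i - i by ring] at hle
  · rwa [show 1 - f.val i + n * period m - (1 - i + n * period m) = -(f.val i - i) by ring,
      abs_neg] at hle

end LPP

/-! ### Exchanging two orbits -/

theorem swapOrbits_cases (m : ℕ) (i j l : ℤ) :
    (∃ γ : G m, l = γ • i ∧ swapOrbits m i j l = γ • j) ∨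
    (∃ γ : G m, l = γ • j ∧ swapOrbits m i j l = γ • i ∧ ¬ Equivalent m i j) ∨
    (¬ Equivalent m i l ∧ ¬ Equivalent m j l ∧ swapOrbits m i j l = l) := by
  by_cases hi : Equivalent m i l
  · obtain ⟨γ, rfl⟩ := hi
    exact Or.inl ⟨γ, rfl, swapOrbits_left i j γ⟩
  · by_cases hj : Equivalent m j l
    · obtain ⟨γ, rfl⟩ := hj
      have hij : ¬ Equivalent m i j := fun h => hi (h.trans ⟨γ, rfl⟩)
      exact Or.inr (Or.inl ⟨γ, rfl, swapOrbits_right i j γ hij, hij⟩)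
    · exact Or.inr (Or.inr ⟨hi, hj, swapOrbits_of_not hi hj⟩)

theorem swapOrbits_self_left (m : ℕ) (i j : ℤ) : swapOrbits m i j i = j := by
  simpa using swapOrbits_left (m := m) i j 1

theorem swapOrbits_self_right {m : ℕ} {i j : ℤ} (h : ¬ Equivalent m i j) :
    swapOrbits m i j j = i := by
  simpa using swapOrbits_right (m := m) i j 1 h

theorem swapOrbits_add (m : ℕ) (i j l n : ℤ) :
    swapOrbits m i j (l + n * period m) = swapOrbits m i j l + n * period m := by
  obtain ⟨γ, hγ⟩ := exists_transl m n
  rw [← hγ, swapOrbits_smul, hγ]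

theorem swapOrbits_mirror (m : ℕ) (i j l : ℤ) :
    swapOrbits m i j (1 - l) = 1 - swapOrbits m i j l := by
  obtain ⟨γ, hγ⟩ := exists_mirror_one m
  rw [← hγ, swapOrbits_smul, hγ]

theorem swapOrbits_involutive {m : ℕ} {i j : ℤ} (h : ¬ Equivalent m i j) (l : ℤ) :
    swapOrbits m i j (swapOrbits m i j l) = l := by
  rcases swapOrbits_cases m i j l with ⟨γ, rfl, hl⟩ | ⟨γ, rfl, hl, -⟩ | ⟨-, -, hl⟩
  · rw [hl, swapOrbits_right i j γ h]
  · rw [hl, swapOrbits_left i j γ]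
  · rw [hl, hl]

theorem swapOrbits_smul_smul {m : ℕ} (γ : G m) (i j : ℤ) :
    swapOrbits m (γ • i) (γ • j) = swapOrbits m i j := by
  funext l
  rcases swapOrbits_cases m i j l with ⟨δ, rfl, hl⟩ | ⟨δ, rfl, hl, hij⟩ | ⟨h1, h2, hl⟩
  · rw [hl]
    have := swapOrbits_left (m := m) (γ • i) (γ • j) (δ * γ⁻¹)
    simpa [mul_smul] using this
  · rw [hl]
    have := swapOrbits_right (m := m) (γ • i) (γ • j) (δ * γ⁻¹)
      (by rwa [equivalent_smul_left_iff, equivalent_smul_right_iff])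
    simpa [mul_smul] using this
  · rw [hl, swapOrbits_of_not] <;> rwa [equivalent_smul_left_iff]

theorem swapOrbits_comm {m : ℕ} {i j : ℤ} (h : ¬ Equivalent m i j) :
    swapOrbits m i j = swapOrbits m j i := by
  funext l
  rcases swapOrbits_cases m i j l with ⟨δ, rfl, hl⟩ | ⟨δ, rfl, hl, hij⟩ | ⟨h1, h2, hl⟩
  · rw [hl, swapOrbits_right _ _ _ (fun h' => h h'.symm)]
  · rw [hl, swapOrbits_left]
  · rw [hl, swapOrbits_of_not h2 h1]

namespace LPP

variable {m k : ℕ}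

open Classical in
/-- The lifted partial permutation `f̃ ∘ t`, where `t` exchanges the orbits of `i` and `j` (for `i`
and `j` in the domain). -/
def swap (f : LPP m k) (i j : ℤ) : LPP m k :=
  if h : i ∈ f.dom ∧ j ∈ f.dom then f.resolveAt i j h.1 h.2 else f

theorem resolveAt_eq_swap (f : LPP m k) {i j : ℤ} (hi : i ∈ f.dom) (hj : j ∈ f.dom) :
    f.resolveAt i j hi hj = f.swap i j := by
  rw [swap, dif_pos ⟨hi, hj⟩]

@[simp] theorem dom_swap (f : LPP m k) (i j : ℤ) : (f.swap i j).dom = f.dom := by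
  unfold swap
  split_ifs with h
  · exact Set.ext (f.swapOrbits_mem_dom h.1 h.2)
  · rfl

theorem val_swap (f : LPP m k) {i j : ℤ} (hi : i ∈ f.dom) (hj : j ∈ f.dom) (l : ℤ) :
    (f.swap i j).val l = f.val (swapOrbits m i j l) := by
  rw [swap, dif_pos ⟨hi, hj⟩]
  by_cases hl : l ∈ f.dom
  · have : (f.resolveAt i j hi hj).toFun l = f.toFun (swapOrbits m i j l) := rfl
    rw [toFun_eq ((f.swapOrbits_mem_dom hi hj l).2 hl)] at this
    exact val_of_toFun this
  · have h1 : ¬ Equivalent m i l := fun h => hl ((f.mem_dom_congr h).1 hi)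
    have h2 : ¬ Equivalent m j l := fun h => hl ((f.mem_dom_congr h).1 hj)
    have : (f.resolveAt i j hi hj).toFun l = f.toFun (swapOrbits m i j l) := rfl
    rw [val, this, swapOrbits_of_not h1 h2]
    rfl

theorem ran_swap (f : LPP m k) {i j : ℤ} (hij : ¬ Equivalent m i j) :
    (f.swap i j).ran = f.ran := by
  by_cases h : i ∈ f.dom ∧ j ∈ f.dom
  · ext a
    simp only [mem_ran_iff, dom_swap, val_swap f h.1 h.2]
    constructor
    · rintro ⟨l, hl, rfl⟩
      exact ⟨_, (f.swapOrbits_mem_dom h.1 h.2 l).2 hl, rfl⟩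
    · rintro ⟨l, hl, rfl⟩
      exact ⟨_, (f.swapOrbits_mem_dom h.1 h.2 l).2 hl, by rw [swapOrbits_involutive hij]⟩
  · rw [swap, dif_neg h]

theorem swap_swap (f : LPP m k) {i j : ℤ} (hi : i ∈ f.dom) (hj : j ∈ f.dom)
    (hij : ¬ Equivalent m i j) : (f.swap i j).swap i j = f := by
  apply ext_val
  · simp
  · intro l _
    rw [val_swap _ (by simpa) (by simpa), val_swap _ hi hj, swapOrbits_involutive hij]

/-- Composition with an equivariant map that preserves every orbit. -/
def post (f : LPP m k) (φ : ℤ → ℤ) (hφ : ∀ (γ : G m) i, φ (γ • i) = γ • φ i)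
    (ho : ∀ i, Equivalent m i (φ i)) : LPP m k where
  toFun i := (f.toFun i).map φ
  equivariant γ i := by
    rw [f.equivariant]
    cases f.toFun i with
    | none => rfl
    | some a => simp [hφ]
  card_orbits := by
    have : {i | ∃ a, (f.toFun i).map φ = some a} = {i | ∃ a, f.toFun i = some a} := by
      ext i
      simp
    rw [this]
    exact f.card_orbits
  inj i j a b hi hj hab := by
    obtain ⟨a', hi', rfl⟩ := Option.map_eq_some_iff.1 hi
    obtain ⟨b', hj', rfl⟩ := Option.map_eq_some_iff.1 hj
    exact f.inj i j a' b' hi' hj' ((ho a').trans (hab.trans (ho b').symm))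

theorem dom_post (f : LPP m k) (φ : ℤ → ℤ) (hφ : ∀ (γ : G m) i, φ (γ • i) = γ • φ i)
    (ho : ∀ i, Equivalent m i (φ i)) : (f.post φ hφ ho).dom = f.dom := by
  ext i
  rw [mem_dom_iff, mem_dom_iff]
  exact not_congr Option.map_eq_none_iff

theorem val_post (f : LPP m k) (φ : ℤ → ℤ) (hφ : ∀ (γ : G m) i, φ (γ • i) = γ • φ i)
    (ho : ∀ i, Equivalent m i (φ i)) {i : ℤ} (hi : i ∈ f.dom) :
    (f.post φ hφ ho).val i = φ (f.val i) := by
  apply val_of_toFun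
  change (f.toFun i).map φ = _
  rw [toFun_eq hi]
  rfl

end LPP

/-- For equivalent `i` and `j` the second clause of `swapOrbits` never applies and every orbit is
preserved. This is what allows `post` to be used for prolonging and turning strands. -/
theorem equivalent_swapOrbits {m : ℕ} {i j : ℤ} (h : Equivalent m i j) (l : ℤ) :
    Equivalent m l (swapOrbits m i j l) := by
  rcases swapOrbits_cases m i j l with ⟨γ, rfl, hl⟩ | ⟨γ, rfl, hl, h'⟩ | ⟨-, -, hl⟩
  · rw [hl, equivalent_smul_left_iff, equivalent_smul_right_iff]; exact h
  · exact absurd h h'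
  · rw [hl]; exact Equivalent.refl' l

theorem equivalent_add (m : ℕ) (i n : ℤ) : Equivalent m i (i + n * period m) :=
  equivalent_iff.2 ⟨n, Or.inl rfl⟩

theorem equivalent_mirror (m : ℕ) (i : ℤ) : Equivalent m i (1 - i) :=
  equivalent_iff.2 ⟨0, Or.inr (by ring)⟩

namespace LPP

variable {m k : ℕ}

/-- The strand with value `a` is prolonged by `n` full turns. -/
def wind (f : LPP m k) (a n : ℤ) : LPP m k :=
  -- Since `a` and `a + n * period m` are equivalent, this map is not an exchange: it shifts the
  -- translates of `a` by `n` periods and their mirror images by `-n` periods.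
  f.post (swapOrbits m a (a + n * period m)) (fun γ i => swapOrbits_smul _ _ i γ)
    (equivalent_swapOrbits (equivalent_add m a n))

@[simp] theorem dom_wind (f : LPP m k) (a n : ℤ) : (f.wind a n).dom = f.dom := dom_post ..

theorem val_wind (f : LPP m k) (a n : ℤ) {l : ℤ} (hl : l ∈ f.dom) :
    (f.wind a n).val l = swapOrbits m a (a + n * period m) (f.val l) := val_post _ _ _ _ hl

theorem val_wind_self (f : LPP m k) {i : ℤ} (n : ℤ) (hi : i ∈ f.dom) :
    (f.wind (f.val i) n).val i = f.val i + n * period m := by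
  rw [val_wind _ _ _ hi, swapOrbits_self_left]

theorem val_wind_of_not (f : LPP m k) {i l : ℤ} (n : ℤ) (hi : i ∈ f.dom) (hl : l ∈ f.dom)
    (h : ¬ Equivalent m i l) : (f.wind (f.val i) n).val l = f.val l := by
  rw [val_wind _ _ _ hl]
  have h1 : ¬ Equivalent m (f.val i) (f.val l) := fun h' => h (f.equivalent_of_val hi hl h')
  exact swapOrbits_of_not h1
    (fun h' => h1 ((equivalent_add m _ n).trans h'))

theorem ran_wind (f : LPP m k) (a n : ℤ) : (f.wind a n).ran = f.ran := by
  have key : ∀ (f : LPP m k) (a n : ℤ), (f.wind a n).ran ⊆ f.ran := by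
    intro f a n b hb
    obtain ⟨i, hi, rfl⟩ := mem_ran_iff.1 hb
    rw [dom_wind] at hi
    rw [val_wind _ _ _ hi]
    exact f.mem_ran_of_equivalent (equivalent_swapOrbits (equivalent_add m a n) _) (val_mem_ran hi)
  refine (key f a n).antisymm fun b hb => ?_
  obtain ⟨i, hi, rfl⟩ := mem_ran_iff.1 hb
  have h1 : i ∈ (f.wind a n).dom := by simpa
  refine (f.wind a n).mem_ran_of_equivalent ?_ (val_mem_ran h1)
  rw [val_wind _ _ _ hi]
  exact (equivalent_swapOrbits (equivalent_add m a n) _).symm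

end LPP

/-! ### Linear operators given by relations -/

open Classical in
/-- The linear map that sends the basis vector `a` to the sum of the (finitely many) basis
vectors `b` with `R a b`. -/
def relOp {α β : Type*} (R : α → β → Prop) : (α →₀ ZMod 2) →ₗ[ZMod 2] (β →₀ ZMod 2) :=
  Finsupp.linearCombination (ZMod 2) fun a =>
    if h : {b | R a b}.Finite then ∑ b ∈ h.toFinset, Finsupp.single b 1 else 0

open Classical in
theorem relOp_single {α β : Type*} {R : α → β → Prop} {a : α} (h : {b | R a b}.Finite) :
    relOp R (Finsupp.single a 1) = ∑ b ∈ h.toFinset, Finsupp.single b 1 := by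
  simp [relOp, h]

open Classical in
theorem relOp_single_apply {α β : Type*} {R : α → β → Prop} {a : α} (h : {b | R a b}.Finite)
    (b : β) : relOp R (Finsupp.single a 1) b = if R a b then 1 else 0 := by
  rw [relOp_single h, Finsupp.finsetSum_apply]
  simp [Finsupp.single_apply]

/-- Over `𝔽` a coefficient of a composite counts two-step paths modulo 2. Identities between
operators thus become parities of numbers of intermediate maps, and conversely. -/
theorem relOp_relOp_single {α β γ : Type*} {R : α → β → Prop} {S : β → γ → Prop}
    (hS : ∀ b, {c | S b c}.Finite) {a : α} (h : {b | R a b}.Finite) (c : γ) :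
    relOp S (relOp R (Finsupp.single a 1)) c = ({b | R a b ∧ S b c}.ncard : ZMod 2) := by
  classical
  rw [relOp_single h, map_sum, Finsupp.finsetSum_apply,
    Finset.sum_congr rfl fun b _ => relOp_single_apply (hS b) c, Finset.sum_boole]
  congr 1
  rw [← Set.ncard_coe_finset]
  congr 1
  ext b
  simp

theorem finsupp_add_self {α : Type*} (v : α →₀ ZMod 2) : v + v = 0 := by
  ext a
  exact CharTwo.add_self_eq_zero (v a)

/-! ### Affine permutations -/

/-- Injective maps `F : ℤ → ℤ` with `F (i + K) = F i + N`. -/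
@[ext]
structure Aff (K N : ℤ) where
  toFun : ℤ → ℤ
  inj : Function.Injective toFun
  map_add' : ∀ i, toFun (i + K) = toFun i + N

namespace Aff

variable {K N : ℤ}

instance : CoeFun (Aff K N) fun _ => ℤ → ℤ := ⟨Aff.toFun⟩

theorem ext_coe {F H : Aff K N} (h : ∀ l, F l = H l) : F = H := Aff.ext (funext h)

theorem map_add (F : Aff K N) (i : ℤ) : F (i + K) = F i + N := F.map_add' i

theorem map_add_mul (F : Aff K N) (i n : ℤ) : F (i + n * K) = F i + n * N := by
  induction n using Int.induction_on with
  | zero => simp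
  | succ n ih =>
    rw [show i + ((n : ℤ) + 1) * K = i + n * K + K by ring, map_add, ih]; ring
  | pred n ih =>
    have := F.map_add (i + (-(n : ℤ) - 1) * K)
    rw [show i + (-(n : ℤ) - 1) * K + K = i + -(n : ℤ) * K by ring, ih] at this
    linarith

/-- The map that exchanges `i + n K` and `j + n K` for all `n`. -/
def tr (K i j l : ℤ) : ℤ := if K ∣ l - i then l - i + j else if K ∣ l - j then l - j + i else l

theorem tr_left (K i j n : ℤ) : tr K i j (i + n * K) = j + n * K := by
  rw [tr, if_pos ⟨n, by ring⟩]; ring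

theorem tr_right {K i j : ℤ} (h : ¬ K ∣ j - i) (n : ℤ) : tr K i j (j + n * K) = i + n * K := by
  have h1 : ¬ K ∣ j + n * K - i := by
    rwa [show j + n * K - i = j - i + K * n by ring, dvd_add_left (dvd_mul_right K n)]
  rw [tr, if_neg h1, if_pos ⟨n, by ring⟩]; ring

theorem tr_of_not {K i j l : ℤ} (h1 : ¬ K ∣ l - i) (h2 : ¬ K ∣ l - j) : tr K i j l = l := by
  rw [tr, if_neg h1, if_neg h2]

theorem tr_cases (K i j l : ℤ) :
    (∃ n, l = i + n * K ∧ tr K i j l = j + n * K) ∨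
    (∃ n, l = j + n * K ∧ tr K i j l = i + n * K ∧ ¬ K ∣ j - i) ∨
    (¬ K ∣ l - i ∧ ¬ K ∣ l - j ∧ tr K i j l = l) := by
  by_cases hi : K ∣ l - i
  · obtain ⟨n, hn⟩ := hi
    obtain rfl : l = i + n * K := by linarith
    exact Or.inl ⟨n, rfl, tr_left ..⟩
  · by_cases hj : K ∣ l - j
    · obtain ⟨n, hn⟩ := hj
      obtain rfl : l = j + n * K := by linarith
      have h : ¬ K ∣ j - i := fun h => hi (by
        rw [show j + n * K - i = j - i + K * n by ring]
        exact dvd_add h (dvd_mul_right K n))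
      exact Or.inr (Or.inl ⟨n, rfl, tr_right h n, h⟩)
    · exact Or.inr (Or.inr ⟨hi, hj, tr_of_not hi hj⟩)

theorem tr_tr {K i j : ℤ} (h : ¬ K ∣ j - i) (l : ℤ) : tr K i j (tr K i j l) = l := by
  rcases tr_cases K i j l with ⟨n, rfl, hl⟩ | ⟨n, rfl, hl, -⟩ | ⟨-, -, hl⟩
  · rw [hl, tr_right h]
  · rw [hl, tr_left]
  · rw [hl, hl]

theorem dvd_add_mul_sub {K a b n : ℤ} : K ∣ a + n * K - b ↔ K ∣ a - b := by
  rw [show a + n * K - b = a - b + K * n by ring, dvd_add_left (dvd_mul_right K n)]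

theorem tr_add (K i j l n : ℤ) : tr K i j (l + n * K) = tr K i j l + n * K := by
  unfold tr
  simp only [dvd_add_mul_sub]
  split_ifs <;> ring

theorem tr_translate (K i j n l : ℤ) : tr K (i + n * K) (j + n * K) l = tr K i j l := by
  unfold tr
  have h : ∀ a : ℤ, K ∣ l - (a + n * K) ↔ K ∣ l - a := fun a => by
    rw [show l - (a + n * K) = l + (-n) * K - a by ring, dvd_add_mul_sub]
  simp only [h]
  split_ifs <;> ring

/-- Composition with `tr`. -/
def swap (F : Aff K N) {i j : ℤ} (h : ¬ K ∣ j - i) : Aff K N where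
  toFun l := F (tr K i j l)
  inj a b hab := by
    have := F.inj hab
    rw [← tr_tr h a, this, tr_tr h]
  map_add' l := by
    have := tr_add K i j l 1
    rw [one_mul] at this
    rw [this, map_add]

theorem swap_apply (F : Aff K N) {i j : ℤ} (h : ¬ K ∣ j - i) (l : ℤ) :
    F.swap h l = F (tr K i j l) := rfl

theorem swap_swap (F : Aff K N) {i j : ℤ} (h : ¬ K ∣ j - i) : (F.swap h).swap h = F :=
  ext_coe fun l => by rw [swap_apply, swap_apply, tr_tr h]

/-- The pair `(i, j)` is an inversion, and exchanging the values at `i` and `j` drops the number of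
inversions by exactly one. -/
def IsCover (F : Aff K N) (i j : ℤ) : Prop :=
  i < j ∧ F j < F i ∧ (∀ c, i < c → c < j → F j < F c → F c < F i → False) ∧
    ¬ (i + K < j ∧ F j + N < F i)

/-- A translation by a positive multiple of `K` raises the value by a positive multiple of `N`, so
translates never form an inversion. -/
theorem not_dvd_of_inv (hK : 0 < K) (hN : 0 < N) (F : Aff K N) {i j : ℤ} (h : i < j)
    (h' : F j < F i) : ¬ K ∣ j - i := by
  rintro ⟨n, hn⟩
  obtain rfl : j = i + n * K := by linarith
  rw [map_add_mul] at h'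
  have h1 : 0 < n * K := by linarith
  have h2 : n * N < 0 := by linarith
  have h3 : 0 < n := pos_of_mul_pos_left h1 hK.le
  nlinarith

/-- `H` is obtained from `F` by resolving an inversion. -/
def Cov (F H : Aff K N) : Prop := ∃ i j, F.IsCover i j ∧ ∀ l, H l = F (tr K i j l)

/-- `H` is obtained from `F` by prolonging, by one turn, a strand that no strand overtakes. -/
def Ext (F H : Aff K N) : Prop :=
  ∃ s, (∀ l < s, F l < F s) ∧ ∀ l, H l = if K ∣ l - s then F l + N else F l

theorem isCover_translate (F : Aff K N) {i j : ℤ} (n : ℤ) (h : F.IsCover i j) :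
    F.IsCover (i + n * K) (j + n * K) := by
  obtain ⟨h1, h2, h3, h4⟩ := h
  refine ⟨by linarith, by rw [map_add_mul, map_add_mul]; linarith, fun c hc1 hc2 hc3 hc4 => ?_,
    fun ⟨h5, h6⟩ => h4 ⟨by linarith, ?_⟩⟩
  · refine h3 (c + (-n) * K) (by linarith) (by linarith) ?_ ?_ <;>
      rw [map_add_mul] at * <;> linarith
  · rw [map_add_mul, map_add_mul] at h6; linarith

/-- The deviation `K * F l - N * l` is periodic in `l`. -/
theorem exists_bound (hK : 0 < K) (F : Aff K N) :
    ∃ M : ℤ, ∀ l, |K * F l - N * l| ≤ M := by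
  obtain ⟨M, hM⟩ := (Finset.Ico (0 : ℤ) K).finite_toSet.image (fun l => |K * F l - N * l|)
    |>.bddAbove
  refine ⟨M, fun l => ?_⟩
  have h1 : l = l % K + l / K * K := by linarith [Int.emod_add_mul_ediv l K]
  generalize l / K = q at h1
  have h2 : |K * F (l % K) - N * (l % K)| ≤ M :=
    hM ⟨l % K, by simp [Int.emod_nonneg l hK.ne', Int.emod_lt_of_pos l hK], rfl⟩
  generalize l % K = r at h1 h2
  subst h1
  rw [map_add_mul]
  convert h2 using 2
  ring

/-- After a translation the left end of the inversion lies in one period. The bounded deviation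
limits the length of an inversion, so the right end has finitely many positions. -/
theorem finite_cov (hK : 0 < K) (hN : 0 < N) (F : Aff K N) : {H | F.Cov H}.Finite := by
  obtain ⟨M, hM⟩ := F.exists_bound hK
  have hfin : ((Set.Ico (0 : ℤ) K ×ˢ Set.Icc (0 : ℤ) (K + 2 * M)) : Set (ℤ × ℤ)).Finite :=
    (Set.finite_Ico _ _).prod (Set.finite_Icc _ _)
  refine (hfin.image fun p => (fun l => F (tr K p.1 p.2 l))).preimage
    (f := fun H : Aff K N => H.toFun) (fun a _ b _ h => Aff.ext h) |>.subset ?_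
  rintro H ⟨i, j, h, hH⟩
  have h1 := Int.emod_add_mul_ediv i K
  have h' := isCover_translate F (-(i / K)) h
  refine ⟨(i + -(i / K) * K, j + -(i / K) * K), ⟨⟨?_, ?_⟩, ?_, ?_⟩, ?_⟩
  · change 0 ≤ i + -(i / K) * K
    have := Int.emod_nonneg i hK.ne'
    linarith
  · change i + -(i / K) * K < K
    have := Int.emod_lt_of_pos i hK
    linarith
  · have := Int.emod_nonneg i hK.ne'
    have := h'.1
    change 0 ≤ j + -(i / K) * K
    linarith
  · have a1 := abs_le.1 (hM i)
    have a2 := abs_le.1 (hM j)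
    have a3 := h.2.1
    have a4 : N * (j - i) ≤ 2 * M := by nlinarith
    have a5 : 0 < j - i := by linarith [h.1]
    have a6 : j - i ≤ N * (j - i) := by nlinarith
    have := Int.emod_lt_of_pos i hK
    change j + -(i / K) * K ≤ K + 2 * M
    linarith
  · funext l
    exact (congrArg F (tr_translate K i j _ l)).trans (hH l).symm

theorem ext_eq_of_dvd (F : Aff K N) {s s' : ℤ} (h : K ∣ s' - s) (l : ℤ) :
    (if K ∣ l - s then F l + N else F l) = if K ∣ l - s' then F l + N else F l := by
  have : K ∣ l - s ↔ K ∣ l - s' := by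
    rw [show l - s = (l - s') + (s' - s) by ring, dvd_add_left h]
  simp [this]

theorem finite_ext (hK : 0 < K) (F : Aff K N) : {H | F.Ext H}.Finite := by
  refine ((Set.finite_Ico (0 : ℤ) K).image
    fun s => fun l => if K ∣ l - s then F l + N else F l).preimage
    (f := fun H : Aff K N => H.toFun) (fun a _ b _ h => Aff.ext h) |>.subset ?_
  rintro H ⟨s, -, hH⟩
  refine ⟨s % K, ⟨Int.emod_nonneg s hK.ne', Int.emod_lt_of_pos s hK⟩, ?_⟩
  funext l
  exact (ext_eq_of_dvd F (s := s % K) (s' := s)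
    ⟨s / K, by have := Int.emod_add_mul_ediv s K; linarith⟩ l).trans (hH l).symm

/-! ### Adjacent exchanges -/

theorem not_dvd_adj (hK : 2 ≤ K) (i : ℤ) : ¬ K ∣ i + 1 - i := by
  rw [show i + 1 - i = 1 by ring]
  intro h
  have := Int.le_of_dvd one_pos h
  omega

/-- The exchange moves every point by at most one, so it can reverse only neighbours, and only those
that are exchanged with each other. -/
theorem tr_adj_lt (hK : 2 ≤ K) (i : ℤ) {x y : ℤ} (h : x < y) :
    tr K i (i + 1) x < tr K i (i + 1) y ∨ (K ∣ x - i ∧ y = x + 1) := by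
  have hn := not_dvd_adj hK i
  have key : ∀ l, (K ∣ l - i ∧ tr K i (i + 1) l = l + 1) ∨
      (K ∣ l - 1 - i ∧ tr K i (i + 1) l = l - 1) ∨
      (¬ K ∣ l - i ∧ ¬ K ∣ l - 1 - i ∧ tr K i (i + 1) l = l) := by
    intro l
    rcases tr_cases K i (i + 1) l with ⟨n, rfl, hl⟩ | ⟨n, rfl, hl, -⟩ | ⟨h1, h2, hl⟩
    · exact Or.inl ⟨⟨n, by ring⟩, by rw [hl]; ring⟩
    · exact Or.inr (Or.inl ⟨⟨n, by ring⟩, by rw [hl]; ring⟩)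
    · exact Or.inr (Or.inr ⟨h1, by rwa [sub_sub, add_comm 1 i], hl⟩)
  by_cases hxy : K ∣ x - i ∧ y = x + 1
  · exact Or.inr hxy
  left
  have hinj : tr K i (i + 1) x ≠ tr K i (i + 1) y := fun he => by
    have := congrArg (tr K i (i + 1)) he
    rw [tr_tr hn, tr_tr hn] at this
    omega
  rcases key x with ⟨hx, hx'⟩ | ⟨hx, hx'⟩ | ⟨hx1, hx2, hx'⟩ <;>
    rcases key y with ⟨hy, hy'⟩ | ⟨hy, hy'⟩ | ⟨hy1, hy2, hy'⟩
  · omega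
  · have : y ≠ x + 1 := fun h => hxy ⟨hx, h⟩
    omega
  · have : y ≠ x + 1 := fun h => hxy ⟨hx, h⟩
    omega
  · omega
  · omega
  · omega
  · omega
  · have : y ≠ x + 1 := by
      rintro rfl
      exact hx1 (by simpa using hy)
    omega
  · omega

theorem lt_iff_of_dvd (F : Aff K N) {x i : ℤ} (h : K ∣ x - i) : F x < F (x + 1) ↔ F i < F (i + 1) := by
  obtain ⟨n, hn⟩ := h
  obtain rfl : x = i + n * K := by linarith
  rw [show i + n * K + 1 = i + 1 + n * K by ring, map_add_mul, map_add_mul]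
  constructor <;> intro h <;> linarith

theorem gt_iff_of_dvd (F : Aff K N) {x i : ℤ} (h : K ∣ x - i) : F (x + 1) < F x ↔ F (i + 1) < F i := by
  obtain ⟨n, hn⟩ := h
  obtain rfl : x = i + n * K := by linarith
  rw [show i + n * K + 1 = i + 1 + n * K by ring, map_add_mul, map_add_mul]
  constructor <;> intro h <;> linarith

theorem lt_or_gt (F : Aff K N) {i j : ℤ} (h : i ≠ j) : F i < F j ∨ F j < F i :=
  lt_or_gt_of_ne fun h' => h (F.inj h')

/-- Composition of transpositions with an adjacent exchange. -/
theorem tr_conj {i j a b : ℤ} (h : ¬ K ∣ j - i) (l : ℤ) :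
    tr K i j (tr K a b l) = tr K (tr K i j a) (tr K i j b) (tr K i j l) := by
  have key : ∀ x y n, tr K i j x = tr K i j y + n * K ↔ x = y + n * K := by
    intro x y n
    rw [← tr_add]
    exact ⟨fun h' => by rw [← tr_tr h x, h', tr_tr h], fun h' => by rw [h']⟩
  have hd : ∀ x y, K ∣ tr K i j x - tr K i j y ↔ K ∣ x - y := by
    intro x y
    constructor
    · rintro ⟨n, hn⟩
      exact ⟨n, by linarith [(key x y n).1 (by linarith)]⟩
    · rintro ⟨n, hn⟩
      exact ⟨n, by linarith [(key x y n).2 (by linarith)]⟩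
  rcases tr_cases K a b l with ⟨n, rfl, hl⟩ | ⟨n, rfl, hl, h'⟩ | ⟨h1, h2, hl⟩
  · rw [hl, tr_add, tr_add, tr_left]
  · rw [hl, tr_add, tr_add, tr_right ((hd _ _).not.2 h')]
  · rw [hl, tr_of_not ((hd _ _).not.2 h1) ((hd _ _).not.2 h2)]

theorem IsCover.cases (F : Aff K N) {a b : ℤ} (h : F.IsCover a b) (x : ℤ) :
    F.IsCover x (tr K a b x) ∨ F.IsCover (tr K a b x) x ∨ tr K a b x = x := by
  rcases tr_cases K a b x with ⟨n, rfl, hl⟩ | ⟨n, rfl, hl, -⟩ | ⟨-, -, hl⟩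
  · exact Or.inl (hl ▸ isCover_translate F n h)
  · exact Or.inr (Or.inl (hl ▸ isCover_translate F n h))
  · exact Or.inr (Or.inr hl)

theorem swap_adj_left (hK : 2 ≤ K) (F : Aff K N) (i : ℤ) :
    F.swap (not_dvd_adj hK i) i = F (i + 1) := by
  have h1 := tr_left K i (i + 1) 0
  simp only [zero_mul, add_zero] at h1
  rw [swap_apply, h1]

theorem swap_adj_right (hK : 2 ≤ K) (F : Aff K N) (i : ℤ) :
    F.swap (not_dvd_adj hK i) (i + 1) = F i := by
  have h1 := tr_right (not_dvd_adj hK i) 0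
  simp only [zero_mul, add_zero] at h1
  rw [swap_apply, h1]

theorem adj_rev (hK : 2 ≤ K) (i : ℤ) {x y : ℤ} (h1 : tr K i (i + 1) x < tr K i (i + 1) y)
    (h2 : y < x) : K ∣ y - i ∧ x = y + 1 := by
  rcases tr_adj_lt hK i h2 with h | h
  · exact absurd (h.trans h1) (lt_irrefl _)
  · exact h

/-- The lifting property of the Bruhat order for `F = e s_i`, which has a descent at `i`. A cover of
`F` other than the adjacent exchange itself keeps the descent, and conjugating its transposition by
the exchange gives a cover of `e`. -/
theorem cov_swap_of_lt (hK : 2 ≤ K) (hN : 0 < N) {i : ℤ} {e : Aff K N} (he : e i < e (i + 1))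
    {H : Aff K N} (h : (e.swap (not_dvd_adj hK i)).Cov H) :
    H = e ∨ (H (i + 1) < H i ∧ e.Cov (H.swap (not_dvd_adj hK i))) := by
  have hn := not_dvd_adj hK i
  have hK0 : 0 < K := by linarith
  have hFi : e.swap hn (i + 1) < e.swap hn i := by
    rwa [swap_adj_left hK, swap_adj_right hK]
  have heF : ∀ l, e l = e.swap hn (tr K i (i + 1) l) := fun l => by rw [swap_apply, tr_tr hn]
  generalize e.swap hn = F at h hFi heF
  have desc : ∀ x, K ∣ x - i → F (x + 1) < F x := fun x hx => (gt_iff_of_dvd F hx).2 hFi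
  obtain ⟨a, b, hcov, hH⟩ := h
  have hcov' := hcov
  obtain ⟨hab, hFab, hrect, haff⟩ := hcov
  by_cases hc : K ∣ a - i ∧ b = a + 1
  · left
    obtain ⟨⟨n, hn'⟩, rfl⟩ := hc
    obtain rfl : a = i + n * K := by linarith
    refine ext_coe fun l => ?_
    rw [hH, show i + n * K + 1 = i + 1 + n * K by ring, tr_translate, heF]
  right
  have hsab := (tr_adj_lt hK i hab).resolve_right hc
  have hti : tr K a b i ≠ i + 1 := by
    intro ht
    rcases tr_cases K a b i with ⟨n, h1, h2⟩ | ⟨n, h1, h2, -⟩ | ⟨h1, h1', h2⟩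
    · exact hc ⟨⟨-n, by linarith⟩, by linarith⟩
    · linarith
    · omega
  have hti' : tr K a b (i + 1) ≠ i := by
    intro ht
    have := tr_tr (not_dvd_of_inv hK0 hN F hab hFab) (i + 1)
    rw [ht] at this
    exact hti this
  -- If the descent were lost, the transposition would move `i` or `i + 1`. In each case the
  -- inequalities clash, or one of the two points lies in the rectangle of an inversion at the
  -- other, or the affine clause of `IsCover` fails.
  have hHi : H (i + 1) < H i := by
    by_contra hcon
    have hcon : H i < H (i + 1) := (lt_or_gt H (by omega)).resolve_right hcon
    rw [hH, hH] at hcon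
    rcases hcov'.cases F i with hA | hA | hA <;>
      rcases hcov'.cases F (i + 1) with hB | hB | hB
    · have := hA.1
      have := hA.2.1
      have := hB.2.1
      exact hA.2.2.1 (i + 1) (by omega) (by omega) (by omega) (by omega)
    · have a1 := hA.1
      have a2 := hA.2.1
      have b1 := hB.1
      have b2 := hB.2.1
      have a3 := hA.2.2.1 (i + 1) (by omega) (by omega)
      have b3 := hB.2.2.1 i (by omega) (by omega)
      have a4 := hA.2.2.2
      rcases tr_cases K a b i with ⟨n, h1, h2⟩ | ⟨n, h1, h2, -⟩ | ⟨h1, h1', h2⟩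
      · rcases tr_cases K a b (i + 1) with ⟨n', h3, h4⟩ | ⟨n', h3, h4, -⟩ | ⟨h3, h3', h4⟩
        · exact hn ⟨n' - n, by linarith⟩
        · have e1 : tr K a b i = i + 1 + (n - n') * K := by rw [h2, h3]; ring
          have e2 : tr K a b (i + 1) = i + (-(n - n')) * K := by rw [h4]; linarith
          -- The inversion runs from `i` to the translate of `i + 1` by `n - n'` periods. Zero
          -- periods are excluded by `hti`; a positive number contradicts the affine clause `a4`.
          have hq : 1 ≤ n - n' := by
            by_contra hneg
            have : (n - n') * K ≤ 0 * K := mul_le_mul_of_nonneg_right (by omega) hK0.le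
            omega
          rw [e2, map_add_mul] at hcon
          rw [e1, map_add_mul] at hcon a4
          have hq1 : 1 * K ≤ (n - n') * K := mul_le_mul_of_nonneg_right hq hK0.le
          have hq2 : 1 * N ≤ (n - n') * N := mul_le_mul_of_nonneg_right hq hN.le
          exact a4 ⟨by linarith, by linarith⟩
        · omega
      · linarith
      · omega
    · have := hA.1
      have := hA.2.1
      rw [hB] at hcon
      exact hA.2.2.1 (i + 1) (by omega) (by omega) (by omega) (by omega)
    · have := hA.2.1
      have := hB.2.1
      omega
    · have := hB.1
      have := hA.2.1
      exact hB.2.2.1 i (by omega) (by omega) (by omega) (by omega)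
    · have := hA.2.1
      rw [hB] at hcon
      omega
    · have := hB.2.1
      rw [hA] at hcon
      omega
    · have := hB.1
      rw [hA] at hcon
      exact hB.2.2.1 i (by omega) (by omega) (by omega) (by omega)
    · rw [hA, hB] at hcon
      omega
  refine ⟨hHi, tr K i (i + 1) a, tr K i (i + 1) b, ⟨hsab, ?_, ?_, ?_⟩, ?_⟩
  · rwa [heF, heF, tr_tr hn, tr_tr hn]
  · intro c hc1 hc2 hc3 hc4
    rw [heF, heF c, tr_tr hn] at hc3
    rw [heF, heF (tr K i (i + 1) a), tr_tr hn] at hc4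
    rw [← tr_tr hn c] at hc1 hc2
    generalize tr K i (i + 1) c = c' at *
    have n1 : c' ≠ a := by rintro rfl; omega
    have n2 : c' ≠ b := by rintro rfl; omega
    rcases lt_or_gt_of_ne n1 with h1 | h1
    · obtain ⟨h2, rfl⟩ := adj_rev hK i hc1 h1
      have := desc c' h2
      omega
    rcases lt_or_gt_of_ne n2 with h3 | h3
    · exact hrect c' h1 h3 hc3 hc4
    · obtain ⟨h2, rfl⟩ := adj_rev hK i hc2 h3
      have := desc b h2
      omega
  · rintro ⟨h1, h2⟩
    rw [heF, heF (tr K i (i + 1) a), tr_tr hn, tr_tr hn] at h2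
    have e1 := tr_add K i (i + 1) a 1
    rw [one_mul] at e1
    rw [← e1] at h1
    rcases lt_trichotomy (a + K) b with h3 | h3 | h3
    · exact haff ⟨h3, h2⟩
    · rw [← h3, map_add] at h2
      have := h3 ▸ hFab
      rw [map_add] at this
      omega
    · obtain ⟨h4, h5⟩ := adj_rev hK i h1 h3
      have := desc b h4
      rw [← h5, map_add] at this
      omega
  · intro l
    rw [swap_apply, hH, heF, tr_conj hn, tr_tr hn, tr_tr hn]

/-- The converse half: a cover of `e` is conjugated back. A point that this pushes into the
rectangle is a neighbour of one of its ends, and the ascent of `H s_i` at `i` rules it out. -/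
theorem cov_swap_of_swap (hK : 2 ≤ K) (hN : 0 < N) {i : ℤ} {e : Aff K N} (he : e i < e (i + 1))
    {H : Aff K N} (hHi : H (i + 1) < H i) (h : e.Cov (H.swap (not_dvd_adj hK i))) :
    (e.swap (not_dvd_adj hK i)).Cov H := by
  have hn := not_dvd_adj hK i
  have hK0 : 0 < K := by linarith
  obtain ⟨a, b, ⟨hab, hFab, hrect, haff⟩, hH⟩ := h
  have hd := not_dvd_of_inv hK0 hN e hab hFab
  have hHE : ∀ l, H l = H.swap hn (tr K i (i + 1) l) := fun l => by rw [swap_apply, tr_tr hn]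
  have hEi : H.swap hn i < H.swap hn (i + 1) := by rwa [swap_adj_left hK, swap_adj_right hK]
  generalize H.swap hn = E at hH hHE hEi
  have asc : ∀ x, K ∣ x - i → E x < E (x + 1) := fun x hx => (lt_iff_of_dvd E hx).2 hEi
  have asc' : ∀ x, K ∣ x - i → e x < e (x + 1) := fun x hx => (lt_iff_of_dvd e hx).2 he
  have hEa : E a = e b := by
    have := tr_left K a b 0
    rw [zero_mul, add_zero, add_zero] at this
    rw [hH, this]
  have hEb : E b = e a := by
    have := tr_right hd 0
    rw [zero_mul, add_zero, add_zero] at this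
    rw [hH, this]
  have hsa : ∀ x, e.swap hn (tr K i (i + 1) x) = e x := fun x => by rw [swap_apply, tr_tr hn]
  have hmul : ∀ n : ℤ, 0 < n * K → 0 < n * N := fun n h =>
    mul_pos (pos_of_mul_pos_left h hK0.le) hN
  refine ⟨tr K i (i + 1) a, tr K i (i + 1) b, ⟨?_, ?_, ?_, ?_⟩, ?_⟩
  · refine (tr_adj_lt hK i hab).resolve_right ?_
    rintro ⟨h1, rfl⟩
    exact lt_asymm hFab (asc' a h1)
  · rwa [hsa, hsa]
  · intro c hc1 hc2 hc3 hc4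
    rw [hsa, swap_apply] at hc3 hc4
    rw [← tr_tr hn c] at hc1 hc2
    generalize tr K i (i + 1) c = c' at *
    have n1 : c' ≠ a := by rintro rfl; omega
    have n2 : c' ≠ b := by rintro rfl; omega
    rcases lt_or_gt_of_ne n1 with h1 | h1
    · obtain ⟨h2, rfl⟩ := adj_rev hK i hc1 h1
      have h3 := asc c' h2
      rw [hEa, hH] at h3
      rcases tr_cases K (c' + 1) b c' with ⟨n, h4, h5⟩ | ⟨n, h4, h5, -⟩ | ⟨h4, h4', h5⟩
      · exact not_dvd_adj hK c' ⟨-n, by linarith⟩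
      · have h6 := hmul (-n) (by linarith)
        have h7 := e.map_add_mul b n
        rw [← h4] at h7
        linarith
      · rw [h5] at h3
        omega
    rcases lt_or_gt_of_ne n2 with h3 | h3
    · exact hrect c' h1 h3 hc3 hc4
    · obtain ⟨h2, rfl⟩ := adj_rev hK i hc2 h3
      have h3 := asc b h2
      rw [hEb, hH] at h3
      rcases tr_cases K a b (b + 1) with ⟨n, h4, h5⟩ | ⟨n, h4, h5, -⟩ | ⟨h4, h4', h5⟩
      · have h6 := hmul n (by linarith)
        have h7 := e.map_add_mul a n
        rw [← h4] at h7
        linarith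
      · exact not_dvd_adj hK b ⟨n, by linarith⟩
      · rw [h5] at h3
        omega
  · rintro ⟨h1, h2⟩
    rw [hsa, hsa] at h2
    have e1 := tr_add K i (i + 1) a 1
    rw [one_mul] at e1
    rw [← e1] at h1
    rcases lt_trichotomy (a + K) b with h3 | h3 | h3
    · exact haff ⟨h3, h2⟩
    · have := h3 ▸ hFab
      rw [map_add] at this
      omega
    · obtain ⟨h4, h5⟩ := adj_rev hK i h1 h3
      have := asc b h4
      rw [← h5, map_add, hEa, hEb] at this
      omega
  · intro l
    rw [hHE, hH, swap_apply, tr_conj hn, tr_tr hn, tr_tr hn]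

theorem cov_swap_self (hK : 2 ≤ K) {i : ℤ} {e : Aff K N} (he : e i < e (i + 1)) :
    (e.swap (not_dvd_adj hK i)).Cov e := by
  have hn := not_dvd_adj hK i
  refine ⟨i, i + 1, ⟨by omega, by rwa [swap_adj_left hK, swap_adj_right hK],
    fun c h1 h2 => by omega, fun h => by omega⟩, fun l => ?_⟩
  rw [swap_apply, tr_tr hn]

theorem ext_swap_of_ext (hK : 2 ≤ K) (hN : 0 < N) {i : ℤ} {e : Aff K N} (he : e i < e (i + 1))
    {H : Aff K N} (h : (e.swap (not_dvd_adj hK i)).Ext H) :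
    H (i + 1) < H i ∧ e.Ext (H.swap (not_dvd_adj hK i)) := by
  have hn := not_dvd_adj hK i
  have hFi : e.swap hn (i + 1) < e.swap hn i := by
    rwa [swap_adj_left hK, swap_adj_right hK]
  have heF : ∀ l, e l = e.swap hn (tr K i (i + 1) l) := fun l => by rw [swap_apply, tr_tr hn]
  generalize e.swap hn = F at h hFi heF
  have desc : ∀ x, K ∣ x - i → F (x + 1) < F x := fun x hx => (gt_iff_of_dvd F hx).2 hFi
  obtain ⟨s, hs, hH⟩ := h
  have hsi : ¬ K ∣ i + 1 - s := by
    rintro ⟨n, hn'⟩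
    have h1 := hs (s - 1) (by omega)
    have h2 := desc (s - 1) ⟨-n, by linarith⟩
    rw [sub_add_cancel] at h2
    omega
  refine ⟨?_, tr K i (i + 1) s, fun l hl => ?_, fun l => ?_⟩
  · rw [hH, hH, if_neg hsi]
    split_ifs <;> linarith
  · rw [heF, heF (tr K i (i + 1) s), tr_tr hn]
    rw [← tr_tr hn l] at hl
    generalize tr K i (i + 1) l = l' at *
    have : l' ≠ s := by rintro rfl; omega
    rcases lt_or_gt_of_ne this with h1 | h1
    · exact hs l' h1
    · obtain ⟨h2, rfl⟩ := adj_rev hK i hl h1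
      exact desc s h2
  · rw [swap_apply, hH, heF]
    have : K ∣ tr K i (i + 1) l - s ↔ K ∣ l - tr K i (i + 1) s := by
      constructor
      · rintro ⟨n, hn'⟩
        have h1 : tr K i (i + 1) l = s + n * K := by linarith
        have h2 := congrArg (tr K i (i + 1)) h1
        rw [tr_tr hn, tr_add] at h2
        exact ⟨n, by linarith⟩
      · rintro ⟨n, hn'⟩
        have h1 : l = tr K i (i + 1) s + n * K := by linarith
        have h2 := congrArg (tr K i (i + 1)) h1
        rw [tr_add, tr_tr hn] at h2
        exact ⟨n, by linarith⟩
    simp only [this]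

theorem ext_swap_of_swap (hK : 2 ≤ K) {i : ℤ} {e : Aff K N}
    {H : Aff K N} (hHi : H (i + 1) < H i) (h : e.Ext (H.swap (not_dvd_adj hK i))) :
    (e.swap (not_dvd_adj hK i)).Ext H := by
  have hn := not_dvd_adj hK i
  obtain ⟨s, hs, hH⟩ := h
  have hHE : ∀ l, H l = H.swap hn (tr K i (i + 1) l) := fun l => by rw [swap_apply, tr_tr hn]
  have hEi : H.swap hn i < H.swap hn (i + 1) := by rwa [swap_adj_left hK, swap_adj_right hK]
  generalize H.swap hn = E at hH hHE hEi
  have asc : ∀ x, K ∣ x - i → E x < E (x + 1) := fun x hx => (lt_iff_of_dvd E hx).2 hEi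
  have hsa : ∀ x, e.swap hn (tr K i (i + 1) x) = e x := fun x => by rw [swap_apply, tr_tr hn]
  refine ⟨tr K i (i + 1) s, fun l hl => ?_, fun l => ?_⟩
  · rw [hsa, swap_apply]
    rw [← tr_tr hn l] at hl
    generalize tr K i (i + 1) l = l' at *
    have : l' ≠ s := by rintro rfl; omega
    rcases lt_or_gt_of_ne this with h1 | h1
    · exact hs l' h1
    · obtain ⟨h2, rfl⟩ := adj_rev hK i hl h1
      have h3 := asc s h2
      rw [hH, hH, if_pos (by simp), if_neg (not_dvd_adj hK s)] at h3
      have h4 := hs (s + 1 + (-1) * K) (by linarith)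
      rw [map_add_mul] at h4
      linarith
  · rw [hHE, hH, swap_apply]
    have : K ∣ tr K i (i + 1) l - s ↔ K ∣ l - tr K i (i + 1) s := by
      constructor
      · rintro ⟨n, hn'⟩
        have h1 : tr K i (i + 1) l = s + n * K := by linarith
        have h2 := congrArg (tr K i (i + 1)) h1
        rw [tr_tr hn, tr_add] at h2
        exact ⟨n, by linarith⟩
      · rintro ⟨n, hn'⟩
        have h1 : l = tr K i (i + 1) s + n * K := by linarith
        have h2 := congrArg (tr K i (i + 1)) h1
        rw [tr_add, tr_tr hn] at h2
        exact ⟨n, by linarith⟩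
    simp only [this]

/-- A strand that starts just after a higher one is overtaken, so the strand at `i + 1` is not the
prolonged one and the descent can only grow. -/
theorem Ext.gt_of_gt (hN : 0 < N) {i : ℤ} {e E : Aff K N} (he : e (i + 1) < e i) (h : e.Ext E) :
    E (i + 1) < E i := by
  obtain ⟨s, hs, hH⟩ := h
  have hsi : ¬ K ∣ i + 1 - s := by
    rintro ⟨n, hn'⟩
    have h1 := hs (s - 1) (by omega)
    have h2 := (gt_iff_of_dvd e (x := s - 1) (i := i) ⟨-n, by linarith⟩).2 he
    rw [sub_add_cancel] at h2
    omega
  rw [hH, hH, if_neg hsi]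
  split_ifs <;> linarith

/-- The operator that introduces a crossing of the strands at `i` and `i + 1`. -/
def adj (N : ℤ) (hK : 2 ≤ K) (i : ℤ) : (Aff K N →₀ ZMod 2) →ₗ[ZMod 2] (Aff K N →₀ ZMod 2) :=
  relOp fun F H => F i < F (i + 1) ∧ H = F.swap (not_dvd_adj hK i)

theorem finite_adj (hK : 2 ≤ K) (i : ℤ) (F : Aff K N) :
    {H | F i < F (i + 1) ∧ H = F.swap (not_dvd_adj hK i)}.Finite :=
  (Set.finite_singleton (F.swap (not_dvd_adj hK i))).subset fun _ h => h.2

/-- The transposed description of `adj`: a coefficient at `H` can only come from `H s_i`. In this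
form the lifting properties can be compared coefficient by coefficient. -/
theorem adj_apply (hK : 2 ≤ K) (i : ℤ) (v : Aff K N →₀ ZMod 2) (H : Aff K N) :
    adj N hK i v H = if H (i + 1) < H i then v (H.swap (not_dvd_adj hK i)) else 0 := by
  classical
  induction v using Finsupp.induction_linear with
  | zero => simp
  | add v w hv hw =>
    rw [_root_.map_add, Finsupp.add_apply, hv, hw]
    split_ifs <;> simp
  | single F c =>
    have hc : Finsupp.single F c = c • Finsupp.single F (1 : ZMod 2) := by simp
    rw [hc, map_smul, Finsupp.smul_apply, adj, relOp_single_apply (finite_adj hK i F)]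
    have : (F i < F (i + 1) ∧ H = F.swap (not_dvd_adj hK i)) ↔
        (H (i + 1) < H i ∧ F = H.swap (not_dvd_adj hK i)) := by
      constructor
      · rintro ⟨h, rfl⟩
        rw [swap_adj_left hK, swap_adj_right hK, swap_swap]
        exact ⟨h, rfl⟩
      · rintro ⟨h, rfl⟩
        rw [swap_adj_left hK, swap_adj_right hK, swap_swap]
        exact ⟨h, rfl⟩
    by_cases h1 : H (i + 1) < H i
    · by_cases h2 : F = H.swap (not_dvd_adj hK i)
      · rw [if_pos (this.2 ⟨h1, h2⟩), if_pos h1, h2]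
        simp
      · rw [if_neg (fun h => h2 (this.1 h).2), if_pos h1]
        simp [h2]
    · rw [if_neg (fun h => h1 (this.1 h).1), if_neg h1, smul_zero]

theorem adj_single_of_lt (hK : 2 ≤ K) {i : ℤ} {F : Aff K N} (h : F i < F (i + 1)) :
    adj N hK i (Finsupp.single F 1) = Finsupp.single (F.swap (not_dvd_adj hK i)) 1 := by
  classical
  ext H
  rw [adj, relOp_single_apply (finite_adj hK i F), Finsupp.single_apply]
  simp only [h, true_and, eq_comm]

theorem adj_single_of_gt (hK : 2 ≤ K) {i : ℤ} {F : Aff K N} (h : F (i + 1) < F i) :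
    adj N hK i (Finsupp.single F 1) = 0 := by
  classical
  ext H
  rw [adj, relOp_single_apply (finite_adj hK i F)]
  simp [h.not_gt]

theorem adj_adj (hK : 2 ≤ K) (i : ℤ) (v : Aff K N →₀ ZMod 2) :
    adj N hK i (adj N hK i v) = 0 := by
  ext H
  rw [adj_apply, adj_apply, swap_adj_left hK, swap_adj_right hK]
  split_ifs with h1 h2
  · exact absurd h1 h2.not_gt
  · rfl
  · rfl

theorem cov_adj_of_lt (hK : 2 ≤ K) (hN : 0 < N) {i : ℤ} {F : Aff K N} (h : F i < F (i + 1)) :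
    relOp Cov (Finsupp.single (F.swap (not_dvd_adj hK i)) 1) =
      Finsupp.single F 1 + adj N hK i (relOp Cov (Finsupp.single F 1)) := by
  classical
  have hK0 : 0 < K := by omega
  ext H
  rw [relOp_single_apply (finite_cov hK0 hN _), Finsupp.add_apply, adj_apply,
    relOp_single_apply (finite_cov hK0 hN _), Finsupp.single_apply]
  by_cases h1 : F = H
  · subst h1
    rw [if_pos (cov_swap_self hK h), if_neg h.not_gt]
    simp
  · rw [if_neg h1, zero_add]
    by_cases h2 : H (i + 1) < H i
    · rw [if_pos h2]
      refine if_congr ⟨fun h3 => ?_, fun h3 => cov_swap_of_swap hK hN h h2 h3⟩ rfl rfl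
      exact ((cov_swap_of_lt hK hN h h3).resolve_left fun h => h1 h.symm).2
    · rw [if_neg h2, if_neg]
      exact fun h3 => h2 ((cov_swap_of_lt hK hN h h3).resolve_left fun h => h1 h.symm).1

/-- The homotopy formula behind the whole section. At an ascent it is the lifting property. At a
descent `F = adj E` with `E = F s_i`; applying `adj` to the formula for `E` gives `adj (Cov F) = F`,
while `adj F = 0`, so both sides vanish modulo 2. -/
theorem cov_adj (hK : 2 ≤ K) (hN : 0 < N) (i : ℤ) (v : Aff K N →₀ ZMod 2) :
    relOp Cov (adj N hK i v) = v + adj N hK i (relOp Cov v) := by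
  have : (relOp Cov ∘ₗ adj N hK i) = LinearMap.id + adj N hK i ∘ₗ relOp Cov := by
    ext1 F
    apply LinearMap.ext_ring
    simp only [LinearMap.comp_apply, LinearMap.add_apply, LinearMap.id_apply,
      Finsupp.lsingle_apply]
    rcases lt_or_gt F (i := i) (j := i + 1) (by omega) with h | h
    · rw [adj_single_of_lt hK h, cov_adj_of_lt hK hN h]
    · have h' : F.swap (not_dvd_adj hK i) i < F.swap (not_dvd_adj hK i) (i + 1) := by
        rwa [swap_adj_left hK, swap_adj_right hK]
      have h2 := cov_adj_of_lt hK hN h'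
      rw [swap_swap] at h2
      rw [adj_single_of_gt hK h, h2, _root_.map_add, adj_adj, adj_single_of_lt hK h', swap_swap,
        add_zero, finsupp_add_self, map_zero]
  exact congrArg (fun φ => φ v) this

theorem ext_adj (hK : 2 ≤ K) (i : ℤ) (v : Aff K N →₀ ZMod 2) (hN : 0 < N) :
    relOp Ext (adj N hK i v) = adj N hK i (relOp Ext v) := by
  classical
  have hK0 : 0 < K := by omega
  have : (relOp Ext ∘ₗ adj N hK i) = adj N hK i ∘ₗ relOp Ext := by
    ext1 F
    apply LinearMap.ext_ring
    simp only [LinearMap.comp_apply, Finsupp.lsingle_apply]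
    ext H
    rw [adj_apply, relOp_single_apply (finite_ext hK0 F)]
    rcases lt_or_gt F (i := i) (j := i + 1) (by omega) with h | h
    · rw [adj_single_of_lt hK h, relOp_single_apply (finite_ext hK0 _)]
      by_cases h2 : H (i + 1) < H i
      · rw [if_pos h2]
        exact if_congr ⟨fun h3 => (ext_swap_of_ext hK hN h h3).2,
          fun h3 => ext_swap_of_swap hK h2 h3⟩ rfl rfl
      · rw [if_neg h2, if_neg]
        exact fun h3 => h2 (ext_swap_of_ext hK hN h h3).1
    · rw [adj_single_of_gt hK h, map_zero, Finsupp.zero_apply]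
      split_ifs with h1 h2
      · have := Ext.gt_of_gt hN h h2
        rw [swap_adj_left hK, swap_adj_right hK] at this
        exact absurd h1 this.not_gt
      · rfl
      · rfl
  exact congrArg (fun φ => φ v) this

/-! ### Induction on the number of crossings -/

/-- The deviation of `F` from the linear map of slope `N / K`. -/
def dev (F : Aff K N) (l : ℤ) : ℤ := K * F l - N * l

theorem dev_add_mul (F : Aff K N) (l n : ℤ) : F.dev (l + n * K) = F.dev l := by
  rw [dev, dev, map_add_mul]; ring

theorem sum_dev_sq (hK : 0 < K) (F : Aff K N) (i : ℤ) :
    ∑ l ∈ Finset.Ico (0 : ℤ) K, F.dev l ^ 2 = ∑ l ∈ Finset.Ico i (i + K), F.dev l ^ 2 := by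
  refine Finset.sum_nbij' (fun l => i + (l - i) % K) (fun l => l % K) ?_ ?_ ?_ ?_ ?_
  · intro l _
    have := Int.emod_nonneg (l - i) hK.ne'
    have := Int.emod_lt_of_pos (l - i) hK
    simp only [Finset.mem_Ico]; omega
  · intro l _
    have := Int.emod_nonneg l hK.ne'
    have := Int.emod_lt_of_pos l hK
    simp only [Finset.mem_Ico]; omega
  · intro l hl
    rw [Finset.mem_Ico] at hl
    have h : l = l % K := (Int.emod_eq_of_lt hl.1 hl.2).symm
    conv_rhs => rw [h]
    change Int.ModEq K _ _
    calc i + (l - i) % K ≡ i + (l - i) [ZMOD K] := Int.ModEq.add_left _ (Int.mod_modEq _ _)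
      _ = l := by ring
  · intro l hl
    rw [Finset.mem_Ico] at hl
    have h : (l % K - i) % K = (l - i) % K := Int.ModEq.sub_right _ (Int.mod_modEq _ _)
    simp only [h]
    rw [Int.emod_eq_of_lt (by omega) (by omega)]
    ring
  · intro l _
    have h : l = i + (l - i) % K + (l - i) / K * K := by
      linarith [Int.emod_add_mul_ediv (l - i) K]
    conv_lhs => rw [h, dev_add_mul]

/-- In the expanded squares only the mixed terms `-2 K N l F(l)` change, and putting two values into
increasing order lowers their sum (the rearrangement inequality). -/
theorem sum_dev_sq_swap_lt (hK : 2 ≤ K) (hN : 0 < N) {i : ℤ} {F : Aff K N}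
    (h : F (i + 1) < F i) :
    ∑ l ∈ Finset.Ico (0 : ℤ) K, (F.swap (not_dvd_adj hK i)).dev l ^ 2 <
      ∑ l ∈ Finset.Ico (0 : ℤ) K, F.dev l ^ 2 := by
  have hK0 : 0 < K := by omega
  rw [sum_dev_sq hK0 _ i, sum_dev_sq hK0 F i]
  have hset : Finset.Ico i (i + K) = insert i (insert (i + 1) (Finset.Ico (i + 2) (i + K))) := by
    ext l; simp only [Finset.mem_Ico, Finset.mem_insert]; omega
  rw [hset, Finset.sum_insert (by simp), Finset.sum_insert (by simp), Finset.sum_insert (by simp),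
    Finset.sum_insert (by simp)]
  have hrest : ∑ l ∈ Finset.Ico (i + 2) (i + K), (F.swap (not_dvd_adj hK i)).dev l ^ 2 =
      ∑ l ∈ Finset.Ico (i + 2) (i + K), F.dev l ^ 2 := by
    refine Finset.sum_congr rfl fun l hl => ?_
    rw [Finset.mem_Ico] at hl
    rw [dev, dev, swap_apply, tr_of_not]
    · intro hd; have := Int.le_of_dvd (by omega) hd; omega
    · intro hd; have := Int.le_of_dvd (by omega) hd; omega
  rw [hrest]
  simp only [dev, swap_adj_left hK, swap_adj_right hK]
  have h1 : 0 < N * K * (F i - F (i + 1)) := by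
    have : 0 < F i - F (i + 1) := by omega
    positivity
  nlinarith

/-- Resolving a descent lowers the sum of squared deviations over one period, a nonnegative integer.
Hence every map arises from an increasing one by adjacent exchanges that create an inversion. -/
theorem induction_swap (hK : 0 < K) (hN : 0 < N) {P : Aff K N → Prop}
    (base : ∀ F : Aff K N, StrictMono F → P F)
    (step : ∀ (hK : 2 ≤ K) (F : Aff K N) (i : ℤ), F i < F (i + 1) → P F →
      P (F.swap (not_dvd_adj hK i))) (F : Aff K N) : P F := by
  induction hn : (∑ l ∈ Finset.Ico (0 : ℤ) K, F.dev l ^ 2).toNat using Nat.strong_induction_on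
    generalizing F with
  | _ n ih =>
    by_cases h : ∃ i, F (i + 1) < F i
    · obtain ⟨i, hi⟩ := h
      have hK2 : 2 ≤ K := by
        by_contra hcon
        obtain rfl : K = 1 := by omega
        have := F.map_add i
        omega
      have hpos : 0 ≤ ∑ l ∈ Finset.Ico (0 : ℤ) K, (F.swap (not_dvd_adj hK2 i)).dev l ^ 2 :=
        Finset.sum_nonneg fun l _ => sq_nonneg _
      have hlt := sum_dev_sq_swap_lt hK2 hN hi
      have := step hK2 (F.swap (not_dvd_adj hK2 i)) i
        (by rwa [swap_adj_left hK2, swap_adj_right hK2]) (ih _ (by omega) _ rfl)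
      rwa [swap_swap] at this
    · refine base F (strictMono_int_of_lt_succ fun i => ?_)
      exact (lt_or_gt F (by omega)).resolve_right fun h' => h ⟨i, h'⟩

theorem not_cov_of_strictMono {F H : Aff K N} (hF : StrictMono F) : ¬ F.Cov H := by
  rintro ⟨i, j, h, -⟩
  exact absurd (hF h.1) h.2.1.not_gt

theorem cov_single_of_strictMono (hK : 0 < K) (hN : 0 < N) {F : Aff K N} (hF : StrictMono F) :
    relOp Cov (Finsupp.single F 1) = 0 := by
  classical
  ext H
  rw [relOp_single_apply (finite_cov hK hN F), if_neg (not_cov_of_strictMono hF)]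
  rfl

/-- Increasing maps have nothing to resolve. In the inductive step the homotopy formula gives `Cov
Cov adj F = Cov F + Cov F + adj Cov Cov F`. -/
theorem cov_cov (hK : 0 < K) (hN : 0 < N) (v : Aff K N →₀ ZMod 2) :
    relOp Cov (relOp Cov v) = 0 := by
  have : relOp Cov ∘ₗ relOp Cov = (0 : (Aff K N →₀ ZMod 2) →ₗ[ZMod 2] _) := by
    ext1 F
    apply LinearMap.ext_ring
    change relOp Cov (relOp Cov (Finsupp.single F 1)) = 0
    induction F using induction_swap hK hN with
    | base F hF => rw [cov_single_of_strictMono hK hN hF, map_zero]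
    | step hK2 F i hi ih =>
      rw [← adj_single_of_lt hK2 hi, cov_adj hK2 hN, _root_.map_add, cov_adj hK2 hN, ih, map_zero,
        add_zero, finsupp_add_self]
  exact congrArg (fun φ => φ v) this

/-- The strand at `s` is prolonged by one turn. -/
def wind (F : Aff K N) (s : ℤ) : Aff K N where
  toFun l := if K ∣ l - s then F l + N else F l
  inj a b hab := by
    have key : ∀ a b : ℤ, K ∣ a - s → ¬ K ∣ b - s → F a + N ≠ F b := by
      intro a b ha hb h
      rw [← map_add] at h
      have := F.inj h
      rw [← this, show a + K - s = a + 1 * K - s by ring, dvd_add_mul_sub] at hb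
      exact hb ha
    by_cases ha : K ∣ a - s <;> by_cases hb : K ∣ b - s <;> simp only [ha, hb, if_true, if_false] at hab
    · exact F.inj (by linarith)
    · exact absurd hab (key a b ha hb)
    · exact absurd hab.symm (key b a hb ha)
    · exact F.inj hab
  map_add' l := by
    have : K ∣ l + K - s ↔ K ∣ l - s := by
      rw [show l + K - s = l + 1 * K - s by ring, dvd_add_mul_sub]
    simp only [this, map_add]
    split_ifs <;> ring

theorem wind_apply_of_dvd (F : Aff K N) {s l : ℤ} (h : K ∣ l - s) : F.wind s l = F l + N := if_pos h

theorem wind_apply_of_not (F : Aff K N) {s l : ℤ} (h : ¬ K ∣ l - s) : F.wind s l = F l := if_neg h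

theorem not_dvd_of_lt {s b : ℤ} (h1 : s < b) (h2 : b < s + K) : ¬ K ∣ b - s := fun h => by
  have := Int.le_of_dvd (by omega) h
  omega

theorem isCover_wind (F : Aff K N) (hF : StrictMono F) {s b : ℤ} (h1 : s < b) (h2 : b < s + K) :
    (F.wind s).IsCover s b := by
  have hs : F.wind s s = F s + N := wind_apply_of_dvd F (by simp)
  have hw : ∀ c, s < c → c < s + K → F.wind s c = F c := fun c hc1 hc2 =>
    wind_apply_of_not F (not_dvd_of_lt hc1 hc2)
  refine ⟨h1, ?_, fun c hc1 hc2 hc3 _ => ?_, fun h => by omega⟩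
  · rw [hs, hw b h1 h2, ← map_add]
    exact hF h2
  · rw [hw b h1 h2, hw c hc1 (by omega)] at hc3
    exact absurd (hF hc2) hc3.not_gt

/-- When one strand of an increasing map is prolonged by a turn, it overtakes exactly the strands
that start between it and its next translate. These are the only inversions up to translation. -/
theorem cov_wind (F : Aff K N) (hF : StrictMono F) (hK : 0 < K) (hN : 0 < N) {s : ℤ} {H : Aff K N} (h : (F.wind s).Cov H) :
    ∃ b, s < b ∧ b < s + K ∧ ∀ l, H l = F.wind s (tr K s b l) := by
  obtain ⟨a, b, hab, hH⟩ := h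
  have hd := not_dvd_of_inv hK hN _ hab.1 hab.2.1
  have has : K ∣ a - s := by
    by_contra hcon
    have h2 := hab.2.1
    rw [wind_apply_of_not F hcon] at h2
    have h3 := hF hab.1
    by_cases hb : K ∣ b - s
    · rw [wind_apply_of_dvd F hb] at h2
      linarith
    · rw [wind_apply_of_not F hb] at h2
      linarith
  obtain ⟨n, hn⟩ := has
  have hab' := isCover_translate _ (-n) hab
  have e1 : a + -n * K = s := by linarith
  rw [e1] at hab'
  have hdb : ¬ K ∣ b + -n * K - s := by
    rw [dvd_add_mul_sub]
    rintro ⟨q, hq⟩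
    exact hd ⟨q - n, by linarith⟩
  refine ⟨b + -n * K, hab'.1, ?_, fun l => ?_⟩
  · have h2 := hab'.2.1
    rw [wind_apply_of_dvd F (by simp : K ∣ s - s), wind_apply_of_not F hdb,
      ← map_add] at h2
    exact hF.lt_iff_lt.1 h2
  · rw [hH, ← tr_translate K a b (-n), e1]

theorem ext_iff_of_strictMono (F : Aff K N) (hF : StrictMono F) {E : Aff K N} : F.Ext E ↔ ∃ s, E = F.wind s := by
  constructor
  · rintro ⟨s, -, hs⟩
    exact ⟨s, ext_coe hs⟩
  · rintro ⟨s, rfl⟩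
    exact ⟨s, fun l hl => hF hl, fun l => rfl⟩

/-- Both maps send `s` to `F b` and `b` to `F s + N` and agree with `F` outside the classes of `s`
and `b`. -/
theorem wind_swap_eq (F : Aff K N) {s b : ℤ} (h1 : s < b) (h2 : b < s + K) (l : ℤ) :
    F.wind s (tr K s b l) = F.wind b (tr K b (s + K) l) := by
  have hd := not_dvd_of_lt h1 h2
  have hd' : ¬ K ∣ s + K - b := not_dvd_of_lt h2 (by omega)
  have hd2 : ¬ K ∣ s - b := fun h => hd (by rw [← neg_sub]; exact h.neg_right)
  rcases tr_cases K s b l with ⟨n, rfl, hl⟩ | ⟨n, rfl, hl, -⟩ | ⟨h3, h4, hl⟩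
  · rw [hl, show s + n * K = s + K + (n - 1) * K by ring, tr_right hd',
      wind_apply_of_not F (by rwa [dvd_add_mul_sub]),
      wind_apply_of_dvd F (by rw [dvd_add_mul_sub]; simp), map_add_mul, map_add_mul]
    ring
  · rw [hl, tr_left, wind_apply_of_dvd F (by rw [dvd_add_mul_sub]; simp),
      wind_apply_of_not F (by rwa [dvd_add_mul_sub]), map_add_mul, map_add_mul, map_add]
    ring
  · have h5 : ¬ K ∣ l - (s + K) := fun h => h3 (by
      rw [show l - s = l - (s + K) + K by ring]
      exact dvd_add h dvd_rfl)
    rw [hl, tr_of_not h4 h5, wind_apply_of_not F h3, wind_apply_of_not F h4]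

/-- Each result of prolonging a strand and then resolving arises in exactly two ways: from the turn
of `s` and from the turn of `b`, where `s` and `b` are the two strands involved. The terms cancel in
pairs. -/
theorem cov_ext_of_strictMono (F : Aff K N) (hF : StrictMono F) (hK : 0 < K) (hN : 0 < N) :
    relOp Cov (relOp Ext (Finsupp.single F 1)) = (0 : Aff K N →₀ ZMod 2) := by
  ext H
  rw [relOp_relOp_single (finite_cov hK hN) (finite_ext hK F)]
  by_cases hne : ∃ E, F.Ext E ∧ E.Cov H
  · obtain ⟨E, hE, hEH⟩ := hne
    obtain ⟨s, rfl⟩ := (ext_iff_of_strictMono F hF).1 hE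
    obtain ⟨b, hsb, hbs, hH⟩ := cov_wind F hF hK hN hEH
    have hd := not_dvd_of_lt hsb hbs
    have hset : {E | F.Ext E ∧ E.Cov H} = {F.wind s, F.wind b} := by
      ext E
      constructor
      · rintro ⟨hE', hEH'⟩
        obtain ⟨s', rfl⟩ := (ext_iff_of_strictMono F hF).1 hE'
        obtain ⟨b', hsb', hbs', hH'⟩ := cov_wind F hF hK hN hEH'
        have hne : H s' ≠ F s' := by
          have := tr_left K s' b' 0
          rw [zero_mul, add_zero, add_zero] at this
          rw [hH', this, wind_apply_of_not F (not_dvd_of_lt hsb' hbs')]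
          exact (hF hsb').ne'
        rcases tr_cases K s b s' with ⟨n, h1, -⟩ | ⟨n, h1, -⟩ | ⟨h3, h4, hl⟩
        · left
          exact ext_coe fun l => ext_eq_of_dvd F ⟨-n, by linarith⟩ l
        · right
          exact ext_coe fun l => ext_eq_of_dvd F ⟨-n, by linarith⟩ l
        · rw [hH, hl, wind_apply_of_not F h3] at hne
          exact absurd rfl hne
      · rintro (rfl | rfl)
        · exact ⟨hE, hEH⟩
        · exact ⟨(ext_iff_of_strictMono F hF).2 ⟨b, rfl⟩, b, s + K,
            isCover_wind F hF hbs (by omega),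
            fun l => (hH l).trans (wind_swap_eq F hsb hbs l)⟩
    rw [hset, Set.ncard_pair]
    · rfl
    · intro h
      have := congrArg (fun E : Aff K N => E b) h
      rw [wind_apply_of_not F hd, wind_apply_of_dvd F (by simp)] at this
      omega
  · have : {E | F.Ext E ∧ E.Cov H} = ∅ := by
      ext E
      simp only [Set.mem_ofPred_eq, Set.mem_empty_iff_false, iff_false]
      exact fun h => hne ⟨E, h⟩
    rw [this]
    simp

/-- Both composites vanish on increasing maps, and the commutation rules with `adj` carry the
equality through the induction. -/
theorem cov_ext (hK : 0 < K) (hN : 0 < N) (v : Aff K N →₀ ZMod 2) :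
    relOp Cov (relOp Ext v) = relOp Ext (relOp Cov v) := by
  have : relOp Cov ∘ₗ relOp Ext = relOp Ext ∘ₗ (relOp Cov : (Aff K N →₀ ZMod 2) →ₗ[ZMod 2] _) := by
    ext1 F
    apply LinearMap.ext_ring
    change relOp Cov (relOp Ext (Finsupp.single F 1)) = relOp Ext (relOp Cov (Finsupp.single F 1))
    induction F using induction_swap hK hN with
    | base F hF =>
      rw [cov_ext_of_strictMono F hF hK hN, cov_single_of_strictMono hK hN hF, map_zero]
    | step hK2 F i hi ih =>
      rw [← adj_single_of_lt hK2 hi, ext_adj hK2 i _ hN, cov_adj hK2 hN, ih, cov_adj hK2 hN,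
        _root_.map_add, ext_adj hK2 i _ hN]
  exact congrArg (fun φ => φ v) this

/-- The number of ways to resolve two crossings in succession, with a given result, is even. -/
theorem even_cov_cov (hK : 0 < K) (hN : 0 < N) (F H : Aff K N) : (({E | F.Cov E ∧ E.Cov H}.ncard : ℕ) : ZMod 2) = 0 := by
  rw [← relOp_relOp_single (finite_cov hK hN) (finite_cov hK hN F), cov_cov hK hN]
  rfl

theorem ncard_ext_cov (hK : 0 < K) (hN : 0 < N) (F H : Aff K N) :
    (({E | F.Ext E ∧ E.Cov H}.ncard : ℕ) : ZMod 2) =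
      (({E | F.Cov E ∧ E.Ext H}.ncard : ℕ) : ZMod 2) := by
  rw [← relOp_relOp_single (finite_cov hK hN) (finite_ext hK F),
    ← relOp_relOp_single (finite_ext hK) (finite_cov hK hN F), cov_ext hK hN]

end Aff

/-! ### Classes of pairs -/

theorem PairClass.mk_eq_iff {m : ℕ} {p q : ℤ × ℤ} :
    PairClass.mk m p = PairClass.mk m q ↔
      ∃ γ : G m, q = (γ • p.1, γ • p.2) ∨ q = (γ • p.2, γ • p.1) := by
  constructor
  · intro h
    have h' := Quot.eqvGen_exact h
    clear h
    induction h' with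
    | rel p q h =>
      rcases h with rfl | ⟨γ, rfl⟩
      · exact ⟨1, Or.inr (by simp [Prod.swap])⟩
      · exact ⟨γ, Or.inl rfl⟩
    | refl p => exact ⟨1, Or.inl (by simp)⟩
    | symm p q h ih =>
      obtain ⟨γ, rfl | rfl⟩ := ih
      · exact ⟨γ⁻¹, Or.inl (by simp)⟩
      · exact ⟨γ⁻¹, Or.inr (by simp)⟩
    | trans p q r h1 h2 ih1 ih2 =>
      obtain ⟨γ, hγ⟩ := ih1
      obtain ⟨δ, hδ⟩ := ih2
      refine ⟨δ * γ, ?_⟩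
      rcases hγ with rfl | rfl <;> rcases hδ with rfl | rfl <;> simp [mul_smul]
  · rintro ⟨γ, rfl | rfl⟩
    · exact Quot.sound (Or.inr ⟨γ, rfl⟩)
    · have h : PairClass.mk m p = PairClass.mk m p.swap := Quot.sound (Or.inl rfl)
      exact h.trans (Quot.sound (Or.inr ⟨γ, rfl⟩))

theorem PairClass.mk_swap {m : ℕ} (a b : ℤ) : PairClass.mk m (a, b) = PairClass.mk m (b, a) :=
  PairClass.mk_eq_iff.2 ⟨1, Or.inr (by simp)⟩

theorem PairClass.mk_smul {m : ℕ} (γ : G m) (a b : ℤ) :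
    PairClass.mk m (γ • a, γ • b) = PairClass.mk m (a, b) :=
  (PairClass.mk_eq_iff (p := (a, b)).2 ⟨γ, Or.inl rfl⟩).symm

/-- The map on classes of pairs induced by an equivariant map. -/
def PairClass.map {m : ℕ} (φ : ℤ → ℤ) (hφ : ∀ (γ : G m) i, φ (γ • i) = γ • φ i) :
    PairClass m → PairClass m :=
  Quot.map (fun p => (φ p.1, φ p.2)) fun p q h => by
    rcases h with rfl | ⟨γ, rfl⟩
    · exact Or.inl rfl
    · exact Or.inr ⟨γ, by simp [hφ]⟩

theorem PairClass.map_mk {m : ℕ} (φ : ℤ → ℤ) (hφ : ∀ (γ : G m) i, φ (γ • i) = γ • φ i)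
    (a b : ℤ) : PairClass.map φ hφ (PairClass.mk m (a, b)) = PairClass.mk m (φ a, φ b) := rfl

theorem PairClass.exists_mk {m : ℕ} (c : PairClass m) : ∃ a b, c = PairClass.mk m (a, b) := by
  induction c using Quot.ind with
  | mk p => exact ⟨p.1, p.2, rfl⟩

/-- The pair is reversed by `φ`. -/
def Reversed (φ : ℤ → ℤ) (a b : ℤ) : Prop := (a < b ∧ φ b < φ a) ∨ (b < a ∧ φ a < φ b)

theorem Reversed.symm {φ : ℤ → ℤ} {a b : ℤ} (h : Reversed φ a b) : Reversed φ b a := Or.symm h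

theorem reversed_smul {m : ℕ} {φ : ℤ → ℤ} (hφ : ∀ (γ : G m) i, φ (γ • i) = γ • φ i) (γ : G m)
    (a b : ℤ) : Reversed φ (γ • a) (γ • b) ↔ Reversed φ a b := by
  unfold Reversed
  rw [hφ, hφ]
  rcases smul_cases γ with ⟨n, hn⟩ | ⟨n, hn⟩ <;> simp only [hn] <;> constructor <;> intro h <;> omega

theorem reversed_of_mk_eq {m : ℕ} {φ : ℤ → ℤ} (hφ : ∀ (γ : G m) i, φ (γ • i) = γ • φ i)
    {a b a' b' : ℤ} (h : PairClass.mk m (a, b) = PairClass.mk m (a', b')) (h' : Reversed φ a b) :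
    Reversed φ a' b' := by
  obtain ⟨γ, h | h⟩ := PairClass.mk_eq_iff.1 h <;> obtain ⟨rfl, rfl⟩ := Prod.ext_iff.1 h
  · exact (reversed_smul hφ γ a b).2 h'
  · exact (reversed_smul hφ γ b a).2 h'.symm

/-! ### Crossings of lifted partial permutations and their number after a resolution -/

namespace LPP

variable {m k : ℕ}

theorem isLiftedCrossing_iff {f : LPP m k} {a b : ℤ} :
    f.IsLiftedCrossing (a, b) ↔ a ∈ f.dom ∧ b ∈ f.dom ∧ Reversed f.val a b := by
  constructor
  · rintro ⟨x, y, hx, hy, hs⟩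
    have ha : a ∈ f.dom := ⟨x, hx⟩
    have hb : b ∈ f.dom := ⟨y, hy⟩
    refine ⟨ha, hb, ?_⟩
    obtain rfl := val_of_toFun hx
    obtain rfl := val_of_toFun hy
    simp only at hs
    have hne : a ≠ b := by rintro rfl; simp at hs
    have hne' : f.val a ≠ f.val b := fun h => hne (f.val_inj ha hb h)
    rcases lt_or_gt_of_ne hne with h1 | h1 <;> rcases lt_or_gt_of_ne hne' with h2 | h2
    · rw [sign_neg (by omega), sign_neg (by omega)] at hs
      exact absurd rfl hs
    · exact Or.inl ⟨h1, h2⟩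
    · exact Or.inr ⟨h1, h2⟩
    · rw [sign_pos (by omega), sign_pos (by omega)] at hs
      exact absurd rfl hs
  · rintro ⟨ha, hb, h⟩
    refine ⟨f.val a, f.val b, toFun_eq ha, toFun_eq hb, ?_⟩
    rcases h with ⟨h1, h2⟩ | ⟨h1, h2⟩
    · change SignType.sign (a - b) ≠ _
      rw [sign_neg (by omega), sign_pos (by omega)]; decide
    · change SignType.sign (a - b) ≠ _
      rw [sign_pos (by omega), sign_neg (by omega)]; decide

theorem mk_mem_cross_iff {f : LPP m k} {a b : ℤ} :
    PairClass.mk m (a, b) ∈ f.Cross ↔ a ∈ f.dom ∧ b ∈ f.dom ∧ Reversed f.val a b := by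
  rw [← isLiftedCrossing_iff]
  refine ⟨?_, fun h => ⟨_, h, rfl⟩⟩
  rintro ⟨⟨a', b'⟩, h, he⟩
  have h : f.IsLiftedCrossing (a', b') := h
  rw [isLiftedCrossing_iff] at h ⊢
  obtain ⟨ha, hb, hr⟩ := h
  refine ⟨?_, ?_, reversed_of_mk_eq f.val_smul he hr⟩
  all_goals
    obtain ⟨γ, h | h⟩ := PairClass.mk_eq_iff.1 he <;> obtain ⟨rfl, rfl⟩ := Prod.ext_iff.1 h <;> simpa

/-- Up to `G m` one of the strands starts in the fundamental domain, and displacements are bounded,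
so only finitely many strands can cross it. -/
theorem finite_cross (hm : 1 < m) (f : LPP m k) : f.Cross.Finite := by
  obtain ⟨M, hM0, hM⟩ := f.exists_displacement_bound hm
  refine (((Set.finite_Icc (1 : ℤ) (m - 1)).prod
    (Set.finite_Icc (-2 * M) (m + 2 * M))).image (PairClass.mk m)).subset ?_
  intro c hc
  obtain ⟨a, b, rfl⟩ := c.exists_mk
  obtain ⟨γ, h1, h2⟩ := exists_rep hm a
  rw [← PairClass.mk_smul γ] at hc ⊢
  obtain ⟨-, -, hr⟩ := mk_mem_cross_iff.1 hc
  refine ⟨(γ • a, γ • b), ⟨⟨h1, h2⟩, ?_⟩, rfl⟩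
  have ha := abs_le.1 (hM (γ • a))
  have hb := abs_le.1 (hM (γ • b))
  change -2 * M ≤ γ • b ∧ γ • b ≤ m + 2 * M
  rcases hr with hr | hr <;> constructor <;> linarith

/-- The displacement caused by the exchange of two orbits. -/
theorem swapOrbits_displacement (f : LPP m k) (i j l : ℤ) :
    (swapOrbits m i j l = l) ∨
    (swapOrbits m i j l = l + (j - i) ∧ f.val (swapOrbits m i j l) = f.val l + (f.val j - f.val i) ∧
      ((∃ n, l = i + n * period m) ∨ (∃ n, l = 1 - j + n * period m))) ∨
    (swapOrbits m i j l = l - (j - i) ∧ f.val (swapOrbits m i j l) = f.val l - (f.val j - f.val i) ∧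
      ((∃ n, l = j + n * period m) ∨ (∃ n, l = 1 - i + n * period m))) := by
  rcases swapOrbits_cases m i j l with ⟨γ, rfl, hl⟩ | ⟨γ, rfl, hl, -⟩ | ⟨-, -, hl⟩
  · rw [hl, val_smul, val_smul]
    rcases smul_cases γ with ⟨n, hn⟩ | ⟨n, hn⟩ <;> simp only [hn]
    · exact Or.inr (Or.inl ⟨by ring, by ring, Or.inl ⟨n, rfl⟩⟩)
    · exact Or.inr (Or.inr ⟨by ring, by ring, Or.inr ⟨n, rfl⟩⟩)
  · rw [hl, val_smul, val_smul]
    rcases smul_cases γ with ⟨n, hn⟩ | ⟨n, hn⟩ <;> simp only [hn]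
    · exact Or.inr (Or.inr ⟨by ring, by ring, Or.inl ⟨n, rfl⟩⟩)
    · exact Or.inr (Or.inl ⟨by ring, by ring, Or.inr ⟨n, rfl⟩⟩)
  · exact Or.inl hl

/-- The classes of crossings of `f` that disappear, beyond those that are matched with new ones, when
the values at `i` and `j` are exchanged. -/
def dropped (f : LPP m k) (i j : ℤ) : Set (PairClass m) :=
  {c | ∃ a b, c = PairClass.mk m (a, b) ∧ a ∈ f.dom ∧ b ∈ f.dom ∧ a < b ∧
    swapOrbits m i j b < swapOrbits m i j a ∧ f.val b < f.val a ∧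
    f.val (swapOrbits m i j a) < f.val (swapOrbits m i j b)}

/-- The exchange `t` acts on classes of pairs. On pairs whose order it preserves, it matches the
crossings of `f` with those of the resolution. On pairs that it reverses, every crossing of the
resolution is already one of `f`, and `dropped` consists of the surplus. -/
theorem cross_eq_cross_swap_add (hm : 1 < m) (f : LPP m k) {i j : ℤ} (hi : i ∈ f.dom)
    (hj : j ∈ f.dom) (hne : ¬ Equivalent m i j) (hij : i < j) (hf : f.val j < f.val i) :
    f.cross = (f.swap i j).cross + (f.dropped i j).ncard := by
  set t := swapOrbits m i j with ht
  have htt : ∀ l, t (t l) = l := swapOrbits_involutive hne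
  have hts : ∀ (γ : G m) l, t (γ • l) = γ • t l := fun γ l => swapOrbits_smul i j l γ
  have htd : ∀ l, t l ∈ f.dom ↔ l ∈ f.dom := f.swapOrbits_mem_dom hi hj
  have hv : ∀ l, (f.swap i j).val l = f.val (t l) := f.val_swap hi hj
  have hinj : ∀ {a b}, t a = t b → a = b := fun {a b} h => by rw [← htt a, h, htt]
  set T := PairClass.map t hts with hT
  have hTT : ∀ c, T (T c) = c := by
    intro c
    obtain ⟨a, b, rfl⟩ := c.exists_mk
    rw [hT, PairClass.map_mk, PairClass.map_mk, htt, htt]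
  have hTinj : Function.Injective T := fun a b h => by rw [← hTT a, h, hTT]
  let R : Set (PairClass m) := {c | ∃ a b, c = PairClass.mk m (a, b) ∧ Reversed t a b}
  have hR : ∀ a b, PairClass.mk m (a, b) ∈ R ↔ Reversed t a b := by
    intro a b
    refine ⟨?_, fun h => ⟨a, b, rfl, h⟩⟩
    rintro ⟨a', b', he, h⟩
    exact reversed_of_mk_eq hts he.symm h
  have hA : ∀ a b, PairClass.mk m (a, b) ∈ (f.swap i j).Cross ↔
      a ∈ f.dom ∧ b ∈ f.dom ∧ Reversed (fun l => f.val (t l)) a b := by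
    intro a b
    rw [mk_mem_cross_iff, dom_swap]
    have : (f.swap i j).val = fun l => f.val (t l) := funext hv
    rw [this]
  have h1 : (f.Cross \ R) = T '' ((f.swap i j).Cross \ R) := by
    have key : ∀ a b, (PairClass.mk m (a, b) ∈ f.Cross ∧ PairClass.mk m (a, b) ∉ R) ↔
        (PairClass.mk m (t a, t b) ∈ (f.swap i j).Cross ∧ PairClass.mk m (t a, t b) ∉ R) := by
      intro a b
      rw [hR, hR, hA, mk_mem_cross_iff, htd, htd]
      unfold Reversed
      simp only [htt]
      have : t a = t b → a = b := hinj
      constructor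
      · rintro ⟨⟨h1, h2, h3⟩, h4⟩
        exact ⟨⟨h1, h2, by omega⟩, by omega⟩
      · rintro ⟨⟨h1, h2, h3⟩, h4⟩
        have : a = b → t a = t b := fun h => by rw [h]
        exact ⟨⟨h1, h2, by omega⟩, by omega⟩
    ext c
    constructor
    · intro hc
      refine ⟨T c, ?_, hTT c⟩
      obtain ⟨a, b, rfl⟩ := c.exists_mk
      exact (key a b).1 hc
    · rintro ⟨c', hc', rfl⟩
      obtain ⟨a, b, rfl⟩ := c'.exists_mk
      refine (key (t a) (t b)).2 ?_
      rwa [htt, htt]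
  have h2 : (f.Cross ∩ R) = ((f.swap i j).Cross ∩ R) ∪ f.dropped i j := by
    -- Positions and values are displaced in opposite senses: a point that `t` moves to the right
    -- has a smaller value at its image, because `i < j` while `f.val j < f.val i`.
    have key : ∀ a b, a ∈ f.dom → b ∈ f.dom → a < b → t b < t a → f.val (t b) < f.val (t a) →
        f.val b < f.val a := by
      intro a b ha hb hab htab hfab
      rcases f.swapOrbits_displacement i j a with h | ⟨h, h', -⟩ | ⟨h, h', -⟩ <;>
        rcases f.swapOrbits_displacement i j b with g | ⟨g, g', -⟩ | ⟨g, g', -⟩ <;>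
        rw [← ht] at h g <;> (try rw [← ht] at h') <;> (try rw [← ht] at g') <;>
        (first | rw [h'] at hfab | rw [h] at hfab) <;> (first | rw [g'] at hfab | rw [g] at hfab) <;>
        omega
    ext c
    constructor
    · rintro ⟨hc, a, b, rfl, hr⟩
      wlog hab : a < b generalizing a b
      · rw [PairClass.mk_swap] at hc ⊢
        exact this b a hr.symm hc (by rcases hr with hr | hr <;> omega)
      have htab : t b < t a := by rcases hr with hr | hr <;> omega
      obtain ⟨ha, hb, hrev⟩ := mk_mem_cross_iff.1 hc
      have hfab : f.val b < f.val a := by rcases hrev with hr | hr <;> omega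
      rcases lt_trichotomy (f.val (t a)) (f.val (t b)) with h | h | h
      · exact Or.inr ⟨a, b, rfl, ha, hb, hab, htab, hfab, h⟩
      · exact absurd (hinj (f.val_inj ((htd a).2 ha) ((htd b).2 hb) h)) hab.ne
      · exact Or.inl ⟨(hA a b).2 ⟨ha, hb, Or.inl ⟨hab, h⟩⟩, (hR a b).2 hr⟩
    · rintro (⟨hc, a, b, rfl, hr⟩ | ⟨a, b, rfl, ha, hb, hab, htab, hfab, h⟩)
      · refine ⟨?_, (hR a b).2 hr⟩
        wlog hab : a < b generalizing a b
        · rw [PairClass.mk_swap] at hc ⊢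
          exact this b a hr.symm hc (by rcases hr with hr | hr <;> omega)
        have htab : t b < t a := by rcases hr with hr | hr <;> omega
        obtain ⟨ha, hb, hrev⟩ := (hA a b).1 hc
        refine mk_mem_cross_iff.2 ⟨ha, hb, Or.inl ⟨hab, key a b ha hb hab htab ?_⟩⟩
        rcases hrev with hr | hr
        · exact hr.2
        · exact absurd hr.1 hab.not_gt
      · exact ⟨mk_mem_cross_iff.2 ⟨ha, hb, Or.inl ⟨hab, hfab⟩⟩, (hR a b).2 (Or.inl ⟨hab, htab⟩)⟩
  have hdisj : Disjoint ((f.swap i j).Cross ∩ R) (f.dropped i j) := by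
    rw [Set.disjoint_left]
    rintro c ⟨hc, -⟩ ⟨a, b, rfl, ha, hb, hab, htab, hfab, h⟩
    obtain ⟨-, -, hr | hr⟩ := (hA a b).1 hc
    · exact absurd h hr.2.not_gt
    · exact absurd hab hr.1.not_gt
  have hfin1 := f.finite_cross hm
  have hfin2 := (f.swap i j).finite_cross hm
  have hfin3 : (f.dropped i j).Finite :=
    (hfin1.inter_of_left R).subset (h2 ▸ Set.subset_union_right)
  unfold cross
  rw [← Set.ncard_inter_add_ncard_sdiff_eq_ncard f.Cross R hfin1,
    ← Set.ncard_inter_add_ncard_sdiff_eq_ncard (f.swap i j).Cross R hfin2, h1,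
    Set.ncard_image_of_injective _ hTinj, h2,
    Set.ncard_union_eq hdisj (hfin2.inter_of_left R) hfin3]
  omega

/-- Two strands `i < j` that move to the right and cross; `j` may be stationary. -/
structure IsRightCrossing (f : LPP m k) (i j : ℤ) : Prop where
  left_mem : i ∈ f.dom
  right_mem : j ∈ f.dom
  lt : i < j
  le_val : j ≤ f.val j
  val_lt : f.val j < f.val i

/-- Translates of a strand do not cross it, and the mirror image of a strand that moves strictly to
the right moves to the left. -/
theorem IsRightCrossing.not_equivalent {f : LPP m k} {i j : ℤ}
    (h : f.IsRightCrossing i j) : ¬ Equivalent m i j := by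
  rw [equivalent_iff]
  rintro ⟨n, hn | hn⟩
  · have h1 := h.val_lt
    have h2 := h.lt
    rw [hn, val_add] at h1
    omega
  · have h1 := h.le_val
    have h2 := h.lt
    have h3 := h.val_lt
    have h4 : f.val j = 1 - f.val i + n * period m := by rw [hn, val_add, val_mirror]
    omega

/-- The crossing `(i, j)` of strands that move to the right is such that its resolution drops the
number of crossings by one. -/
def IsCover (f : LPP m k) (i j : ℤ) : Prop :=
  f.IsRightCrossing i j ∧
    (∀ c ∈ f.dom, i < c → c < j → f.val j < f.val c → f.val c < f.val i → False) ∧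
    ¬ (i + period m < j ∧ f.val j + period m < f.val i)

/-- The class of `(i, j)` is always dropped. A strand `c` in the rectangle drops `(i, c)` as well,
and a failure of the affine clause drops `(i, j - period m)`. Conversely, a reversed pair contains a
translate or mirror image of `i` or `j`, and a case check leaves only `(i, j)`. -/
theorem isCover_iff (hm : 1 < m) {f : LPP m k} {i j : ℤ} (h : f.IsRightCrossing i j) :
    f.IsCover i j ↔ (f.swap i j).cross + 1 = f.cross := by
  have hne := h.not_equivalent
  obtain ⟨hi, hj, hij, hle, hlt⟩ := id h
  have hp := period_pos hm
  have hti : swapOrbits m i j i = j := swapOrbits_self_left m i j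
  have htj : swapOrbits m i j j = i := swapOrbits_self_right hne
  rw [f.cross_eq_cross_swap_add hm hi hj hne hij hlt, add_right_inj, eq_comm, Set.ncard_eq_one]
  have hmem : PairClass.mk m (i, j) ∈ f.dropped i j :=
    ⟨i, j, rfl, hi, hj, hij, by rw [hti, htj]; exact hij, hlt, by rw [hti, htj]; exact hlt⟩
  constructor
  · rintro ⟨-, hrect, haff⟩
    refine ⟨PairClass.mk m (i, j), Set.eq_singleton_iff_unique_mem.2 ⟨hmem, ?_⟩⟩
    rintro _ ⟨a, b, rfl, ha, hb, hab, htab, hfab, hfab'⟩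
    have hq : ∀ q : ℤ, i < j + q * period m → i + q * period m < j →
        f.val j + q * period m < f.val i → f.val j < f.val i + q * period m → q = 0 := by
      intro q h1 h2 h3 h4
      rcases lt_trichotomy q 0 with hq | hq | hq
      · have : q * period m ≤ (-1) * period m := mul_le_mul_of_nonneg_right (by omega) hp.le
        exact absurd ⟨by linarith, by linarith⟩ haff
      · exact hq
      · have : 1 * period m ≤ q * period m := mul_le_mul_of_nonneg_right (by omega) hp.le
        exact absurd ⟨by linarith, by linarith⟩ haff
    rcases f.swapOrbits_displacement i j a with hA | ⟨hA, hA', ⟨n, rfl⟩ | ⟨n, rfl⟩⟩ |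
        ⟨hA, hA', ⟨n, rfl⟩ | ⟨n, rfl⟩⟩ <;>
      rcases f.swapOrbits_displacement i j b with hB | ⟨hB, hB', ⟨n', rfl⟩ | ⟨n', rfl⟩⟩ |
        ⟨hB, hB', ⟨n', rfl⟩ | ⟨n', rfl⟩⟩ <;> (try omega) <;>
      (try rw [hA'] at hfab') <;> (try rw [hB'] at hfab') <;>
      (try rw [hA] at hfab') <;> (try rw [hB] at hfab') <;>
      simp only [val_add, val_mirror] at hfab hfab'
    · exact absurd (hrect (a + -n' * period m) ((f.add_mem_dom a (-n')).2 ha) (by linarith) (by linarith)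
        (by rw [val_add]; linarith) (by rw [val_add]; linarith)) id
    · exact absurd (hrect (1 - a + n' * period m) (by simpa using ha) (by linarith) (by linarith)
        (by rw [val_add, val_mirror]; linarith) (by rw [val_add, val_mirror]; linarith)) id
    · exact absurd (hrect (b + -n * period m) ((f.add_mem_dom b (-n)).2 hb) (by linarith) (by linarith)
        (by rw [val_add]; linarith) (by rw [val_add]; linarith)) id
    · have := hq (n' - n) (by linarith) (by linarith) (by linarith) (by linarith)
      obtain rfl : n' = n := by omega
      obtain ⟨γ, hγ⟩ := exists_transl m n'
      rw [← hγ, ← hγ, PairClass.mk_smul]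
    · omega
    · exact absurd (hrect (1 - b + n * period m) (by simpa using hb) (by linarith) (by linarith)
        (by rw [val_add, val_mirror]; linarith) (by rw [val_add, val_mirror]; linarith)) id
    · omega
    · have := hq (n' - n) (by linarith) (by linarith) (by linarith) (by linarith)
      obtain rfl : n' = n := by omega
      obtain ⟨γ, hγ⟩ := exists_mirror m n'
      rw [← hγ, ← hγ, PairClass.mk_smul, PairClass.mk_swap]
  · rintro ⟨c₀, hc₀⟩
    have huniq : ∀ c ∈ f.dropped i j, c = PairClass.mk m (i, j) := by
      intro c hc
      rw [hc₀] at hc hmem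
      exact (Set.mem_singleton_iff.1 hc).trans (Set.mem_singleton_iff.1 hmem).symm
    refine ⟨h, fun c hc hic hcj h1 h2 => ?_, fun ⟨h1, h2⟩ => ?_⟩
    · have hci : ¬ Equivalent m i c := by
        rw [equivalent_iff]
        rintro ⟨n, rfl | rfl⟩
        · rw [val_add] at h2; omega
        · rw [val_add, val_mirror] at h1 h2; omega
      have hcj' : ¬ Equivalent m j c := by
        rw [equivalent_iff]
        rintro ⟨n, rfl | rfl⟩
        · rw [val_add] at h1; omega
        · rw [val_add, val_mirror] at h1 h2; omega
      have htc := swapOrbits_of_not hci hcj'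
      have := huniq (PairClass.mk m (i, c)) ⟨i, c, rfl, hi, hc, hic, by rw [hti, htc]; exact hcj,
        h2, by rw [hti, htc]; exact h1⟩
      obtain ⟨γ, h' | h'⟩ := PairClass.mk_eq_iff.1 this <;> obtain ⟨e1, e2⟩ := Prod.ext_iff.1 h'
      · exact hcj' (Equivalent.symm ⟨γ, e2.symm⟩)
      · exact hci (Equivalent.symm ⟨γ, e1.symm⟩)
    · have e1 : swapOrbits m i j (j - period m) = i - period m := by
        have := swapOrbits_add m i j j (-1)
        rw [htj] at this
        convert this using 2 <;> ring
      have := huniq (PairClass.mk m (i, j - period m)) ⟨i, j - period m, rfl, hi, by simpa,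
        by omega, by rw [hti, e1]; omega, by rw [val_sub_period]; omega,
        by rw [hti, e1, val_sub_period]; omega⟩
      obtain ⟨γ, h' | h'⟩ := PairClass.mk_eq_iff.1 this <;> obtain ⟨e1, e2⟩ := Prod.ext_iff.1 h'
      · have hγ : γ = 1 := G_free (i := i) (by rw [one_smul]; exact e1.symm)
        subst hγ
        simp only [one_smul] at e2
        omega
      · exact hne ⟨γ, e2.symm⟩

/-! ### Local multiplicities -/

/-- The strands that pass the half-integer `g - 1/2` from the left to the right. -/
def up (f : LPP m k) (g : ℤ) : Set ℤ := {l | l ∈ f.dom ∧ l < g ∧ g ≤ f.val l}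

theorem mem_up {f : LPP m k} {g l : ℤ} : l ∈ f.up g ↔ l ∈ f.dom ∧ l < g ∧ g ≤ f.val l := Iff.rfl

theorem finite_up (hm : 1 < m) (f : LPP m k) (g : ℤ) : (f.up g).Finite := by
  obtain ⟨M, -, hM⟩ := f.exists_displacement_bound hm
  refine (Set.finite_Icc (g - M) g).subset ?_
  rintro l ⟨-, h1, h2⟩
  have := (abs_le.1 (hM l)).2
  exact ⟨by linarith, by linarith⟩

theorem ncard_up_mirror (f : LPP m k) (g : ℤ) :
    (f.up (2 - g)).ncard = {l | l ∈ f.dom ∧ f.val l < g ∧ g ≤ l}.ncard := by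
  have : f.up (2 - g) = (fun l => 1 - l) '' {l | l ∈ f.dom ∧ f.val l < g ∧ g ≤ l} := by
    ext l
    constructor
    · rintro ⟨h1, h2, h3⟩
      refine ⟨1 - l, ⟨by simpa, ?_, by linarith⟩, by ring⟩
      rw [val_mirror]; omega
    · rintro ⟨l, ⟨h1, h2, h3⟩, rfl⟩
      refine ⟨by simpa, ?_, ?_⟩
      · change 1 - l < 2 - g; omega
      · change 2 - g ≤ f.val (1 - l); rw [val_mirror]; omega
  rw [this, Set.ncard_image_of_injective _ (fun a b h => by simpa using h)]

theorem ncard_up_add (f : LPP m k) (g n : ℤ) :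
    (f.up (g + n * period m)).ncard = (f.up g).ncard := by
  have : f.up (g + n * period m) = (fun l => l + n * period m) '' f.up g := by
    ext l
    constructor
    · rintro ⟨h1, h2, h3⟩
      refine ⟨l + (-n) * period m, ⟨(f.add_mem_dom _ _).2 h1, by linarith, ?_⟩, by ring⟩
      rw [val_add]; linarith
    · rintro ⟨l, ⟨h1, h2, h3⟩, rfl⟩
      refine ⟨(f.add_mem_dom _ _).2 h1, ?_, ?_⟩
      · change l + n * period m < _; linarith
      · change _ ≤ f.val (l + n * period m); rw [val_add]; linarith
  rw [this, Set.ncard_image_of_injective _ (fun a b h => by simpa using h)]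

/-- The mirror carries the strands that pass `g - 1/2` to the left onto those that pass `(2 - g) -
1/2` to the right, so right-moving strands carry all the information. -/
theorem mult_eq (hm : 1 < m) (f : LPP m k) (g : ℤ) :
    f.mult g = (((f.up g).ncard : ℚ) + ((f.up (2 - g)).ncard : ℚ)) / 2 := by
  have hL : {l | l ∈ f.dom ∧ f.val l < g ∧ g ≤ l}.Finite := by
    obtain ⟨M, -, hM⟩ := f.exists_displacement_bound hm
    refine (Set.finite_Icc g (g + M)).subset ?_
    rintro l ⟨-, h1, h2⟩
    have := (abs_le.1 (hM l)).1
    exact ⟨by linarith, by linarith⟩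
  have : {i | ∃ a, f.toFun i = some a ∧ ((i < g ∧ g ≤ a) ∨ (a < g ∧ g ≤ i))} =
      f.up g ∪ {l | l ∈ f.dom ∧ f.val l < g ∧ g ≤ l} := by
    ext l
    constructor
    · rintro ⟨a, ha, h⟩
      obtain rfl := val_of_toFun ha
      exact h.imp (fun h => ⟨⟨_, ha⟩, h⟩) (fun h => ⟨⟨_, ha⟩, h⟩)
    · rintro (⟨h, h'⟩ | ⟨h, h'⟩)
      · exact ⟨_, toFun_eq h, Or.inl h'⟩
      · exact ⟨_, toFun_eq h, Or.inr h'⟩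
  rw [mult, this, Set.ncard_union_eq ?_ (f.finite_up hm g) hL, ncard_up_mirror, Nat.cast_add]
  rw [Set.disjoint_left]
  rintro l ⟨-, h1, -⟩ ⟨-, -, h2⟩
  omega

theorem mult_mirror (hm : 1 < m) (f : LPP m k) (g : ℤ) : f.mult (2 - g) = f.mult g := by
  rw [mult_eq hm, mult_eq hm, sub_sub_cancel, add_comm]

theorem mult_add (hm : 1 < m) (f : LPP m k) (g n : ℤ) : f.mult (g + n * period m) = f.mult g := by
  rw [mult_eq hm, mult_eq hm, ncard_up_add,
    show 2 - (g + n * period m) = (2 - g) + (-n) * period m by ring, ncard_up_add]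

/-- Every half-integer is equivalent to one of the `m` that index the components of weights. -/
theorem exists_weight_index (hm : 1 < m) (g : ℤ) :
    ∃ i : Fin m, (∃ n, g = (i : ℕ) + 1 + n * period m) ∨ ∃ n, 2 - g = (i : ℕ) + 1 + n * period m := by
  have hp := period_pos hm
  have h1 := Int.emod_nonneg (g - 1) hp.ne'
  have h2 := Int.emod_lt_of_pos (g - 1) hp
  have h3 := Int.emod_add_mul_ediv (g - 1) (period m)
  set r := (g - 1) % period m
  set q := (g - 1) / period m
  have hpm : period m = 2 * m - 2 := rfl
  rcases lt_or_ge r m with h | h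
  · exact ⟨⟨r.toNat, by omega⟩, Or.inl ⟨q, by simp only [Int.toNat_of_nonneg h1]; linarith⟩⟩
  · refine ⟨⟨(period m - r).toNat, by omega⟩, Or.inr ⟨-q - 1, ?_⟩⟩
    simp only [Int.toNat_of_nonneg (show 0 ≤ period m - r by omega)]
    linarith

theorem exists_mult_eq_weight (hm : 1 < m) (g : ℤ) :
    ∃ i : Fin m, ∀ {k : ℕ} (f : LPP m k), f.mult g = f.weight i := by
  obtain ⟨i, ⟨n, h⟩ | ⟨n, h⟩⟩ := exists_weight_index hm g
  · exact ⟨i, fun f => by rw [h, mult_add hm]; rfl⟩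
  · exact ⟨i, fun f => by rw [← mult_mirror hm, h, mult_add hm]; rfl⟩

open Classical in
-- Conservation at the point `j`: from one side of `j` to the other, the net flow to the right gains
-- the strand that starts at `j` and loses the one that ends there.
theorem up_succ_balance (hm : 1 < m) (f : LPP m k) (j : ℤ) :
    ((f.up (j + 1)).ncard : ℤ) - ((f.up (2 - (j + 1))).ncard : ℤ) =
      (f.up j).ncard - (f.up (2 - j)).ncard +
        ((if j ∈ f.dom then 1 else 0) - (if j ∈ f.ran then 1 else 0)) := by
  obtain ⟨M, -, hM⟩ := f.exists_displacement_bound hm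
  have hM1 := fun l => (abs_le.1 (hM l)).1
  have hM2 := fun l => (abs_le.1 (hM l)).2
  have fin : ∀ p : ℤ → Prop, (∀ l, p l → (l ≤ j + 1 ∧ j ≤ f.val l) ∨ (j ≤ l ∧ f.val l ≤ j + 1)) →
      {l | l ∈ f.dom ∧ p l}.Finite := by
    intro p hp
    refine (Set.finite_Icc (j - M) (j + 1 + M)).subset ?_
    rintro l ⟨-, hl⟩
    have := hM1 l
    have := hM2 l
    rcases hp l hl with h | h <;> exact ⟨by linarith, by linarith⟩
  have split : ∀ p q r : ℤ → Prop, (∀ l ∈ f.dom, p l ↔ q l ∨ r l) → (∀ l, q l → ¬ r l) →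
      (∀ l, q l → (l ≤ j + 1 ∧ j ≤ f.val l) ∨ (j ≤ l ∧ f.val l ≤ j + 1)) →
      (∀ l, r l → (l ≤ j + 1 ∧ j ≤ f.val l) ∨ (j ≤ l ∧ f.val l ≤ j + 1)) →
      {l | l ∈ f.dom ∧ p l}.ncard = {l | l ∈ f.dom ∧ q l}.ncard + {l | l ∈ f.dom ∧ r l}.ncard := by
    intro p q r h1 h2 h3 h4
    rw [← Set.ncard_union_eq _ (fin q h3) (fin r h4)]
    · congr 1
      ext l
      change (_ ∧ _) ↔ (_ ∧ _) ∨ (_ ∧ _)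
      constructor
      · rintro ⟨h, h'⟩
        exact ((h1 l h).1 h').imp (fun h' => ⟨h, h'⟩) (fun h' => ⟨h, h'⟩)
      · rintro (⟨h, h'⟩ | ⟨h, h'⟩)
        · exact ⟨h, (h1 l h).2 (Or.inl h')⟩
        · exact ⟨h, (h1 l h).2 (Or.inr h')⟩
    · rw [Set.disjoint_left]
      rintro l ⟨-, h⟩ ⟨-, h'⟩
      exact h2 l h h'
  have single : ∀ (p : ℤ → Prop) (i : ℤ), (∀ l, l ∈ f.dom ∧ p l → l = i) →
      {l | l ∈ f.dom ∧ p l}.ncard = if i ∈ f.dom ∧ p i then 1 else 0 := by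
    intro p i h
    split_ifs with hi
    · rw [Set.ncard_eq_one]
      exact ⟨i, Set.eq_singleton_iff_unique_mem.2 ⟨hi, h⟩⟩
    · have : {l | l ∈ f.dom ∧ p l} = ∅ :=
        Set.eq_empty_of_forall_notMem fun l hl => hi (h l hl ▸ hl)
      rw [this, Set.ncard_empty]
  rw [ncard_up_mirror, ncard_up_mirror]
  have e1 := split (fun l => l ≤ j ∧ j ≤ f.val l) (fun l => l < j + 1 ∧ j + 1 ≤ f.val l)
    (fun l => l ≤ j ∧ f.val l = j) (by intros; omega) (by intros; omega) (by intros; omega)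
    (by intros; omega)
  have e2 := split (fun l => l ≤ j ∧ j ≤ f.val l) (fun l => l < j ∧ j ≤ f.val l)
    (fun l => l = j ∧ j ≤ f.val l) (by intros; omega) (by intros; omega) (by intros; omega)
    (by intros; omega)
  have e3 := split (fun l => j ≤ l ∧ f.val l ≤ j) (fun l => f.val l < j ∧ j ≤ l)
    (fun l => j ≤ l ∧ f.val l = j) (by intros; omega) (by intros; omega) (by intros; omega)
    (by intros; omega)
  have e4 := split (fun l => j ≤ l ∧ f.val l ≤ j) (fun l => f.val l < j + 1 ∧ j + 1 ≤ l)
    (fun l => l = j ∧ f.val l ≤ j) (by intros; omega) (by intros; omega) (by intros; omega)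
    (by intros; omega)
  rw [single (fun l => l = j ∧ j ≤ f.val l) j (fun l h => h.2.1)] at e2
  rw [single (fun l => l = j ∧ f.val l ≤ j) j (fun l h => h.2.1)] at e4
  have hd : ((if j ∈ f.dom ∧ j = j ∧ j ≤ f.val j then 1 else 0 : ℕ) : ℤ) +
      (if j ∈ f.dom ∧ j = j ∧ f.val j ≤ j then 1 else 0 : ℕ) =
      (if j ∈ f.dom then 1 else 0) + (if j ∈ f.dom ∧ f.val j = j then 1 else 0) := by
    by_cases h : j ∈ f.dom <;> simp only [h, true_and, false_and, if_true, if_false] <;>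
      (try split_ifs) <;> push_cast <;> omega
  by_cases hj : j ∈ f.ran
  · obtain ⟨i, hi, hij⟩ := mem_ran_iff.1 hj
    have hu : ∀ l ∈ f.dom, f.val l = j → l = i := fun l hl h => f.val_inj hl hi (h.trans hij.symm)
    rw [single (fun l => l ≤ j ∧ f.val l = j) i (fun l h => hu l h.1 h.2.2)] at e1
    rw [single (fun l => j ≤ l ∧ f.val l = j) i (fun l h => hu l h.1 h.2.2)] at e3
    have hij' : (j ∈ f.dom ∧ f.val j = j) ↔ i = j :=
      ⟨fun h => (hu j h.1 h.2).symm, fun h => by subst h; exact ⟨hi, hij⟩⟩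
    simp only [hij'] at hd
    have hr : ((if i ∈ f.dom ∧ i ≤ j ∧ f.val i = j then 1 else 0 : ℕ) : ℤ) +
        (if i ∈ f.dom ∧ j ≤ i ∧ f.val i = j then 1 else 0 : ℕ) = 1 + (if i = j then 1 else 0) := by
      simp only [hi, hij, true_and, and_true]
      split_ifs <;> push_cast <;> omega
    rw [if_pos hj]
    unfold up
    zify at e1 e2 e3 e4
    push_cast at hd hr e1 e2 e3 e4
    linarith
  · have h0 : ∀ l ∈ f.dom, f.val l ≠ j := fun l hl h => hj (h ▸ val_mem_ran hl)
    rw [single (fun l => l ≤ j ∧ f.val l = j) j (fun l h => absurd h.2.2 (h0 l h.1)),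
      if_neg (fun h => h0 j h.1 h.2.2)] at e1
    rw [single (fun l => j ≤ l ∧ f.val l = j) j (fun l h => absurd h.2.2 (h0 l h.1)),
      if_neg (fun h => h0 j h.1 h.2.2)] at e3
    rw [if_neg (show ¬ (j ∈ f.dom ∧ f.val j = j) from fun h => h0 j h.1 h.2)] at hd
    rw [if_neg hj]
    unfold up
    zify at e1 e2 e3 e4
    push_cast at hd e1 e2 e3 e4
    simp only [true_and] at hd e2 e4
    linarith

open Classical in
-- At the wall `g = 1` the mirror point `2 - g` is `g` itself, so the net flow vanishes there; the
-- rest is summation of the local balance.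
theorem up_balance (hm : 1 < m) (f : LPP m k) (n : ℕ) :
    ((f.up (n + 1)).ncard : ℤ) - ((f.up (2 - (n + 1))).ncard : ℤ) =
      (((Finset.Icc (1 : ℤ) n).filter (· ∈ f.dom)).card : ℤ) -
        (((Finset.Icc (1 : ℤ) n).filter (· ∈ f.ran)).card : ℤ) := by
  induction n with
  | zero => simp
  | succ n ih =>
    rw [Nat.cast_succ, up_succ_balance hm, ih]
    have hI : Finset.Icc (1 : ℤ) (n + 1) = insert ((n : ℤ) + 1) (Finset.Icc 1 (n : ℤ)) := by
      ext l; simp only [Finset.mem_Icc, Finset.mem_insert]; omega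
    rw [hI, Finset.filter_insert, Finset.filter_insert]
    have hn : ∀ p : ℤ → Prop, (n : ℤ) + 1 ∉ (Finset.Icc (1 : ℤ) n).filter p := by
      intro p h
      have := (Finset.mem_Icc.1 (Finset.mem_filter.1 h).1).2
      omega
    split_ifs <;> (try rw [Finset.card_insert_of_notMem (hn _)]) <;>
      (try rw [Finset.card_insert_of_notMem (hn _)]) <;> push_cast <;> ring

end LPP

/-! ### Weights of resolutions -/

/-- If the two points are equivalent, the crossing is one of a strand with its own mirror image, and
the reflection that relates the points exchanges them. -/
theorem swapOrbits_self_right_of_lt {m : ℕ} {f : LPP m k} {i j : ℤ} (hij : i < j)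
    (hf : f.val j < f.val i) : swapOrbits m i j j = i := by
  by_cases hne : Equivalent m i j
  · obtain ⟨n, rfl | rfl⟩ := equivalent_iff.1 hne
    · rw [LPP.val_add] at hf; omega
    · obtain ⟨γ, hγ⟩ := exists_mirror m n
      rw [← hγ, swapOrbits_left, hγ, hγ]; ring
  · exact swapOrbits_self_right hne

namespace LPP

variable {m k : ℕ}

/-- For two strands moving to the right the exchange only redistributes the passing strands: `t`
sends each start that begins to pass to one that ceases to pass. The count, and therefore the
weight, is unchanged. -/
theorem up_sdiff_up_swap {f : LPP m k} {i j : ℤ} (h : f.IsRightCrossing i j) (g : ℤ) :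
    f.up g \ (f.swap i j).up g = swapOrbits m i j '' ((f.swap i j).up g \ f.up g) := by
  have hne := h.not_equivalent
  obtain ⟨hi, hj, hij, hle, hlt⟩ := h
  have hd : ∀ l, swapOrbits m i j l ∈ f.dom ↔ l ∈ f.dom := f.swapOrbits_mem_dom hi hj
  have hinv := swapOrbits_involutive hne
  have key : ∀ l, swapOrbits m i j l ∈ f.up g \ (f.swap i j).up g ↔
      l ∈ (f.swap i j).up g \ f.up g := by
    intro l
    simp only [Set.mem_sdiff, mem_up, dom_swap, val_swap f hi hj, hd, hinv]
    rcases f.swapOrbits_displacement i j l with h | ⟨h1, h2, ⟨n, rfl⟩ | ⟨n, rfl⟩⟩ |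
        ⟨h1, h2, ⟨n, rfl⟩ | ⟨n, rfl⟩⟩
    · simp only [h]
    all_goals
      rw [h2, h1]
      simp only [val_add, val_mirror]
      constructor
      · rintro ⟨⟨a, b, c⟩, d⟩
        refine ⟨⟨a, ?_, ?_⟩, fun ⟨_, e⟩ => d ⟨a, ?_⟩⟩ <;> by_contra hcon <;>
          (apply d; refine ⟨a, ?_, ?_⟩ <;> linarith)
      · rintro ⟨⟨a, b, c⟩, d⟩
        refine ⟨⟨a, ?_, ?_⟩, fun ⟨_, e⟩ => d ⟨a, ?_⟩⟩ <;> by_contra hcon <;>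
          (apply d; refine ⟨a, ?_, ?_⟩ <;> linarith)
  ext l
  constructor
  · intro hl
    refine ⟨swapOrbits m i j l, ?_, hinv l⟩
    rw [← key, hinv]
    exact hl
  · rintro ⟨l, hl, rfl⟩
    exact (key l).2 hl

theorem up_swap_eq (hm : 1 < m) {f : LPP m k} {i j : ℤ} (h : f.IsRightCrossing i j) (g : ℤ) :
    ((f.swap i j).up g).ncard = (f.up g).ncard := by
  have hinv := swapOrbits_involutive h.not_equivalent
  have hinj : Function.Injective (swapOrbits m i j) := fun a b hab => by rw [← hinv a, hab, hinv]
  rw [← Set.ncard_inter_add_ncard_sdiff_eq_ncard (f.up g) ((f.swap i j).up g) (f.finite_up hm g),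
    ← Set.ncard_inter_add_ncard_sdiff_eq_ncard ((f.swap i j).up g) (f.up g) (finite_up hm _ g),
    up_sdiff_up_swap h, Set.ncard_image_of_injective _ hinj, Set.inter_comm]

/-- The strands from `i` and `j` pass `g - 1/2` in opposite directions, and neither does so after
the exchange. The newly passing starts inject via `t` into the lost ones, and `i` is lost in
addition. -/
theorem up_swap_lt (hm : 1 < m) {f : LPP m k} {i j g : ℤ} (hi : i ∈ f.dom) (hj : j ∈ f.dom)
    (hig : i < g) (hgj : g ≤ j) (hfj : f.val j < g) (hfi : g ≤ f.val i) :
    ((f.swap i j).up g).ncard + 1 ≤ (f.up g).ncard := by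
  have htj : swapOrbits m i j j = i :=
    swapOrbits_self_right_of_lt (f := f) (by omega) (by omega)
  have hti : swapOrbits m i j i = j := swapOrbits_self_left m i j
  have hd : ∀ l, swapOrbits m i j l ∈ f.dom ↔ l ∈ f.dom := f.swapOrbits_mem_dom hi hj
  have hinv : ∀ l, swapOrbits m i j (swapOrbits m i j l) = l := by
    intro l
    rcases swapOrbits_cases m i j l with ⟨γ, rfl, h⟩ | ⟨γ, rfl, h, -⟩ | ⟨-, -, h⟩
    · rw [h, swapOrbits_smul, htj]
    · rw [h, swapOrbits_smul, hti]
    · rw [h, h]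
  have hinj : Function.Injective (swapOrbits m i j) := fun a b hab => by rw [← hinv a, hab, hinv]
  have hsub : insert i (swapOrbits m i j '' ((f.swap i j).up g \ f.up g)) ⊆
      f.up g \ (f.swap i j).up g := by
    rintro l (rfl | ⟨l, hl, rfl⟩)
    · refine ⟨⟨hi, hig, hfi⟩, ?_⟩
      rintro ⟨-, -, h⟩
      rw [val_swap f hi hj, hti] at h
      omega
    · revert hl
      simp only [Set.mem_sdiff, mem_up, dom_swap, val_swap f hi hj, hd, hinv]
      rcases f.swapOrbits_displacement i j l with h | ⟨h1, h2, -⟩ | ⟨h1, h2, -⟩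
      · simp only [h]; tauto
      all_goals
        rw [h2, h1]
        rintro ⟨⟨a, b, c⟩, d⟩
        have : f.val l < g := by by_contra hcon; exact d ⟨a, b, by omega⟩
        exact ⟨⟨a, by omega, by omega⟩, by omega⟩
  have hnot : i ∉ swapOrbits m i j '' ((f.swap i j).up g \ f.up g) := by
    rintro ⟨l, ⟨⟨-, h, -⟩, -⟩, h'⟩
    have := hinj (h'.trans htj.symm)
    omega
  have h1 := Set.ncard_le_ncard hsub ((f.finite_up hm g).sdiff)
  rw [Set.ncard_insert_of_notMem hnot (((finite_up hm _ g).sdiff).image _),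
    Set.ncard_image_of_injective _ hinj] at h1
  rw [← Set.ncard_inter_add_ncard_sdiff_eq_ncard (f.up g) ((f.swap i j).up g) (f.finite_up hm g),
    ← Set.ncard_inter_add_ncard_sdiff_eq_ncard ((f.swap i j).up g) (f.up g) (finite_up hm _ g),
    Set.inter_comm]
  omega

theorem swap_mirror (f : LPP m k) (i j : ℤ) : f.swap (1 - i) (1 - j) = f.swap i j := by
  obtain ⟨γ, hγ⟩ := exists_mirror_one m
  by_cases hi : i ∈ f.dom
  · by_cases hj : j ∈ f.dom
    · refine ext_val (by simp) fun l _ => ?_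
      rw [val_swap f hi hj, val_swap f (by simpa) (by simpa), ← hγ, ← hγ, swapOrbits_smul_smul]
    · unfold swap
      rw [dif_neg (by simp [hj]), dif_neg (by simp [hj])]
  · unfold swap
    rw [dif_neg (by simp [hi]), dif_neg (by simp [hi])]

/-- Resolving a crossing of two strands that approach each other loses weight. -/
theorem swap_symm {f : LPP m k} {i j : ℤ} (hi : i ∈ f.dom) (hj : j ∈ f.dom)
    (h : Reversed f.val i j) : f.swap j i = f.swap i j := by
  wlog hij : i < j generalizing i j
  · exact (this hj hi h.symm (by rcases h with h | h <;> omega)).symm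
  have hf : f.val j < f.val i := by rcases h with h | h <;> omega
  refine ext_val (by simp) fun l _ => ?_
  rw [val_swap f hi hj, val_swap f hj hi]
  congr 1
  have htj : swapOrbits m i j j = i := swapOrbits_self_right_of_lt (f := f) hij hf
  by_cases hne : Equivalent m i j
  · rcases swapOrbits_cases m i j l with ⟨γ, rfl, h⟩ | ⟨γ, rfl, h, h'⟩ | ⟨h, h', h''⟩
    · obtain ⟨δ, rfl⟩ := hne
      rw [swapOrbits_smul, swapOrbits_smul, swapOrbits_self_left]
      have := swapOrbits_left (m := m) (δ • i) i δ⁻¹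
      rw [inv_smul_smul] at this
      rw [this]
      rw [swapOrbits_left] at htj
      congr 1
      rw [inv_smul_eq_iff, htj]
    · exact absurd hne h'
    · rw [h'', swapOrbits_of_not h' h]
  · rw [swapOrbits_comm hne]

/-- Strands that approach each other and cross pass a common half-integer in opposite directions.
Both directions lose a passage there, so the multiplicity drops by a full unit; in `Q` such a
crossing does not count. -/
theorem exists_mult_drop (hm : 1 < m) {f : LPP m k} {i j : ℤ} (hi : i ∈ f.dom) (hj : j ∈ f.dom)
    (hij : i < j) (hf : f.val j < f.val i) (h1 : f.val j < j) (h2 : i < f.val i) :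
    ∃ g, (f.swap i j).mult g + 1 ≤ f.mult g := by
  refine ⟨max i (f.val j) + 1, ?_⟩
  set g := max i (f.val j) + 1
  have a := up_swap_lt hm (f := f) (g := g) hi hj (by omega) (by omega) (by omega) (by omega)
  have b := up_swap_lt hm (f := f) (i := 1 - j) (j := 1 - i) (g := 2 - g) (by simpa) (by simpa)
    (by omega) (by omega) (by rw [val_mirror]; omega) (by rw [val_mirror]; omega)
  rw [swap_mirror] at b
  rw [swap_symm hi hj (Or.inl ⟨hij, hf⟩)] at b
  rw [mult_eq hm, mult_eq hm]
  have a' : (((f.swap i j).up g).ncard : ℚ) + 1 ≤ (f.up g).ncard := by exact_mod_cast a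
  have b' : (((f.swap i j).up (2 - g)).ncard : ℚ) + 1 ≤ (f.up (2 - g)).ncard := by exact_mod_cast b
  linarith

/-! ### Composites -/

theorem dom_comp (g f : LPP m k) (h : g.dom = f.ran) : (g.comp f h).dom = f.dom := by
  ext i
  simp only [mem_dom_iff, comp]
  constructor
  · intro hi hf; exact hi (by rw [hf]; rfl)
  · intro hi
    have hi := mem_dom_iff.2 hi
    rw [toFun_eq hi]
    exact mem_dom_iff.1 (h ▸ val_mem_ran hi)

theorem val_comp (g f : LPP m k) (h : g.dom = f.ran) {l : ℤ} (hl : l ∈ f.dom) :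
    (g.comp f h).val l = g.val (f.val l) := by
  refine val_of_toFun ?_
  have hi : f.val l ∈ g.dom := h ▸ val_mem_ran hl
  change (f.toFun l).bind g.toFun = _
  rw [toFun_eq hl]
  exact toFun_eq hi

theorem ncard_up_pullback {g f : LPP m k} (h : g.dom = f.ran) (j : ℤ) :
    {l | l ∈ f.dom ∧ f.val l ∈ g.up j}.ncard = (g.up j).ncard := by
  rw [← Set.InjOn.ncard_image (f := f.val) (s := {l | l ∈ f.dom ∧ f.val l ∈ g.up j})
    (fun a ha b hb hab => f.val_inj ha.1 hb.1 hab)]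
  congr 1
  ext a
  constructor
  · rintro ⟨l, hl, rfl⟩; exact hl.2
  · intro ha
    obtain ⟨l, hl, rfl⟩ := mem_ran_iff.1 (h ▸ ha.1)
    exact ⟨l, ⟨hl, ha⟩, rfl⟩

theorem finite_up_pullback (hm : 1 < m) {g f : LPP m k} (j : ℤ) :
    {l | l ∈ f.dom ∧ f.val l ∈ g.up j}.Finite := by
  refine Set.Finite.of_finite_image ((g.finite_up hm j).subset ?_)
    (fun a ha b hb hab => f.val_inj ha.1 hb.1 hab)
  rintro _ ⟨l, hl, rfl⟩
  exact hl.2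

theorem up_comp_subset {g f : LPP m k} (h : g.dom = f.ran) (j : ℤ) :
    (g.comp f h).up j ⊆ f.up j ∪ {l | l ∈ f.dom ∧ f.val l ∈ g.up j} := by
  rintro l ⟨h1, h2, h3⟩
  rw [dom_comp] at h1
  rw [val_comp g f h h1] at h3
  rcases le_or_gt j (f.val l) with hj | hj
  · exact Or.inl ⟨h1, h2, hj⟩
  · exact Or.inr ⟨h1, h ▸ val_mem_ran h1, hj, h3⟩

/-- If no strand turns back in a composite, the local multiplicities add up. -/
theorem mult_comp_of_monotone (hm : 1 < m) {g f : LPP m k} (h : g.dom = f.ran)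
    (hmono : ∀ l ∈ f.dom, (l ≤ f.val l ∧ f.val l ≤ g.val (f.val l)) ∨
      (f.val l ≤ l ∧ g.val (f.val l) ≤ f.val l)) (j : ℤ) :
    (g.comp f h).mult j = f.mult j + g.mult j := by
  have key : ∀ j, ((g.comp f h).up j).ncard = (f.up j).ncard + (g.up j).ncard := by
    intro j
    rw [← ncard_up_pullback h j, ← Set.ncard_union_eq _ (f.finite_up hm j) (finite_up_pullback hm j)]
    · congr 1
      refine Set.Subset.antisymm (up_comp_subset h j) ?_
      rintro l (⟨h1, h2, h3⟩ | ⟨h1, -, h2, h3⟩)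
      all_goals
        refine ⟨by rwa [dom_comp], ?_, ?_⟩
        · have := hmono l h1
          omega
        · rw [val_comp g f h h1]
          have := hmono l h1
          omega
    · rw [Set.disjoint_left]
      rintro l ⟨h1, h2, h3⟩ ⟨-, -, h4, h5⟩
      omega
  rw [mult_eq hm, mult_eq hm, mult_eq hm, key, key]
  push_cast; ring

theorem up_comp_lt (hm : 1 < m) {g f : LPP m k} (h : g.dom = f.ran) {j l : ℤ}
    (hl : l ∈ f.up j ∪ {l | l ∈ f.dom ∧ f.val l ∈ g.up j}) (hl' : l ∉ (g.comp f h).up j) :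
    ((g.comp f h).up j).ncard + 1 ≤ (f.up j).ncard + (g.up j).ncard := by
  have h1 : insert l ((g.comp f h).up j) ⊆ f.up j ∪ {l | l ∈ f.dom ∧ f.val l ∈ g.up j} :=
    Set.insert_subset hl (up_comp_subset h j)
  have h2 := Set.ncard_le_ncard h1 ((f.finite_up hm j).union (finite_up_pullback hm j))
  rw [Set.ncard_insert_of_notMem hl' (finite_up hm _ j)] at h2
  have h3 := Set.ncard_union_le (f.up j) {l | l ∈ f.dom ∧ f.val l ∈ g.up j}
  rw [ncard_up_pullback h j] at h3
  omega

/-- If some strand of a composite turns back from left to right, then weight is lost. -/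
theorem exists_mult_comp_drop (hm : 1 < m) {g f : LPP m k} (h : g.dom = f.ran) {l : ℤ}
    (hl : l ∈ f.dom) (h1 : f.val l < l) (h2 : f.val l < g.val (f.val l)) :
    ∃ j, (g.comp f h).mult j + 1 ≤ f.mult j + g.mult j := by
  refine ⟨f.val l + 1, ?_⟩
  have hg : f.val l ∈ g.dom := h ▸ val_mem_ran hl
  have a := up_comp_lt hm h (j := f.val l + 1) (l := l)
    (Or.inr ⟨hl, hg, by omega, by omega⟩) (fun hcon => by have := hcon.2.1; omega)
  have b := up_comp_lt hm h (j := 2 - (f.val l + 1)) (l := 1 - l)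
    (Or.inl ⟨by simpa, by omega, by rw [val_mirror]; omega⟩) (fun hcon => by
      have := hcon.2.2
      rw [val_comp g f h (by simpa), val_mirror, val_mirror] at this; omega)
  have a' : (((g.comp f h).up (f.val l + 1)).ncard : ℚ) + 1 ≤
    (f.up (f.val l + 1)).ncard + (g.up (f.val l + 1)).ncard := by exact_mod_cast a
  have b' : (((g.comp f h).up (2 - (f.val l + 1))).ncard : ℚ) + 1 ≤
    (f.up (2 - (f.val l + 1))).ncard + (g.up (2 - (f.val l + 1))).ncard := by exact_mod_cast b
  rw [mult_eq hm, mult_eq hm, mult_eq hm]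
  linarith

/-- The crossing number is additive if and only if no crossing of `f` is undone by `g`. -/
theorem cross_comp_eq_iff (hm : 1 < m) {g f : LPP m k} (h : g.dom = f.ran) :
    (g.comp f h).cross = g.cross + f.cross ↔ ∀ a ∈ f.dom, ∀ b ∈ f.dom, a < b →
      f.val b < f.val a → g.val (f.val b) < g.val (f.val a) := by
  set F := PairClass.map (m := m) f.val f.val_smul with hF
  set B : Set (PairClass m) := {c | ∃ a ∈ f.dom, ∃ b ∈ f.dom, c = PairClass.mk m (a, b) ∧
    Reversed g.val (f.val a) (f.val b)} with hB
  have hBmem : ∀ a ∈ f.dom, ∀ b ∈ f.dom,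
      (PairClass.mk m (a, b) ∈ B ↔ Reversed g.val (f.val a) (f.val b)) := by
    intro a ha b hb
    refine ⟨?_, fun h => ⟨a, ha, b, hb, rfl, h⟩⟩
    rintro ⟨a', ha', b', hb', he, hr⟩
    have := congrArg F he
    rw [hF, PairClass.map_mk, PairClass.map_mk] at this
    exact reversed_of_mk_eq g.val_smul this.symm hr
  have hinj : Set.InjOn F B := by
    rintro _ ⟨a, ha, b, hb, rfl, -⟩ _ ⟨a', ha', b', hb', rfl, -⟩ he
    rw [hF, PairClass.map_mk, PairClass.map_mk] at he
    obtain ⟨γ, h | h⟩ := PairClass.mk_eq_iff.1 he <;> obtain ⟨h1, h2⟩ := Prod.ext_iff.1 h <;>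
      simp only [← val_smul] at h1 h2
    · rw [f.val_inj ha' (by simpa) h1, f.val_inj hb' (by simpa) h2, PairClass.mk_smul]
    · rw [f.val_inj ha' (by simpa) h1, f.val_inj hb' (by simpa) h2, PairClass.mk_smul,
        PairClass.mk_swap]
  have himage : F '' B = g.Cross := by
    ext c
    constructor
    · rintro ⟨_, ⟨a, ha, b, hb, rfl, hr⟩, rfl⟩
      exact mk_mem_cross_iff.2 ⟨h ▸ val_mem_ran ha, h ▸ val_mem_ran hb, hr⟩
    · intro hc
      obtain ⟨a, b, rfl⟩ := c.exists_mk
      obtain ⟨ha, hb, hr⟩ := mk_mem_cross_iff.1 hc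
      obtain ⟨a, ha', rfl⟩ := mem_ran_iff.1 (h ▸ ha)
      obtain ⟨b, hb', rfl⟩ := mem_ran_iff.1 (h ▸ hb)
      exact ⟨_, ⟨a, ha', b, hb', rfl, hr⟩, rfl⟩
  have hcard : B.ncard = g.cross := by rw [cross, ← himage, hinj.ncard_image]
  have hfinB : B.Finite := Set.Finite.of_finite_image (himage ▸ g.finite_cross hm) hinj
  have hfinA := f.finite_cross hm
  -- A pair crosses in the composite precisely when it crosses in exactly one of the two factors; a
  -- pair crossed in both is undone and costs two.
  have hcomp : (g.comp f h).Cross = symmDiff f.Cross B := by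
    ext c
    obtain ⟨a, b, rfl⟩ := c.exists_mk
    rw [Set.mem_symmDiff, mk_mem_cross_iff, mk_mem_cross_iff, dom_comp]
    by_cases ha : a ∈ f.dom
    · by_cases hb : b ∈ f.dom
      · rw [hBmem a ha b hb]
        simp only [ha, hb, true_and]
        unfold Reversed
        rw [val_comp g f h ha, val_comp g f h hb]
        have h1 : f.val a = f.val b → a = b := f.val_inj ha hb
        have h2 : g.val (f.val a) = g.val (f.val b) → f.val a = f.val b :=
          g.val_inj (h ▸ val_mem_ran ha) (h ▸ val_mem_ran hb)
        have h3 : a = b → f.val a = f.val b := fun h => by rw [h]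
        omega
      · have : PairClass.mk m (a, b) ∉ B := by
          rintro ⟨a', ha', b', hb', he, -⟩
          obtain ⟨γ, h | h⟩ := PairClass.mk_eq_iff.1 he <;> obtain ⟨h1, h2⟩ := Prod.ext_iff.1 h <;>
            simp only at h1 h2
          · rw [h2] at hb'; exact hb (by simpa using hb')
          · rw [h1] at ha'; exact hb (by simpa using ha')
        simp [hb, this]
    · have : PairClass.mk m (a, b) ∉ B := by
        rintro ⟨a', ha', b', hb', he, -⟩
        obtain ⟨γ, h | h⟩ := PairClass.mk_eq_iff.1 he <;> obtain ⟨h1, h2⟩ := Prod.ext_iff.1 h <;>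
          simp only at h1 h2
        · rw [h1] at ha'; exact ha (by simpa using ha')
        · rw [h2] at hb'; exact ha (by simpa using hb')
      simp [ha, this]
  have hsd : (symmDiff f.Cross B).ncard + 2 * (f.Cross ∩ B).ncard = f.cross + B.ncard := by
    rw [Set.symmDiff_def, Set.ncard_union_eq disjoint_sdiff_sdiff hfinA.sdiff hfinB.sdiff, cross,
      ← Set.ncard_inter_add_ncard_sdiff_eq_ncard f.Cross B hfinA,
      ← Set.ncard_inter_add_ncard_sdiff_eq_ncard B f.Cross hfinB, Set.inter_comm B]
    ring
  have hiff : (g.comp f h).cross = g.cross + f.cross ↔ f.Cross ∩ B = ∅ := by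
    rw [cross, hcomp, ← Set.ncard_eq_zero (hfinA.inter_of_left B), ← hcard]
    omega
  rw [hiff]
  constructor
  · intro h0 a ha b hb hab hf
    by_contra hcon
    have hne : g.val (f.val a) ≠ g.val (f.val b) := fun he => by
      have := g.val_inj (h ▸ val_mem_ran ha) (h ▸ val_mem_ran hb) he
      omega
    have : PairClass.mk m (a, b) ∈ f.Cross ∩ B :=
      ⟨mk_mem_cross_iff.2 ⟨ha, hb, Or.inl ⟨hab, hf⟩⟩, (hBmem a ha b hb).2 (Or.inr ⟨hf, by omega⟩)⟩
    rw [h0] at this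
    exact this
  · intro h0
    refine Set.eq_empty_of_forall_notMem ?_
    rintro c ⟨hc, a, ha, b, hb, rfl, hr⟩
    obtain ⟨-, -, hr'⟩ := mk_mem_cross_iff.1 hc
    have h1 := h0 a ha b hb
    have h2 := h0 b hb a ha
    unfold Reversed at hr hr'
    omega

/-! ### Resolutions as relations between lifted partial permutations -/

theorem swap_smul (f : LPP m k) (γ : G m) (i j : ℤ) : f.swap (γ • i) (γ • j) = f.swap i j := by
  by_cases hi : i ∈ f.dom
  · by_cases hj : j ∈ f.dom
    · refine ext_val (by simp) fun l _ => ?_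
      rw [val_swap f hi hj, val_swap f (by simpa) (by simpa), swapOrbits_smul_smul]
    · unfold swap
      rw [dif_neg (by simp [hj]), dif_neg (by simp [hj])]
  · unfold swap
    rw [dif_neg (by simp [hi]), dif_neg (by simp [hi])]

/-- Two representatives of a crossing differ by a group element and possibly by the order of the
strands; neither affects the exchange. The choice made in `resolve` is thus harmless. -/
theorem resolve_eq_swap {f : LPP m k} {i j : ℤ} (c : f.Cross) (h : c.1 = PairClass.mk m (i, j)) :
    f.resolve c = f.swap i j := by
  have h1 := c.2.choose_spec.1
  have h2 := c.2.choose_spec.2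
  have e : f.resolve c = f.swap c.2.choose.1 c.2.choose.2 :=
    f.resolveAt_eq_swap (IsLiftedCrossing.fst_mem h1) (IsLiftedCrossing.snd_mem h1)
  rw [e]
  obtain ⟨ha, hb, hr⟩ := isLiftedCrossing_iff.1 h1
  obtain ⟨γ, h | h⟩ := PairClass.mk_eq_iff.1 (h2.trans h) <;> obtain ⟨rfl, rfl⟩ := Prod.ext_iff.1 h
  · rw [swap_smul]
  · rw [swap_smul]
    exact (swap_symm ha hb hr).symm

/-- `h` is a resolution of `f` that contributes to the differential of `f` in `Q`. -/
def Cov (f h : LPP m k) : Prop := ∃ i j, f.IsCover i j ∧ h = f.swap i j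

/-- `h` is obtained from `b` by prolonging, by a full turn, a strand that moves to the right and is
not overtaken. -/
def Ext (b h : LPP m k) : Prop :=
  ∃ i ∈ b.dom, i ≤ b.val i ∧ (∀ l ∈ b.dom, l < i → b.val l < b.val i) ∧ h = b.wind (b.val i) 1

theorem IsRightCrossing.mk_mem_cross {f : LPP m k} {i j : ℤ} (h : f.IsRightCrossing i j) :
    PairClass.mk m (i, j) ∈ f.Cross :=
  mk_mem_cross_iff.2 ⟨h.left_mem, h.right_mem, Or.inl ⟨h.lt, h.val_lt⟩⟩

/-- The exchange can be recovered from its result by injectivity, so distinct crossings have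
distinct resolutions and the terms of the differential do not cancel. -/
theorem mk_eq_of_swap_eq {f : LPP m k} {i j i' j' : ℤ} (h : f.IsRightCrossing i j)
    (h' : f.IsRightCrossing i' j') (he : f.swap i j = f.swap i' j') :
    PairClass.mk m (i, j) = PairClass.mk m (i', j') := by
  have hne := h.not_equivalent
  have ht : ∀ l, l ∈ f.dom → swapOrbits m i j l = swapOrbits m i' j' l := by
    intro l hl
    have := congrArg (fun f => f.val l) he
    simp only [val_swap f h.left_mem h.right_mem, val_swap f h'.left_mem h'.right_mem] at this
    exact f.val_inj ((f.swapOrbits_mem_dom h.left_mem h.right_mem l).2 hl)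
      ((f.swapOrbits_mem_dom h'.left_mem h'.right_mem l).2 hl) this
  have := ht i' h'.left_mem
  rw [swapOrbits_self_left] at this
  rcases swapOrbits_cases m i j i' with ⟨γ, h1, h2⟩ | ⟨γ, h1, h2, -⟩ | ⟨-, -, h2⟩
  · rw [← this, h2, h1, PairClass.mk_smul]
  · rw [← this, h2, h1, PairClass.mk_smul, PairClass.mk_swap]
  · exact absurd (h2.symm.trans this) h'.lt.ne

theorem finite_cov (hm : 1 < m) (f : LPP m k) : {h | f.Cov h}.Finite := by
  have := (f.finite_cross hm).to_subtype
  refine (Set.finite_range f.resolve).subset ?_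
  rintro h ⟨i, j, hc, rfl⟩
  exact ⟨⟨_, hc.1.mk_mem_cross⟩, resolve_eq_swap _ rfl⟩

theorem wind_smul (f : LPP m k) (γ : G m) (a : ℤ) :
    f.wind (γ • a) 1 = f.wind a 1 ∨ f.wind (γ • a) 1 = f.wind a (-1) := by
  rcases smul_cases γ with ⟨n, hn⟩ | ⟨n, hn⟩
  · left
    refine ext_val (by simp) fun l hl => ?_
    rw [dom_wind] at hl
    rw [val_wind f _ _ hl, val_wind f _ _ hl, ← swapOrbits_smul_smul γ a,
      show γ • (a + 1 * period m) = γ • a + 1 * period m by simp only [hn]; ring]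
  · right
    refine ext_val (by simp) fun l hl => ?_
    rw [dom_wind] at hl
    rw [val_wind f _ _ hl, val_wind f _ _ hl, ← swapOrbits_smul_smul γ a,
      show γ • (a + -1 * period m) = γ • a + 1 * period m by simp only [hn]; ring]

theorem finite_ext (hm : 1 < m) (f : LPP m k) : {h | f.Ext h}.Finite := by
  refine (((Set.finite_Icc (1 : ℤ) (m - 1)).image (fun a => f.wind a 1)).union
    ((Set.finite_Icc (1 : ℤ) (m - 1)).image (fun a => f.wind a (-1)))).subset ?_
  rintro h ⟨i, hi, -, -, rfl⟩
  obtain ⟨γ, h1, h2⟩ := exists_rep hm (f.val i)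
  have := f.wind_smul γ⁻¹ (γ • f.val i)
  rw [inv_smul_smul] at this
  rcases this with h | h <;> rw [h]
  · exact Or.inl ⟨_, ⟨h1, h2⟩, rfl⟩
  · exact Or.inr ⟨_, ⟨h1, h2⟩, rfl⟩

theorem mult_swap (hm : 1 < m) {f : LPP m k} {i j : ℤ} (h : f.IsRightCrossing i j) (g : ℤ) :
    (f.swap i j).mult g = f.mult g := by
  rw [mult_eq hm, mult_eq hm, up_swap_eq hm h, up_swap_eq hm h]

theorem weight_swap (hm : 1 < m) {f : LPP m k} {i j : ℤ} (h : f.IsRightCrossing i j) :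
    (f.swap i j).weight = f.weight := funext fun _ => mult_swap hm h _

/-- A crossing contributes to the differential of `Q` if and only if it is represented by a
crossing of strands that move to the right and whose resolution drops the number of crossings by
one. -/
theorem contributes_iff (hm : 1 < m) {f : LPP m k} (c : f.Cross) :
    ((f.resolve c).cross + 1 = f.cross ∧ ∀ i, ⌊(f.weight - (f.resolve c).weight) i⌋₊ = 0) ↔
      ∃ i j, c.1 = PairClass.mk m (i, j) ∧ f.IsCover i j := by
  constructor
  · rintro ⟨h1, h2⟩
    obtain ⟨c, hc⟩ := c
    obtain ⟨a, b, rfl⟩ := c.exists_mk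
    rw [resolve_eq_swap ⟨_, hc⟩ rfl] at h1 h2
    obtain ⟨i, j, hi, hj, hij, hf, he⟩ : ∃ i j, i ∈ f.dom ∧ j ∈ f.dom ∧ i < j ∧ f.val j < f.val i ∧
        PairClass.mk m (a, b) = PairClass.mk m (i, j) := by
      obtain ⟨ha, hb, hr | hr⟩ := mk_mem_cross_iff.1 hc
      · exact ⟨a, b, ha, hb, hr.1, hr.2, rfl⟩
      · exact ⟨b, a, hb, ha, hr.1, hr.2, PairClass.mk_swap _ _⟩
    have hs : f.swap a b = f.swap i j := by
      rw [← resolve_eq_swap ⟨_, hc⟩ rfl, ← resolve_eq_swap ⟨_, hc⟩ he]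
    rw [hs] at h1 h2
    simp only [he]
    -- Three cases: neither strand moves to the left; neither moves to the right, which is the
    -- mirror image of the first case; or the strands approach each other and weight is lost.
    rcases le_or_gt j (f.val j) with h | h
    · exact ⟨i, j, rfl, (isCover_iff hm ⟨hi, hj, hij, h, hf⟩).2 h1⟩
    · rcases le_or_gt (f.val i) i with h' | h'
      · refine ⟨1 - j, 1 - i, ?_, (isCover_iff hm ⟨by simpa, by simpa, by omega, ?_, ?_⟩).2 ?_⟩
        · obtain ⟨γ, hγ⟩ := exists_mirror_one m
          rw [← hγ, ← hγ, PairClass.mk_smul, PairClass.mk_swap]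
        · rw [val_mirror]; omega
        · rw [val_mirror, val_mirror]; omega
        · rwa [swap_mirror, swap_symm hi hj (Or.inl ⟨hij, hf⟩)]
      · obtain ⟨g, hg⟩ := exists_mult_drop hm hi hj hij hf h h'
        obtain ⟨ix, hix⟩ := exists_mult_eq_weight hm g
        rw [hix, hix] at hg
        have := h2 ix
        rw [Nat.floor_eq_zero, Pi.sub_apply] at this
        linarith
  · rintro ⟨i, j, hc, h⟩
    rw [resolve_eq_swap c hc, weight_swap hm h.1]
    exact ⟨(isCover_iff hm h.1).1 h, fun i => by simp⟩

end LPP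

/-! ### The quotient `Q` as a vector space -/

theorem constantCoeff_vMonomial {m : ℕ} (a : Fin m → ℚ) [Decidable (∀ i, ⌊a i⌋₊ = 0)] :
    MvPolynomial.constantCoeff (vMonomial a) = if ∀ i, ⌊a i⌋₊ = 0 then (1 : ZMod 2) else 0 := by
  rw [vMonomial, map_prod]
  simp only [map_pow, MvPolynomial.constantCoeff_X]
  split_ifs with h
  · exact Finset.prod_eq_one fun i _ => by rw [h i, pow_zero]
  · push Not at h
    obtain ⟨i, hi⟩ := h
    exact Finset.prod_eq_zero (Finset.mem_univ i) (zero_pow hi)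

namespace Pong

variable {m k : ℕ}

/-- The constant coefficients of an element of the pong algebra. -/
def const (m k : ℕ) : Pong m k →ₛₗ[(MvPolynomial.constantCoeff : Base m →+* ZMod 2)]
    (LPP m k →₀ ZMod 2) where
  toFun a := a.mapRange MvPolynomial.constantCoeff (map_zero _)
  map_add' a b := Finsupp.mapRange_add (fun x y => map_add _ x y) a b
  map_smul' r a := by ext f; simp

theorem const_apply (a : Pong m k) (f : LPP m k) :
    const m k a f = MvPolynomial.constantCoeff (a f) := rfl

theorem const_pure (f : LPP m k) : const m k (pure f) = Finsupp.single f 1 := by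
  classical
  ext g
  rw [const_apply, pure, Finsupp.single_apply, Finsupp.single_apply]
  split_ifs <;> simp

theorem mem_ideal_of_constantCoeff_eq_zero {p : Base m} (h : MvPolynomial.constantCoeff p = 0) :
    p ∈ Ideal.span (Set.range (MvPolynomial.X : Fin m → Base m)) := by
  rw [← Set.image_univ, MvPolynomial.mem_ideal_span_X_image]
  intro n hn
  by_contra hcon
  push Not at hcon
  have : n = 0 := by ext i; simpa using hcon i (Set.mem_univ i)
  subst this
  rw [MvPolynomial.mem_support_iff] at hn
  exact hn h

/-- A polynomial with vanishing constant coefficient lies in the ideal of the variables. So `Q` is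
read through constant coefficients as the vector space on the lifted partial permutations. -/
theorem vIdeal_eq_ker : vIdeal m k = LinearMap.ker (const m k) := by
  apply le_antisymm
  · rw [vIdeal, Submodule.smul_le]
    intro r hr a _
    have hr' : MvPolynomial.constantCoeff r = 0 := by
      have : Ideal.span (Set.range (MvPolynomial.X : Fin m → Base m)) ≤
          RingHom.ker (MvPolynomial.constantCoeff : Base m →+* ZMod 2) := by
        rw [Ideal.span_le]
        rintro _ ⟨i, rfl⟩
        exact MvPolynomial.constantCoeff_X _ i
      exact this hr
    rw [LinearMap.mem_ker, LinearMap.map_smulₛₗ, hr', zero_smul]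
  · intro a ha
    rw [← Finsupp.sum_single a]
    refine Submodule.sum_mem _ fun f _ => ?_
    rw [← mul_one (a f), ← smul_eq_mul, ← Finsupp.smul_single]
    refine Submodule.smul_mem_smul (mem_ideal_of_constantCoeff_eq_zero ?_) trivial
    rw [← const_apply, LinearMap.mem_ker.1 ha]; rfl

end Pong

namespace Quo

variable {m k : ℕ}

/-- The coefficients of an element of `Q` with respect to the lifted partial permutations. -/
def coeff (m k : ℕ) : Quo m k →ₗ[ZMod 2] (LPP m k →₀ ZMod 2) where
  toFun := (Pong.vIdeal m k).liftQ (Pong.const m k) Pong.vIdeal_eq_ker.le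
  map_add' := map_add _
  map_smul' r a := by
    have : r • a = (MvPolynomial.C r : Base m) • a := by
      induction a using Submodule.Quotient.induction_on with
      | H a =>
        rw [← Submodule.Quotient.mk_smul, ← Submodule.Quotient.mk_smul]
        congr 1
        ext f
        simp [MvPolynomial.smul_eq_C_mul]
    rw [this, LinearMap.map_smulₛₗ]; simp

theorem coeff_injective : Function.Injective (coeff m k) := by
  rw [← LinearMap.ker_eq_bot, eq_bot_iff]
  intro a ha
  induction a using Submodule.Quotient.induction_on with
  | H a =>
    have ha : Pong.const m k a = 0 := ha
    rw [Submodule.mem_bot, Submodule.Quotient.mk_eq_zero, Pong.vIdeal_eq_ker]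
    exact ha

/-- The element of `Q` given by a lifted partial permutation. -/
def pure (f : LPP m k) : Quo m k := proj m k (Pong.pure f)

theorem coeff_pure (f : LPP m k) : coeff m k (pure f) = Finsupp.single f 1 := Pong.const_pure f

/-- Only terms with trivial monomial survive, and these are the covers; each cover comes from a
single crossing by `mk_eq_of_swap_eq`. -/
theorem coeff_d_pure (hm : 1 < m) (f : LPP m k) :
    coeff m k (d (pure f)) = relOp LPP.Cov (Finsupp.single f 1) := by
  classical
  have : Fintype f.Cross := (f.finite_cross hm).fintype
  have h1 : coeff m k (d (pure f)) = ∑ c : f.Cross, Pong.const m k (Pong.dCrossing f c) := by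
    rw [← map_sum, ← finsum_eq_sum_of_fintype]
    change Pong.const m k (Pong.d (Pong.pure f)) = _
    rw [Pong.d, Pong.pure, Finsupp.linearCombination_single, one_smul]
  have h2 : ∀ c : f.Cross, Pong.const m k (Pong.dCrossing f c) =
      if ∃ i j, c.1 = PairClass.mk m (i, j) ∧ f.IsCover i j then
        Finsupp.single (f.resolve c) 1 else 0 := by
    intro c
    rw [← if_congr (LPP.contributes_iff hm c) rfl rfl, Pong.dCrossing]
    by_cases hc : (f.resolve c).cross + 1 = f.cross
    · rw [if_pos hc, LinearMap.map_smulₛₗ, constantCoeff_vMonomial, Pong.const_pure]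
      simp only [hc, true_and]
      split_ifs <;> simp
    · simp [hc]
  rw [h1, Finset.sum_congr rfl fun c _ => h2 c]
  ext h
  rw [relOp_single_apply (f.finite_cov hm), Finsupp.finsetSum_apply]
  split_ifs with hcov
  · obtain ⟨i, j, hij, rfl⟩ := hcov
    rw [Finset.sum_eq_single (⟨_, hij.1.mk_mem_cross⟩ : f.Cross)]
    · rw [if_pos ⟨i, j, rfl, hij⟩, LPP.resolve_eq_swap _ rfl, Finsupp.single_eq_same]
    · rintro c - hc
      split_ifs with h
      · obtain ⟨i', j', h', hij'⟩ := h
        rw [LPP.resolve_eq_swap c h', Finsupp.single_eq_of_ne]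
        intro he
        refine hc (Subtype.ext ?_)
        rw [h']
        exact (LPP.mk_eq_of_swap_eq hij.1 hij'.1 he).symm
      · rfl
    · intro h; exact absurd (Finset.mem_univ _) h
  · refine Finset.sum_eq_zero fun c _ => ?_
    split_ifs with hc
    · obtain ⟨i, j, h', hij⟩ := hc
      rw [LPP.resolve_eq_swap c h', Finsupp.single_eq_of_ne]
      exact fun he => hcov ⟨i, j, hij, he⟩
    · rfl

end Quo

/-! ### Multiplication by `Ω`: full turns -/

namespace LPP

variable {m k : ℕ}

theorem orb_ran_ncard (f : LPP m k) : (orb m '' f.ran).ncard = k := by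
  have hout : ∀ i, Equivalent m i (orb m i).out := fun i =>
    orb_eq_iff.1 (Quotient.out_eq (orb m i)).symm
  set F : Orbits m → Orbits m := fun c => orb m (f.val c.out)
  have hF : ∀ i, F (orb m i) = orb m (f.val i) := fun i =>
    orb_eq_iff.2 (f.equivalent_val (hout i).symm)
  have h : orb m '' f.ran = F '' (orb m '' f.dom) := by
    ext c
    constructor
    · rintro ⟨a, ha, rfl⟩
      obtain ⟨i, hi, rfl⟩ := mem_ran_iff.1 ha
      exact ⟨_, ⟨i, hi, rfl⟩, hF i⟩
    · rintro ⟨_, ⟨i, hi, rfl⟩, rfl⟩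
      exact ⟨f.val i, val_mem_ran hi, (hF i).symm⟩
  rw [h, Set.InjOn.ncard_image, orb_dom_ncard]
  rintro _ ⟨i, hi, rfl⟩ _ ⟨j, hj, rfl⟩ hij
  rw [hF, hF, orb_eq_iff] at hij
  exact orb_eq_iff.2 (f.equivalent_of_val hi hj hij)

open Classical in
/-- The identity of a `G_m`-invariant set with `k` orbits. -/
def idOn (S : Set ℤ) (hS : ∀ (γ : G m) i, γ • i ∈ S ↔ i ∈ S) (hk : (orb m '' S).ncard = k) :
    LPP m k where
  toFun i := if i ∈ S then some i else none
  equivariant γ i := by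
    by_cases h : i ∈ S
    · rw [if_pos h, if_pos ((hS γ i).2 h)]; rfl
    · rw [if_neg h, if_neg (mt (hS γ i).1 h)]; rfl
  card_orbits := by
    rw [← hk]
    congr 2
    ext i
    by_cases h : i ∈ S <;> simp [h]
  inj i j a b hi hj hab := by
    split_ifs at hi hj
    obtain rfl := Option.some.inj hi
    obtain rfl := Option.some.inj hj
    exact hab

theorem dom_idOn (S : Set ℤ) (hS : ∀ (γ : G m) i, γ • i ∈ S ↔ i ∈ S)
    (hk : (orb m '' S).ncard = k) : (idOn S hS hk).dom = S := by
  ext i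
  rw [mem_dom_iff]
  by_cases h : i ∈ S <;> simp [idOn, h]

theorem val_idOn (S : Set ℤ) (hS : ∀ (γ : G m) i, γ • i ∈ S ↔ i ∈ S)
    (hk : (orb m '' S).ncard = k) {i : ℤ} (hi : i ∈ S) : (idOn S hS hk).val i = i := by
  apply val_of_toFun
  simp [idOn, hi]

/-- The identity of the image. -/
def idRan (f : LPP m k) : LPP m k :=
  idOn f.ran (fun γ i => (f.mem_ran_congr (equivalent_smul γ i)).symm) f.orb_ran_ncard

theorem dom_idRan (f : LPP m k) : f.idRan.dom = f.ran := dom_idOn ..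

theorem val_idRan (f : LPP m k) {i : ℤ} (hi : i ∈ f.ran) : f.idRan.val i = i := val_idOn _ _ _ hi

theorem eq_of_dom_eq (hm : 1 < m) {f g : LPP m k}
    (h : ∀ i ∈ Finset.Icc (1 : ℤ) (m - 1), f.toFun i = g.toFun i) : f = g := by
  refine LPP.ext (funext fun i => ?_)
  obtain ⟨γ, h1, h2⟩ := exists_rep hm i
  rw [← inv_smul_smul γ i, f.equivariant, g.equivariant, h _ (Finset.mem_Icc.2 ⟨h1, h2⟩)]

theorem dom_eq_of_forall_mem_Icc (hm : 1 < m) {f : LPP m k} {S : Set ℤ}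
    (hS : ∀ (γ : G m) i, γ • i ∈ S ↔ i ∈ S)
    (h : ∀ i ∈ Finset.Icc (1 : ℤ) (m - 1), i ∈ f.dom ↔ i ∈ S) : f.dom = S := by
  ext i
  obtain ⟨γ, h1, h2⟩ := exists_rep hm i
  rw [← f.smul_mem_dom γ, ← hS γ]
  exact h _ (Finset.mem_Icc.2 ⟨h1, h2⟩)

/-- A domain is determined by its part in `{1, …, m - 1}`. Finiteness is what makes the `finsum` in
`sumOf` an honest sum. -/
theorem finite_of_dom_injective (hm : 1 < m) {p : LPP m k → Prop}
    (h : ∀ f g, p f → p g → f.dom = g.dom → f = g) : {f | p f}.Finite := by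
  classical
  refine Set.Finite.of_finite_image (f := fun f : LPP m k =>
    (Finset.Icc (1 : ℤ) (m - 1)).filter (· ∈ f.dom))
    ((Finset.finite_toSet (Finset.Icc (1 : ℤ) (m - 1)).powerset).subset ?_) ?_
  · rintro _ ⟨f, -, rfl⟩
    exact Finset.mem_coe.2 (Finset.mem_powerset.2 (Finset.filter_subset _ _))
  · intro f hf g hg hfg
    refine h f g hf hg (dom_eq_of_forall_mem_Icc hm (fun γ i => g.smul_mem_dom γ i) fun i hi => ?_)
    have := Finset.ext_iff.1 hfg i
    simpa only [Finset.mem_filter, hi, true_and] using this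

/-- The strands of `b`, when the strand with value `a` is prolonged by a full turn. -/
theorem wind_cases (b : LPP m k) {i l : ℤ} (hi : i ∈ b.dom) (hl : l ∈ b.dom) :
    (∃ n, l = i + n * period m ∧ b.val l = b.val i + n * period m ∧
      swapOrbits m (b.val i) (b.val i + 1 * period m) (b.val l) = b.val l + period m) ∨
    (∃ n, l = 1 - i + n * period m ∧ b.val l = 1 - b.val i + n * period m ∧
      swapOrbits m (b.val i) (b.val i + 1 * period m) (b.val l) = b.val l - period m) ∨
    (swapOrbits m (b.val i) (b.val i + 1 * period m) (b.val l) = b.val l ∧ ¬ Equivalent m i l) := by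
  by_cases h : Equivalent m i l
  · obtain ⟨n, rfl | rfl⟩ := equivalent_iff.1 h
    · refine Or.inl ⟨n, rfl, val_add .., ?_⟩
      rw [val_add, swapOrbits_add, swapOrbits_self_left]; ring
    · refine Or.inr (Or.inl ⟨n, rfl, by rw [val_add, val_mirror], ?_⟩)
      rw [val_add, val_mirror, swapOrbits_add, swapOrbits_mirror, swapOrbits_self_left]; ring
  · refine Or.inr (Or.inr ⟨?_, h⟩)
    have := b.val_wind_of_not 1 hi hl h
    rwa [val_wind _ _ _ hl] at this

/-- Prolonging a strand can undo only crossings in which this strand ends lower than one that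
started before it, up to translates and mirror images. So no crossing is lost exactly when nothing
overtakes it. -/
theorem wind_cross_iff (hm : 1 < m) {b : LPP m k} {i : ℤ} (hi : i ∈ b.dom) :
    (∀ c ∈ b.dom, ∀ d ∈ b.dom, c < d → b.val d < b.val c →
      swapOrbits m (b.val i) (b.val i + 1 * period m) (b.val d) <
        swapOrbits m (b.val i) (b.val i + 1 * period m) (b.val c)) ↔
    ∀ l ∈ b.dom, l < i → b.val l < b.val i := by
  have hp := period_pos hm
  constructor
  · intro h l hl hli
    by_contra hcon
    have hne : b.val l ≠ b.val i := fun he => hli.ne (b.val_inj hl hi he)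
    -- Shifting the overtaking strand `q` periods to the left brings its value into the first period
    -- above `b.val i`, while it still starts before `i`. The full turn then undoes its crossing
    -- with the strand from `i`.
    set q := (b.val l - b.val i) / period m
    have h1 := Int.emod_add_mul_ediv (b.val l - b.val i) (period m)
    have h2 := Int.emod_nonneg (b.val l - b.val i) hp.ne'
    have h3 := Int.emod_lt_of_pos (b.val l - b.val i) hp
    have hq : 0 ≤ q := Int.ediv_nonneg (by omega) hp.le
    have hq' : 0 ≤ q * period m := mul_nonneg hq hp.le
    have hc : l + -q * period m ∈ b.dom := (b.add_mem_dom _ _).2 hl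
    have hbc : b.val (l + -q * period m) = b.val l + -q * period m := val_add ..
    have h4 : period m * q = q * period m := mul_comm _ _
    have hci : l + -q * period m < i := by linarith
    have hne' : b.val (l + -q * period m) ≠ b.val i := fun he => hci.ne (b.val_inj hc hi he)
    have hgt : b.val i < b.val (l + -q * period m) := by
      refine lt_of_le_of_ne ?_ hne'.symm
      rw [hbc]; linarith
    have := h _ hc _ hi hci hgt
    rw [swapOrbits_self_left] at this
    have hlt : b.val (l + -q * period m) < b.val i + period m := by rw [hbc]; linarith
    rcases b.wind_cases hi hc with ⟨n, e1, e2, e3⟩ | ⟨n, e1, e2, e3⟩ | ⟨e1, -⟩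
    · rw [e2] at hgt hlt
      have hn1 : 0 < n := by
        by_contra hn; nlinarith
      have hn2 : n < 1 := by
        by_contra hn; nlinarith
      omega
    · omega
    · omega
  · intro h c hc d hd hcd hbd
    have key : ∀ c ∈ b.dom, ∀ n, c < i + n * period m → b.val c < b.val i + n * period m := by
      intro c hc n hcn
      have := h (c + -n * period m) ((b.add_mem_dom _ _).2 hc) (by linarith)
      rw [val_add] at this
      linarith
    rcases b.wind_cases hi hc with ⟨n, e1, e2, e3⟩ | ⟨n, e1, e2, e3⟩ | ⟨e3, -⟩ <;>
      rcases b.wind_cases hi hd with ⟨n', g1, g2, g3⟩ | ⟨n', g1, g2, g3⟩ | ⟨g3, -⟩ <;>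
      rw [e3, g3] <;> try omega
    · have := key c hc n' (by omega); omega
    · have := key (1 - d) (by simpa) (-n) (by linarith)
      rw [val_mirror] at this
      linarith
    · have := key c hc n' (by omega); omega

end LPP

namespace Pong

variable {m k : ℕ}

theorem sumOf_eq {p : LPP m k → Prop} (h : {f | p f}.Finite) :
    sumOf p = ∑ f ∈ h.toFinset, pure f := by
  have : Fintype {f // p f} := h.fintype
  rw [sumOf, finsum_eq_sum_of_fintype]
  exact Finset.sum_subtype h.toFinset (fun f => by simp) (fun f => pure f) |>.symm

theorem mul_pure (g f : LPP m k) : mul (pure g) (pure f) = mulPure g f := by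
  simp [mul, pure]

theorem mulPure_of_ne {g f : LPP m k} (h : g.dom ≠ f.ran) : mulPure g f = 0 := dif_neg h

theorem mul_mulPure_of_ne {g f b : LPP m k} (h : g.dom ≠ f.ran ∨ f.dom ≠ b.ran) :
    mul (mulPure g f) (pure b) = 0 := by
  rcases h with h | h
  · rw [mulPure_of_ne h]; simp
  · unfold mulPure
    split_ifs
    · rw [map_smul, LinearMap.smul_apply, mul_pure, mulPure_of_ne (by rwa [LPP.dom_comp]), smul_zero]
    · simp
    · simp

theorem mul_mul_sumOf {p q : LPP m k → Prop} (hp : {f | p f}.Finite) (hq : {f | q f}.Finite)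
    (b : LPP m k) : mul (mul (sumOf p) (sumOf q)) (pure b) =
      ∑ g ∈ hp.toFinset, ∑ f ∈ hq.toFinset, mul (mulPure g f) (pure b) := by
  rw [sumOf_eq hp, sumOf_eq hq]
  simp only [map_sum, LinearMap.sum_apply, mul_pure]
  rw [Finset.sum_comm]

/-- Factors compose only when the domain of one is the image of the other. If this determines the
factor, the double sum has a single term. -/
theorem mul_mul_sumOf_of_unique {p q : LPP m k → Prop} (hp : {f | p f}.Finite)
    (hq : {f | q f}.Finite) {b g f : LPP m k} (hg : p g) (hf : q f)
    (hug : ∀ g', p g' → g'.dom = f.ran → g' = g) (huf : ∀ f', q f' → f'.dom = b.ran → f' = f) :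
    mul (mul (sumOf p) (sumOf q)) (pure b) = mul (mulPure g f) (pure b) := by
  rw [mul_mul_sumOf hp hq, Finset.sum_comm, Finset.sum_eq_single f, Finset.sum_eq_single g]
  · intro g' hg' hne
    exact mul_mulPure_of_ne (Or.inl fun h => hne (hug g' (by simpa using hg') h))
  · intro h; exact absurd (by simpa using hg) h
  · intro f' hf' hne
    exact Finset.sum_eq_zero fun g' _ =>
      mul_mulPure_of_ne (Or.inr fun h => hne (huf f' (by simpa using hf') h))
  · intro h; exact absurd (by simpa using hf) h

theorem mul_mul_sumOf_of_none {p q : LPP m k → Prop} (hp : {f | p f}.Finite)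
    (hq : {f | q f}.Finite) {b : LPP m k} (huf : ∀ f', q f' → f'.dom ≠ b.ran) :
    mul (mul (sumOf p) (sumOf q)) (pure b) = 0 := by
  rw [mul_mul_sumOf hp hq]
  exact Finset.sum_eq_zero fun g' _ => Finset.sum_eq_zero fun f' hf' =>
      mul_mulPure_of_ne (Or.inr (huf f' (by simpa using hf')))

/-- The product of two elements all of whose strands turn in the same direction. -/
theorem mulPure_eq_pure_comp (hm : 1 < m) {g f : LPP m k} (h : g.dom = f.ran) {s t : ℤ}
    (hs : 0 ≤ s) (ht : s ≤ t)
    (hc : ∀ l ∈ f.dom, (f.val l = l + s ∧ g.val (f.val l) = l + t) ∨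
      (f.val l = l - s ∧ g.val (f.val l) = l - t) ∨ (f.val l = l ∧ g.val (f.val l) = l)) :
    mulPure g f = pure (g.comp f h) := by
  have h1 : (g.comp f h).cross = g.cross + f.cross := by
    rw [LPP.cross_comp_eq_iff hm h]
    intro a ha b hb hab hf
    have := hc a ha
    have := hc b hb
    omega
  have h2 : f.weight + g.weight - (g.comp f h).weight = 0 := by
    funext i
    change f.mult _ + g.mult _ - (g.comp f h).mult _ = 0
    rw [LPP.mult_comp_of_monotone hm h, sub_self]
    intro l hl
    have := hc l hl
    omega
  rw [mulPure, dif_pos h, if_pos h1, h2, vMonomial]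
  simp

-- In `Q` the product with a full turn can vanish for two reasons only: the strand moves to the left
-- and turns back, which loses weight, or it is overtaken, which loses a crossing.
open Classical in
theorem const_mulPure_wind (hm : 1 < m) {g b : LPP m k} {i : ℤ} (hi : i ∈ b.dom)
    (h : g.dom = b.ran)
    (hg : ∀ l ∈ b.ran, g.val l = swapOrbits m (b.val i) (b.val i + 1 * period m) l) :
    const m k (mulPure g b) = if i ≤ b.val i ∧ ∀ l ∈ b.dom, l < i → b.val l < b.val i then
      Finsupp.single (b.wind (b.val i) 1) 1 else 0 := by
  have hp := period_pos hm
  have hcomp : g.comp b h = b.wind (b.val i) 1 := by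
    refine LPP.ext_val (by rw [LPP.dom_comp, LPP.dom_wind]) fun l hl => ?_
    rw [LPP.dom_comp] at hl
    rw [LPP.val_comp g b h hl, hg _ (LPP.val_mem_ran hl), LPP.val_wind _ _ _ hl]
  have hcross : (g.comp b h).cross = g.cross + b.cross ↔
      ∀ l ∈ b.dom, l < i → b.val l < b.val i := by
    rw [LPP.cross_comp_eq_iff hm h, ← LPP.wind_cross_iff hm hi]
    refine forall₂_congr fun c hc => forall₂_congr fun d hd => ?_
    rw [hg _ (LPP.val_mem_ran hc), hg _ (LPP.val_mem_ran hd)]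
  rw [mulPure, dif_pos h]
  by_cases hx : ∀ l ∈ b.dom, l < i → b.val l < b.val i
  · rw [if_pos (hcross.2 hx), LinearMap.map_smulₛₗ, constantCoeff_vMonomial, const_pure, hcomp]
    rw [if_congr (and_iff_left hx) rfl rfl]
    by_cases hle : i ≤ b.val i
    · rw [if_pos hle, if_pos, one_smul]
      intro ix
      have : (b.weight + g.weight - (b.wind (b.val i) 1).weight) ix = 0 := by
        rw [← hcomp]
        change b.mult _ + g.mult _ - (g.comp b h).mult _ = 0
        rw [LPP.mult_comp_of_monotone hm h, sub_self]
        intro l hl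
        rw [hg _ (LPP.val_mem_ran hl)]
        rcases b.wind_cases hi hl with ⟨n, e1, e2, e3⟩ | ⟨n, e1, e2, e3⟩ | ⟨e3, -⟩ <;> rw [e3] <;>
          omega
      rw [this, Nat.floor_zero]
    · rw [if_neg hle, if_neg, zero_smul]
      intro hw
      obtain ⟨j, hj⟩ := LPP.exists_mult_comp_drop hm h hi (by omega) (by
        rw [hg _ (LPP.val_mem_ran hi), swapOrbits_self_left]; omega)
      obtain ⟨ix, hix⟩ := LPP.exists_mult_eq_weight hm j
      rw [hix, hix, hix, hcomp] at hj
      have := hw ix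
      rw [Nat.floor_eq_zero, Pi.sub_apply, Pi.add_apply] at this
      linarith
  · rw [if_neg (mt hcross.1 hx), if_neg (fun h => hx h.2), map_zero]

end Pong

/-! ### Single turns at the two walls, and full turns indexed by the end point -/

namespace LPP

variable {m k : ℕ}

theorem ran_post (f : LPP m k) (φ : ℤ → ℤ) (hφ : ∀ (γ : G m) i, φ (γ • i) = γ • φ i)
    (ho : ∀ i, Equivalent m i (φ i)) : (f.post φ hφ ho).ran = f.ran := by
  ext a
  simp only [mem_ran_iff, dom_post]
  constructor
  · rintro ⟨i, hi, rfl⟩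
    rw [val_post _ _ _ _ hi]
    exact mem_ran_iff.1 (f.mem_ran_of_equivalent (ho _) (val_mem_ran hi))
  · rintro ⟨i, hi, rfl⟩
    have h1 : i ∈ (f.post φ hφ ho).dom := by rwa [dom_post]
    have := (f.post φ hφ ho).mem_ran_of_equivalent (b := f.val i)
      (by rw [val_post _ _ _ _ hi]; exact (ho _).symm) (val_mem_ran h1)
    rw [mem_ran_iff, dom_post] at this
    exact this

/-- One strand from `i` to `r`, and all other strands stationary. -/
def IsTurn (r i : ℤ) (f : LPP m k) : Prop :=
  f.toFun i = some r ∧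
    ∀ l ∈ Finset.Icc (1 : ℤ) (m - 1), l ≠ i → l ∈ f.dom → f.toFun l = some l

theorem IsTurn.eq (hm : 1 < m) {r i : ℤ} {f g : LPP m k} (hf : f.IsTurn r i) (hg : g.IsTurn r i)
    (h : f.dom = g.dom) : f = g := by
  refine eq_of_dom_eq hm fun l hl => ?_
  by_cases hli : l = i
  · rw [hli, hf.1, hg.1]
  · by_cases hd : l ∈ f.dom
    · rw [hf.2 l hl hli hd, hg.2 l hl hli (h ▸ hd)]
    · have hd' : l ∉ g.dom := h ▸ hd
      rw [mem_dom_iff, not_not] at hd hd'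
      rw [hd, hd']

theorem finite_isTurn (hm : 1 < m) (r i : ℤ) : {f : LPP m k | f.IsTurn r i}.Finite :=
  finite_of_dom_injective hm fun _ _ hf hg h => hf.eq hm hg h

/-- The identity of the image of `b`, except that the strand at `i` ends at `r`. -/
def turn (b : LPP m k) (i r : ℤ) (h : Equivalent m i r) : LPP m k :=
  b.idRan.post (swapOrbits m i r) (fun γ l => swapOrbits_smul _ _ l γ) (equivalent_swapOrbits h)

theorem dom_turn (b : LPP m k) {i r : ℤ} (h : Equivalent m i r) : (b.turn i r h).dom = b.ran := by
  rw [turn, dom_post, dom_idRan]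

theorem ran_idRan (b : LPP m k) : b.idRan.ran = b.ran := by
  ext a
  rw [mem_ran_iff, dom_idRan]
  constructor
  · rintro ⟨i, hi, rfl⟩; rwa [val_idRan _ hi]
  · intro ha; exact ⟨a, ha, val_idRan _ ha⟩

theorem ran_turn (b : LPP m k) {i r : ℤ} (h : Equivalent m i r) : (b.turn i r h).ran = b.ran := by
  rw [turn, ran_post, ran_idRan]

theorem val_turn (b : LPP m k) {i r l : ℤ} (h : Equivalent m i r) (hl : l ∈ b.ran) :
    (b.turn i r h).val l = swapOrbits m i r l := by
  rw [turn, val_post _ _ _ _ (by rwa [dom_idRan]), val_idRan _ hl]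

theorem val_turn_self (b : LPP m k) {i r : ℤ} (h : Equivalent m i r) (hl : i ∈ b.ran) :
    (b.turn i r h).val i = r := by
  rw [val_turn _ _ hl, swapOrbits_self_left]

theorem val_turn_of_not (b : LPP m k) {i r l : ℤ} (h : Equivalent m i r) (hl : l ∈ b.ran)
    (hil : ¬ Equivalent m i l) : (b.turn i r h).val l = l := by
  rw [val_turn _ _ hl, swapOrbits_of_not hil fun h' => hil (h.trans h')]

theorem isTurn_turn (hm : 1 < m) (b : LPP m k) {i r : ℤ} (h : Equivalent m i r) (hi : i ∈ b.ran)
    (hi1 : 1 ≤ i) (him : i ≤ m - 1) : (b.turn i r h).IsTurn r i := by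
  refine ⟨toFun_eq_some.2 ⟨by rwa [dom_turn], val_turn_self _ _ hi⟩, fun l hl hli hd => ?_⟩
  have hd' := hd
  rw [dom_turn] at hd'
  refine toFun_eq_some.2 ⟨hd, val_turn_of_not _ _ hd' fun he => hli ?_⟩
  exact (eq_of_equivalent_of_mem hm he (Finset.mem_Icc.2 ⟨hi1, him⟩) hl).symm

/-- The strand of `b` that ends in `a` moves to the right and is not overtaken, and `h` is obtained
by prolonging it by a full turn. -/
def ExtAt (b : LPP m k) (a : ℤ) (h : LPP m k) : Prop :=
  ∃ i ∈ b.dom, b.val i = a ∧ i ≤ a ∧ (∀ l ∈ b.dom, l < i → b.val l < a) ∧ h = b.wind a 1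

theorem ext_iff_exists_extAt {b h : LPP m k} : b.Ext h ↔ ∃ a, b.ExtAt a h := by
  constructor
  · rintro ⟨i, hi, hle, hov, rfl⟩
    exact ⟨_, i, hi, rfl, hle, hov, rfl⟩
  · rintro ⟨_, i, hi, rfl, hle, hov, rfl⟩
    exact ⟨i, hi, hle, hov, rfl⟩

theorem ExtAt.add {b h : LPP m k} {a : ℤ} (H : b.ExtAt a h) (n : ℤ) :
    b.ExtAt (a + n * period m) h := by
  obtain ⟨i, hi, rfl, hle, hov, rfl⟩ := H
  refine ⟨i + n * period m, (b.add_mem_dom _ _).2 hi, val_add .., by linarith, fun l hl hli => ?_, ?_⟩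
  · have := hov (l + -n * period m) ((b.add_mem_dom _ _).2 hl) (by linarith)
    rw [val_add] at this
    linarith
  · refine ext_val (by simp) fun l hl => ?_
    rw [dom_wind] at hl
    rw [val_wind _ _ _ hl, val_wind _ _ _ hl]
    obtain ⟨γ, hγ⟩ := exists_transl m n
    rw [← swapOrbits_smul_smul γ, hγ, hγ]
    congr 1; ring

theorem ExtAt.eq_add (hm : 1 < m) {b h : LPP m k} {a a' : ℤ} (H : b.ExtAt a h)
    (H' : b.ExtAt a' h) : ∃ n, a = a' + n * period m := by
  have hp := period_pos hm
  obtain ⟨i, hi, rfl, -, -, rfl⟩ := H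
  obtain ⟨i', hi', rfl, -, -, he⟩ := H'
  have := congrArg (fun f => f.val i) he
  simp only [val_wind_self _ _ hi, val_wind _ _ _ hi] at this
  rcases b.wind_cases hi' hi with ⟨n, -, e, -⟩ | ⟨n, -, -, e⟩ | ⟨e, -⟩
  · exact ⟨n, e⟩
  · rw [e] at this; omega
  · rw [e] at this; omega

end LPP

/-! ### Products of two turns with a generator -/

namespace Pong

variable {m k : ℕ}

-- The two turns go in the same direction, so their product loses neither weight nor crossings, and
-- it is the full turn at `a`. Composition with `b` then falls under `const_mulPure_wind`.
open Classical in
theorem const_mul_turn_turn (hm : 1 < m) {g f b : LPP m k} {a s : ℤ} (ha : a ∈ b.ran)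
    (hf : f.dom = b.ran) (h : g.dom = f.ran) (hs : 0 ≤ s) (hs' : s ≤ period m)
    (hfa : f.val a = a + s) (hga : g.val (a + s) = a + period m)
    (hfl : ∀ l ∈ b.ran, ¬ Equivalent m a l → f.val l = l)
    (hgl : ∀ l ∈ b.ran, ¬ Equivalent m a l → g.val l = l) (h' : LPP m k) :
    const m k (mul (mulPure g f) (pure b)) h' = if b.ExtAt a h' then 1 else 0 := by
  have key : ∀ l ∈ b.ran, (f.val l = l + s ∧ g.val (f.val l) = l + period m ∧
        swapOrbits m a (a + 1 * period m) l = l + period m) ∨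
      (f.val l = l - s ∧ g.val (f.val l) = l - period m ∧
        swapOrbits m a (a + 1 * period m) l = l - period m) ∨
      (f.val l = l ∧ g.val (f.val l) = l ∧ swapOrbits m a (a + 1 * period m) l = l) := by
    intro l hl
    by_cases hal : Equivalent m a l
    · obtain ⟨n, rfl | rfl⟩ := equivalent_iff.1 hal
      · left
        refine ⟨by rw [LPP.val_add, hfa]; ring, ?_, ?_⟩
        · rw [LPP.val_add, hfa, LPP.val_add, hga]; ring
        · rw [swapOrbits_add, swapOrbits_self_left]; ring
      · right; left
        refine ⟨by rw [LPP.val_add, LPP.val_mirror, hfa]; ring, ?_, ?_⟩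
        · rw [LPP.val_add, LPP.val_mirror, hfa, LPP.val_add, LPP.val_mirror, hga]; ring
        · rw [swapOrbits_add, swapOrbits_mirror, swapOrbits_self_left]; ring
    · right; right
      rw [hfl l hl hal, hgl l hl hal]
      exact ⟨rfl, rfl, swapOrbits_of_not hal fun h' => hal ((equivalent_add m a 1).trans h')⟩
  rw [mulPure_eq_pure_comp hm h hs hs' (fun l hl => by
    have := key l (hf ▸ hl)
    omega), mul_pure]
  obtain ⟨i, hi, rfl⟩ := LPP.mem_ran_iff.1 ha
  rw [const_mulPure_wind hm hi (by rw [LPP.dom_comp, hf])]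
  · split_ifs with h1 h2 h2
    · obtain ⟨_, -, -, -, -, rfl⟩ := h2
      exact Finsupp.single_eq_same
    · rw [Finsupp.single_eq_of_ne]
      exact fun he => h2 ⟨i, hi, rfl, h1.1, h1.2, he⟩
    · obtain ⟨i', hi', he, h3, h4, -⟩ := h2
      obtain rfl := b.val_inj hi' hi he
      exact absurd ⟨h3, h4⟩ h1
    · rfl
  · intro l hl
    rw [LPP.val_comp _ _ _ (hf ▸ hl)]
    have := key l hl
    omega

theorem X0_eq (i : ℤ) : X0 m k i = sumOf (LPP.IsTurn (1 - i) i) := rfl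

theorem Xm_eq (i : ℤ) : Xm m k i = sumOf (LPP.IsTurn (2 * m - 1 - i) i) := rfl

-- The right wall is met first: `i ↦ 2m - 1 - i ↦ i + period m`. The strand that ends at `i` is
-- prolonged.
open Classical in
theorem const_mul_X0_Xm (hm : 1 < m) (b : LPP m k) {i : ℤ} (hi : 1 ≤ i) (hi' : i ≤ m - 1)
    (h : LPP m k) : const m k (mul (mul (X0 m k i) (Xm m k i)) (pure b)) h =
      if b.ExtAt i h then 1 else 0 := by
  have hpm : period m = 2 * m - 2 := rfl
  have e0 : Equivalent m i (1 - i) := equivalent_mirror m i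
  have em : Equivalent m i (2 * m - 1 - i) := equivalent_iff.2 ⟨1, Or.inr (by rw [hpm]; ring)⟩
  rw [X0_eq, Xm_eq]
  by_cases hb : i ∈ b.ran
  · rw [mul_mul_sumOf_of_unique (LPP.finite_isTurn hm _ _) (LPP.finite_isTurn hm _ _)
      (b.isTurn_turn hm e0 hb hi hi') (b.isTurn_turn hm em hb hi hi')
      (fun g' hg' hd => hg'.eq hm (b.isTurn_turn hm e0 hb hi hi')
        (by rw [hd, LPP.ran_turn, LPP.dom_turn]))
      (fun f' hf' hd => hf'.eq hm (b.isTurn_turn hm em hb hi hi') (by rw [hd, LPP.dom_turn]))]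
    refine const_mul_turn_turn hm (s := 2 * m - 1 - 2 * i) hb (b.dom_turn _)
      (by rw [LPP.dom_turn, LPP.ran_turn]) (by omega) (by omega)
      (by rw [LPP.val_turn_self _ _ hb]; ring) ?_
      (fun l hl => b.val_turn_of_not _ hl) (fun l hl => b.val_turn_of_not _ hl) h
    rw [show i + (2 * (m : ℤ) - 1 - 2 * i) = 1 - i + 1 * period m by rw [hpm]; ring, LPP.val_add,
      LPP.val_mirror, LPP.val_turn_self _ _ hb]
    ring
  · rw [mul_mul_sumOf_of_none (LPP.finite_isTurn hm _ _) (LPP.finite_isTurn hm _ _), if_neg,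
      map_zero, Finsupp.zero_apply]
    · rintro ⟨i', hd, rfl, -⟩
      exact hb (LPP.val_mem_ran hd)
    · intro f' hf' hd
      exact hb (hd ▸ ⟨_, hf'.1⟩)

-- The left wall is met first: `i ↦ 1 - i ↦ i - period m`. Equivalently `1 - i` is advanced by a
-- period, so the strand that ends at `1 - i` is prolonged.
open Classical in
theorem const_mul_Xm_X0 (hm : 1 < m) (b : LPP m k) {i : ℤ} (hi : 1 ≤ i) (hi' : i ≤ m - 1)
    (h : LPP m k) : const m k (mul (mul (Xm m k i) (X0 m k i)) (pure b)) h =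
      if b.ExtAt (1 - i) h then 1 else 0 := by
  have hpm : period m = 2 * m - 2 := rfl
  have e0 : Equivalent m i (1 - i) := equivalent_mirror m i
  have em : Equivalent m i (2 * m - 1 - i) := equivalent_iff.2 ⟨1, Or.inr (by rw [hpm]; ring)⟩
  have hne : ∀ l, ¬ Equivalent m (1 - i) l → ¬ Equivalent m i l := fun l h h' => h (e0.symm.trans h')
  rw [X0_eq, Xm_eq]
  by_cases hb : i ∈ b.ran
  · rw [mul_mul_sumOf_of_unique (LPP.finite_isTurn hm _ _) (LPP.finite_isTurn hm _ _)
      (b.isTurn_turn hm em hb hi hi') (b.isTurn_turn hm e0 hb hi hi')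
      (fun g' hg' hd => hg'.eq hm (b.isTurn_turn hm em hb hi hi')
        (by rw [hd, LPP.ran_turn, LPP.dom_turn]))
      (fun f' hf' hd => hf'.eq hm (b.isTurn_turn hm e0 hb hi hi') (by rw [hd, LPP.dom_turn]))]
    refine const_mul_turn_turn hm (s := 2 * i - 1) ((b.mirror_mem_ran _).2 hb) (b.dom_turn _)
      (by rw [LPP.dom_turn, LPP.ran_turn]) (by omega) (by omega)
      (by rw [LPP.val_mirror, LPP.val_turn_self _ _ hb]; ring) ?_
      (fun l hl h => b.val_turn_of_not _ hl (hne l h))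
      (fun l hl h => b.val_turn_of_not _ hl (hne l h)) h
    rw [show 1 - i + (2 * i - 1) = i by ring, LPP.val_turn_self _ _ hb, hpm]
    ring
  · rw [mul_mul_sumOf_of_none (LPP.finite_isTurn hm _ _) (LPP.finite_isTurn hm _ _), if_neg,
      map_zero, Finsupp.zero_apply]
    · rintro ⟨i', hi', he, -⟩
      exact hb ((b.mirror_mem_ran _).1 (he ▸ LPP.val_mem_ran hi'))
    · intro f' hf' hd
      exact hb (hd ▸ ⟨_, hf'.1⟩)

end Pong

namespace Quo

variable {m k : ℕ}

/-- The numbers `i` and `1 - i` with `0 < i < m` represent each class modulo `period m` once. Hence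
every admissible full turn comes from exactly one summand of the commutators; signs do not matter
over `𝔽`. -/
theorem coeff_Omega_mul_pure (hm : 1 < m) (b : LPP m k) :
    coeff m k (mul (Omega m k) (pure b)) = relOp LPP.Ext (Finsupp.single b 1) := by
  classical
  have hp := period_pos hm
  have hpm : period m = 2 * m - 2 := rfl
  ext h
  rw [relOp_single_apply (b.finite_ext hm)]
  have h1 : coeff m k (mul (Omega m k) (pure b)) h = ∑ i ∈ Finset.Icc (1 : ℤ) (m - 1),
      ((if b.ExtAt i h then (1 : ZMod 2) else 0) - if b.ExtAt (1 - i) h then 1 else 0) := by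
    change Pong.const m k (Pong.mul (Pong.Omega m k) (Pong.pure b)) h = _
    simp only [Pong.Omega, map_sum, LinearMap.sum_apply, Finsupp.finsetSum_apply]
    refine Finset.sum_congr rfl fun i hi => ?_
    rw [Finset.mem_Icc] at hi
    rw [map_sub, LinearMap.sub_apply, map_sub, Finsupp.sub_apply,
      Pong.const_mul_X0_Xm hm b hi.1 hi.2, Pong.const_mul_Xm_X0 hm b hi.1 hi.2]
  rw [h1]
  have hu : ∀ {a a' : ℤ}, b.ExtAt a h → b.ExtAt a' h → 2 - m ≤ a → a ≤ m - 1 → 2 - m ≤ a' →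
      a' ≤ m - 1 → a = a' := by
    intro a a' ha ha' h1 h2 h3 h4
    obtain ⟨n, hn⟩ := ha.eq_add hm ha'
    have hn1 : n < 1 := by by_contra hc; nlinarith
    have hn2 : -1 < n := by by_contra hc; nlinarith
    obtain rfl : n = 0 := by omega
    simpa using hn
  split_ifs with he
  · obtain ⟨a, ha⟩ := LPP.ext_iff_exists_extAt.1 he
    obtain ⟨γ, h2, h3⟩ := exists_rep hm a
    rw [Finset.sum_eq_single (γ • a)]
    · rcases smul_cases γ with ⟨n, hn⟩ | ⟨n, hn⟩
      · have h4 : b.ExtAt (γ • a) h := by rw [hn]; exact ha.add n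
        rw [if_pos h4, if_neg, sub_zero]
        intro h5
        have := hu h4 h5 (by omega) (by omega) (by omega) (by omega)
        omega
      · have h4 : b.ExtAt (1 - γ • a) h := by
          have := ha.add (-n)
          rw [hn]
          convert this using 1
          ring
        rw [if_pos h4, if_neg, zero_sub]
        · decide
        intro h5
        have := hu h4 h5 (by omega) (by omega) (by omega) (by omega)
        omega
    · intro i hi hne
      rw [Finset.mem_Icc] at hi
      have h6 : ¬ b.ExtAt i h ∧ ¬ b.ExtAt (1 - i) h := by
        rcases smul_cases γ with ⟨n, hn⟩ | ⟨n, hn⟩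
        · have h4 : b.ExtAt (γ • a) h := by rw [hn]; exact ha.add n
          refine ⟨fun h5 => ?_, fun h5 => ?_⟩
          · have := hu h4 h5 (by omega) (by omega) (by omega) (by omega)
            omega
          · have := hu h4 h5 (by omega) (by omega) (by omega) (by omega)
            omega
        · have h4 : b.ExtAt (1 - γ • a) h := by
            have := ha.add (-n)
            rw [hn]
            convert this using 1
            ring
          refine ⟨fun h5 => ?_, fun h5 => ?_⟩
          · have := hu h4 h5 (by omega) (by omega) (by omega) (by omega)
            omega
          · have := hu h4 h5 (by omega) (by omega) (by omega) (by omega)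
            omega
      rw [if_neg h6.1, if_neg h6.2, sub_zero]
    · intro h
      exact absurd (Finset.mem_Icc.2 ⟨h2, h3⟩) h
  · refine Finset.sum_eq_zero fun i _ => ?_
    rw [if_neg fun h => he (LPP.ext_iff_exists_extAt.2 ⟨_, h⟩),
      if_neg fun h => he (LPP.ext_iff_exists_extAt.2 ⟨_, h⟩), sub_zero]

end Quo

/-! ### Idempotent states and generators -/

/-- The points of the orbits of the elements of `x`. -/
def orbitsOf (m : ℕ) (x : Finset ℤ) : Set ℤ := {l | ∃ a ∈ x, Equivalent m a l}

theorem smul_mem_orbitsOf {m : ℕ} {x : Finset ℤ} (γ : G m) (i : ℤ) :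
    γ • i ∈ orbitsOf m x ↔ i ∈ orbitsOf m x := by
  simp only [orbitsOf, Set.mem_ofPred_eq, equivalent_smul_right_iff]

theorem mem_orbitsOf_iff {m k : ℕ} (hm : 1 < m) (x : IdemState m k) {i : ℤ}
    (hi : i ∈ Finset.Icc (1 : ℤ) (m - 1)) : i ∈ orbitsOf m x.carrier ↔ i ∈ x.carrier := by
  constructor
  · rintro ⟨a, ha, h⟩
    rwa [← eq_of_equivalent_of_mem hm h (x.subset ha) hi]
  · intro h
    exact ⟨i, h, Equivalent.refl' i⟩

theorem ncard_orb_orbitsOf {m k : ℕ} (hm : 1 < m) (x : IdemState m k) :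
    (orb m '' orbitsOf m x.carrier).ncard = k := by
  have : orb m '' orbitsOf m x.carrier = orb m '' (x.carrier : Set ℤ) := by
    ext c
    constructor
    · rintro ⟨i, ⟨a, ha, h⟩, rfl⟩
      exact ⟨a, ha, orb_eq_iff.2 h⟩
    · rintro ⟨i, hi, rfl⟩
      exact ⟨i, ⟨i, hi, Equivalent.refl' i⟩, rfl⟩
  rw [this, Set.InjOn.ncard_image, Set.ncard_coe_finset, x.card]
  intro a ha b hb hab
  exact eq_of_equivalent_of_mem hm (orb_eq_iff.1 hab) (x.subset ha) (x.subset hb)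

namespace LPP

variable {m k : ℕ}

/-- The identity of the orbits of an idempotent state. -/
def idState (hm : 1 < m) (x : IdemState m k) : LPP m k :=
  idOn (orbitsOf m x.carrier) smul_mem_orbitsOf (ncard_orb_orbitsOf hm x)

theorem dom_idState (hm : 1 < m) (x : IdemState m k) :
    (idState hm x).dom = orbitsOf m x.carrier := dom_idOn ..

theorem val_idState (hm : 1 < m) (x : IdemState m k) {i : ℤ} (hi : i ∈ orbitsOf m x.carrier) :
    (idState hm x).val i = i := val_idOn _ _ _ hi

theorem ran_idState (hm : 1 < m) (x : IdemState m k) :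
    (idState hm x).ran = orbitsOf m x.carrier := by
  ext a
  rw [mem_ran_iff, dom_idState]
  constructor
  · rintro ⟨i, hi, rfl⟩; rwa [val_idState hm x hi]
  · intro ha; exact ⟨a, ha, val_idState hm x ha⟩

/-- Prolonging a strand by a full turn adds one strand that passes `g - 1/2` from the left. -/
theorem exists_up_wind_eq (hm : 1 < m) {b : LPP m k} {i : ℤ} (hi : i ∈ b.dom) (hle : i ≤ b.val i)
    (g : ℤ) : ∃ n : ℤ, i + n * period m ∉ b.up g ∧ b.val i + n * period m < g ∧
      g ≤ b.val i + n * period m + period m ∧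
      (b.wind (b.val i) 1).up g = insert (i + n * period m) (b.up g) := by
  have hp := period_pos hm
  set q := (g - 1 - b.val i) / period m
  have h1 := Int.emod_add_mul_ediv (g - 1 - b.val i) (period m)
  have h2 := Int.emod_nonneg (g - 1 - b.val i) hp.ne'
  have h3 := Int.emod_lt_of_pos (g - 1 - b.val i) hp
  have h4 : period m * q = q * period m := mul_comm _ _
  have hs : i + q * period m ∈ b.dom := (b.add_mem_dom _ _).2 hi
  have hbs : b.val (i + q * period m) = b.val i + q * period m := val_add ..
  have hnot : i + q * period m ∉ b.up g := by
    rintro ⟨-, -, h⟩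
    rw [hbs] at h
    linarith
  refine ⟨q, hnot, by linarith, by linarith, ?_⟩
  ext l
  rw [Set.mem_insert_iff, mem_up, mem_up, dom_wind]
  by_cases hl : l ∈ b.dom
  · rw [val_wind _ _ _ hl]
    rcases b.wind_cases hi hl with ⟨n, rfl, e2, e3⟩ | ⟨n, rfl, e2, e3⟩ | ⟨e3, hne⟩
    · rw [e3, e2]
      constructor
      · rintro ⟨-, h5, h6⟩
        rcases le_or_gt g (b.val i + n * period m) with h7 | h7
        · exact Or.inr ⟨hl, h5, h7⟩
        · left
          have : n = q := by
            have a1 : n < q + 1 := by by_contra hc; nlinarith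
            have a2 : q < n + 1 := by by_contra hc; nlinarith
            omega
          rw [this]
      · rintro (h5 | ⟨-, h5, h6⟩)
        · have hn : n * period m = q * period m := by linarith
          rw [hn]
          exact ⟨hs, by linarith, by linarith⟩
        · exact ⟨hl, h5, by linarith⟩
    · rw [e3, e2]
      constructor
      · rintro ⟨-, h5, h6⟩; linarith
      · rintro (h5 | ⟨-, h5, h6⟩)
        · have h8 : 2 * i = 1 + 2 * ((n - q) * (m - 1)) := by
            have : period m = 2 * m - 2 := rfl
            rw [this] at h5
            linear_combination -h5
          omega
        · linarith
    · rw [e3]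
      refine ⟨fun h => Or.inr h, ?_⟩
      rintro (rfl | h)
      · exact absurd (equivalent_add m i q) hne
      · exact h
  · simp only [hl, false_and, or_false, false_iff]
    rintro rfl
    exact hl hs

theorem up_wind (hm : 1 < m) {b : LPP m k} {i : ℤ} (hi : i ∈ b.dom) (hle : i ≤ b.val i) (g : ℤ) :
    ((b.wind (b.val i) 1).up g).ncard = (b.up g).ncard + 1 := by
  obtain ⟨n, hn, -, -, h⟩ := exists_up_wind_eq hm hi hle g
  rw [h, Set.ncard_insert_of_notMem hn (b.finite_up hm g)]

/-- A full turn passes each half-integer once more in each direction. This is why `X` has weight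
`(1, …, 1)`. -/
theorem mult_wind (hm : 1 < m) {b : LPP m k} {i : ℤ} (hi : i ∈ b.dom) (hle : i ≤ b.val i) (g : ℤ) :
    (b.wind (b.val i) 1).mult g = b.mult g + 1 := by
  rw [mult_eq hm, mult_eq hm, up_wind hm hi hle, up_wind hm hi hle]
  push_cast; ring

/-- The generators of the summand `I_x · Q(w) · I_y` of `Q`. -/
def gens (x y : Finset ℤ) (w : Fin m → ℚ) : Set (LPP m k) :=
  {f | f.dom = orbitsOf m y ∧ f.ran = orbitsOf m x ∧ f.weight = w}

theorem Cov.mem_gens (hm : 1 < m) {f h : LPP m k} (H : f.Cov h) {x y : Finset ℤ} {w : Fin m → ℚ}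
    (hf : f ∈ gens x y w) : h ∈ gens x y w := by
  obtain ⟨i, j, hc, rfl⟩ := H
  exact ⟨by rw [dom_swap, hf.1], by rw [ran_swap f hc.1.not_equivalent, hf.2.1],
    by rw [weight_swap hm hc.1, hf.2.2]⟩

theorem Ext.mem_gens (hm : 1 < m) {f h : LPP m k} (H : f.Ext h) {x y : Finset ℤ} {w : Fin m → ℚ}
    (hf : f ∈ gens x y (w - 1)) : h ∈ gens x y w := by
  obtain ⟨i, hi, hle, -, rfl⟩ := H
  refine ⟨by rw [dom_wind, hf.1], by rw [ran_wind, hf.2.1], funext fun ix => ?_⟩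
  have := congrFun hf.2.2 ix
  rw [Pi.sub_apply, Pi.one_apply] at this
  change mult _ _ = _
  rw [mult_wind hm hi hle]
  change f.weight ix + 1 = _
  rw [this]; ring

end LPP

/-! ### The complex `Q'(x, y; w)` -/

namespace Pong

variable {m k : ℕ}

theorem idem_eq_pure (hm : 1 < m) (x : IdemState m k) :
    idem m k x.carrier = pure (LPP.idState hm x) := by
  have hp : ∀ f : LPP m k, (∀ l ∈ Finset.Icc (1 : ℤ) (m - 1),
      f.toFun l = if l ∈ x.carrier then some l else none) ↔ f = LPP.idState hm x := by
    intro f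
    have h1 : ∀ l ∈ Finset.Icc (1 : ℤ) (m - 1),
        (LPP.idState hm x).toFun l = if l ∈ x.carrier then some l else none := by
      intro l hl
      split_ifs with h
      · rw [← mem_orbitsOf_iff hm x hl] at h
        exact LPP.toFun_eq_some.2 ⟨by rwa [LPP.dom_idState], LPP.val_idState hm x h⟩
      · rw [← mem_orbitsOf_iff hm x hl, ← LPP.dom_idState hm x, LPP.mem_dom_iff, not_not] at h
        exact h
    constructor
    · intro h
      exact LPP.eq_of_dom_eq hm fun l hl => (h l hl).trans (h1 l hl).symm
    · rintro rfl
      exact h1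
  have hfin : {f : LPP m k | f = LPP.idState hm x}.Finite := Set.finite_singleton _
  rw [idem]
  simp only [hp]
  rw [sumOf_eq hfin]
  simp

open Classical in
theorem mulPure_idState_left (hm : 1 < m) (x : IdemState m k) (f : LPP m k) :
    mulPure (LPP.idState hm x) f = if f.ran = orbitsOf m x.carrier then pure f else 0 := by
  split_ifs with h
  · have hd : (LPP.idState hm x).dom = f.ran := by rw [LPP.dom_idState, h]
    have hv : ∀ l ∈ f.dom, (LPP.idState hm x).val (f.val l) = f.val l := fun l hl =>
      LPP.val_idState hm x (h ▸ LPP.val_mem_ran hl)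
    have hc : (LPP.idState hm x).comp f hd = f := LPP.ext_val (LPP.dom_comp ..) fun l hl => by
      rw [LPP.dom_comp] at hl
      rw [LPP.val_comp _ _ _ hl, hv l hl]
    have h1 : ((LPP.idState hm x).comp f hd).cross = (LPP.idState hm x).cross + f.cross := by
      rw [LPP.cross_comp_eq_iff hm hd]
      intro a ha b hb hab hf
      rwa [hv a ha, hv b hb]
    have h2 : f.weight + (LPP.idState hm x).weight - ((LPP.idState hm x).comp f hd).weight = 0 := by
      funext i
      change f.mult _ + (LPP.idState hm x).mult _ - ((LPP.idState hm x).comp f hd).mult _ = 0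
      rw [LPP.mult_comp_of_monotone hm hd, sub_self]
      intro l hl
      rw [hv l hl]
      omega
    rw [mulPure, dif_pos hd, if_pos h1, h2, vMonomial, hc]
    simp
  · exact mulPure_of_ne fun hd => h (by rw [← hd, LPP.dom_idState])

open Classical in
theorem mulPure_idState_right (hm : 1 < m) (x : IdemState m k) (f : LPP m k) :
    mulPure f (LPP.idState hm x) = if f.dom = orbitsOf m x.carrier then pure f else 0 := by
  split_ifs with h
  · have hd : f.dom = (LPP.idState hm x).ran := by rw [LPP.ran_idState, h]
    have hv : ∀ l ∈ (LPP.idState hm x).dom, (LPP.idState hm x).val l = l := fun l hl =>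
      LPP.val_idState hm x (by rwa [LPP.dom_idState] at hl)
    have hc : f.comp (LPP.idState hm x) hd = f :=
      LPP.ext_val (by rw [LPP.dom_comp, LPP.dom_idState, h]) fun l hl => by
        rw [LPP.dom_comp] at hl
        rw [LPP.val_comp _ _ _ hl, hv l hl]
    have h1 : (f.comp (LPP.idState hm x) hd).cross = f.cross + (LPP.idState hm x).cross := by
      rw [LPP.cross_comp_eq_iff hm hd]
      intro a ha b hb hab hf
      rw [hv a ha, hv b hb] at hf
      omega
    have h2 : (LPP.idState hm x).weight + f.weight - (f.comp (LPP.idState hm x) hd).weight = 0 := by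
      funext i
      change (LPP.idState hm x).mult _ + f.mult _ - (f.comp (LPP.idState hm x) hd).mult _ = 0
      rw [LPP.mult_comp_of_monotone hm hd, sub_self]
      intro l hl
      rw [hv l hl]
      omega
    rw [mulPure, dif_pos hd, if_pos h1, h2, vMonomial, hc]
    simp
  · exact mulPure_of_ne fun hd => h (by rw [hd, LPP.ran_idState])

end Pong

namespace Quo

variable {m k : ℕ}

/-- The map `c ↦ I_x · c · I_y` from `Q` to itself. -/
def sandwich (m k : ℕ) (x y : Finset ℤ) : Quo m k →ₗ[ZMod 2] Quo m k :=
  (mul.flip (idem m k y) ∘ₗ mul (idem m k x)).restrictScalars (ZMod 2)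

open Classical in
theorem sandwich_pure (hm : 1 < m) (x y : IdemState m k) (f : LPP m k) :
    sandwich m k x.carrier y.carrier (pure f) =
      if f.dom = orbitsOf m y.carrier ∧ f.ran = orbitsOf m x.carrier then pure f else 0 := by
  have h1 : mul (idem m k x.carrier) (pure f) =
      if f.ran = orbitsOf m x.carrier then pure f else 0 := by
    rw [idem, pure, mul_proj, Pong.idem_eq_pure hm, Pong.mul_pure, Pong.mulPure_idState_left]
    split_ifs <;> simp
  have h2 : mul (pure f) (idem m k y.carrier) =
      if f.dom = orbitsOf m y.carrier then pure f else 0 := by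
    rw [idem, pure, mul_proj, Pong.idem_eq_pure hm, Pong.mul_pure, Pong.mulPure_idState_right]
    split_ifs <;> simp
  change mul (mul (idem m k x.carrier) (pure f)) (idem m k y.carrier) = _
  rw [h1]
  by_cases h : f.ran = orbitsOf m x.carrier
  · rw [if_pos h, h2]
    simp [h]
  · simp [h]

theorem weightPart_eq_span (w : Fin m → ℚ) :
    weightPart m k w = Submodule.span (ZMod 2) (pure '' {f : LPP m k | f.weight = w}) := by
  rw [weightPart, Pong.weightPart, Submodule.map_span]
  apply le_antisymm
  · rw [Submodule.span_le]
    rintro _ ⟨_, ⟨n, f, hn, rfl⟩, rfl⟩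
    by_cases h : n = 0
    · subst h
      refine Submodule.subset_span ⟨f, funext fun i => by simpa using hn i, ?_⟩
      change _ = proj m k _
      rw [MvPolynomial.monomial_zero', map_one, one_smul, pure]
    · have : ((proj m k).restrictScalars (ZMod 2))
          (MvPolynomial.monomial n (1 : ZMod 2) • Pong.pure f) = 0 := by
        apply coeff_injective
        change Pong.const m k _ = _
        rw [LinearMap.map_smulₛₗ, MvPolynomial.constantCoeff_monomial, if_neg h, zero_smul, map_zero]
      rw [this]
      exact zero_mem _
  · rw [Submodule.span_le]
    rintro _ ⟨f, rfl, rfl⟩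
    refine Submodule.subset_span ⟨_, ⟨0, f, fun i => by simp, rfl⟩, ?_⟩
    change proj m k _ = _
    rw [MvPolynomial.monomial_zero', map_one, one_smul, pure]

theorem map_sandwich_weightPart (hm : 1 < m) (x y : IdemState m k) (w : Fin m → ℚ) :
    (weightPart m k w).map (sandwich m k x.carrier y.carrier) =
      Submodule.span (ZMod 2) (pure '' (LPP.gens x.carrier y.carrier w : Set (LPP m k))) := by
  classical
  rw [weightPart_eq_span, Submodule.map_span]
  apply le_antisymm
  · rw [Submodule.span_le]
    rintro _ ⟨_, ⟨f, hf, rfl⟩, rfl⟩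
    rw [sandwich_pure hm]
    split_ifs with h
    · exact Submodule.subset_span ⟨f, ⟨h.1, h.2, hf⟩, rfl⟩
    · exact zero_mem _
  · rw [Submodule.span_le]
    rintro _ ⟨f, ⟨h1, h2, h3⟩, rfl⟩
    exact Submodule.subset_span ⟨_, ⟨f, h3, rfl⟩, by rw [sandwich_pure hm, if_pos ⟨h1, h2⟩]⟩

end Quo

namespace QuoX

variable {m k : ℕ}

/-- The pairs of generators related by the differential of `Q'`; here `Sum.inl f` stands for `f` and
`Sum.inr b` for `X b`. -/
def Rel : LPP m k ⊕ LPP m k → LPP m k ⊕ LPP m k → Prop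
  | Sum.inl f, Sum.inl h => f.Cov h
  | Sum.inl _, Sum.inr _ => False
  | Sum.inr b, Sum.inl h => b.Ext h
  | Sum.inr b, Sum.inr h => b.Cov h

theorem finite_rel (hm : 1 < m) (s : LPP m k ⊕ LPP m k) : {t | Rel s t}.Finite := by
  rcases s with f | b
  · refine ((f.finite_cov hm).image Sum.inl).subset ?_
    rintro (h | h) H
    · exact ⟨h, H, rfl⟩
    · exact H.elim
  · refine (((b.finite_ext hm).image Sum.inl).union ((b.finite_cov hm).image Sum.inr)).subset ?_
    rintro (h | h) H
    · exact Or.inl ⟨h, H, rfl⟩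
    · exact Or.inr ⟨h, H, rfl⟩

/-- The element of `Q'` given by a generator. -/
def pure : LPP m k ⊕ LPP m k → QuoX m k
  | Sum.inl f => (Quo.pure f, 0)
  | Sum.inr b => (0, Quo.pure b)

/-- The coefficients of an element of `Q'`. -/
def coeff (m k : ℕ) : QuoX m k →ₗ[ZMod 2] (LPP m k ⊕ LPP m k →₀ ZMod 2) :=
  (Finsupp.sumFinsuppLEquivProdFinsupp (ZMod 2)).symm.toLinearMap ∘ₗ
    (Quo.coeff m k).prodMap (Quo.coeff m k)

theorem coeff_inl (z : QuoX m k) (f : LPP m k) : coeff m k z (Sum.inl f) = Quo.coeff m k z.1 f := rfl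

theorem coeff_inr (z : QuoX m k) (f : LPP m k) : coeff m k z (Sum.inr f) = Quo.coeff m k z.2 f := rfl

theorem coeff_injective : Function.Injective (coeff m k) := by
  intro a b h
  refine Prod.ext (Quo.coeff_injective ?_) (Quo.coeff_injective ?_)
  · ext f; rw [← coeff_inl, h, coeff_inl]
  · ext f; rw [← coeff_inr, h, coeff_inr]

theorem coeff_pure (s : LPP m k ⊕ LPP m k) : coeff m k (pure s) = Finsupp.single s 1 := by
  classical
  rcases s with f | b <;> ext (h | h) <;>
    simp [coeff_inl, coeff_inr, pure, Quo.coeff_pure, Finsupp.single_apply]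

theorem coeff_d_pure (hm : 1 < m) (s : LPP m k ⊕ LPP m k) :
    coeff m k (d m k (pure s)) = relOp Rel (Finsupp.single s 1) := by
  classical
  ext t
  rw [relOp_single_apply (finite_rel hm s)]
  rcases s with f | b
  · have h1 : d m k (pure (Sum.inl f)) = (Quo.d (Quo.pure f), 0) := by
      simp [d, pure]
    rw [h1]
    rcases t with h | h
    · rw [coeff_inl, Quo.coeff_d_pure hm, relOp_single_apply (f.finite_cov hm)]
      rfl
    · rw [coeff_inr, map_zero]
      exact (if_neg id).symm
  · have h1 : d m k (pure (Sum.inr b)) =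
        (Quo.mul (Quo.Omega m k) (Quo.pure b), Quo.d (Quo.pure b)) := by
      simp [d, pure]
    rw [h1]
    rcases t with h | h
    · rw [coeff_inl, Quo.coeff_Omega_mul_pure hm, relOp_single_apply (b.finite_ext hm)]
      rfl
    · rw [coeff_inr, Quo.coeff_d_pure hm, relOp_single_apply (b.finite_cov hm)]
      rfl

/-- The generators of `Q'(x, y; w)`. -/
def gens (x y : Finset ℤ) (w : Fin m → ℚ) : Set (LPP m k ⊕ LPP m k) :=
  Sum.inl '' LPP.gens x y w ∪ Sum.inr '' LPP.gens x y (w - 1)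

theorem Rel.mem_gens (hm : 1 < m) {s t : LPP m k ⊕ LPP m k} (H : Rel s t) {x y : Finset ℤ}
    {w : Fin m → ℚ} (hs : s ∈ gens x y w) : t ∈ gens x y w := by
  rcases hs with ⟨f, hf, rfl⟩ | ⟨b, hb, rfl⟩ <;> rcases t with h | h
  · exact Or.inl ⟨h, LPP.Cov.mem_gens hm H hf, rfl⟩
  · exact H.elim
  · exact Or.inl ⟨h, LPP.Ext.mem_gens hm H hb, rfl⟩
  · exact Or.inr ⟨h, LPP.Cov.mem_gens hm H hb, rfl⟩

theorem part_eq_span (hm : 1 < m) (x y : IdemState m k) (w : Fin m → ℚ) :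
    part m k x.carrier y.carrier w =
      Submodule.span (ZMod 2) (pure '' (gens x.carrier y.carrier w : Set (LPP m k ⊕ LPP m k))) := by
  have h1 : part m k x.carrier y.carrier w =
      ((Quo.weightPart m k w).map (Quo.sandwich m k x.carrier y.carrier)).prod
        ((Quo.weightPart m k (w - 1)).map (Quo.sandwich m k x.carrier y.carrier)) := by
    ext ⟨a, b⟩
    constructor
    · rintro ⟨⟨a', b'⟩, ⟨ha, hb⟩, h⟩
      obtain ⟨rfl, rfl⟩ := Prod.ext_iff.1 h
      exact ⟨⟨a', ha, rfl⟩, ⟨b', hb, rfl⟩⟩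
    · rintro ⟨⟨a', ha, h⟩, ⟨b', hb, h'⟩⟩
      exact ⟨(a', b'), ⟨ha, hb⟩, Prod.ext h h'⟩
  rw [h1, Quo.map_sandwich_weightPart hm, Quo.map_sandwich_weightPart hm,
    ← LinearMap.span_inl_union_inr, gens, Set.image_union, Set.image_image, Set.image_image,
    Set.image_image, Set.image_image]
  rfl

end QuoX

/-! ### Homology of a finite complex with a basis -/

/-- Rank and nullity in coordinates: the cycles have dimension `card ι - rank D`, and the
boundaries, which are cycles because `D` squares to zero, have dimension `rank D`. -/
theorem finrank_homology_add {ι M : Type*} [Fintype ι] [AddCommGroup M] [Module (ZMod 2) M]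
    (d : M →ₗ[ZMod 2] M) (P : Submodule (ZMod 2) M) (ψ : (ι →₀ ZMod 2) →ₗ[ZMod 2] M)
    (hψ : Function.Injective ψ) (hP : LinearMap.range ψ = P)
    (D : (ι →₀ ZMod 2) →ₗ[ZMod 2] (ι →₀ ZMod 2)) (hd : ∀ v, d (ψ v) = ψ (D v))
    (hD : ∀ v, D (D v) = 0) :
    Module.Finite (ZMod 2) (↥(P ⊓ LinearMap.ker d) ⧸
      (P.map d).submoduleOf (P ⊓ LinearMap.ker d)) ∧
    Module.finrank (ZMod 2) (↥(P ⊓ LinearMap.ker d) ⧸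
      (P.map d).submoduleOf (P ⊓ LinearMap.ker d)) + 2 * Module.finrank (ZMod 2) (LinearMap.range D)
      = Fintype.card ι := by
  have hZ : P ⊓ LinearMap.ker d = (LinearMap.ker D).map ψ := by
    subst hP
    ext z
    constructor
    · rintro ⟨⟨v, rfl⟩, hz⟩
      refine ⟨v, ?_, rfl⟩
      apply hψ
      rw [← hd, map_zero]
      exact hz
    · rintro ⟨v, hv, rfl⟩
      refine ⟨⟨v, rfl⟩, ?_⟩
      change d (ψ v) = 0
      rw [hd, LinearMap.mem_ker.1 hv, map_zero]
  have hB : P.map d = (LinearMap.range D).map ψ := by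
    subst hP
    ext z
    constructor
    · rintro ⟨_, ⟨v, rfl⟩, rfl⟩
      exact ⟨D v, ⟨v, rfl⟩, (hd v).symm⟩
    · rintro ⟨_, ⟨v, rfl⟩, rfl⟩
      exact ⟨ψ v, ⟨v, rfl⟩, hd v⟩
  have hle : P.map d ≤ P ⊓ LinearMap.ker d := by
    rw [hZ, hB]
    refine Submodule.map_mono ?_
    rintro _ ⟨v, rfl⟩
    exact hD v
  have e1 := LinearEquiv.finrank_eq (Submodule.equivMapOfInjective ψ hψ (LinearMap.ker D))
  have e2 := LinearEquiv.finrank_eq (Submodule.equivMapOfInjective ψ hψ (LinearMap.range D))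
  have e3 := LinearEquiv.finrank_eq (Submodule.submoduleOfEquivOfLe hle)
  have hfin : Module.Finite (ZMod 2) ↥(P ⊓ LinearMap.ker d) := by rw [hZ]; infer_instance
  refine ⟨inferInstance, ?_⟩
  have e4 := Submodule.finrank_quotient_add_finrank ((P.map d).submoduleOf (P ⊓ LinearMap.ker d))
  have e5 := LinearMap.finrank_range_add_finrank_ker D
  rw [Module.finrank_finsupp_self] at e5
  rw [e3] at e4
  have e6 : Module.finrank (ZMod 2) ↥(P ⊓ LinearMap.ker d) =
    Module.finrank (ZMod 2) (LinearMap.ker D) := by rw [hZ, e1]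
  have e7 : Module.finrank (ZMod 2) ↥(P.map d) =
    Module.finrank (ZMod 2) (LinearMap.range D) := by rw [hB, e2]
  omega

/-- In a vanishing combination of the vectors `D s`, take an index `s` with nonzero coefficient and
minimal `κ s`. At the coordinate `μ s` triangularity kills every other term. So these vectors are
independent. -/
theorem card_le_finrank_range {ι α : Type*} [Fintype ι] [LinearOrder α]
    (D : (ι →₀ ZMod 2) →ₗ[ZMod 2] (ι →₀ ZMod 2)) (S : Finset ι) (μ : ι → ι) (κ : ι → α)
    (h1 : ∀ s ∈ S, D (Finsupp.single s 1) (μ s) ≠ 0)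
    (h2 : ∀ s ∈ S, ∀ s' ∈ S, D (Finsupp.single s 1) (μ s') ≠ 0 → s = s' ∨ κ s < κ s') :
    S.card ≤ Module.finrank (ZMod 2) (LinearMap.range D) := by
  have hli : LinearIndependent (ZMod 2) (fun s : S => LinearMap.rangeRestrict D
      (Finsupp.single (s : ι) 1)) := by
    rw [linearIndependent_iff']
    intro T c hc i hi
    by_contra hne
    obtain ⟨s, hs, hmin⟩ := Finset.exists_min_image (T.filter fun s => c s ≠ 0) (fun s => κ s)
      ⟨i, Finset.mem_filter.2 ⟨hi, hne⟩⟩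
    rw [Finset.mem_filter] at hs
    have h3 := congrArg (fun v : LinearMap.range D => (v : ι →₀ ZMod 2) (μ s)) hc
    simp only [Submodule.coe_sum, Submodule.coe_smul, LinearMap.codRestrict_apply,
      LinearMap.rangeRestrict, Finsupp.finsetSum_apply, Finsupp.smul_apply, smul_eq_mul, Submodule.coe_zero,
      Finsupp.zero_apply] at h3
    rw [Finset.sum_eq_single s] at h3
    · exact (mul_ne_zero hs.2 (h1 s s.2)) h3
    · intro b hb hbs
      by_contra hcon
      rcases h2 b b.2 s s.2 (right_ne_zero_of_mul hcon) with h | h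
      · exact hbs (Subtype.ext h)
      · exact absurd h (hmin b (Finset.mem_filter.2 ⟨hb, left_ne_zero_of_mul hcon⟩)).not_gt
    · intro h; exact absurd hs.1 h
  have := hli.fintype_card_le_finrank
  simpa using this

/-! ### Finiteness of the sets of generators -/

namespace LPP

variable {m k : ℕ}

/-- If the strand from `l` were longer, it and its `B` translates by successive periods to the left
would all pass `l + 1/2`. -/
theorem val_lt_of_mult_le (hm : 1 < m) {f : LPP m k} {B : ℕ} (hB : ∀ g, 2 * f.mult g ≤ B) {l : ℤ}
    (hl : l ∈ f.dom) : f.val l < l + (B + 1) * period m := by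
  have hp := period_pos hm
  by_contra hcon
  have hsub : (fun t : ℕ => l + (-(t : ℤ)) * period m) '' (Finset.range (B + 1) : Set ℕ) ⊆
      f.up (l + 1) := by
    rintro _ ⟨t, ht, rfl⟩
    have ht' : (t : ℤ) ≤ B := by
      have := Finset.mem_range.1 (Finset.mem_coe.1 ht); omega
    have h1 : (t : ℤ) * period m ≤ B * period m := mul_le_mul_of_nonneg_right ht' hp.le
    have h2 : (0 : ℤ) ≤ t * period m := by positivity
    refine ⟨(f.add_mem_dom _ _).2 hl, ?_, ?_⟩
    · change l + -(t : ℤ) * period m < l + 1; linarith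
    · change l + 1 ≤ f.val (l + -(t : ℤ) * period m); rw [val_add]; linarith
  have h1 := Set.ncard_le_ncard hsub (f.finite_up hm _)
  rw [Set.ncard_image_of_injective _ (fun a b h => by
    have h : l + -(a : ℤ) * period m = l + -(b : ℤ) * period m := h
    have : (a : ℤ) * period m = b * period m := by linarith
    exact_mod_cast mul_right_cancel₀ hp.ne' this), Set.ncard_coe_finset, Finset.card_range] at h1
  have h2 := hB (l + 1)
  rw [mult_eq hm] at h2
  have h3 : ((B + 1 : ℕ) : ℚ) ≤ (f.up (l + 1)).ncard := by exact_mod_cast h1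
  have h4 : (0 : ℚ) ≤ (f.up (2 - (l + 1))).ncard := by positivity
  push_cast at h3
  linarith

/-- A fixed weight bounds the displacement in both directions, by the mirror, and a map is
determined by its values on representatives. -/
theorem finite_gens (hm : 1 < m) (x y : Finset ℤ) (w : Fin m → ℚ) :
    (gens x y w : Set (LPP m k)).Finite := by
  obtain ⟨B, hB⟩ : ∃ B : ℕ, ∀ i, 2 * w i ≤ B := by
    refine ⟨∑ i, ⌈2 * w i⌉₊, fun i => (Nat.le_ceil _).trans ?_⟩
    exact_mod_cast Finset.single_le_sum (f := fun i => ⌈2 * w i⌉₊) (fun _ _ => Nat.zero_le _)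
      (Finset.mem_univ i)
  set C : ℤ := m + (B + 1) * period m
  set T : Set (Option ℤ) := insert none (some '' Set.Icc (-C) C)
  have hT : T.Finite := ((Set.finite_Icc _ _).image _).insert _
  refine Set.Finite.of_finite_image (f := fun (f : LPP m k) (i : Fin m) => f.toFun (i : ℕ))
    ((Set.Finite.pi' fun _ => hT).subset ?_) ?_
  · rintro _ ⟨f, ⟨-, -, rfl⟩, rfl⟩ i
    by_cases hi : ((i : ℕ) : ℤ) ∈ f.dom
    · right
      refine ⟨_, ?_, (toFun_eq hi).symm⟩
      have hB' : ∀ g, 2 * f.mult g ≤ B := fun g => by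
        obtain ⟨ix, hix⟩ := exists_mult_eq_weight hm g
        rw [hix]; exact hB ix
      have h1 := f.val_lt_of_mult_le hm hB' hi
      have h2 := f.val_lt_of_mult_le hm hB' ((f.mirror_mem_dom _).2 hi)
      rw [val_mirror] at h2
      have h3 : ((i : ℕ) : ℤ) < m := by exact_mod_cast i.2
      have h4 : (0 : ℤ) ≤ (i : ℕ) := by positivity
      constructor <;> simp only [C] <;> linarith
    · left
      rw [mem_dom_iff, not_not] at hi
      exact hi
  · intro f _ g _ hfg
    refine eq_of_dom_eq hm fun i hi => ?_
    rw [Finset.mem_Icc] at hi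
    have := congrFun hfg ⟨i.toNat, by omega⟩
    simpa only [Int.toNat_of_nonneg (show 0 ≤ i by omega)] using this

end LPP

/-! ### The homology from a triangular matching of generators -/

namespace QuoX

variable {m k : ℕ}

theorem finite_gens (hm : 1 < m) (x y : Finset ℤ) (w : Fin m → ℚ) :
    (gens x y w : Set (LPP m k ⊕ LPP m k)).Finite :=
  ((LPP.finite_gens hm x y w).image _).union ((LPP.finite_gens hm x y _).image _)

/-- The differential of `Q'` squares to zero. -/
def SqZero (m k : ℕ) : Prop :=
  ∀ s u : LPP m k ⊕ LPP m k, (({t | Rel s t ∧ Rel t u}.ncard : ℕ) : ZMod 2) = 0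

/-- The type of generators of `Q'(x, y; w)`. -/
abbrev Gen (x y : Finset ℤ) (w : Fin m → ℚ) : Type := (gens x y w : Set (LPP m k ⊕ LPP m k))

theorem homology_aux (hm : 1 < m) (hsq : SqZero m k) (x y : IdemState m k) (w : Fin m → ℚ)
    [Fintype (Gen (k := k) x.carrier y.carrier w)] :
    Module.Finite (ZMod 2) (Homology m k x.carrier y.carrier w) ∧
    Module.finrank (ZMod 2) (Homology m k x.carrier y.carrier w) +
      2 * Module.finrank (ZMod 2) (LinearMap.range
        (relOp fun s t : Gen (k := k) x.carrier y.carrier w => Rel s.1 t.1)) =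
      Fintype.card (Gen (k := k) x.carrier y.carrier w) := by
  classical
  set R : Gen x.carrier y.carrier w → Gen x.carrier y.carrier w → Prop := fun s t => Rel s.1 t.1 with hR
  have hfin : ∀ s, {t | R s t}.Finite := fun s => Set.toFinite _
  set ψ : (Gen (k := k) x.carrier y.carrier w →₀ ZMod 2) →ₗ[ZMod 2] QuoX m k :=
    Finsupp.linearCombination (ZMod 2) fun s : Gen x.carrier y.carrier w => pure s.1 with hψ
  have hψ1 : ∀ s, ψ (Finsupp.single s 1) = pure s.1 := fun s => by
    rw [hψ, Finsupp.linearCombination_single, one_smul]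
  have hcψ : ∀ v, coeff m k (ψ v) = Finsupp.lmapDomain (ZMod 2) (ZMod 2) Subtype.val v := by
    intro v
    have : coeff m k ∘ₗ ψ = Finsupp.lmapDomain (ZMod 2) (ZMod 2) Subtype.val := by
      ext1 s
      ext1
      simp [hψ1, coeff_pure]
    exact LinearMap.congr_fun this v
  refine finrank_homology_add (d m k) (part m k x.carrier y.carrier w) ψ ?_ ?_ (relOp R) ?_ ?_
  · intro a b hab
    have := congrArg (coeff m k) hab
    rw [hcψ, hcψ] at this
    exact Finsupp.mapDomain_injective Subtype.val_injective this
  · rw [part_eq_span hm, hψ, Finsupp.range_linearCombination]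
    congr 1
    ext z
    constructor
    · rintro ⟨s, rfl⟩; exact ⟨s.1, s.2, rfl⟩
    · rintro ⟨s, hs, rfl⟩; exact ⟨⟨s, hs⟩, rfl⟩
  · intro v
    have : d m k ∘ₗ ψ = ψ ∘ₗ relOp R := by
      ext1 s
      ext1
      apply coeff_injective
      change coeff m k (d m k (ψ (Finsupp.single s 1))) =
        coeff m k (ψ (relOp R (Finsupp.single s 1)))
      rw [hψ1, coeff_d_pure hm, relOp_single (hfin s), map_sum, map_sum,
        relOp_single (finite_rel hm s.1)]
      simp only [hψ1, coeff_pure]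
      refine (Finset.sum_bij (fun t _ => t.1) ?_ ?_ ?_ ?_).symm
      · intro t ht; simpa using ht
      · intro a _ b _ h; exact Subtype.ext h
      · intro t ht
        have ht : Rel s.1 t := by simpa using ht
        exact ⟨⟨t, Rel.mem_gens hm ht s.2⟩, by simpa using ht, rfl⟩
      · intro t _; rfl
    exact LinearMap.congr_fun this v
  · intro v
    have : relOp R ∘ₗ relOp R = 0 := by
      ext1 s
      ext1
      ext u
      change relOp R (relOp R (Finsupp.single s 1)) u = 0
      rw [relOp_relOp_single hfin (hfin s), ← hsq s.1 u.1]
      congr 1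
      rw [← Set.ncard_image_of_injective _ Subtype.val_injective]
      congr 1
      ext t
      constructor
      · rintro ⟨t, ht, rfl⟩; exact ht
      · intro ht; exact ⟨⟨t, Rel.mem_gens hm ht.1 s.2⟩, ht, rfl⟩
    exact LinearMap.congr_fun this v

/-- A triangular matching of generators shows that the rank of the differential is large. -/
structure Matching (x y : Finset ℤ) (w : Fin m → ℚ) (S : Set (LPP m k ⊕ LPP m k))
    (μ : LPP m k ⊕ LPP m k → LPP m k ⊕ LPP m k) {α : Type*} [LinearOrder α]
    (κ : LPP m k ⊕ LPP m k → α) : Prop where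
  subset : S ⊆ gens x y w
  rel : ∀ s ∈ S, Rel s (μ s)
  notMem : ∀ s ∈ S, μ s ∉ S
  triangular : ∀ s ∈ S, ∀ s' ∈ S, Rel s (μ s') → s = s' ∨ κ s < κ s'

theorem Matching.injOn {x y : Finset ℤ} {w : Fin m → ℚ} {S : Set (LPP m k ⊕ LPP m k)}
    {μ : LPP m k ⊕ LPP m k → LPP m k ⊕ LPP m k} {α : Type*} [LinearOrder α]
    {κ : LPP m k ⊕ LPP m k → α} (h : Matching x y w S μ κ) : Set.InjOn μ S := by
  intro s hs s' hs' he
  rcases h.triangular s hs s' hs' (he ▸ h.rel s hs) with h1 | h1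
  · exact h1
  · rcases h.triangular s' hs' s hs (he.symm ▸ h.rel s' hs') with h2 | h2
    · exact h2.symm
    · exact absurd h1 h2.not_gt

theorem Matching.ncard_le (hm : 1 < m) {x y : IdemState m k} {w : Fin m → ℚ}
    {S : Set (LPP m k ⊕ LPP m k)} {μ : LPP m k ⊕ LPP m k → LPP m k ⊕ LPP m k} {α : Type*}
    [LinearOrder α] {κ : LPP m k ⊕ LPP m k → α} (h : Matching x.carrier y.carrier w S μ κ) :
    S.ncard ≤ Module.finrank (ZMod 2) (LinearMap.range
      (relOp fun s t : Gen (k := k) x.carrier y.carrier w => Rel s.1 t.1)) := by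
  classical
  have : Fintype (Gen (k := k) x.carrier y.carrier w) :=
    (finite_gens hm _ _ _).fintype
  set ι := Gen (k := k) x.carrier y.carrier w
  have hμ : ∀ s ∈ S, μ s ∈ gens x.carrier y.carrier w := fun s hs => Rel.mem_gens hm (h.rel s hs) (h.subset hs)
  have hfin : ∀ s : ι, {t : ι | Rel s.1 t.1}.Finite := fun s => Set.toFinite _
  have key := card_le_finrank_range (relOp fun s t : ι => Rel s.1 t.1)
    (Finset.univ.filter fun s : ι => s.1 ∈ S)
    (fun s => if hs : s.1 ∈ S then ⟨μ s.1, hμ _ hs⟩ else s) (fun s => κ s.1) ?_ ?_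
  · refine le_trans (le_of_eq ?_) key
    rw [← Set.ncard_coe_finset, ← Set.ncard_image_of_injective _ Subtype.val_injective]
    congr 1
    ext s
    constructor
    · intro hs; exact ⟨⟨s, h.subset hs⟩, Finset.mem_coe.2 (Finset.mem_filter.2 ⟨Finset.mem_univ _, hs⟩), rfl⟩
    · rintro ⟨s, hs, rfl⟩; exact (Finset.mem_filter.1 (Finset.mem_coe.1 hs)).2
  · intro s hs
    have hs : s.1 ∈ S := by simpa using hs
    rw [dif_pos hs, relOp_single_apply (hfin s), if_pos (h.rel _ hs)]
    exact one_ne_zero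
  · intro s hs s' hs' hne
    have hs : s.1 ∈ S := by simpa using hs
    have hs' : s'.1 ∈ S := by simpa using hs'
    rw [dif_pos hs', relOp_single_apply (hfin s)] at hne
    have hr : Rel s.1 (μ s'.1) := by by_contra hc; exact hne (if_neg hc)
    exact (h.triangular _ hs _ hs' hr).imp_left Subtype.ext

/-- There are at most `2 |S|` generators and the rank is at least `|S|`, so no dimension is left. -/
theorem subsingleton_of_matching (hm : 1 < m) (hsq : SqZero m k) {x y : IdemState m k}
    {w : Fin m → ℚ} {S : Set (LPP m k ⊕ LPP m k)} {μ : LPP m k ⊕ LPP m k → LPP m k ⊕ LPP m k}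
    {α : Type*} [LinearOrder α] {κ : LPP m k ⊕ LPP m k → α}
    (h : Matching x.carrier y.carrier w S μ κ)
    (hall : ∀ t ∈ gens x.carrier y.carrier w, t ∈ S ∨ ∃ s ∈ S, μ s = t) :
    Subsingleton (Homology m k x.carrier y.carrier w) := by
  classical
  have hfin := finite_gens (k := k) hm x.carrier y.carrier w
  have : Fintype (Gen (k := k) x.carrier y.carrier w) := hfin.fintype
  obtain ⟨hf, he⟩ := homology_aux hm hsq x y w
  have h1 := h.ncard_le hm
  have hS := hfin.subset h.subset
  have h2 : Fintype.card (Gen (k := k) x.carrier y.carrier w) ≤ 2 * S.ncard := by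
    rw [← Nat.card_eq_fintype_card, Nat.card_coe_set_eq]
    refine (Set.ncard_le_ncard (t := S ∪ μ '' S) (fun t ht => hall t ht)
      (hS.union (hS.image μ))).trans ((Set.ncard_union_le _ _).trans ?_)
    rw [h.injOn.ncard_image]; omega
  exact Module.finrank_zero_iff.1 (show Module.finrank (ZMod 2) _ = 0 by omega)

/-- With `2 |S| + 1` generators and rank at least `|S|`, the rank must equal `|S|` and one dimension
remains. No cycle has to be exhibited. -/
theorem nonempty_equiv_of_matching (hm : 1 < m) (hsq : SqZero m k) {x y : IdemState m k}
    {w : Fin m → ℚ} {S : Set (LPP m k ⊕ LPP m k)} {μ : LPP m k ⊕ LPP m k → LPP m k ⊕ LPP m k}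
    {α : Type*} [LinearOrder α] {κ : LPP m k ⊕ LPP m k → α}
    (h : Matching x.carrier y.carrier w S μ κ) {c : LPP m k ⊕ LPP m k}
    (hc : c ∈ gens x.carrier y.carrier w) (hcS : c ∉ S) (hcT : ∀ s ∈ S, μ s ≠ c)
    (hall : ∀ t ∈ gens x.carrier y.carrier w, t = c ∨ t ∈ S ∨ ∃ s ∈ S, μ s = t) :
    Nonempty (Homology m k x.carrier y.carrier w ≃ₗ[ZMod 2] ZMod 2) := by
  classical
  have hfin := finite_gens (k := k) hm x.carrier y.carrier w
  have : Fintype (Gen (k := k) x.carrier y.carrier w) := hfin.fintype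
  obtain ⟨hf, he⟩ := homology_aux hm hsq x y w
  have h1 := h.ncard_le hm
  have hS := hfin.subset h.subset
  have h2 : Fintype.card (Gen (k := k) x.carrier y.carrier w) =
      2 * S.ncard + 1 := by
    rw [← Nat.card_eq_fintype_card, Nat.card_coe_set_eq]
    have h3 : gens x.carrier y.carrier w = insert c (S ∪ μ '' S) := by
      refine Set.Subset.antisymm (fun t ht => hall t ht) (Set.insert_subset hc ?_)
      rintro t (ht | ⟨s, hs, rfl⟩)
      · exact h.subset ht
      · exact Rel.mem_gens hm (h.rel s hs) (h.subset hs)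
    have hdisj : Disjoint S (μ '' S) := by
      rw [Set.disjoint_left]
      rintro _ ht ⟨s, hs, rfl⟩
      exact h.notMem s hs ht
    have hcU : c ∉ S ∪ μ '' S := by
      rintro (h | ⟨s, hs, h⟩)
      · exact hcS h
      · exact hcT s hs h
    rw [h3, Set.ncard_insert_of_notMem hcU (hS.union (hS.image μ)),
      Set.ncard_union_eq hdisj hS (hS.image μ), h.injOn.ncard_image]
    omega
  have hge : Module.finrank (ZMod 2) (LinearMap.range
      (relOp fun s t : Gen (k := k) x.carrier y.carrier w => Rel s.1 t.1)) =
      S.ncard := by omega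
  have h4 : Module.finrank (ZMod 2) (Homology m k x.carrier y.carrier w) = 1 := by
    rw [hge] at he; omega
  exact ⟨LinearEquiv.ofFinrankEq _ _ (by rw [h4, Module.finrank_self])⟩

end QuoX

/-! ### The differential of `Q'` squares to zero -/

/-- A periodic set of integers can be enumerated in increasing order. -/
theorem exists_enumeration {N : ℤ} (hN : 0 < N) {P : Set ℤ} (hP : ∀ i, i + N ∈ P ↔ i ∈ P)
    (hne : P.Nonempty) : ∃ K : ℤ, 0 < K ∧ ∃ pos : ℤ → ℤ, StrictMono pos ∧ Set.range pos = P ∧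
      ∀ q, pos (q + K) = pos q + N := by
  classical
  have hP' : ∀ i, i - N ∈ P ↔ i ∈ P := fun i => by rw [← hP (i - N), sub_add_cancel]
  have : Nonempty P := hne.to_subtype
  have : NoMaxOrder P := ⟨fun a => ⟨⟨a + N, (hP a).2 a.2⟩, by
    change (a : ℤ) < a + N; omega⟩⟩
  have : NoMinOrder P := ⟨fun a => ⟨⟨a - N, (hP' a).2 a.2⟩, by
    change (a : ℤ) - N < a; omega⟩⟩
  let : SuccOrder P := LinearLocallyFiniteOrder.succOrder P
  let : PredOrder P := LinearLocallyFiniteOrder.predOrder P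
  let e : P ≃o ℤ := orderIsoIntOfLinearSuccPredArch
  let t : P ≃o P :=
    { toFun := fun a => ⟨a + N, (hP a).2 a.2⟩
      invFun := fun a => ⟨a - N, (hP' a).2 a.2⟩
      left_inv := fun a => Subtype.ext (by simp)
      right_inv := fun a => Subtype.ext (by simp)
      map_rel_iff' := by
        intro a b
        change (a : ℤ) + N ≤ b + N ↔ (a : ℤ) ≤ b
        omega }
  -- The shift by `N`, read in the index, is an order automorphism of `ℤ`, hence a translation; its
  -- length is the required `K`.
  let φ : ℤ ≃o ℤ := e.symm.trans (t.trans e)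
  have hsucc : ∀ q, φ (q + 1) = φ q + 1 := fun q => φ.map_succ q
  have hφ : ∀ q, φ q = q + φ 0 := by
    intro q
    induction q using Int.induction_on with
    | zero => simp
    | succ n ih => rw [hsucc, ih]; ring
    | pred n ih =>
      have := hsucc (-(n : ℤ) - 1)
      rw [sub_add_cancel, ih] at this
      linarith
  have ht : ∀ q, e.symm (φ q) = t (e.symm q) := fun q => by simp [φ]
  refine ⟨φ 0, ?_, fun q => (e.symm q : ℤ), fun a b h => e.symm.strictMono h, ?_, ?_⟩
  · have h1 : e.symm 0 < t (e.symm 0) := by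
      change (e.symm 0 : ℤ) < e.symm 0 + N; omega
    rw [← ht] at h1
    exact e.symm.lt_iff_lt.1 h1
  · ext i
    constructor
    · rintro ⟨q, rfl⟩; exact (e.symm q).2
    · intro hi; exact ⟨e ⟨i, hi⟩, by simp⟩
  · intro q
    change ((e.symm (q + φ 0) : P) : ℤ) = _
    rw [← hφ, ht]
    rfl

/-! ### Reduction from lifted partial permutations to affine permutations -/

namespace LPP

variable {m k : ℕ}

/-- An enumeration of representatives of the orbits that are contained in `Y`. -/
structure Enum (m : ℕ) (Y : Set ℤ) (K : ℤ) where
  pos : ℤ → ℤ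
  strictMono : StrictMono pos
  map_add : ∀ q, pos (q + K) = pos q + period m
  mem : ∀ q, pos q ∈ Y
  exists_pos : ∀ i ∈ Y, (∃ q, pos q = i) ∨ ∃ q, pos q = 1 - i
  not_mirror : ∀ q q', pos q ≠ 1 - pos q'

namespace Enum

variable {Y : Set ℤ} {K : ℤ} (P : Enum m Y K)

theorem map_add_mul (q n : ℤ) : P.pos (q + n * K) = P.pos q + n * period m := by
  induction n using Int.induction_on with
  | zero => simp
  | succ n ih =>
    rw [show q + ((n : ℤ) + 1) * K = q + n * K + K by ring, P.map_add, ih]; ring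
  | pred n ih =>
    have := P.map_add (q + (-(n : ℤ) - 1) * K)
    rw [show q + (-(n : ℤ) - 1) * K + K = q + -(n : ℤ) * K by ring, ih] at this
    linarith

theorem exists_eq_add {q q' : ℤ} (h : Equivalent m (P.pos q) (P.pos q')) : ∃ n, q' = q + n * K := by
  obtain ⟨n, h | h⟩ := equivalent_iff.1 h
  · exact ⟨n, P.strictMono.injective (by rw [h, P.map_add_mul])⟩
  · refine absurd h ?_
    rw [show 1 - P.pos q + n * period m = 1 - P.pos (q + -n * K) by rw [P.map_add_mul]; ring]
    exact P.not_mirror _ _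

theorem dvd_iff (q q' : ℤ) : K ∣ q' - q ↔ Equivalent m (P.pos q) (P.pos q') := by
  constructor
  · rintro ⟨n, hn⟩
    obtain rfl : q' = q + n * K := by linarith
    rw [P.map_add_mul]
    exact equivalent_add m _ n
  · intro h
    obtain ⟨n, rfl⟩ := P.exists_eq_add h
    exact ⟨n, by ring⟩

theorem swapOrbits_pos (s t q : ℤ) :
    swapOrbits m (P.pos s) (P.pos t) (P.pos q) = P.pos (Aff.tr K s t q) := by
  by_cases h1 : K ∣ q - s
  · obtain ⟨n, hn⟩ := h1
    obtain rfl : q = s + n * K := by linarith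
    rw [Aff.tr_left, P.map_add_mul, P.map_add_mul, swapOrbits_add, swapOrbits_self_left]
  · by_cases h2 : K ∣ q - t
    · have hst : ¬ K ∣ t - s := fun h => h1 (by
        have := dvd_add h2 h; rwa [sub_add_sub_cancel] at this)
      obtain ⟨n, hn⟩ := h2
      obtain rfl : q = t + n * K := by linarith
      rw [Aff.tr_right hst, P.map_add_mul, P.map_add_mul, swapOrbits_add, swapOrbits_self_right]
      rwa [← P.dvd_iff]
    · rw [Aff.tr_of_not h1 h2, swapOrbits_of_not (by rwa [← P.dvd_iff]) (by rwa [← P.dvd_iff])]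

/-- All strands that start at a chosen representative move to the right or are stationary. -/
def Adapted (f : LPP m k) : Prop := f.dom = Y ∧ ∀ q, P.pos q ≤ f.val (P.pos q)

variable {P}

theorem Adapted.exists_pos {f : LPP m k} (hf : P.Adapted f) {i : ℤ} (hi : i ∈ f.dom)
    (hlt : i < f.val i) : ∃ q, P.pos q = i := by
  rcases P.exists_pos i (hf.1 ▸ hi) with h | ⟨q, hq⟩
  · exact h
  · have := hf.2 q
    rw [hq, val_mirror] at this
    omega

theorem Adapted.of_cov {e h : LPP m k} (hh : P.Adapted h) (H : e.Cov h) : P.Adapted e := by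
  obtain ⟨i, j, ⟨⟨hi, hj, hij, hle, hlt⟩, -⟩, rfl⟩ := H
  refine ⟨by rw [← dom_swap e i j]; exact hh.1, fun q => ?_⟩
  have hq := hh.2 q
  rw [val_swap e hi hj] at hq
  rcases e.swapOrbits_displacement i j (P.pos q) with h | ⟨h1, h2, -⟩ | ⟨h1, h2, h3⟩
  · rwa [h] at hq
  · rw [h2] at hq; omega
  · rcases h3 with ⟨n, h3⟩ | ⟨n, h3⟩
    · rw [h3, val_add]; linarith
    · have h4 : e.val (P.pos q) = 1 - e.val i + n * period m := by rw [h3, val_add, val_mirror]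
      rw [h2] at hq
      omega

theorem Adapted.of_ext (hm : 1 < m) {e h : LPP m k} (hh : P.Adapted h) (H : e.Ext h) :
    P.Adapted e := by
  have hp := period_pos hm
  obtain ⟨i, hi, hle, -, rfl⟩ := H
  have hY : e.dom = Y := by rw [← dom_wind e (e.val i) 1]; exact hh.1
  refine ⟨hY, fun q => ?_⟩
  have hq := hh.2 q
  have hqd : P.pos q ∈ e.dom := hY ▸ P.mem q
  rw [val_wind _ _ _ hqd] at hq
  rcases e.wind_cases hi hqd with ⟨n, h1, h2, -⟩ | ⟨n, -, -, h⟩ | ⟨h, -⟩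
  · omega
  · omega
  · rwa [h] at hq

variable (P) in
/-- The affine map given by the values at the chosen representatives. -/
def toAff (f : LPP m k) (hf : f.dom = Y) : Aff K (period m) where
  toFun q := f.val (P.pos q)
  inj q q' h := P.strictMono.injective (f.val_inj (hf ▸ P.mem q) (hf ▸ P.mem q') h)
  map_add' q := by rw [P.map_add, val_add_period]

theorem toAff_apply {f : LPP m k} (hf : f.dom = Y) (q : ℤ) : P.toAff f hf q = f.val (P.pos q) := rfl

theorem eq_of_toAff_eq {f g : LPP m k} (hf : f.dom = Y) (hg : g.dom = Y)
    (h : P.toAff f hf = P.toAff g hg) : f = g := by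
  have hq : ∀ q, f.val (P.pos q) = g.val (P.pos q) := fun q => by
    rw [← toAff_apply hf, h, toAff_apply]
  refine ext_val (by rw [hf, hg]) fun i hi => ?_
  rcases P.exists_pos i (hf ▸ hi) with ⟨q, rfl⟩ | ⟨q, h⟩
  · exact hq q
  · have := hq q
    rw [h, val_mirror, val_mirror] at this
    omega

/-- A strand in the rectangle of a crossing of right-moving strands itself moves to the right, so it
occurs in the enumeration and no obstruction is overlooked. -/
theorem Adapted.isCover_iff {f : LPP m k} (hf : P.Adapted f) (s t : ℤ) :
    f.IsCover (P.pos s) (P.pos t) ↔ (P.toAff f hf.1).IsCover s t := by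
  have hd : ∀ q, P.pos q ∈ f.dom := fun q => hf.1 ▸ P.mem q
  have e1 : P.pos s + period m < P.pos t ↔ s + K < t := by
    rw [← P.map_add, P.strictMono.lt_iff_lt]
  constructor
  · rintro ⟨⟨-, -, h1, h2, h3⟩, h4, h5⟩
    exact ⟨P.strictMono.lt_iff_lt.1 h1, h3, fun c hc1 hc2 hc3 hc4 => h4 _ (hd c)
      (P.strictMono hc1) (P.strictMono hc2) hc3 hc4, fun h => h5 ⟨e1.2 h.1, h.2⟩⟩
  · rintro ⟨h1, h2, h3, h4⟩
    refine ⟨⟨hd s, hd t, P.strictMono h1, hf.2 t, h2⟩, fun c hc hc1 hc2 hc3 hc4 => ?_,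
      fun h => h4 ⟨e1.1 h.1, h.2⟩⟩
    have := hf.2 t
    obtain ⟨q, rfl⟩ := hf.exists_pos hc (by omega)
    exact h3 q (P.strictMono.lt_iff_lt.1 hc1) (P.strictMono.lt_iff_lt.1 hc2) hc3 hc4

theorem Adapted.cov_toAff {f h : LPP m k} (hf : P.Adapted f) (hh : P.Adapted h) (H : f.Cov h) :
    (P.toAff f hf.1).Cov (P.toAff h hh.1) := by
  obtain ⟨i, j, hc, rfl⟩ := H
  obtain ⟨hi, hj, hij, hle, hlt⟩ := hc.1
  obtain ⟨s, rfl⟩ := hf.exists_pos hi (by omega)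
  obtain ⟨t, rfl⟩ := hh.exists_pos (i := j) (by simpa) (by
    rw [val_swap f hi hj, swapOrbits_self_right hc.1.not_equivalent]; omega)
  refine ⟨s, t, (hf.isCover_iff s t).1 hc, fun q => ?_⟩
  rw [toAff_apply, toAff_apply, val_swap f hi hj, P.swapOrbits_pos]

theorem Adapted.exists_of_cov {f : LPP m k} (hf : P.Adapted f) {E : Aff K (period m)}
    (H : (P.toAff f hf.1).Cov E) : ∃ (h : LPP m k) (hh : P.Adapted h), f.Cov h ∧
      P.toAff h hh.1 = E := by
  obtain ⟨s, t, hc, hE⟩ := H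
  have hc' := (hf.isCover_iff s t).2 hc
  obtain ⟨hi, hj, hij, hle, hlt⟩ := hc'.1
  have hval : ∀ q, (f.swap (P.pos s) (P.pos t)).val (P.pos q) = E q := fun q => by
    rw [hE, val_swap f hi hj, P.swapOrbits_pos, toAff_apply]
  refine ⟨f.swap (P.pos s) (P.pos t), ⟨by rw [dom_swap, hf.1], fun q => ?_⟩, ⟨_, _, hc', rfl⟩,
    Aff.ext_coe hval⟩
  rw [hval, hE, toAff_apply]
  have h1 := P.strictMono hc.1
  rcases Aff.tr_cases K s t q with ⟨n, rfl, h⟩ | ⟨n, rfl, h, -⟩ | ⟨-, -, h⟩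
  · rw [h, P.map_add_mul, P.map_add_mul, val_add]; omega
  · rw [h, P.map_add_mul, P.map_add_mul, val_add]; omega
  · rw [h]; exact hf.2 q

theorem Adapted.ext_toAff {f h : LPP m k} (hf : P.Adapted f) (hh : P.Adapted h) (hm : 1 < m)
    (H : f.Ext h) : (P.toAff f hf.1).Ext (P.toAff h hh.1) := by
  have hp := period_pos hm
  obtain ⟨i, hi, hle, hov, rfl⟩ := H
  obtain ⟨s, rfl⟩ := hh.exists_pos (i := i) (by simpa) (by rw [val_wind_self _ _ hi]; omega)
  have hd : ∀ q, P.pos q ∈ f.dom := fun q => hf.1 ▸ P.mem q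
  refine ⟨s, fun l hl => hov _ (hd l) (P.strictMono hl), fun q => ?_⟩
  rw [toAff_apply, toAff_apply, val_wind _ _ _ (hd q)]
  split_ifs with h
  · obtain ⟨n, hn⟩ := h
    obtain rfl : q = s + n * K := by linarith
    rw [P.map_add_mul, val_add, swapOrbits_add, swapOrbits_self_left]; ring
  · rw [P.dvd_iff] at h
    have := f.val_wind_of_not 1 hi (hd q) h
    rwa [val_wind _ _ _ (hd q)] at this

theorem Adapted.exists_of_ext {f : LPP m k} (hf : P.Adapted f) (hm : 1 < m)
    {E : Aff K (period m)} (H : (P.toAff f hf.1).Ext E) :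
    ∃ (h : LPP m k) (hh : P.Adapted h), f.Ext h ∧ P.toAff h hh.1 = E := by
  have hp := period_pos hm
  obtain ⟨s, hov, hE⟩ := H
  have hd : ∀ q, P.pos q ∈ f.dom := fun q => hf.1 ▸ P.mem q
  have hval : ∀ q, (f.wind (f.val (P.pos s)) 1).val (P.pos q) = E q := fun q => by
    rw [hE, toAff_apply]
    split_ifs with h
    · obtain ⟨n, hn⟩ := h
      obtain rfl : q = s + n * K := by linarith
      rw [val_wind _ _ _ (hd _), P.map_add_mul, val_add, swapOrbits_add, swapOrbits_self_left]; ring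
    · rw [P.dvd_iff] at h
      exact f.val_wind_of_not 1 (hd s) (hd q) h
  refine ⟨f.wind (f.val (P.pos s)) 1, ⟨by rw [dom_wind, hf.1], fun q => ?_⟩,
    ⟨_, hd s, hf.2 s, fun l hl hls => ?_, rfl⟩, Aff.ext_coe hval⟩
  · rw [hval, hE, toAff_apply]
    have := hf.2 q
    split_ifs <;> omega
  · have h1 := hf.2 s
    rcases lt_or_ge l (f.val l) with h | h
    · obtain ⟨q, rfl⟩ := hf.exists_pos hl h
      exact hov q (P.strictMono.lt_iff_lt.1 hls)
    · omega

/-- Adaptedness travels backwards from the end, so every intermediate map unfolds to an affine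
permutation and paths correspond bijectively. -/
theorem ncard_two_step {R R' : LPP m k → LPP m k → Prop}
    {T T' : Aff K (period m) → Aff K (period m) → Prop}
    (h1 : ∀ f h (hf : P.Adapted f) (hh : P.Adapted h), R f h → T (P.toAff f hf.1) (P.toAff h hh.1))
    (h2 : ∀ f (hf : P.Adapted f) E, T (P.toAff f hf.1) E →
      ∃ (h : LPP m k) (hh : P.Adapted h), R f h ∧ P.toAff h hh.1 = E)
    (h1' : ∀ f h (hf : P.Adapted f) (hh : P.Adapted h), R' f h →
      T' (P.toAff f hf.1) (P.toAff h hh.1))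
    (h2' : ∀ f (hf : P.Adapted f) E, T' (P.toAff f hf.1) E →
      ∃ (h : LPP m k) (hh : P.Adapted h), R' f h ∧ P.toAff h hh.1 = E)
    (h3 : ∀ f h, P.Adapted h → R' f h → P.Adapted f) {f h : LPP m k} (hf : P.Adapted f)
    (hh : P.Adapted h) :
    {e | R f e ∧ R' e h}.ncard =
      {E | T (P.toAff f hf.1) E ∧ T' E (P.toAff h hh.1)}.ncard := by
  refine Set.ncard_congr (fun e he => P.toAff e (h3 e h hh he.2).1) ?_ ?_ ?_
  · rintro e ⟨he, he'⟩
    exact ⟨h1 _ _ hf (h3 e h hh he') he, h1' _ _ (h3 e h hh he') hh he'⟩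
  · intro e e' he he' heq
    exact eq_of_toAff_eq (h3 e h hh he.2).1 (h3 e' h hh he'.2).1 heq
  · rintro E ⟨hE, hE'⟩
    obtain ⟨e, he, hfe, rfl⟩ := h2 f hf E hE
    obtain ⟨h', hh', heh, hEq⟩ := h2' e he _ hE'
    obtain rfl := eq_of_toAff_eq _ _ hEq
    exact ⟨e, ⟨hfe, heh⟩, rfl⟩

end Enum

/-- There is an enumeration to which a given lifted partial permutation is adapted. -/
theorem exists_enum (hm : 1 < m) (h : LPP m k) (hne : h.dom.Nonempty) :
    ∃ K : ℤ, 0 < K ∧ ∃ P : Enum m h.dom K, P.Adapted h := by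
  have hp := period_pos hm
  have hpm : period m = 2 * m - 2 := rfl
  -- A strand and its mirror image must not both be chosen. The direction of motion decides; for
  -- stationary strands the residue condition selects one half of each period.
  set S : Set ℤ := {i | i ∈ h.dom ∧ (i < h.val i ∨ (h.val i = i ∧ (i - 1) % period m < m - 1))}
  have hmir : ∀ i, (1 - i - 1) % period m < m - 1 ↔ ¬ (i - 1) % period m < m - 1 := by
    intro i
    have h1 := Int.emod_add_mul_ediv (i - 1) (period m)
    have h2 := Int.emod_nonneg (i - 1) hp.ne'
    have h3 := Int.emod_lt_of_pos (i - 1) hp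
    have h4 : (1 - i - 1) % period m = period m - 1 - (i - 1) % period m := by
      rw [show 1 - i - 1 = (period m - 1 - (i - 1) % period m) +
        period m * (-1 - (i - 1) / period m) by linarith, Int.add_mul_emod_self_left,
        Int.emod_eq_of_lt (by omega) (by omega)]
    rw [h4]; omega
  obtain ⟨K, hK, pos, hmono, hrange, hadd⟩ := exists_enumeration hp (P := S) (fun i => by
    simp only [S, Set.mem_ofPred_eq, add_period_mem_dom, val_add_period,
      show i + period m - 1 = i - 1 + period m by ring, Int.add_emod_right]
    refine and_congr Iff.rfl (or_congr ?_ (and_congr ?_ Iff.rfl)) <;> omega) (by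
    obtain ⟨i, hi⟩ := hne
    rcases lt_trichotomy i (h.val i) with h1 | h1 | h1
    · exact ⟨i, hi, Or.inl h1⟩
    · by_cases h2 : (i - 1) % period m < m - 1
      · exact ⟨i, hi, Or.inr ⟨h1.symm, h2⟩⟩
      · exact ⟨1 - i, by simpa, Or.inr ⟨by rw [val_mirror, ← h1], (hmir i).2 h2⟩⟩
    · exact ⟨1 - i, by simpa, Or.inl (by rw [val_mirror]; omega)⟩)
  have hpos : ∀ q, pos q ∈ S := fun q => hrange ▸ Set.mem_range_self q
  refine ⟨K, hK, ⟨pos, hmono, hadd, fun q => (hpos q).1, fun i hi => ?_, fun q q' he => ?_⟩,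
    rfl, fun q => ?_⟩
  · rcases lt_trichotomy i (h.val i) with h1 | h1 | h1
    · left; rw [← Set.mem_range, hrange]; exact ⟨hi, Or.inl h1⟩
    · by_cases h2 : (i - 1) % period m < m - 1
      · left; rw [← Set.mem_range, hrange]; exact ⟨hi, Or.inr ⟨h1.symm, h2⟩⟩
      · right; rw [← Set.mem_range, hrange]
        exact ⟨by simpa, Or.inr ⟨by rw [val_mirror, ← h1], (hmir i).2 h2⟩⟩
    · right; rw [← Set.mem_range, hrange]; exact ⟨by simpa, Or.inl (by rw [val_mirror]; omega)⟩
  · obtain ⟨-, h1⟩ := hpos q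
    obtain ⟨-, h2⟩ := hpos q'
    rw [he, val_mirror, hmir] at h1
    omega
  · change pos q ≤ h.val (pos q)
    rcases (hpos q).2 with h1 | h1 <;> omega

theorem cov_cov_even (hm : 1 < m) (f h : LPP m k) :
    (({e | f.Cov e ∧ e.Cov h}.ncard : ℕ) : ZMod 2) = 0 := by
  by_cases hne : {e | f.Cov e ∧ e.Cov h}.Nonempty
  · obtain ⟨e, he, he'⟩ := hne
    obtain ⟨i, j, hc, rfl⟩ := id he'
    obtain ⟨K, hK, P, hP⟩ := exists_enum hm (e.swap i j) ⟨i, by simpa using hc.1.left_mem⟩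
    have hf := (hP.of_cov he').of_cov he
    rw [Enum.ncard_two_step (T := Aff.Cov) (T' := Aff.Cov)
      (fun f h hf hh H => hf.cov_toAff hh H) (fun f hf E H => hf.exists_of_cov H)
      (fun f h hf hh H => hf.cov_toAff hh H) (fun f hf E H => hf.exists_of_cov H)
      (fun f h hh H => hh.of_cov H) hf hP]
    exact Aff.even_cov_cov hK (period_pos hm) _ _
  · rw [Set.not_nonempty_iff_eq_empty.1 hne, Set.ncard_empty, Nat.cast_zero]

theorem ext_cov_eq (hm : 1 < m) (b h : LPP m k) :
    (({e | b.Ext e ∧ e.Cov h}.ncard : ℕ) : ZMod 2) = ({e | b.Cov e ∧ e.Ext h}.ncard : ℕ) := by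
  by_cases hne : h.dom.Nonempty
  · obtain ⟨K, hK, P, hP⟩ := exists_enum hm h hne
    by_cases hb : P.Adapted b
    · rw [Enum.ncard_two_step (T := Aff.Ext) (T' := Aff.Cov)
        (fun f h hf hh H => hf.ext_toAff hh hm H) (fun f hf E H => hf.exists_of_ext hm H)
        (fun f h hf hh H => hf.cov_toAff hh H) (fun f hf E H => hf.exists_of_cov H)
        (fun f h hh H => hh.of_cov H) hb hP,
        Enum.ncard_two_step (T := Aff.Cov) (T' := Aff.Ext)
        (fun f h hf hh H => hf.cov_toAff hh H) (fun f hf E H => hf.exists_of_cov H)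
        (fun f h hf hh H => hf.ext_toAff hh hm H) (fun f hf E H => hf.exists_of_ext hm H)
        (fun f h hh H => hh.of_ext hm H) hb hP]
      exact Aff.ncard_ext_cov hK (period_pos hm) _ _
    · have h1 : {e | b.Ext e ∧ e.Cov h} = ∅ :=
        Set.eq_empty_of_forall_notMem fun e he => hb ((hP.of_cov he.2).of_ext hm he.1)
      have h2 : {e | b.Cov e ∧ e.Ext h} = ∅ :=
        Set.eq_empty_of_forall_notMem fun e he => hb ((hP.of_ext hm he.2).of_cov he.1)
      rw [h1, h2]
  · have h1 : {e | b.Ext e ∧ e.Cov h} = ∅ := Set.eq_empty_of_forall_notMem fun e he => by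
      obtain ⟨i, j, hc, rfl⟩ := he.2
      exact hne ⟨i, by simpa using hc.1.left_mem⟩
    have h2 : {e | b.Cov e ∧ e.Ext h} = ∅ := Set.eq_empty_of_forall_notMem fun e he => by
      obtain ⟨i, hi, -, -, rfl⟩ := he.2
      exact hne ⟨i, by simpa using hi⟩
    rw [h1, h2]

end LPP

namespace QuoX

variable {m k : ℕ}

/-- Resolutions cancel in pairs. From `X b` to `h` there are also the paths that turn and resolve in
either order, and these are equally many modulo 2. -/
theorem sqZero (hm : 1 < m) : SqZero m k := by
  rintro (f | b) (h | h)
  · have : {t | Rel (Sum.inl f) t ∧ Rel t (Sum.inl h)} = Sum.inl '' {e | f.Cov e ∧ e.Cov h} := by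
      ext (t | t)
      · exact ⟨fun H => ⟨t, H, rfl⟩, by rintro ⟨t, H, ⟨⟩⟩; exact H⟩
      · exact ⟨fun H => H.1.elim, by rintro ⟨t, H, ⟨⟩⟩⟩
    rw [this, Set.ncard_image_of_injective _ Sum.inl_injective, LPP.cov_cov_even hm]
  · have : {t | Rel (Sum.inl f) t ∧ Rel t (Sum.inr h)} = ∅ := by
      ext (t | t)
      · exact ⟨fun H => H.2.elim, fun H => H.elim⟩
      · exact ⟨fun H => H.1.elim, fun H => H.elim⟩
    rw [this, Set.ncard_empty, Nat.cast_zero]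
  · have : {t | Rel (Sum.inr b) t ∧ Rel t (Sum.inl h)} =
        Sum.inl '' {e | b.Ext e ∧ e.Cov h} ∪ Sum.inr '' {e | b.Cov e ∧ e.Ext h} := by
      ext (t | t)
      · exact ⟨fun H => Or.inl ⟨t, H, rfl⟩, by rintro (⟨t, H, ⟨⟩⟩ | ⟨t, H, ⟨⟩⟩); exact H⟩
      · exact ⟨fun H => Or.inr ⟨t, H, rfl⟩, by rintro (⟨t, H, ⟨⟩⟩ | ⟨t, H, ⟨⟩⟩); exact H⟩
    have hd : Disjoint (Sum.inl '' {e | b.Ext e ∧ e.Cov h} : Set (LPP m k ⊕ LPP m k))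
        (Sum.inr '' {e | b.Cov e ∧ e.Ext h}) := by
      rw [Set.disjoint_left]
      rintro _ ⟨e, -, rfl⟩ ⟨e', -, ⟨⟩⟩
    rw [this, Set.ncard_union_eq hd
        ((((b.finite_ext hm).subset fun e he => he.1)).image _)
        ((((b.finite_cov hm).subset fun e he => he.1)).image _),
      Set.ncard_image_of_injective _ Sum.inl_injective,
      Set.ncard_image_of_injective _ Sum.inr_injective, Nat.cast_add, LPP.ext_cov_eq hm]
    exact CharTwo.add_self_eq_zero _
  · have : {t | Rel (Sum.inr b) t ∧ Rel t (Sum.inr h)} = Sum.inr '' {e | b.Cov e ∧ e.Cov h} := by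
      ext (t | t)
      · exact ⟨fun H => H.2.elim, by rintro ⟨t, H, ⟨⟩⟩⟩
      · exact ⟨fun H => ⟨t, H, rfl⟩, by rintro ⟨t, H, ⟨⟩⟩; exact H⟩
    rw [this, Set.ncard_image_of_injective _ Sum.inr_injective, LPP.cov_cov_even hm]

end QuoX

/-! ### The first two strands that pass a half-integer -/

/-- `p < q` are the two smallest elements of `A`. -/
structure FirstTwo (A : Set ℤ) (p q : ℤ) : Prop where
  left_mem : p ∈ A
  right_mem : q ∈ A
  lt : p < q
  le_of_mem : ∀ l ∈ A, l = p ∨ q ≤ l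

theorem FirstTwo.eq {A : Set ℤ} {p q p' q' : ℤ} (h : FirstTwo A p q) (h' : FirstTwo A p' q') :
    p = p' ∧ q = q' := by
  have h1 := h.le_of_mem _ h'.left_mem
  have h2 := h.le_of_mem _ h'.right_mem
  have h3 := h'.le_of_mem _ h.left_mem
  have h4 := h'.le_of_mem _ h.right_mem
  have := h.lt
  have := h'.lt
  omega

theorem sInf_mem_of_finite {A : Set ℤ} (hA : A.Finite) (hne : A.Nonempty) :
    sInf A ∈ A ∧ ∀ l ∈ A, sInf A ≤ l :=
  ⟨Int.csInf_mem hne hA.bddBelow, fun _ hl => csInf_le hA.bddBelow hl⟩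

/-- The second smallest element of a set. -/
def second (A : Set ℤ) : ℤ := sInf (A \ {sInf A})

theorem firstTwo_sInf {A : Set ℤ} (hA : A.Finite) (h : 2 ≤ A.ncard) :
    FirstTwo A (sInf A) (second A) := by
  have hne : A.Nonempty := (Set.ncard_pos hA).1 (by omega)
  obtain ⟨h1, h2⟩ := sInf_mem_of_finite hA hne
  have hne' : (A \ {sInf A}).Nonempty := by
    rw [← Set.ncard_pos hA.sdiff, Set.ncard_sdiff_singleton_of_mem h1]
    omega
  obtain ⟨⟨h3, h4⟩, h5⟩ := sInf_mem_of_finite hA.sdiff hne'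
  refine ⟨h1, h3, lt_of_le_of_ne (h2 _ h3) fun h => h4 h.symm, fun l hl => ?_⟩
  by_cases h6 : l = sInf A
  · exact Or.inl h6
  · exact Or.inr (h5 l ⟨hl, h6⟩)

theorem FirstTwo.sInf_eq {A : Set ℤ} {p q : ℤ} (h : FirstTwo A p q) (hA : A.Finite) :
    sInf A = p ∧ second A = q :=
  (firstTwo_sInf hA ((Set.one_lt_ncard hA).2 ⟨p, h.left_mem, q, h.right_mem, h.lt.ne⟩)).eq h

namespace LPP

variable {m k : ℕ}

/-- The sum of the starting points of the strands that pass `g - 1/2` from the left. -/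
def upSum (hm : 1 < m) (f : LPP m k) (g : ℤ) : ℤ := ∑ l ∈ (f.finite_up hm g).toFinset, l

/-- A start that newly passes lies to the right of the lost start that `t` assigns to it. Thus
`upSum` is monotone along the differential and serves as the order of the matching. -/
theorem upSum_le_upSum_swap (hm : 1 < m) {f : LPP m k} {i j : ℤ} (h : f.IsRightCrossing i j)
    (g : ℤ) : f.upSum hm g ≤ (f.swap i j).upSum hm g ∧
      (f.upSum hm g = (f.swap i j).upSum hm g → (f.swap i j).up g = f.up g) := by
  classical
  have hinv := swapOrbits_involutive h.not_equivalent
  have himg := up_sdiff_up_swap h g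
  set A := (f.finite_up hm g).toFinset with hA
  set B := ((f.swap i j).finite_up hm g).toFinset with hB
  have hAB : A \ B = (B \ A).image (swapOrbits m i j) := by
    rw [← Finset.coe_inj, Finset.coe_image, Finset.coe_sdiff, Finset.coe_sdiff, hA, hB,
      Set.Finite.coe_toFinset, Set.Finite.coe_toFinset, himg]
  have hsum : ∑ l ∈ A \ B, l = ∑ l ∈ B \ A, swapOrbits m i j l := by
    rw [hAB, Finset.sum_image]
    intro a _ b _ hab
    rw [← hinv a, hab, hinv]
  have hlt : ∀ l ∈ B \ A, swapOrbits m i j l < l := by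
    intro l hl
    rw [Finset.mem_sdiff, hA, hB, Set.Finite.mem_toFinset, Set.Finite.mem_toFinset] at hl
    obtain ⟨⟨h1, h2, h3⟩, h4⟩ := hl
    rw [dom_swap] at h1
    rw [val_swap f h.left_mem h.right_mem] at h3
    have h5 : f.val l < g := by by_contra hc; exact h4 ⟨h1, h2, by omega⟩
    have := h.lt
    have := h.val_lt
    have := h.le_val
    rcases f.swapOrbits_displacement i j l with e | ⟨e1, e2, -⟩ | ⟨e1, e2, -⟩
    · rw [e] at h3; omega
    · rw [e2] at h3; omega
    · omega
  have e1 : f.upSum hm g = ∑ l ∈ A ∩ B, l + ∑ l ∈ B \ A, swapOrbits m i j l := by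
    rw [← hsum, Finset.sum_inter_add_sum_sdiff]; rfl
  have e2 : (f.swap i j).upSum hm g = ∑ l ∈ A ∩ B, l + ∑ l ∈ B \ A, l := by
    rw [Finset.inter_comm, Finset.sum_inter_add_sum_sdiff]; rfl
  rw [e1, e2]
  constructor
  · exact add_le_add le_rfl (Finset.sum_le_sum fun l hl => (hlt l hl).le)
  · intro he
    have hemp : B \ A = ∅ := by
      by_contra hne
      exact (Finset.sum_lt_sum_of_nonempty (Finset.nonempty_iff_ne_empty.2 hne) hlt).ne
        (add_left_cancel he)
    have hemp' : A \ B = ∅ := by rw [hAB, hemp, Finset.image_empty]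
    have : A = B := Finset.Subset.antisymm (Finset.sdiff_eq_empty_iff_subset.1 hemp')
      (Finset.sdiff_eq_empty_iff_subset.1 hemp)
    exact (Set.Finite.toFinset_inj.1 this).symm

theorem upSum_congr (hm : 1 < m) {f h : LPP m k} {g : ℤ} (he : f.up g = h.up g) :
    f.upSum hm g = h.upSum hm g :=
  Finset.sum_congr (Set.Finite.toFinset_inj.2 he) fun _ _ => rfl

theorem upSum_insert (hm : 1 < m) {f h : LPP m k} {g i : ℤ} (hi : i ∉ f.up g)
    (he : h.up g = insert i (f.up g)) : h.upSum hm g = i + f.upSum hm g := by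
  classical
  have h1 := Finset.sum_insert (f := fun l : ℤ => l) (s := (f.finite_up hm g).toFinset) (a := i)
    (by simpa using hi)
  rw [upSum, upSum, ← h1]
  refine Finset.sum_congr ?_ fun _ _ => rfl
  ext l
  simp [he]

/-- A passing translate of `p` is not to the left of `p`, so it still ends beyond `g` after the
exchange; other passing strands keep or raise their values. No start is lost, and their number is
constant. -/
theorem _root_.PongAlg.FirstTwo.up_swap (hm : 1 < m) {f : LPP m k} {g p q : ℤ}
    (h : FirstTwo (f.up g) p q) (hlt : f.val q < f.val p) : (f.swap p q).up g = f.up g := by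
  obtain ⟨hp, hpg, hfp⟩ := h.left_mem
  obtain ⟨hq, hqg, hfq⟩ := h.right_mem
  have hpq := h.lt
  have hc : f.IsRightCrossing p q := ⟨hp, hq, hpq, by omega, hlt⟩
  refine (Set.eq_of_subset_of_ncard_le ?_ (up_swap_eq hm hc g).le (finite_up hm _ g)).symm
  intro l hl
  have hl' := h.le_of_mem l hl
  obtain ⟨hld, hlg, hfl⟩ := hl
  refine ⟨by simpa, hlg, ?_⟩
  rw [val_swap f hp hq]
  rcases f.swapOrbits_displacement p q l with e | ⟨e1, e2, ⟨n, rfl⟩ | ⟨n, rfl⟩⟩ | ⟨e1, e2, -⟩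
  · rwa [e]
  · rw [e2, val_add]; omega
  · rw [val_add, val_mirror] at hfl; omega
  · omega

theorem _root_.PongAlg.FirstTwo.ne_mirror {f : LPP m k} {g p q : ℤ} (h : FirstTwo (f.up g) p q) (n : ℤ) :
    q ≠ 1 - p + n * period m := by
  rintro rfl
  obtain ⟨-, h1, h2⟩ := h.left_mem
  obtain ⟨-, h3, h4⟩ := h.right_mem
  rw [val_add, val_mirror] at h4
  omega

/-- The mirror image of a right-moving strand does not move right, so `q` is a translate of `p`; and
`p + period m` already passes if a later translate does. -/
theorem _root_.PongAlg.FirstTwo.eq_add_period (hm : 1 < m) {f : LPP m k} {g p q : ℤ} (h : FirstTwo (f.up g) p q)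
    (he : Equivalent m p q) : q = p + period m := by
  have hp := period_pos hm
  obtain ⟨n, rfl | rfl⟩ := equivalent_iff.1 he
  · have hn : 0 < n := by
      by_contra hc
      have := h.lt
      nlinarith
    have h1 : p + period m ∈ f.up g := by
      obtain ⟨h1, h2, h3⟩ := h.left_mem
      obtain ⟨h4, h5, h6⟩ := h.right_mem
      refine ⟨by simpa, ?_, ?_⟩
      · nlinarith
      · rw [val_add_period]; omega
    have h2 := h.le_of_mem _ h1
    have h3 : period m ≤ n * period m := by nlinarith
    omega
  · exact absurd rfl (h.ne_mirror n)

theorem _root_.PongAlg.FirstTwo.swap {f : LPP m k} {g p q : ℤ} (h : FirstTwo (f.up g) p q)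
    (hne : ¬ Equivalent m p q) : FirstTwo ((f.swap p q).up g) p q := by
  obtain ⟨hp, hpg, hfp⟩ := h.left_mem
  obtain ⟨hq, hqg, hfq⟩ := h.right_mem
  have hlt := h.lt
  refine ⟨⟨by simpa, hpg, ?_⟩, ⟨by simpa, hqg, ?_⟩, hlt, ?_⟩
  · rwa [val_swap f hp hq, swapOrbits_self_left]
  · rwa [val_swap f hp hq, swapOrbits_self_right hne]
  · rintro l ⟨hl, hlg, hfl⟩
    rw [dom_swap] at hl
    rw [val_swap f hp hq] at hfl
    by_contra hcon
    push Not at hcon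
    have hl' : f.val l < g := by
      by_contra hc
      have := h.le_of_mem l ⟨hl, hlg, by omega⟩
      omega
    rcases f.swapOrbits_displacement p q l with e | ⟨e1, e2, ⟨n, rfl⟩ | ⟨n, rfl⟩⟩ |
        ⟨e1, e2, ⟨n, rfl⟩ | ⟨n, rfl⟩⟩
    · rw [e] at hfl; omega
    · rw [val_add] at e2 hl'
      have h1 : q + n * period m ∈ f.up g :=
        ⟨(f.add_mem_dom _ _).2 hq, by omega, by rw [val_add]; omega⟩
      rcases h.le_of_mem _ h1 with h2 | h2
      · exact hne (Equivalent.symm (h2 ▸ equivalent_add m q n))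
      · omega
    · rw [val_add, val_mirror] at e2 hl'
      omega
    · rw [val_add] at e2 hl'
      have h1 : p + n * period m ∈ f.up g :=
        ⟨(f.add_mem_dom _ _).2 hp, by omega, by rw [val_add]; omega⟩
      rcases h.le_of_mem _ h1 with h2 | h2 <;> omega
    · rw [val_add, val_mirror] at e2 hl'
      omega

theorem _root_.PongAlg.FirstTwo.isRightCrossing {f : LPP m k} {g p q : ℤ} (h : FirstTwo (f.up g) p q)
    (hlt : f.val q < f.val p) : f.IsRightCrossing p q := by
  obtain ⟨hq, hqg, hfq⟩ := h.right_mem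
  exact ⟨h.left_mem.1, hq, h.lt, by omega, hlt⟩

/-- Any strand in the rectangle, or a translate violating the affine clause, would be a further
passing start between `p` and `q`. -/
theorem _root_.PongAlg.FirstTwo.isCover (hm : 1 < m) {f : LPP m k} {g p q : ℤ} (h : FirstTwo (f.up g) p q)
    (hlt : f.val q < f.val p) : f.IsCover p q := by
  have hpp := period_pos hm
  obtain ⟨hp, hpg, hfp⟩ := h.left_mem
  obtain ⟨hq, hqg, hfq⟩ := h.right_mem
  refine ⟨h.isRightCrossing hlt, fun c hc h1 h2 h3 h4 => ?_, fun ⟨h1, h2⟩ => ?_⟩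
  · have := h.le_of_mem c ⟨hc, by omega, by omega⟩
    omega
  · have := h.le_of_mem (p + period m) ⟨by simpa, by omega, by rw [val_add_period]; omega⟩
    omega

theorem IsCover.translate {f : LPP m k} {i j : ℤ} (h : f.IsCover i j) (n : ℤ) :
    f.IsCover (i + n * period m) (j + n * period m) ∧
      f.swap (i + n * period m) (j + n * period m) = f.swap i j := by
  obtain ⟨⟨h1, h2, h3, h4, h5⟩, h6, h7⟩ := h
  refine ⟨⟨⟨(f.add_mem_dom _ _).2 h1, (f.add_mem_dom _ _).2 h2, by omega, by rw [val_add]; omega,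
    by rw [val_add, val_add]; omega⟩, fun c hc c1 c2 c3 c4 => ?_, ?_⟩, ?_⟩
  · rw [val_add] at c3 c4
    refine h6 (c + -n * period m) ((f.add_mem_dom _ _).2 hc) (by linarith) (by linarith) ?_ ?_ <;>
      rw [val_add] <;> linarith
  · rw [val_add, val_add]
    exact fun h => h7 ⟨by omega, by omega⟩
  · obtain ⟨γ, hγ⟩ := exists_transl m n
    rw [← hγ, ← hγ, swap_smul]

/-- If a resolution that contributes to the differential uncrosses the first two of the strands that
pass `g - 1/2`, and the set of starting points of these strands does not change, then it is the
resolution at the crossing of these two strands. -/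
theorem _root_.PongAlg.FirstTwo.eq_swap {f : LPP m k} {g p q i j : ℤ} (h : FirstTwo (f.up g) p q)
    (hlt : f.val q < f.val p) (hc : f.IsCover i j) (hup : (f.swap i j).up g = f.up g)
    (hlt' : (f.swap i j).val p < (f.swap i j).val q) : f.swap i j = f.swap p q := by
  have hpq := h.lt
  obtain ⟨hp, hpg, hfp⟩ := h.left_mem
  obtain ⟨hq, hqg, hfq⟩ := h.right_mem
  have hpg' := (hup ▸ h.left_mem : p ∈ (f.swap i j).up g).2.2
  have hqg' := (hup ▸ h.right_mem : q ∈ (f.swap i j).up g).2.2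
  have hmem : ∀ l ∈ f.dom, l < g → g ≤ f.val l → l = p ∨ q ≤ l := fun l h1 h2 h3 =>
    h.le_of_mem l ⟨h1, h2, h3⟩
  have hle := hc.1.le_val
  have hij := hc.1.lt
  have hvlt := hc.1.val_lt
  rw [val_swap f hc.1.left_mem hc.1.right_mem] at hpg' hqg'
  rw [val_swap f hc.1.left_mem hc.1.right_mem, val_swap f hc.1.left_mem hc.1.right_mem] at hlt'
  rcases f.swapOrbits_displacement i j p with e | ⟨e1, e2, ⟨n, hn⟩ | ⟨n, hn⟩⟩ |
      ⟨e1, e2, ⟨n, hn⟩ | ⟨n, hn⟩⟩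
  · rw [e] at hlt'
    rcases f.swapOrbits_displacement i j q with u | ⟨u1, u2, -⟩ | ⟨u1, u2, ⟨n, hn⟩ | ⟨n, hn⟩⟩
    · rw [u] at hlt'; omega
    · rw [u2] at hlt'; omega
    · obtain ⟨hc', hs⟩ := hc.translate n
      rw [← hn] at hc' hs
      have hfi : f.val (i + n * period m) = f.val i + n * period m := val_add ..
      have hfj : f.val q = f.val j + n * period m := by rw [hn, val_add]
      rcases lt_trichotomy (i + n * period m) p with h1 | h1 | h1
      · rw [u2] at hlt'
        exact (hc'.2.1 p hp h1 hpq hlt (by omega)).elim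
      · rw [← hs, h1]
      · have := hmem _ hc'.1.left_mem (by omega) (by omega)
        omega
    · rw [hn, val_add, val_mirror] at hfq; omega
  · obtain ⟨hc', hs⟩ := hc.translate n
    rw [← hn] at hc' hs
    have hfj : f.val (j + n * period m) = f.val j + n * period m := val_add ..
    have hfi : f.val p = f.val i + n * period m := by rw [hn, val_add]
    rw [e2] at hpg' hlt'
    have hjp : ¬ j + n * period m < q := fun h1 => by
      have := hmem _ hc'.1.right_mem (by omega) (by omega)
      omega
    rcases f.swapOrbits_displacement i j q with u | ⟨u1, u2, -⟩ | ⟨u1, u2, ⟨n', hn'⟩ | ⟨n', hn'⟩⟩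
    · rw [u] at hlt'
      rcases lt_trichotomy q (j + n * period m) with h1 | h1 | h1
      · exact (hc'.2.1 q hq hpq h1 (by omega) hlt).elim
      · rw [← hs, h1]
      · omega
    · rw [u2] at hlt'; omega
    · rw [u2] at hqg'
      have hfq' : f.val q = f.val j + n' * period m := by rw [hn', val_add]
      have h1 : f.val (i + n' * period m) = f.val i + n' * period m := val_add ..
      have h2 := hmem (i + n' * period m) ((f.add_mem_dom _ _).2 hc.1.left_mem) (by omega) (by omega)
      have h3 : i + n' * period m = p := by omega
      rw [← (hc.translate n').2, ← hn', h3]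
    · rw [hn', val_add, val_mirror] at hfq; omega
  · rw [hn, val_add, val_mirror] at hfp; omega
  · rw [e2] at hlt'
    rcases f.swapOrbits_displacement i j q with u | ⟨u1, u2, -⟩ | ⟨u1, u2, -⟩
    · rw [u] at hlt'; omega
    · rw [u2] at hlt'; omega
    · rw [u2] at hlt'; omega
  · rw [hn, val_add, val_mirror] at hfp; omega

end LPP

/-! ### Triples for which two strands pass a half-integer -/

/-- The difference of the numbers of elements of `y` and of `x` below `j`. -/
def countDiff (x y : Finset ℤ) (j : ℤ) : ℤ := ((y.filter (· < j)).card : ℤ) - (x.filter (· < j)).card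

open Classical in
theorem card_filter_mem_orbitsOf {m k : ℕ} (hm : 1 < m) (x : IdemState m k) {n : ℕ} (hn : n < m) :
    ((Finset.Icc (1 : ℤ) n).filter (· ∈ orbitsOf m x.carrier)).card =
      (x.carrier.filter (· < (n : ℤ) + 1)).card := by
  congr 1
  ext l
  simp only [Finset.mem_filter, Finset.mem_Icc]
  constructor
  · rintro ⟨⟨h1, h2⟩, h3⟩
    rw [mem_orbitsOf_iff hm x (Finset.mem_Icc.2 ⟨h1, by omega⟩)] at h3
    exact ⟨h3, by omega⟩
  · rintro ⟨h1, h2⟩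
    have h3 := x.subset h1
    rw [mem_orbitsOf_iff hm x h3]
    rw [Finset.mem_Icc] at h3
    exact ⟨⟨h3.1, by omega⟩, h1⟩

namespace LPP

variable {m k : ℕ}

/-- The weight is half the sum of the two counts and the balance is their difference, so both counts
are determined by `x`, `y` and `w`. -/
theorem up_of_mem_gens (hm : 1 < m) {x y : IdemState m k} {w : Fin m → ℚ} {f : LPP m k}
    (hf : f ∈ gens x.carrier y.carrier w) (i : Fin m) :
    ((f.up ((i : ℕ) + 1)).ncard : ℚ) = w i + countDiff x.carrier y.carrier ((i : ℕ) + 1) / 2 ∧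
    ((f.up (2 - ((i : ℕ) + 1))).ncard : ℚ) =
      w i - countDiff x.carrier y.carrier ((i : ℕ) + 1) / 2 := by
  have h1 := f.up_balance hm i
  rw [hf.1, hf.2.1, card_filter_mem_orbitsOf hm y i.2, card_filter_mem_orbitsOf hm x i.2] at h1
  have h2 : f.mult ((i : ℕ) + 1) = w i := congrFun hf.2.2 i
  rw [mult_eq hm] at h2
  have h3 : ((f.up ((i : ℕ) + 1)).ncard : ℚ) - ((f.up (2 - ((i : ℕ) + 1))).ncard : ℚ) =
      countDiff x.carrier y.carrier ((i : ℕ) + 1) := by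
    rw [countDiff]
    exact_mod_cast h1
  constructor <;> linarith

theorem ncard_up_eq_add (hm : 1 < m) {x y : IdemState m k} {w w' : Fin m → ℚ} {f h : LPP m k}
    (hf : f ∈ gens x.carrier y.carrier w) (hh : h ∈ gens x.carrier y.carrier w') (r : ℤ)
    (hw : ∀ i, w' i = w i + r) (g : ℤ) : ((h.up g).ncard : ℤ) = (f.up g).ncard + r := by
  have key : ∀ i : Fin m, ((h.up ((i : ℕ) + 1)).ncard : ℤ) = (f.up ((i : ℕ) + 1)).ncard + r ∧
      ((h.up (2 - ((i : ℕ) + 1))).ncard : ℤ) = (f.up (2 - ((i : ℕ) + 1))).ncard + r := by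
    intro i
    obtain ⟨h1, h2⟩ := up_of_mem_gens hm hf i
    obtain ⟨h3, h4⟩ := up_of_mem_gens hm hh i
    rw [hw i] at h3 h4
    constructor
    · have : ((h.up ((i : ℕ) + 1)).ncard : ℚ) = (f.up ((i : ℕ) + 1)).ncard + r := by
        rw [h1, h3]; ring
      exact_mod_cast this
    · have : ((h.up (2 - ((i : ℕ) + 1))).ncard : ℚ) = (f.up (2 - ((i : ℕ) + 1))).ncard + r := by
        rw [h2, h4]; ring
      exact_mod_cast this
  obtain ⟨i, ⟨n, hn⟩ | ⟨n, hn⟩⟩ := exists_weight_index hm g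
  · rw [hn, ncard_up_add, ncard_up_add]
    exact (key i).1
  · rw [show g = (2 - ((i : ℕ) + 1)) + (-n) * period m by linarith, ncard_up_add, ncard_up_add]
    exact (key i).2

theorem swap_mem_gens_iff (hm : 1 < m) {f : LPP m k} {i j : ℤ} (h : f.IsRightCrossing i j)
    {x y : Finset ℤ} {w : Fin m → ℚ} : f.swap i j ∈ gens x y w ↔ f ∈ gens x y w := by
  change (_ ∧ _ ∧ _) ↔ (_ ∧ _ ∧ _)
  rw [dom_swap, ran_swap f h.not_equivalent, weight_swap hm h]

theorem wind_mem_gens_iff (hm : 1 < m) {f : LPP m k} {i : ℤ} (hi : i ∈ f.dom) (hle : i ≤ f.val i)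
    {x y : Finset ℤ} {w : Fin m → ℚ} :
    f.wind (f.val i) 1 ∈ gens x y w ↔ f ∈ gens x y (w - 1) := by
  change (_ ∧ _ ∧ _) ↔ (_ ∧ _ ∧ _)
  rw [dom_wind, ran_wind]
  have : (f.wind (f.val i) 1).weight = f.weight + 1 := funext fun ix => mult_wind hm hi hle _
  rw [this, eq_sub_iff_add_eq]

/-- A strand that is prolonged by a full turn and then shortened by a full turn. -/
theorem wind_wind (f : LPP m k) {i : ℤ} (hi : i ∈ f.dom) (n : ℤ) :
    (f.wind (f.val i) n).wind (f.val i + n * period m) (-n) = f := by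
  have hi' : i ∈ (f.wind (f.val i) n).dom := by simpa
  refine ext_val (by simp) fun l hl => ?_
  rw [dom_wind, dom_wind] at hl
  have hl' : l ∈ (f.wind (f.val i) n).dom := by simpa
  have hv := f.val_wind_self n hi
  by_cases h : Equivalent m i l
  · rw [← hv]
    obtain ⟨q, rfl | rfl⟩ := equivalent_iff.1 h
    · rw [val_add, val_wind_self _ _ hi', hv, val_add]; ring
    · rw [val_add, val_mirror, val_wind_self _ _ hi', hv, val_add, val_mirror]; ring
  · rw [← hv, val_wind_of_not _ _ hi' hl' h, val_wind_of_not _ _ hi hl h]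

/-- The smallest starting point of a strand that passes `g - 1/2` from the left. -/
theorem sInf_up_mem (hm : 1 < m) {b : LPP m k} {g : ℤ} (h : 0 < (b.up g).ncard) :
    sInf (b.up g) ∈ b.up g ∧ ∀ l ∈ b.up g, sInf (b.up g) ≤ l :=
  sInf_mem_of_finite (b.finite_up hm g) ((Set.ncard_pos (b.finite_up hm g)).1 h)

end LPP

namespace QuoX

variable {m k : ℕ}

/-- The number of strands of a generator that pass `g - 1/2` from the left, where `X` counts as
one more strand. -/
def level : LPP m k ⊕ LPP m k → ℤ → ℤ
  | Sum.inl f, g => (f.up g).ncard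
  | Sum.inr b, g => (b.up g).ncard + 1

theorem level_eq (hm : 1 < m) {x y : IdemState m k} {w : Fin m → ℚ} {s t : LPP m k ⊕ LPP m k}
    (hs : s ∈ gens x.carrier y.carrier w) (ht : t ∈ gens x.carrier y.carrier w) (g : ℤ) :
    level s g = level t g := by
  rcases hs with ⟨f, hf, rfl⟩ | ⟨b, hb, rfl⟩ <;> rcases ht with ⟨f', hf', rfl⟩ | ⟨b', hb', rfl⟩
  · have := LPP.ncard_up_eq_add hm hf hf' 0 (fun i => by simp) g
    simp only [level]; omega
  · have := LPP.ncard_up_eq_add hm hf hb' (-1) (fun i => by simp; ring) g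
    simp only [level]; omega
  · have := LPP.ncard_up_eq_add hm hb hf' 1 (fun i => by simp) g
    simp only [level]; omega
  · have := LPP.ncard_up_eq_add hm hb hb' 0 (fun i => by simp) g
    simp only [level]; omega

/-- The generators in which the first two strands that pass `g - 1/2` cross, and the multiples of
`X`. -/
def crossedGens (x y : Finset ℤ) (w : Fin m → ℚ) (g : ℤ) : Set (LPP m k ⊕ LPP m k)
  | Sum.inl f => f ∈ LPP.gens x y w ∧ f.val (second (f.up g)) < f.val (sInf (f.up g))
  | Sum.inr b => b ∈ LPP.gens x y (w - 1)

/-- Resolve the crossing of the first two strands that pass `g - 1/2`; replace `X` by a full turn of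
the first strand. -/
def uncross (g : ℤ) : LPP m k ⊕ LPP m k → LPP m k
  | Sum.inl f => f.swap (sInf (f.up g)) (second (f.up g))
  | Sum.inr b => b.wind (b.val (sInf (b.up g))) 1

/-- After a full turn of the first strand its previous translate also passes, and nothing passes
before that translate. The first two strands then belong to one orbit, which marks the partners of
multiples of `X`. -/
theorem uncross_inr (hm : 1 < m) {b : LPP m k} {g : ℤ} (h : 0 < (b.up g).ncard) :
    (uncross g (Sum.inr b)).up g = insert (sInf (b.up g) - period m) (b.up g) ∧
      FirstTwo ((uncross g (Sum.inr b)).up g) (sInf (b.up g) - period m) (sInf (b.up g)) := by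
  have hp := period_pos hm
  obtain ⟨h1, h2⟩ := LPP.sInf_up_mem hm h
  obtain ⟨hd, hg1, hg2⟩ := id h1
  obtain ⟨n, hn1, hn2, hn3, hn4⟩ := LPP.exists_up_wind_eq hm hd (by omega) g
  have hn : n = -1 := by
    have h3 : n < 0 := by
      by_contra hc
      have : 0 ≤ n * period m := mul_nonneg (by omega) hp.le
      omega
    by_contra hc
    have h4 : n * period m ≤ -2 * period m := mul_le_mul_of_nonneg_right (by omega) hp.le
    have := h2 (sInf (b.up g) - period m)
      ⟨by simpa, by omega, by rw [LPP.val_sub_period]; omega⟩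
    omega
  subst hn
  rw [show sInf (b.up g) + -1 * period m = sInf (b.up g) - period m by ring] at hn4
  refine ⟨hn4, ?_⟩
  rw [uncross, hn4]
  refine ⟨Set.mem_insert _ _, Set.mem_insert_of_mem _ h1, by omega, ?_⟩
  rintro l (rfl | hl)
  · exact Or.inl rfl
  · exact Or.inr (h2 l hl)

theorem inl_mem_crossedGens (hm : 1 < m) {x y : Finset ℤ} {w : Fin m → ℚ} {g p q : ℤ} {f : LPP m k}
    (h : FirstTwo (f.up g) p q) : Sum.inl f ∈ crossedGens x y w g ↔
      f ∈ LPP.gens x y w ∧ f.val q < f.val p := by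
  obtain ⟨rfl, rfl⟩ := h.sInf_eq (f.finite_up hm g)
  rfl

/-- A full turn adds one start. One period later it either passed already or lies beyond `g`, so the
added start is at least one period before the first start; equality means that the first strand is
the one prolonged. -/
theorem upSum_uncross_inr (hm : 1 < m) {b : LPP m k} {g : ℤ} (h : 0 < (b.up g).ncard) {h' : LPP m k}
    (hE : b.Ext h') : (uncross g (Sum.inr b)).upSum hm g ≤ h'.upSum hm g ∧
      ((uncross g (Sum.inr b)).upSum hm g = h'.upSum hm g → h' = uncross g (Sum.inr b)) := by
  classical
  obtain ⟨i, hi, hle, hov, rfl⟩ := hE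
  obtain ⟨h1, -⟩ := uncross_inr hm h
  obtain ⟨h2, h3⟩ := LPP.sInf_up_mem hm h
  obtain ⟨n, hn1, hn2, hn3, hn4⟩ := LPP.exists_up_wind_eq hm hi hle g
  have hp := period_pos hm
  have hnot : sInf (b.up g) - period m ∉ b.up g := fun hc => by have := h3 _ hc; omega
  have e1 := LPP.upSum_insert hm hnot h1
  have e2 := LPP.upSum_insert hm hn1 hn4
  have h4 : sInf (b.up g) ≤ i + n * period m + period m := by
    have hlt : i + n * period m < g := by omega
    by_cases hg : i + n * period m + period m < g
    · exact h3 _ ⟨by rw [LPP.add_period_mem_dom, LPP.add_mem_dom]; exact hi, hg, by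
        rw [LPP.val_add_period, LPP.val_add]; exact hn3⟩
    · have := h2.2.1
      omega
  rw [e1, e2]
  refine ⟨by omega, fun he => ?_⟩
  have hs : sInf (b.up g) = i + (n + 1) * period m := by rw [add_mul]; omega
  have hA : b.ExtAt (b.val i) (b.wind (b.val i) 1) := ⟨i, hi, rfl, hle, hov, rfl⟩
  obtain ⟨-, -, -, -, -, hA'⟩ := hA.add (n + 1)
  rw [hA', uncross, hs, LPP.val_add]

theorem uncross_inr_inj (hm : 1 < m) {b b' : LPP m k} {g : ℤ} (h : 0 < (b.up g).ncard)
    (h' : 0 < (b'.up g).ncard) (he : uncross g (Sum.inr b) = uncross g (Sum.inr b')) : b = b' := by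
  have h1 := ((uncross_inr hm h).2.eq (he ▸ (uncross_inr hm h').2)).2
  have hd := (LPP.sInf_up_mem hm h).1.1
  have hd' := (LPP.sInf_up_mem hm h').1.1
  rw [← h1] at hd'
  rw [uncross, uncross, ← h1] at he
  have hv := congrArg (fun f => f.val (sInf (b.up g))) he
  simp only [LPP.val_wind_self _ _ hd, LPP.val_wind_self _ _ hd'] at hv
  have hv' : b.val (sInf (b.up g)) = b'.val (sInf (b.up g)) := by omega
  rw [← b.wind_wind hd 1, ← b'.wind_wind hd' 1, he, hv']

/-- If the first two strands are successive translates, the strand can be shortened by a full turn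
and still pass from `p + period m`, where it becomes the first. -/
theorem exists_uncross_inr_eq (hm : 1 < m) {x y : Finset ℤ} {w : Fin m → ℚ} {f : LPP m k} {g p : ℤ}
    (hf : f ∈ LPP.gens x y w) (h : FirstTwo (f.up g) p (p + period m)) :
    ∃ b ∈ LPP.gens x y (w - 1), uncross g (Sum.inr b) = f := by
  have hp := period_pos hm
  obtain ⟨hpd, hpg, hfp⟩ := h.left_mem
  obtain ⟨hq, hqg, hfq⟩ := h.right_mem
  set q := p + period m with hqe
  have hvq : f.val q = f.val p + period m := by rw [hqe, LPP.val_add_period]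
  set b := f.wind (f.val q) (-1) with hb
  have hqb : q ∈ b.dom := by simpa [hb]
  have hbq : b.val q = f.val q + -1 * period m := by rw [hb, LPP.val_wind_self _ _ hq]
  have hw : b.wind (b.val q) 1 = f := by
    have := f.wind_wind hq (-1)
    rwa [neg_neg, ← hb, ← hbq] at this
  have hle : q ≤ b.val q := by omega
  obtain ⟨n, hn1, hn2, hn3, hn4⟩ := LPP.exists_up_wind_eq hm hqb hle g
  rw [hw] at hn4
  have hneg : n < 0 := by
    by_contra hc
    have : 0 ≤ n * period m := mul_nonneg (by omega) hp.le
    omega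
  have hnq : n * period m < 0 := mul_neg_of_neg_of_pos hneg hp
  have hi : q + n * period m = p := by
    rcases h.le_of_mem (q + n * period m) (hn4 ▸ Set.mem_insert _ _) with h1 | h1 <;> omega
  rw [hi] at hn1 hn4
  have hqu : q ∈ b.up g := by
    have := h.right_mem
    rw [hn4] at this
    rcases this with h1 | h1
    · omega
    · exact h1
  have hs : sInf (b.up g) = q := by
    obtain ⟨h1, h2⟩ := LPP.sInf_up_mem hm ((Set.ncard_pos (b.finite_up hm g)).2 ⟨q, hqu⟩)
    have h3 := h2 q hqu
    rcases h.le_of_mem _ (hn4 ▸ Set.mem_insert_of_mem _ h1) with h4 | h4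
    · exact absurd (h4 ▸ h1) hn1
    · omega
  refine ⟨b, ?_, ?_⟩
  · rw [← LPP.wind_mem_gens_iff hm hqb hle, hw]; exact hf
  · rw [uncross, hs, hw]

/-- A generator whose first two strands cross is matched with its resolution there, and `X b` with
the full turn of the first strand of `b`. The key is `upSum` of the partner: resolutions do not
lower it, and equality forces the starts to agree and identifies the term. -/
theorem matching_of_two_le (hm : 1 < m) {x y : IdemState m k} {w : Fin m → ℚ} {g : ℤ}
    (hg : ∀ t : LPP m k ⊕ LPP m k, t ∈ gens x.carrier y.carrier w → 2 ≤ level t g) :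
    Matching x.carrier y.carrier w (crossedGens x.carrier y.carrier w g)
      (fun s : LPP m k ⊕ LPP m k => Sum.inl (uncross g s))
      (Sum.elim (fun f : LPP m k => f.upSum hm g)
        (fun b => (uncross g (Sum.inr b)).upSum hm g)) ∧
    ∀ t : LPP m k ⊕ LPP m k, t ∈ gens x.carrier y.carrier w →
      t ∈ crossedGens x.carrier y.carrier w g ∨
        ∃ s ∈ crossedGens x.carrier y.carrier w g, Sum.inl (uncross g s) = t := by
  have hp := period_pos hm
  have hf2 : ∀ f : LPP m k, f ∈ LPP.gens x.carrier y.carrier w →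
      FirstTwo (f.up g) (sInf (f.up g)) (second (f.up g)) := by
    intro f hf
    have := hg _ (Or.inl ⟨f, hf, rfl⟩)
    simp only [level] at this
    exact firstTwo_sInf (f.finite_up hm g) (by omega)
  have hb1 : ∀ b : LPP m k, b ∈ LPP.gens x.carrier y.carrier (w - 1) → 0 < (b.up g).ncard := by
    intro b hb
    have := hg _ (Or.inr ⟨b, hb, rfl⟩)
    simp only [level] at this
    omega
  have hne : ∀ f : LPP m k, Sum.inl f ∈ crossedGens x.carrier y.carrier w g → ∀ p,
      ¬ FirstTwo (f.up g) (p - period m) p := by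
    intro f hf p hc
    have h1 := (inl_mem_crossedGens hm hc).1 hf
    have h2 := h1.2
    rw [LPP.val_sub_period] at h2
    omega
  refine ⟨⟨?_, ?_, ?_, ?_⟩, ?_⟩
  · rintro (f | b) h
    · exact Or.inl ⟨f, h.1, rfl⟩
    · exact Or.inr ⟨b, h, rfl⟩
  · rintro (f | b) h
    · exact ⟨_, _, (hf2 f h.1).isCover hm h.2, rfl⟩
    · obtain ⟨⟨h1, h2, h3⟩, h4⟩ := LPP.sInf_up_mem hm (hb1 b h)
      refine ⟨_, h1, by omega, fun l hl hlt => ?_, rfl⟩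
      by_contra hc
      have := h4 l ⟨hl, by omega, by omega⟩
      omega
  · rintro (f | b) h h'
    · have h1 := hf2 f h.1
      have h2 := (h1.isRightCrossing h.2).not_equivalent
      have h3 := ((inl_mem_crossedGens hm (h1.swap h2)).1 h').2
      rw [LPP.val_swap _ h1.left_mem.1 h1.right_mem.1, LPP.val_swap _ h1.left_mem.1 h1.right_mem.1,
        swapOrbits_self_left, swapOrbits_self_right h2] at h3
      exact absurd h.2 h3.not_gt
    · exact hne _ h' _ (uncross_inr hm (hb1 b h)).2
  · rintro (f | b) h (f' | b') h' hr
    · obtain ⟨i, j, hc, he⟩ := hr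
      have h1 := hf2 f h.1
      have h1' := hf2 f' h'.1
      have hu : (uncross g (Sum.inl f')).up g = f'.up g := h1'.up_swap hm h'.2
      obtain ⟨h2, h3⟩ := LPP.upSum_le_upSum_swap hm hc.1 g
      rw [← he, LPP.upSum_congr hm hu] at h2 h3
      -- If the sum does not grow, the starts at `g` are the same. The first two strands of `f`
      -- become uncrossed, so by `FirstTwo.eq_swap` the resolution is the one at their crossing.
      rcases h2.lt_or_eq with h2 | h2
      · exact Or.inr h2
      left
      have hup := (hu.symm.trans (h3 h2)).symm
      have hlt' : (f.swap i j).val (sInf (f.up g)) < (f.swap i j).val (second (f.up g)) := by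
        rw [← he, uncross, hup, LPP.val_swap _ h1'.left_mem.1 h1'.right_mem.1,
          LPP.val_swap _ h1'.left_mem.1 h1'.right_mem.1, swapOrbits_self_left,
          swapOrbits_self_right (h1'.isRightCrossing h'.2).not_equivalent]
        exact h'.2
      have h5 := h1.eq_swap h.2 hc (by rw [← he]; exact hu.trans hup.symm) hlt'
      rw [← he, uncross, ← hup] at h5
      rw [← hup] at h1'
      have h6 : f'.swap (sInf (f.up g)) (second (f.up g)) =
        f.swap (sInf (f.up g)) (second (f.up g)) := h5
      rw [← LPP.swap_swap f h1.left_mem.1 h1.right_mem.1 (h1.isRightCrossing h.2).not_equivalent,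
        ← h6, LPP.swap_swap f' (hup.subset h1'.left_mem).1 (hup.subset h1'.right_mem).1
          (h1.isRightCrossing h.2).not_equivalent]
    · obtain ⟨i, j, hc, he⟩ := hr
      right
      obtain ⟨h2, h3⟩ := LPP.upSum_le_upSum_swap hm hc.1 g
      rw [← he] at h2 h3
      -- Equality would make the first two strands of `f` translates of each other, and translates
      -- do not cross.
      refine lt_of_le_of_ne h2 fun h4 => ?_
      exact hne f h _ (h3 h4 ▸ (uncross_inr hm (hb1 b' h')).2)
    · right
      have h1' := hf2 f' h'.1
      have hu : (uncross g (Sum.inl f')).up g = f'.up g := h1'.up_swap hm h'.2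
      obtain ⟨h2, h3⟩ := upSum_uncross_inr hm (hb1 b h) hr
      rw [LPP.upSum_congr hm hu] at h2 h3
      refine lt_of_le_of_ne h2 fun h4 => hne f' h' (sInf (b.up g)) ?_
      rw [← hu, h3 h4]
      exact (uncross_inr hm (hb1 b h)).2
    · obtain ⟨h2, h3⟩ := upSum_uncross_inr hm (hb1 b h) hr
      rcases h2.lt_or_eq with h2 | h2
      · exact Or.inr h2
      · exact Or.inl (congrArg _ (uncross_inr_inj hm (hb1 b h) (hb1 b' h') (h3 h2).symm))
  · rintro t (⟨f, hf, rfl⟩ | ⟨b, hb, rfl⟩)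
    · have h1 := hf2 f hf
      -- First two strands in one orbit: the partner is a multiple of `X`. Otherwise they cross
      -- already, or exchanging their values gives the crossed partner.
      by_cases he : Equivalent m (sInf (f.up g)) (second (f.up g))
      · rw [h1.eq_add_period hm he] at h1
        obtain ⟨b, hb, hbe⟩ := exists_uncross_inr_eq hm hf h1
        exact Or.inr ⟨_, hb, congrArg _ hbe⟩
      rcases lt_trichotomy (f.val (second (f.up g))) (f.val (sInf (f.up g))) with h2 | h2 | h2
      · exact Or.inl ⟨hf, h2⟩
      · exact absurd (f.val_inj h1.right_mem.1 h1.left_mem.1 h2) h1.lt.ne'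
      · right
        set p := sInf (f.up g)
        set q := second (f.up g)
        have h3 := h1.swap he
        have hd1 := h1.left_mem.1
        have hd2 := h1.right_mem.1
        have hlt : (f.swap p q).val q < (f.swap p q).val p := by
          rwa [LPP.val_swap _ hd1 hd2, LPP.val_swap _ hd1 hd2, swapOrbits_self_left,
            swapOrbits_self_right he]
        have hss : (f.swap p q).swap p q = f := f.swap_swap hd1 hd2 he
        refine ⟨Sum.inl (f.swap p q), (inl_mem_crossedGens hm h3).2 ⟨?_, hlt⟩, congrArg _ ?_⟩
        · rw [← LPP.swap_mem_gens_iff hm (h3.isRightCrossing hlt), hss]; exact hf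
        · rw [uncross, (h3.sInf_eq (LPP.finite_up hm _ g)).1, (h3.sInf_eq (LPP.finite_up hm _ g)).2]
          exact hss
    · exact Or.inl hb

theorem subsingleton_of_two_le (hm : 1 < m) {x y : IdemState m k} {w : Fin m → ℚ} {g : ℤ}
    (hg : ∀ t : LPP m k ⊕ LPP m k, t ∈ gens x.carrier y.carrier w → 2 ≤ level t g) :
    Subsingleton (Homology m k x.carrier y.carrier w) :=
  subsingleton_of_matching hm (sqZero hm) (matching_of_two_le hm hg).1 (matching_of_two_le hm hg).2

end QuoX

/-! ### Broken strands -/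

namespace LPP

variable {m k : ℕ}

/-- At most one strand passes each half-integer from the left. -/
def Flat (f : LPP m k) : Prop := ∀ g, (f.up g).ncard ≤ 1

theorem Flat.eq (hm : 1 < m) {f : LPP m k} (hf : f.Flat) {g i j : ℤ} (hi : i ∈ f.up g)
    (hj : j ∈ f.up g) : i = j :=
  (Set.ncard_le_one (f.finite_up hm g)).1 (hf g) i hi j hj

/-- A strand that moves to the right ends at `p` and another one starts at `p`. -/
def Broken (f : LPP m k) (p : ℤ) : Prop :=
  p ∈ f.dom ∧ p < f.val p ∧ ∃ q ∈ f.dom, q < p ∧ f.val q = p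

theorem Broken.add {f : LPP m k} {p : ℤ} (h : f.Broken p) (n : ℤ) :
    f.Broken (p + n * period m) := by
  obtain ⟨h1, h2, q, h3, h4, h5⟩ := h
  exact ⟨(f.add_mem_dom _ _).2 h1, by rw [val_add]; omega, q + n * period m,
    (f.add_mem_dom _ _).2 h3, by omega, by rw [val_add]; omega⟩

theorem Broken.not_mirror {f : LPP m k} {p : ℤ} (h : f.Broken p) : ¬ f.Broken (1 - p) := by
  rintro ⟨-, h', -⟩
  rw [val_mirror] at h'
  have := h.2.1
  omega

/-- If a right-moving strand starts at `p`, flatness forces the incoming strand to end at `p`. If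
the strand from `p` moves left, the right-moving one passes over `p`, so the strand ending at `p`
comes from the right. -/
theorem fix_or_broken (hm : 1 < m) {f : LPP m k} (hf : f.Flat) {p : ℤ} (hd : p ∈ f.dom)
    (hr : p ∈ f.ran) (h0 : (f.up p).Nonempty) (h1 : (f.up (p + 1)).Nonempty) :
    f.val p = p ∨ f.Broken p ∨ f.Broken (1 - p) := by
  obtain ⟨i, hi, hip, hfi⟩ := h0
  obtain ⟨j, hj, hjp, hfj⟩ := h1
  rcases lt_trichotomy (f.val p) p with h | h | h
  · right; right
    have hjp' : j ≠ p := fun h => by subst h; omega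
    have he : i = j := hf.eq hm ⟨hi, hip, hfi⟩ (⟨hj, by omega, by omega⟩ : j ∈ f.up p)
    obtain ⟨a, ha, hfa⟩ := mem_ran_iff.1 hr
    have hap : p < a := by
      rcases lt_trichotomy a p with h2 | h2 | h2
      · have := hf.eq hm ⟨hi, hip, hfi⟩ (⟨ha, h2, by omega⟩ : a ∈ f.up p)
        subst he this
        omega
      · subst h2; omega
      · exact h2
    exact ⟨by simpa, by rw [val_mirror]; omega, 1 - a, by simpa, by omega, by
      rw [val_mirror, hfa]⟩
  · exact Or.inl h
  · right; left
    refine ⟨hd, h, i, hi, hip, ?_⟩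
    by_contra hne
    have := hf.eq hm (⟨hd, by omega, by omega⟩ : p ∈ f.up (p + 1)) (⟨hi, by omega, by omega⟩)
    omega

/-- The effect of a resolution of the crossing of the strand from `i` with the fixed point `p`. -/
theorem swap_fixed_cases {f : LPP m k} {i p : ℤ} (h : f.IsRightCrossing i p) (hp : f.val p = p)
    (l : ℤ) :
    (f.swap i p).val l = f.val l ∧ ¬ Equivalent m i l ∧ ¬ Equivalent m p l ∨
    (∃ n, l = i + n * period m ∧ (f.swap i p).val l = p + n * period m ∧
      f.val l = f.val i + n * period m) ∨
    (∃ n, l = 1 - p + n * period m ∧ (f.swap i p).val l = 1 - f.val i + n * period m ∧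
      f.val l = l) ∨
    (∃ n, l = p + n * period m ∧ (f.swap i p).val l = f.val i + n * period m ∧ f.val l = l) ∨
    (∃ n, l = 1 - i + n * period m ∧ (f.swap i p).val l = 1 - p + n * period m ∧
      f.val l = 1 - f.val i + n * period m) := by
  have hv := val_swap f h.left_mem h.right_mem
  by_cases hi : Equivalent m i l
  · obtain ⟨n, rfl | rfl⟩ := equivalent_iff.1 hi
    · refine Or.inr (Or.inl ⟨n, rfl, ?_, val_add ..⟩)
      rw [val_add, hv, swapOrbits_self_left, hp]
    · refine Or.inr (Or.inr (Or.inr (Or.inr ⟨n, rfl, ?_, by rw [val_add, val_mirror]⟩)))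
      rw [val_add, val_mirror, hv, swapOrbits_self_left, hp]
  by_cases hj : Equivalent m p l
  · obtain ⟨n, rfl | rfl⟩ := equivalent_iff.1 hj
    · refine Or.inr (Or.inr (Or.inr (Or.inl ⟨n, rfl, ?_, by rw [val_add, hp]⟩)))
      rw [val_add, hv, swapOrbits_self_right h.not_equivalent]
    · refine Or.inr (Or.inr (Or.inl ⟨n, rfl, ?_, by rw [val_add, val_mirror, hp]⟩))
      rw [val_add, val_mirror, hv, swapOrbits_self_right h.not_equivalent]
  · exact Or.inl ⟨by rw [hv, swapOrbits_of_not hi hj], hi, hj⟩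

/-- Breaking a strand at `p` adds starts and ends only in the orbit of `p`; at other points motion
to the right starts and ends as before. -/
theorem broken_swap_fixed_iff {f : LPP m k} {i p : ℤ} (h : f.IsRightCrossing i p)
    (hp : f.val p = p) {q : ℤ} (hq : ¬ Equivalent m p q) :
    (f.swap i p).Broken q ↔ f.Broken q := by
  have hip := h.lt
  have hpi : p < f.val i := hp ▸ h.val_lt
  have e1 : ∀ n, q ≠ p + n * period m := fun n hn => hq (hn ▸ equivalent_add m p n)
  have e2 : ∀ n, q ≠ 1 - p + n * period m := fun n hn => hq (equivalent_iff.2 ⟨n, Or.inr hn⟩)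
  have c := f.swap_fixed_cases h hp
  rw [Broken, Broken, dom_swap]
  refine and_congr_right fun _ => and_congr ?_ ⟨?_, ?_⟩
  · rcases c q with ⟨h1, -, -⟩ | ⟨n, h1, h2, h3⟩ | ⟨n, h1, -⟩ | ⟨n, h1, -⟩ | ⟨n, h1, h2, h3⟩
    · rw [h1]
    · constructor <;> intro <;> omega
    · exact absurd h1 (e2 n)
    · exact absurd h1 (e1 n)
    · constructor <;> intro <;> omega
  · rintro ⟨a, ha, haq, hfa⟩
    rcases c a with ⟨h1, -, -⟩ | ⟨n, h1, h2, h3⟩ | ⟨n, h1, h2, h3⟩ | ⟨n, h1, h2, h3⟩ |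
      ⟨n, h1, h2, h3⟩
    · exact ⟨a, ha, haq, by rw [← h1, hfa]⟩
    · exact absurd (hfa.symm.trans h2) (e1 n)
    · omega
    · exact ⟨i + n * period m, (f.add_mem_dom _ _).2 h.left_mem, by omega, by
        rw [val_add]; omega⟩
    · exact absurd (hfa.symm.trans h2) (e2 n)
  · rintro ⟨a, ha, haq, hfa⟩
    rcases c a with ⟨h1, -, -⟩ | ⟨n, h1, h2, h3⟩ | ⟨n, h1, h2, h3⟩ | ⟨n, h1, h2, h3⟩ |
      ⟨n, h1, h2, h3⟩
    · exact ⟨a, ha, haq, by rw [h1, hfa]⟩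
    · refine ⟨p + n * period m, (f.add_mem_dom _ _).2 h.right_mem, by omega, ?_⟩
      rw [val_add, val_swap f h.left_mem h.right_mem, swapOrbits_self_right h.not_equivalent]
      omega
    · omega
    · omega
    · omega

theorem broken_swap_fixed {f : LPP m k} {i p : ℤ} (h : f.IsRightCrossing i p) (hp : f.val p = p) :
    (f.swap i p).Broken p := by
  have hv := val_swap f h.left_mem h.right_mem
  refine ⟨by simpa using h.right_mem, ?_, i, by simpa using h.left_mem, h.lt, ?_⟩
  · rw [hv, swapOrbits_self_right h.not_equivalent]; exact hp ▸ h.val_lt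
  · rw [hv, swapOrbits_self_left, hp]

end LPP

/-! ### The differential for levels at most one: breaking a strand at a fixed point -/

namespace QuoX

variable {m k : ℕ}

/-- The lifted partial permutation underlying a generator of `Q'`. -/
def strands : LPP m k ⊕ LPP m k → LPP m k := Sum.elim id id

/-- All levels are at most one. -/
def Flat (t : LPP m k ⊕ LPP m k) : Prop := ∀ g, level t g ≤ 1

theorem Flat.inl {f : LPP m k} (h : Flat (Sum.inl f)) : f.Flat := fun g => by
  have := h g
  simp only [level] at this
  exact_mod_cast this

/-- The element `X` already accounts for level one everywhere, so no strand of `b` is allowed to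
move. -/
theorem Flat.inr (hm : 1 < m) {b : LPP m k} (h : Flat (Sum.inr b)) {l : ℤ} (hl : l ∈ b.dom) :
    b.val l = l := by
  have key : ∀ l ∈ b.dom, b.val l ≤ l := by
    intro l hl
    by_contra hc
    have h1 := h (l + 1)
    have h2 : 0 < (b.up (l + 1)).ncard :=
      (Set.ncard_pos (b.finite_up hm _)).2 ⟨l, hl, by omega, by omega⟩
    simp only [level] at h1
    omega
  have h1 := key l hl
  have h2 := key (1 - l) (by simpa)
  rw [LPP.val_mirror] at h2
  omega

/-- The point `p` is fixed. -/
def IsFix (t : LPP m k ⊕ LPP m k) (p : ℤ) : Prop :=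
  p ∈ (strands t).dom ∧ (strands t).val p = p

/-- A strand that moves to the right ends at `p` and another one starts at `p`. -/
def IsBroken : LPP m k ⊕ LPP m k → ℤ → Prop
  | Sum.inl f, p => f.Broken p
  | Sum.inr _, _ => False

theorem IsFix.not_isBroken {t : LPP m k ⊕ LPP m k} {p : ℤ} (h : IsFix t p) : ¬ IsBroken t p := by
  rcases t with f | b
  · intro h'
    have h1 : f.val p = p := h.2
    have h2 := h'.2.1
    omega
  · exact fun h' => h'

theorem IsFix.add {t : LPP m k ⊕ LPP m k} {p : ℤ} (h : IsFix t p) (n : ℤ) :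
    IsFix t (p + n * period m) :=
  ⟨((strands t).add_mem_dom _ _).2 h.1, by rw [LPP.val_add, h.2]⟩

theorem IsFix.mirror {t : LPP m k ⊕ LPP m k} {p : ℤ} (h : IsFix t p) : IsFix t (1 - p) :=
  ⟨((strands t).mirror_mem_dom _).2 h.1, by rw [LPP.val_mirror, h.2]⟩

/-- `h` is obtained from `t` by breaking, at the fixed point `p`, the strand that passes `p` from the
left; the role of this strand is played by `X` if there is none. -/
def BreakAt : LPP m k ⊕ LPP m k → ℤ → LPP m k → Prop
  | Sum.inl f, p, h => f.val p = p ∧ ∃ i, f.IsCover i p ∧ h = f.swap i p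
  | Sum.inr b, p, h => p ∈ b.dom ∧ b.val p = p ∧ h = b.wind p 1

theorem BreakAt.isFix {t : LPP m k ⊕ LPP m k} {p : ℤ} {h : LPP m k} (H : BreakAt t p h) :
    IsFix t p := by
  rcases t with f | b
  · obtain ⟨h1, i, h2, -⟩ := H
    exact ⟨h2.1.right_mem, h1⟩
  · exact ⟨H.1, H.2.1⟩

theorem BreakAt.rel (hm : 1 < m) {t : LPP m k ⊕ LPP m k} (ht : Flat t) {p : ℤ} {h : LPP m k}
    (H : BreakAt t p h) : Rel t (Sum.inl h) := by
  rcases t with f | b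
  · obtain ⟨-, i, h2, h3⟩ := H
    exact ⟨i, p, h2, h3⟩
  · obtain ⟨h1, h2, h3⟩ := H
    exact ⟨p, h1, h2.ge, fun l hl hlp => by rw [ht.inr hm hl, h2]; exact hlp, by rw [h2]; exact h3⟩

theorem BreakAt.add {t : LPP m k ⊕ LPP m k} {p : ℤ} {h : LPP m k} (H : BreakAt t p h) (n : ℤ) :
    BreakAt t (p + n * period m) h := by
  rcases t with f | b
  · obtain ⟨h1, i, h2, rfl⟩ := H
    exact ⟨by rw [LPP.val_add, h1], i + n * period m, (h2.translate n).1, (h2.translate n).2.symm⟩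
  · obtain ⟨h1, h2, rfl⟩ := H
    refine ⟨(b.add_mem_dom _ _).2 h1, by rw [LPP.val_add, h2], ?_⟩
    obtain ⟨γ, hγ⟩ := exists_transl m n
    refine LPP.ext_val (by simp) fun l hl => ?_
    rw [LPP.dom_wind] at hl
    rw [LPP.val_wind _ _ _ hl, LPP.val_wind _ _ _ hl, ← swapOrbits_smul_smul γ p, hγ, hγ,
      add_right_comm]

/-- If both strands of a contributing crossing moved, both would pass `j + 1/2`. So the second one
is stationary and the resolution breaks the first at its position. -/
theorem exists_breakAt_of_rel (hm : 1 < m) {t : LPP m k ⊕ LPP m k} (ht : Flat t) {h : LPP m k}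
    (H : Rel t (Sum.inl h)) : ∃ p, BreakAt t p h := by
  rcases t with f | b
  · obtain ⟨i, j, hc, rfl⟩ := H
    have h1 := hc.1.lt
    have h2 := hc.1.le_val
    have h3 := hc.1.val_lt
    refine ⟨j, ?_, i, hc, rfl⟩
    by_contra hne
    have := ht.inl.eq hm (⟨hc.1.left_mem, by omega, by omega⟩ : i ∈ f.up (j + 1))
      (⟨hc.1.right_mem, by omega, by omega⟩ : j ∈ f.up (j + 1))
    omega
  · obtain ⟨i, hi, -, -, rfl⟩ := H
    have h1 := ht.inr hm hi
    exact ⟨i, hi, h1, by rw [h1]⟩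

/-- Only one strand passes `p`, so nothing can lie in the rectangle and the affine clause holds:
every break at a passed fixed point contributes. -/
theorem exists_breakAt (hm : 1 < m) {t : LPP m k ⊕ LPP m k} (ht : Flat t) {p : ℤ}
    (hp : IsFix t p) (h1 : level t p = 1) : ∃ h, BreakAt t p h := by
  have hpp := period_pos hm
  rcases t with f | b
  · obtain ⟨i, hi⟩ : (f.up p).Nonempty :=
      (Set.ncard_pos (f.finite_up hm p)).1 (by simp only [level] at h1; omega)
    have hv : f.val p = p := hp.2
    have hiu := hi
    obtain ⟨hid, hip, hle⟩ := hi
    have hne : f.val i ≠ p := fun h => hip.ne (f.val_inj hid hp.1 (h.trans hv.symm))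
    refine ⟨_, hv, i, ⟨⟨hid, hp.1, hip, hv.ge, by omega⟩, ?_, ?_⟩, rfl⟩
    · intro c hc h1 h2 h3 h4
      have := ht.inl.eq hm hiu (⟨hc, h2, by omega⟩ : c ∈ f.up p)
      omega
    · rintro ⟨h1, h2⟩
      have := ht.inl.eq hm hiu (⟨by simpa, h1, by rw [LPP.val_add_period]; omega⟩ :
        i + period m ∈ f.up p)
      omega
  · exact ⟨_, hp.1, hp.2, rfl⟩

theorem BreakAt.unique (hm : 1 < m) {t : LPP m k ⊕ LPP m k} (ht : Flat t) {p : ℤ} {h h' : LPP m k}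
    (H : BreakAt t p h) (H' : BreakAt t p h') : h = h' := by
  rcases t with f | b
  · obtain ⟨h1, i, h2, rfl⟩ := H
    obtain ⟨-, j, h3, rfl⟩ := H'
    have := h2.1.val_lt
    have := h3.1.val_lt
    rw [ht.inl.eq hm (⟨h2.1.left_mem, h2.1.lt, by omega⟩ : i ∈ f.up p)
      (⟨h3.1.left_mem, h3.1.lt, by omega⟩ : j ∈ f.up p)]
  · rw [H.2.2, H'.2.2]

theorem wind_fixed {b : LPP m k} {p : ℤ} (hp : p ∈ b.dom) (hv : b.val p = p) (n : ℤ) :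
    (b.wind p 1).val (p + n * period m) = p + period m + n * period m ∧
      (b.wind p 1).val (1 - p + n * period m) = 1 - p - period m + n * period m ∧
        ∀ l ∈ b.dom, ¬ Equivalent m p l → (b.wind p 1).val l = b.val l := by
  have h1 := b.val_wind_self 1 hp
  rw [hv] at h1
  refine ⟨by rw [LPP.val_add, h1]; ring, by rw [LPP.val_add, LPP.val_mirror, h1]; ring,
    fun l hl hne => ?_⟩
  have := b.val_wind_of_not 1 hp hl hne
  rwa [hv] at this

theorem BreakAt.broken (hm : 1 < m) {t : LPP m k ⊕ LPP m k} {p : ℤ} {h : LPP m k}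
    (H : BreakAt t p h) : h.Broken p := by
  have hpp := period_pos hm
  rcases t with f | b
  · obtain ⟨h1, i, h2, rfl⟩ := H
    exact LPP.broken_swap_fixed h2.1 h1
  · obtain ⟨h1, h2, rfl⟩ := H
    have h3 := (wind_fixed h1 h2 0).1
    have h4 := (wind_fixed h1 h2 (-1)).1
    rw [zero_mul, add_zero, add_zero] at h3
    exact ⟨by simpa, by omega, p + -1 * period m, by rw [LPP.add_mem_dom]; simpa, by omega, by omega⟩

theorem BreakAt.broken_iff (hm : 1 < m) {t : LPP m k ⊕ LPP m k} (ht : Flat t) {p q : ℤ}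
    {h : LPP m k} (H : BreakAt t p h) (hq : ¬ Equivalent m p q) : h.Broken q ↔ IsBroken t q := by
  rcases t with f | b
  · obtain ⟨h1, i, h2, rfl⟩ := H
    exact LPP.broken_swap_fixed_iff h2.1 h1 hq
  · obtain ⟨h1, h2, rfl⟩ := H
    refine iff_of_false ?_ fun h => h
    rintro ⟨h3, h4, -⟩
    rw [LPP.dom_wind] at h3
    rw [(wind_fixed h1 h2 0).2.2 q h3 hq, ht.inr hm h3] at h4
    exact lt_irrefl _ h4

/-- A fixed point that becomes broken is the one at which the strand is broken. -/
theorem BreakAt.of_broken {t : LPP m k ⊕ LPP m k} {j p : ℤ} {h : LPP m k}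
    (hm : 1 < m) (ht : Flat t) (H : BreakAt t j h) (hp : IsFix t p) (hb : h.Broken p) :
    BreakAt t p h := by
  by_cases he : Equivalent m j p
  · obtain ⟨n, rfl | rfl⟩ := equivalent_iff.1 he
    · exact H.add n
    · have h1 := ((H.add (-n)).broken hm).not_mirror
      rw [show 1 - (j + -n * period m) = 1 - j + n * period m by ring] at h1
      exact absurd hb h1
  · exact absurd ((H.broken_iff hm ht he).1 hb) hp.not_isBroken

/-- The strand that ends at `p` after the break is the one to be rejoined. It is a translate of the
strand from `p` exactly when the original generator is a multiple of `X`, so the two kinds cannot be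
confused. -/
theorem BreakAt.injective (hm : 1 < m) {t t' : LPP m k ⊕ LPP m k} {p : ℤ} {h : LPP m k}
    (ht : Flat t) (ht' : Flat t') (H : BreakAt t p h) (H' : BreakAt t' p h) : t = t' := by
  have key : ∀ f b : LPP m k, BreakAt (Sum.inl f) p h → BreakAt (Sum.inr b) p h → False := by
    rintro f b ⟨h1, i, h2, rfl⟩ ⟨h3, h4, h5⟩
    have h6 : (f.swap i p).val i = p := by
      rw [LPP.val_swap _ h2.1.left_mem h2.1.right_mem, swapOrbits_self_left, h1]
    have hi : i ∈ (f.swap i p).dom := by simpa using h2.1.left_mem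
    have h7 := (wind_fixed h3 h4 (-1)).1
    rw [← h5] at h7
    have hp : p + -1 * period m ∈ (f.swap i p).dom := by
      rw [LPP.add_mem_dom]; simpa using h2.1.right_mem
    have := (f.swap i p).val_inj hi hp (by rw [h6, h7]; ring)
    exact h2.1.not_equivalent (Equivalent.symm (this ▸ equivalent_add m p (-1)))
  rcases t with f | b <;> rcases t' with f' | b'
  · obtain ⟨h1, i, h2, rfl⟩ := H
    obtain ⟨h3, i', h4, h5⟩ := H'
    have e1 : (f.swap i p).val i = p := by
      rw [LPP.val_swap _ h2.1.left_mem h2.1.right_mem, swapOrbits_self_left, h1]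
    have e2 : (f.swap i p).val i' = p := by
      rw [h5, LPP.val_swap _ h4.1.left_mem h4.1.right_mem, swapOrbits_self_left, h3]
    have hi : i ∈ (f.swap i p).dom := by simpa using h2.1.left_mem
    have hi' : i' ∈ (f.swap i p).dom := by rw [h5]; simpa using h4.1.left_mem
    obtain rfl := LPP.val_inj _ hi hi' (e1.trans e2.symm)
    rw [← f.swap_swap h2.1.left_mem h2.1.right_mem h2.1.not_equivalent, h5,
      f'.swap_swap h4.1.left_mem h4.1.right_mem h2.1.not_equivalent]
  · exact (key _ _ H H').elim
  · exact (key _ _ H' H).elim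
  · obtain ⟨h1, h2, rfl⟩ := H
    obtain ⟨h3, h4, h5⟩ := H'
    refine congrArg Sum.inr (LPP.ext_val ?_ fun l hl => ?_)
    · have := congrArg LPP.dom h5
      simpa using this
    · have hl' : l ∈ b'.dom := by
        have := congrArg LPP.dom h5
        simp only [LPP.dom_wind] at this
        rwa [← this]
      rw [ht.inr hm hl, ht'.inr hm hl']

/-- Rejoin the two strands at `p`. If they are translates of each other, rejoining would close up a
loop, and the preimage is a multiple of `X` instead. -/
theorem exists_breakAt_of_broken (hm : 1 < m) {x y : IdemState m k} {w : Fin m → ℚ} {h : LPP m k}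
    (hh : h ∈ LPP.gens x.carrier y.carrier w)
    (hflat : ∀ t : LPP m k ⊕ LPP m k, t ∈ gens x.carrier y.carrier w → Flat t) {p : ℤ}
    (hb : h.Broken p) : ∃ t ∈ gens x.carrier y.carrier w, BreakAt t p h := by
  have hpp := period_pos hm
  have hfl := (hflat _ (Or.inl ⟨h, hh, rfl⟩)).inl
  obtain ⟨hp, hlt, q, hq, hqp, hv⟩ := hb
  have hqu : q ∈ h.up p := ⟨hq, hqp, hv.ge⟩
  by_cases he : Equivalent m p q
  · obtain ⟨n, hn | hn⟩ := equivalent_iff.1 he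
    · have hn0 : n < 0 := by
        by_contra hc
        have : 0 ≤ n * period m := mul_nonneg (by omega) hpp.le
        omega
      have hn1 : n = -1 := by
        by_contra hc
        have h1 : n * period m ≤ -2 * period m := mul_le_mul_of_nonneg_right (by omega) hpp.le
        have := hfl.eq hm hqu (⟨by simpa, by omega, by rw [LPP.val_add_period]; omega⟩ :
          q + period m ∈ h.up p)
        omega
      have hpq : p = q + 1 * period m := by subst hn1; omega
      have hvp : h.val p = p + period m := by rw [hpq, LPP.val_add, hv]; omega
      set b := h.wind (h.val p) (-1) with hbd
      have hbp : p ∈ b.dom := by simpa [hbd]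
      have hbv : b.val p = p := by rw [hbd, LPP.val_wind_self _ _ hp, hvp]; ring
      have hw : b.wind p 1 = h := by
        have := h.wind_wind hp (-1)
        rwa [neg_neg, ← hbd, hvp, show p + period m + -1 * period m = p by ring] at this
      refine ⟨Sum.inr b, Or.inr ⟨b, ?_, rfl⟩, hbp, hbv, hw.symm⟩
      rw [← LPP.wind_mem_gens_iff hm hbp hbv.ge, hbv, hw]
      exact hh
    · exfalso
      have h1 := hv
      rw [hn, LPP.val_add, LPP.val_mirror] at h1
      omega
  · have he' : ¬ Equivalent m q p := fun h => he h.symm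
    set f := h.swap q p with hf
    have e1 : f.val q = h.val p := by rw [hf, LPP.val_swap _ hq hp, swapOrbits_self_left]
    have e2 : f.val p = p := by rw [hf, LPP.val_swap _ hq hp, swapOrbits_self_right he', hv]
    have hqf : q ∈ f.dom := by simpa [hf]
    have hpf : p ∈ f.dom := by simpa [hf]
    have hss : f.swap q p = h := h.swap_swap hq hp he'
    have hc : f.IsRightCrossing q p := ⟨hqf, hpf, hqp, e2.ge, by omega⟩
    have hfg : f ∈ LPP.gens x.carrier y.carrier w := by
      rw [← LPP.swap_mem_gens_iff hm hc, hss]; exact hh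
    have hffl := (hflat _ (Or.inl ⟨f, hfg, rfl⟩)).inl
    have hqfu : q ∈ f.up p := ⟨hqf, hqp, by omega⟩
    refine ⟨Sum.inl f, Or.inl ⟨f, hfg, rfl⟩, e2, q, ⟨hc, ?_, ?_⟩, hss.symm⟩
    · intro c hc h1 h2 h3 h4
      have := hffl.eq hm hqfu (⟨hc, h2, by omega⟩ : c ∈ f.up p)
      omega
    · rintro ⟨h1, h2⟩
      have := hffl.eq hm hqfu (⟨by simpa, h1, by rw [LPP.val_add_period]; omega⟩ :
        q + period m ∈ f.up p)
      omega

/-! ### The matching given by a set of sites -/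

/-- The elements `p` of `P` such that no strand that moves to the left is broken at `p`. -/
def openSites (P : Finset ℤ) (t : LPP m k ⊕ LPP m k) : Set ℤ := {p | p ∈ P ∧ ¬ IsBroken t (1 - p)}

/-- The first element `p` of `P` such that no strand that moves to the left is broken at `p`. -/
def firstOpen (P : Finset ℤ) (t : LPP m k ⊕ LPP m k) : ℤ := sInf (openSites P t)

theorem firstOpen_mem {P : Finset ℤ} {t : LPP m k ⊕ LPP m k} (h : (openSites P t).Nonempty) :
    firstOpen P t ∈ openSites P t ∧ ∀ p ∈ openSites P t, firstOpen P t ≤ p :=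
  sInf_mem_of_finite (P.finite_toSet.subset fun _ hp => hp.1) h

/-- The generators for which the first open site is a fixed point. -/
def fixedGens (x y : Finset ℤ) (w : Fin m → ℚ) (P : Finset ℤ) : Set (LPP m k ⊕ LPP m k) :=
  {t | t ∈ gens x y w ∧ (openSites P t).Nonempty ∧ IsFix t (firstOpen P t)}

/-- Break a strand at the first open site. -/
def breakFirst (P : Finset ℤ) (t : LPP m k ⊕ LPP m k) : LPP m k :=
  @Classical.epsilon _ ⟨strands t⟩ (BreakAt t (firstOpen P t))

/-- A break never repairs another one: it happens at a fixed point, and the rest is unchanged. Hence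
open sites can only be closed. -/
theorem openSites_subset_of_breakAt (hm : 1 < m) {P : Finset ℤ} {t : LPP m k ⊕ LPP m k}
    (ht : Flat t) {j : ℤ} {h : LPP m k} (H : BreakAt t j h) :
    openSites P (Sum.inl h : LPP m k ⊕ LPP m k) ⊆ openSites P t := by
  rintro q ⟨hq, hb⟩
  refine ⟨hq, fun hc => ?_⟩
  by_cases he : Equivalent m j (1 - q)
  · obtain ⟨n, hn | hn⟩ := equivalent_iff.1 he
    · exact (hn ▸ H.isFix.add n).not_isBroken hc
    · exact (hn ▸ H.isFix.mirror.add n).not_isBroken hc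
  · exact hb ((H.broken_iff hm ht he).2 hc)

/-- A break at a site itself affects the right-moving strand there, whereas a site is closed by a
break of the left-moving one. -/
theorem openSites_eq_of_breakAt (hm : 1 < m) {P : Finset ℤ}
    (hP : ∀ p ∈ P, ∀ q ∈ P, Equivalent m p q → p = q) {t : LPP m k ⊕ LPP m k}
    (ht : Flat t) {p : ℤ} (hp : p ∈ P) {h : LPP m k} (H : BreakAt t p h) :
    openSites P (Sum.inl h : LPP m k ⊕ LPP m k) = openSites P t := by
  refine (openSites_subset_of_breakAt hm ht H).antisymm ?_
  rintro q ⟨hq, hb⟩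
  refine ⟨hq, fun hc => ?_⟩
  by_cases he : Equivalent m p (1 - q)
  · obtain rfl := hP p hp q hq (he.trans (equivalent_mirror m q).symm)
    exact (H.broken hm).not_mirror hc
  · exact hb ((H.broken_iff hm ht he).1 hc)

/-- The hypotheses on a set of sites. -/
structure Sites (x y : Finset ℤ) (w : Fin m → ℚ) (k : ℕ) (P : Finset ℤ) : Prop where
  flat : ∀ t : LPP m k ⊕ LPP m k, t ∈ gens x y w → Flat t
  inj : ∀ p ∈ P, ∀ q ∈ P, Equivalent m p q → p = q
  mem_left : ∀ p ∈ P, p ∈ orbitsOf m x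
  mem_right : ∀ p ∈ P, p ∈ orbitsOf m y
  level_eq : ∀ t : LPP m k ⊕ LPP m k, t ∈ gens x y w → ∀ p ∈ P, level t p = 1
  level_succ_eq : ∀ t : LPP m k ⊕ LPP m k, t ∈ gens x y w → ∀ p ∈ P, level t (p + 1) = 1

theorem Sites.breakAt (hm : 1 < m) {x y : Finset ℤ} {w : Fin m → ℚ} {P : Finset ℤ}
    (hP : Sites x y w k P) {t : LPP m k ⊕ LPP m k} (ht : t ∈ fixedGens x y w P) :
    BreakAt t (firstOpen P t) (breakFirst P t) := by
  obtain ⟨h1, h2, h3⟩ := ht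
  have hex := exists_breakAt hm (hP.flat t h1) h3 (hP.level_eq t h1 _ (firstOpen_mem h2).1.1)
  exact Classical.epsilon_spec (p := BreakAt t (firstOpen P t)) hex

theorem Sites.openSites_breakFirst (hm : 1 < m) {x y : Finset ℤ} {w : Fin m → ℚ} {P : Finset ℤ}
    (hP : Sites x y w k P) {t : LPP m k ⊕ LPP m k} (ht : t ∈ fixedGens x y w P) :
    openSites P (Sum.inl (breakFirst P t) : LPP m k ⊕ LPP m k) = openSites P t :=
  openSites_eq_of_breakAt hm hP.inj (hP.flat t ht.1) (firstOpen_mem ht.2.1).1.1 (hP.breakAt hm ht)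

/-- Along the differential the first open site can only move to the right. If it stays, it was fixed
before and is broken afterwards, so the break took place exactly there, and injectivity of breaking
identifies the source. -/
theorem Sites.matching (hm : 1 < m) {x y : Finset ℤ} {w : Fin m → ℚ} {P : Finset ℤ}
    (hP : Sites x y w k P) :
    Matching x y w (fixedGens x y w P) (fun t : LPP m k ⊕ LPP m k => Sum.inl (breakFirst P t))
      (firstOpen P) := by
  refine ⟨fun t ht => ht.1, fun t ht => (hP.breakAt hm ht).rel hm (hP.flat t ht.1), ?_, ?_⟩
  · rintro t ht ⟨-, -, h⟩
    rw [firstOpen, hP.openSites_breakFirst hm ht] at h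
    exact h.not_isBroken ((hP.breakAt hm ht).broken hm)
  · intro s hs t ht hr
    have hfs := hP.flat s hs.1
    obtain ⟨j, hj⟩ := exists_breakAt_of_rel hm hfs hr
    have hsub := openSites_subset_of_breakAt (P := P) hm hfs hj
    rw [hP.openSites_breakFirst hm ht] at hsub
    have hle := (firstOpen_mem hs.2.1).2 _ (hsub (firstOpen_mem ht.2.1).1)
    rcases hle.lt_or_eq with h | h
    · exact Or.inr h
    have hb := hP.breakAt hm ht
    exact Or.inl (BreakAt.injective hm hfs (hP.flat t ht.1)
      (hj.of_broken hm hfs (h ▸ hs.2.2) (hb.broken hm)) hb)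

/-- The first open site is either fixed, so that the generator is a source, or broken to the right,
and rejoining there gives a source with the same open sites. -/
theorem Sites.mem_or_exists (hm : 1 < m) {x y : IdemState m k} {w : Fin m → ℚ} {P : Finset ℤ}
    (hP : Sites x.carrier y.carrier w k P) {t : LPP m k ⊕ LPP m k}
    (ht : t ∈ gens x.carrier y.carrier w) (hne : (openSites P t).Nonempty) :
    t ∈ fixedGens x.carrier y.carrier w P ∨
      ∃ s ∈ fixedGens x.carrier y.carrier w P, Sum.inl (breakFirst P s) = t := by
  obtain ⟨h1, h2⟩ := (firstOpen_mem hne).1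
  have hfl := hP.flat t ht
  rcases ht with ⟨f, hf, rfl⟩ | ⟨b, hb, rfl⟩
  · have ht : Sum.inl f ∈ gens x.carrier y.carrier w := Or.inl ⟨f, hf, rfl⟩
    have e0 := hP.level_eq _ ht _ h1
    have e1 := hP.level_succ_eq _ ht _ h1
    simp only [level] at e0 e1
    set p := firstOpen P (Sum.inl f : LPP m k ⊕ LPP m k) with hp
    have hd : p ∈ f.dom := by rw [hf.1]; exact hP.mem_right _ h1
    rcases LPP.fix_or_broken hm hfl.inl (p := p) hd (by rw [hf.2.1]; exact hP.mem_left _ h1)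
      ((Set.ncard_pos (f.finite_up hm _)).1 (by omega))
      ((Set.ncard_pos (f.finite_up hm _)).1 (by omega)) with h | h | h
    · exact Or.inl ⟨ht, hne, hd, h⟩
    · obtain ⟨s, hs, hsb⟩ := exists_breakAt_of_broken hm hf hP.flat h
      have hsf := hP.flat s hs
      have he := openSites_eq_of_breakAt hm hP.inj hsf h1 hsb
      have hfo : firstOpen P s = p := by rw [firstOpen, ← he]; rfl
      have hsm : s ∈ fixedGens x.carrier y.carrier w P := ⟨hs, he ▸ hne, hfo ▸ hsb.isFix⟩
      have hbr := hP.breakAt hm hsm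
      rw [hfo] at hbr
      exact Or.inr ⟨s, hsm, congrArg _ (hbr.unique hm hsf hsb)⟩
    · exact absurd h h2
  · have hd : firstOpen P (Sum.inr b : LPP m k ⊕ LPP m k) ∈ b.dom := by
      rw [hb.1]; exact hP.mem_right _ h1
    exact Or.inl ⟨Or.inr ⟨b, hb, rfl⟩, hne, hd, hfl.inr hm hd⟩

theorem Sites.subsingleton (hm : 1 < m) {x y : IdemState m k} {w : Fin m → ℚ} {P : Finset ℤ}
    (hP : Sites x.carrier y.carrier w k P)
    (hne : ∀ t : LPP m k ⊕ LPP m k, t ∈ gens x.carrier y.carrier w → (openSites P t).Nonempty) :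
    Subsingleton (Homology m k x.carrier y.carrier w) :=
  subsingleton_of_matching hm (sqZero hm) (hP.matching hm)
    fun t ht => hP.mem_or_exists hm ht (hne t ht)

theorem Sites.nonempty_equiv (hm : 1 < m) {x y : IdemState m k} {w : Fin m → ℚ} {P : Finset ℤ}
    (hP : Sites x.carrier y.carrier w k P) {c : LPP m k ⊕ LPP m k}
    (hc : c ∈ gens x.carrier y.carrier w) (hco : openSites P c = ∅)
    (huniq : ∀ t ∈ gens x.carrier y.carrier w, openSites P t = ∅ → t = c) :
    Nonempty (Homology m k x.carrier y.carrier w ≃ₗ[ZMod 2] ZMod 2) := by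
  refine nonempty_equiv_of_matching hm (sqZero hm) (hP.matching hm) hc ?_ ?_ ?_
  · rintro ⟨-, h, -⟩
    exact h.ne_empty hco
  · rintro s hs rfl
    rw [hP.openSites_breakFirst hm hs] at hco
    exact hs.2.1.ne_empty hco
  · intro t ht
    rcases (openSites P t).eq_empty_or_nonempty with h | h
    · exact Or.inl (huniq t ht h)
    · exact Or.inr (hP.mem_or_exists hm ht h)

end QuoX

/-! ### Triples that violate the conditions -/

section

variable {m k : ℕ}

theorem IdemState.lt_card_filter_iff (x : IdemState m k) (s : Fin k) (j : ℤ) :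
    (s : ℕ) < (x.carrier.filter (· < j)).card ↔ x.elt s < j := by
  have hmono : StrictMono x.elt := (x.carrier.orderEmbOfFin x.card).strictMono
  have hcard : (x.carrier.filter (· < j)).card =
      (Finset.univ.filter fun t : Fin k => x.elt t < j).card := by
    rw [← Finset.card_image_of_injective _ hmono.injective]
    congr 1
    ext l
    simp only [Finset.mem_filter, Finset.mem_image, Finset.mem_univ, true_and]
    constructor
    · rintro ⟨h1, h2⟩
      rw [← Finset.mem_coe, ← Finset.range_orderEmbOfFin x.carrier x.card] at h1
      obtain ⟨t, rfl⟩ := h1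
      exact ⟨t, h2, rfl⟩
    · rintro ⟨t, h1, rfl⟩
      exact ⟨Finset.orderEmbOfFin_mem _ _ _, h1⟩
  rw [hcard]
  constructor
  · intro h
    by_contra hc
    have : (Finset.univ.filter fun t : Fin k => x.elt t < j) ⊆ Finset.Iio s := by
      intro t ht
      rw [Finset.mem_filter] at ht
      exact Finset.mem_Iio.2 (hmono.lt_iff_lt.1 (by omega))
    have := Finset.card_le_card this
    rw [Fin.card_Iio] at this
    omega
  · intro h
    have : Finset.Iic s ⊆ (Finset.univ.filter fun t : Fin k => x.elt t < j) := by
      intro t ht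
      exact Finset.mem_filter.2 ⟨Finset.mem_univ _,
        (hmono.monotone (Finset.mem_Iic.1 ht)).trans_lt h⟩
    have := Finset.card_le_card this
    rw [Fin.card_Iic] at this
    omega

theorem IdemState.elt_mem (x : IdemState m k) (s : Fin k) : x.elt s ∈ x.carrier :=
  Finset.orderEmbOfFin_mem _ _ _

theorem IdemState.elt_strictMono (x : IdemState m k) : StrictMono x.elt :=
  (x.carrier.orderEmbOfFin x.card).strictMono

theorem LPP.up_succ_of_notMem {f : LPP m k} {l : ℤ} (hd : l ∉ f.dom) (hr : l ∉ f.ran) :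
    f.up (l + 1) = f.up l := by
  ext a
  simp only [mem_up]
  refine and_congr_right fun ha => ?_
  have h1 : a ≠ l := fun h => hd (h ▸ ha)
  have h2 : f.val a ≠ l := fun h => hr (h ▸ val_mem_ran ha)
  omega

namespace QuoX

theorem level_nonneg (t : LPP m k ⊕ LPP m k) (g : ℤ) : 0 ≤ level t g := by
  rcases t with f | b <;> simp only [level] <;> positivity

theorem level_add (t : LPP m k ⊕ LPP m k) (g n : ℤ) : level t (g + n * period m) = level t g := by
  rcases t with f | b <;> simp only [level, LPP.ncard_up_add]

theorem level_of_mem_gens (hm : 1 < m) {x y : IdemState m k} {w : Fin m → ℚ}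
    {t : LPP m k ⊕ LPP m k} (ht : t ∈ gens x.carrier y.carrier w) (i : Fin m) :
    (level t ((i : ℕ) + 1) : ℚ) = w i + countDiff x.carrier y.carrier ((i : ℕ) + 1) / 2 ∧
    (level t (2 - ((i : ℕ) + 1)) : ℚ) = w i - countDiff x.carrier y.carrier ((i : ℕ) + 1) / 2 := by
  rcases ht with ⟨f, hf, rfl⟩ | ⟨b, hb, rfl⟩
  · exact_mod_cast LPP.up_of_mem_gens hm hf i
  · obtain ⟨h1, h2⟩ := LPP.up_of_mem_gens hm hb i
    simp only [level, Int.cast_add, Int.cast_natCast, Int.cast_one, h1, h2, Pi.sub_apply,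
      Pi.one_apply]
    constructor <;> ring

theorem level_sub_level (hm : 1 < m) {x y : IdemState m k} {w : Fin m → ℚ}
    {t : LPP m k ⊕ LPP m k} (ht : t ∈ gens x.carrier y.carrier w) {p : ℤ} (h1 : 1 ≤ p)
    (h2 : p ≤ m) : level t p - level t (2 - p) = countDiff x.carrier y.carrier p := by
  obtain ⟨h3, h4⟩ := level_of_mem_gens hm ht ⟨(p - 1).toNat, by omega⟩
  have hp : (((p - 1).toNat : ℕ) : ℤ) + 1 = p := by omega
  simp only [hp] at h3 h4
  have : ((level t p - level t (2 - p) : ℤ) : ℚ) = countDiff x.carrier y.carrier p := by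
    push_cast
    rw [h3, h4]
    ring
  exact_mod_cast this

theorem level_pos_of_isBroken (hm : 1 < m) {t : LPP m k ⊕ LPP m k} {a : ℤ} (h : IsBroken t a) :
    0 < level t a ∧ 0 < level t (a + 1) := by
  rcases t with f | b
  · obtain ⟨h1, h2, q, h3, h4, h5⟩ := h
    simp only [level, Nat.cast_pos]
    exact ⟨(Set.ncard_pos (f.finite_up hm _)).2 ⟨q, h3, h4, h5.ge⟩,
      (Set.ncard_pos (f.finite_up hm _)).2 ⟨a, h1, by omega, by omega⟩⟩
  · exact h.elim

theorem level_succ_of_notMem {x y : Finset ℤ} {w : Fin m → ℚ} {t : LPP m k ⊕ LPP m k}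
    (ht : t ∈ gens x y w) {l : ℤ} (hx : l ∉ orbitsOf m x) (hy : l ∉ orbitsOf m y) :
    level t (l + 1) = level t l := by
  rcases ht with ⟨f, hf, rfl⟩ | ⟨f, hf, rfl⟩ <;>
    simp only [level, LPP.up_succ_of_notMem (f := f) (hf.1 ▸ hy) (hf.2.1 ▸ hx)]

/-- If all levels are at most one and a triple has generators, then it satisfies the conditions on
the weight. -/
theorem boundedWeight_of_flat (hm : 1 < m) {x y : IdemState m k} {w : Fin m → ℚ}
    {t : LPP m k ⊕ LPP m k} (ht : t ∈ gens x.carrier y.carrier w) (hf : Flat t) :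
    BoundedWeight w := by
  intro i
  obtain ⟨h1, h2⟩ := level_of_mem_gens hm ht i
  have a1 : (level t ((i : ℕ) + 1) : ℚ) ≤ 1 := by exact_mod_cast hf _
  have a2 : (level t (2 - ((i : ℕ) + 1)) : ℚ) ≤ 1 := by exact_mod_cast hf _
  have a3 : (0 : ℚ) ≤ level t ((i : ℕ) + 1) := by exact_mod_cast level_nonneg t _
  have a4 : (0 : ℚ) ≤ level t (2 - ((i : ℕ) + 1)) := by exact_mod_cast level_nonneg t _
  constructor <;> linarith

theorem orbitsOf_mirror (x : Finset ℤ) (l : ℤ) : 1 - l ∈ orbitsOf m x ↔ l ∈ orbitsOf m x := by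
  obtain ⟨γ, hγ⟩ := exists_mirror_one m
  rw [← hγ, smul_mem_orbitsOf]

theorem constantOffStates_of_mem_gens (hm : 1 < m) {x y : IdemState m k} {w : Fin m → ℚ}
    {t : LPP m k ⊕ LPP m k} (ht : t ∈ gens x.carrier y.carrier w) : ConstantOffStates x y w := by
  intro i j hij hx hy
  obtain ⟨h1, h2⟩ := level_of_mem_gens hm ht i
  obtain ⟨h3, h4⟩ := level_of_mem_gens hm ht j
  have hj : ((j : ℕ) : ℤ) ∈ Finset.Icc (1 : ℤ) (m - 1) := Finset.mem_Icc.2 (by omega)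
  rw [← mem_orbitsOf_iff hm x hj] at hx
  rw [← mem_orbitsOf_iff hm y hj] at hy
  have e1 := level_succ_of_notMem ht hx hy
  have e2 := level_succ_of_notMem (l := 1 - ((j : ℕ) : ℤ)) ht
    (by rwa [orbitsOf_mirror]) (by rwa [orbitsOf_mirror])
  have hij' : ((i : ℕ) : ℤ) + 1 = (j : ℕ) := by exact_mod_cast hij
  rw [hij'] at h1 h2
  rw [e1] at h3
  rw [show (2 : ℤ) - ((j : ℕ) + 1) = 1 - (j : ℕ) by ring, ← e2,
    show (1 : ℤ) - (j : ℕ) + 1 = 2 - (j : ℕ) by ring] at h4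
  linarith

theorem mem_orbitsOf_self {x : Finset ℤ} {p : ℤ} (h : p ∈ x) : p ∈ orbitsOf m x :=
  ⟨p, h, Equivalent.refl' p⟩

/-- A failure of interleaving forces, whenever generators exist, a common point of `x` and `y` that
is passed in one direction only on one of its sides. Strands in the other direction cannot be broken
there, so this single site is always open and the matching is complete. -/
theorem subsingleton_of_not_interleaved (hm : 1 < m) {x y : IdemState m k} {w : Fin m → ℚ}
    (hflat : ∀ t : LPP m k ⊕ LPP m k, t ∈ gens x.carrier y.carrier w → Flat t)
    (h : ¬ Interleaved x y) : Subsingleton (Homology m k x.carrier y.carrier w) := by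
  have hxm := fun s => Finset.mem_Icc.1 (x.subset (x.elt_mem s))
  have hym := fun s => Finset.mem_Icc.1 (y.subset (y.elt_mem s))
  have of_site : ∀ p, p ∈ orbitsOf m x.carrier → p ∈ orbitsOf m y.carrier →
      (∀ t : LPP m k ⊕ LPP m k, t ∈ gens x.carrier y.carrier w →
        level t p = 1 ∧ level t (p + 1) = 1 ∧ (level t (1 - p) = 0 ∨ level t (1 - p + 1) = 0)) →
      Subsingleton (Homology m k x.carrier y.carrier w) := by
    intro p hx hy hl
    have hP : Sites x.carrier y.carrier w k {p} := by
      refine ⟨hflat, ?_, ?_, ?_, fun t ht q hq => ?_, fun t ht q hq => ?_⟩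
      · intro a ha b hb _
        rw [Finset.mem_singleton.1 ha, Finset.mem_singleton.1 hb]
      · intro a ha; rwa [Finset.mem_singleton.1 ha]
      · intro a ha; rwa [Finset.mem_singleton.1 ha]
      · rw [Finset.mem_singleton.1 hq]; exact (hl t ht).1
      · rw [Finset.mem_singleton.1 hq]; exact (hl t ht).2.1
    refine hP.subsingleton hm fun t ht => ⟨p, Finset.mem_singleton_self p, fun hb => ?_⟩
    have h1 := level_pos_of_isBroken hm hb
    have h2 := (hl t ht).2.2
    omega
  rw [Interleaved] at h
  push Not at h
  obtain ⟨s, s', hs, h⟩ := h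
  have hss : s < s' := by rw [Fin.lt_def]; omega
  have hx := x.elt_strictMono hss
  have hy := y.elt_strictMono hss
  have cx := x.lt_card_filter_iff
  have cy := y.lt_card_filter_iff
  rcases (show y.elt s' ≤ x.elt s ∨ x.elt s' ≤ y.elt s by omega) with h | h
  · obtain ⟨p, hp⟩ : ∃ p, x.elt s = p := ⟨_, rfl⟩
    have a1 := hxm s
    have hpm := x.elt_mem s
    rw [hp] at a1 h hpm
    -- With indices from zero, exactly `s` elements of `x` and at least `s + 1` elements of `y` lie
    -- below `p`. Levels are zero or one, so the difference is exactly one and `y.elt s'` cannot lie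
    -- below `p`.
    have hdiff : ∀ t : LPP m k ⊕ LPP m k, t ∈ gens x.carrier y.carrier w →
        y.elt s' = p ∧ level t p = 1 ∧ level t (2 - p) = 0 ∧ level t (p + 1) = 1 := by
      intro t ht
      have h1 := level_sub_level hm ht a1.1 (by omega)
      have h2 := level_sub_level hm ht (p := p + 1) (by omega)
        (by omega)
      rw [countDiff] at h1 h2
      have b1 := hflat t ht p
      have b2 := level_nonneg t (2 - p)
      have b3 := hflat t ht (p + 1)
      have b4 := level_nonneg t (2 - (p + 1))
      have d1 := cx s p
      have d2 := cy s p
      have d3 := cy s' p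
      have d4 := cx s' (p + 1)
      have d5 := cy s' (p + 1)
      omega
    by_cases he : y.elt s' = p
    · refine of_site p (mem_orbitsOf_self hpm) (mem_orbitsOf_self (he ▸ y.elt_mem s'))
        fun t ht => ?_
      obtain ⟨-, h1, h2, h3⟩ := hdiff t ht
      exact ⟨h1, h3, Or.inr (by rw [show 1 - p + 1 = 2 - p by ring]; exact h2)⟩
    · have hP : Sites x.carrier y.carrier w k ∅ := ⟨hflat, by simp, by simp, by simp, by simp,
        by simp⟩
      exact hP.subsingleton hm fun t ht => absurd (hdiff t ht).1 he
  · obtain ⟨p, hp⟩ : ∃ p, y.elt s = p := ⟨_, rfl⟩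
    have a1 := hym s
    have hpm := y.elt_mem s
    rw [hp] at a1 h hpm
    have hdiff : ∀ t : LPP m k ⊕ LPP m k, t ∈ gens x.carrier y.carrier w →
        x.elt s' = p ∧ level t p = 0 ∧ level t (2 - p) = 1 ∧ level t (2 - (p + 1)) = 1 := by
      intro t ht
      have h1 := level_sub_level hm ht a1.1 (by omega)
      have h2 := level_sub_level hm ht (p := p + 1) (by omega)
        (by omega)
      rw [countDiff] at h1 h2
      have b1 := hflat t ht (2 - p)
      have b2 := level_nonneg t p
      have b3 := hflat t ht (2 - (p + 1))
      have b4 := level_nonneg t (p + 1)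
      have d1 := cy s p
      have d2 := cx s p
      have d3 := cx s' p
      have d4 := cy s' (p + 1)
      have d5 := cx s' (p + 1)
      omega
    by_cases he : x.elt s' = p
    · refine of_site (1 - p) ((orbitsOf_mirror _ _).2 (mem_orbitsOf_self (he ▸ x.elt_mem s')))
        ((orbitsOf_mirror _ _).2 (mem_orbitsOf_self hpm)) fun t ht => ?_
      obtain ⟨-, h1, h2, h3⟩ := hdiff t ht
      refine ⟨by rw [show 1 - p = 2 - (p + 1) by ring]; exact h3,
        by rw [show 1 - p + 1 = 2 - p by ring]; exact h2, Or.inl ?_⟩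
      rw [sub_sub_cancel]; exact h1
    · have hP : Sites x.carrier y.carrier w k ∅ := ⟨hflat, by simp, by simp, by simp, by simp,
        by simp⟩
      exact hP.subsingleton hm fun t ht => absurd (hdiff t ht).1 he

/-- A level of at least two is one obstruction and the absence of generators another. Otherwise
bounded weight and constancy hold by themselves, and only interleaving can fail. -/
theorem subsingleton_of_not_conditions (hm : 1 < m) {x y : IdemState m k} {w : Fin m → ℚ}
    (h : ¬ (Interleaved x y ∧ BoundedWeight w ∧ ConstantOffStates x y w)) :
    Subsingleton (Homology m k x.carrier y.carrier w) := by
  by_cases h2 : ∃ t : LPP m k ⊕ LPP m k, t ∈ gens x.carrier y.carrier w ∧ ∃ g, 2 ≤ level t g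
  · obtain ⟨t, ht, g, hg⟩ := h2
    exact subsingleton_of_two_le hm fun s hs => by rwa [level_eq hm hs ht g]
  · push Not at h2
    have hflat : ∀ t : LPP m k ⊕ LPP m k, t ∈ gens x.carrier y.carrier w → Flat t :=
      fun t ht g => by have := h2 t ht g; omega
    by_cases hne : ∃ t : LPP m k ⊕ LPP m k, t ∈ gens x.carrier y.carrier w
    · obtain ⟨t, ht⟩ := hne
      exact subsingleton_of_not_interleaved hm hflat fun hi =>
        h ⟨hi, boundedWeight_of_flat hm ht (hflat t ht), constantOffStates_of_mem_gens hm ht⟩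
    · have hP : Sites x.carrier y.carrier w k ∅ := ⟨hflat, by simp, by simp, by simp, by simp,
        by simp⟩
      exact hP.subsingleton hm fun t ht => absurd ⟨t, ht⟩ hne

end QuoX

end

/-! ### Construction of lifted partial permutations -/

namespace LPP

variable {m k : ℕ}

/-- A right-moving strand starts at `l` exactly when the flow begins there or is broken there, and
both are part of the common data. -/
theorem lt_val_of_flat (hm : 1 < m) {f f' : LPP m k} (hf : f.Flat)
    (hu : ∀ g, (f.up g).ncard = (f'.up g).ncard) (hb : ∀ a, f.Broken a → f'.Broken a) {l : ℤ}
    (hl : l ∈ f.dom) (h : l < f.val l) : l < f'.val l := by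
  have hne : ∀ g, (f.up g).Nonempty ↔ (f'.up g).Nonempty := fun g => by
    rw [← Set.ncard_pos (f.finite_up hm g), hu, Set.ncard_pos (f'.finite_up hm g)]
  by_cases h0 : (f.up l).Nonempty
  · obtain ⟨i, hi, hil, hfi⟩ := h0
    refine (hb l ⟨hl, h, i, hi, hil, ?_⟩).2.1
    by_contra hc
    have := hf.eq hm (⟨hi, by omega, by omega⟩ : i ∈ f.up (l + 1)) (⟨hl, by omega, by omega⟩)
    omega
  · rw [hne] at h0
    obtain ⟨j, hj, hjl, hfj⟩ := (hne (l + 1)).1 ⟨l, hl, by omega, by omega⟩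
    by_cases hjl' : j = l
    · rw [← hjl']; omega
    · exact absurd ⟨j, hj, by omega, by omega⟩ h0

/-- If the strand of `f'` went on beyond `f.val l`, then `f` would have another strand starting
there. So `f`, and with it `f'`, would be broken at that point. -/
theorem val_le_of_flat (hm : 1 < m) {f f' : LPP m k} (hf : f.Flat) (hf' : f'.Flat)
    (hu : ∀ g, (f.up g).ncard = (f'.up g).ncard) (hb : ∀ a, f.Broken a → f'.Broken a) {l : ℤ}
    (hl : l ∈ f.dom) (hl' : l ∈ f'.dom) (h : l < f.val l) : f'.val l ≤ f.val l := by
  have hne : ∀ g, (f.up g).Nonempty ↔ (f'.up g).Nonempty := fun g => by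
    rw [← Set.ncard_pos (f.finite_up hm g), hu, Set.ncard_pos (f'.finite_up hm g)]
  by_contra hc
  obtain ⟨j, hj, hjl, hfj⟩ := (hne (f.val l + 1)).2 ⟨l, hl', by omega, by omega⟩
  have hja : j = f.val l := by
    by_contra hne
    have := hf.eq hm (⟨hj, by omega, by omega⟩ : j ∈ f.up (f.val l)) ⟨hl, h, le_rfl⟩
    subst this
    omega
  obtain ⟨-, -, q, hq, hqa, hv⟩ := hb (f.val l) ⟨hja ▸ hj, by rw [← hja]; omega, l, hl, h, rfl⟩
  have := hf'.eq hm (⟨hq, hqa, hv.ge⟩ : q ∈ f'.up (f.val l)) ⟨hl', h, by omega⟩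
  subst this
  omega

/-- If at most one strand passes each half-integer in each direction, then the lifted partial
permutation is determined by its domain, by the half-integers that are passed and by the broken
strands. -/
theorem eq_of_flat (hm : 1 < m) {f f' : LPP m k} (hf : f.Flat) (hf' : f'.Flat)
    (hd : f.dom = f'.dom) (hu : ∀ g, (f.up g).ncard = (f'.up g).ncard)
    (hb : ∀ a, f.Broken a ↔ f'.Broken a) : f = f' := by
  have h1 : ∀ l ∈ f.dom, (l < f.val l ↔ l < f'.val l) := fun l hl =>
    ⟨lt_val_of_flat hm hf hu (fun a => (hb a).1) hl,
      lt_val_of_flat hm hf' (fun g => (hu g).symm) (fun a => (hb a).2) (hd ▸ hl)⟩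
  have h2 : ∀ l ∈ f.dom, l < f.val l → f.val l = f'.val l := fun l hl h => le_antisymm
    (val_le_of_flat hm hf' hf (fun g => (hu g).symm) (fun a => (hb a).2) (hd ▸ hl) hl
      ((h1 l hl).1 h))
    (val_le_of_flat hm hf hf' hu (fun a => (hb a).1) hl (hd ▸ hl) h)
  refine ext_val hd fun l hl => ?_
  have hl' : 1 - l ∈ f.dom := by simpa
  have h3 := h1 l hl
  have h4 := h1 _ hl'
  have h5 := h2 l hl
  have h6 := h2 _ hl'
  rw [val_mirror, val_mirror] at h4 h6
  omega

/-- The lifted partial permutation given by an equivariant map. -/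
def ofMap (S : Set ℤ) (F : ℤ → ℤ) (hS : ∀ (γ : G m) i, γ • i ∈ S ↔ i ∈ S)
    (hk : (orb m '' S).ncard = k) (hF : ∀ (γ : G m) i, F (γ • i) = γ • F i)
    (hinj : ∀ i ∈ S, ∀ j ∈ S, Equivalent m (F i) (F j) → Equivalent m i j) : LPP m k :=
  open Classical in
  { toFun i := if i ∈ S then some (F i) else none
    equivariant γ i := by
      by_cases h : i ∈ S
      · rw [if_pos h, if_pos ((hS γ i).2 h), hF]; rfl
      · rw [if_neg h, if_neg (mt (hS γ i).1 h)]; rfl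
    card_orbits := by
      convert hk using 3
      ext i
      by_cases h : i ∈ S <;> simp [h]
    inj i j a b ha hb hab := by
      by_cases hi : i ∈ S
      · by_cases hj : j ∈ S
        · rw [if_pos hi] at ha
          rw [if_pos hj] at hb
          obtain rfl := Option.some_injective _ ha
          obtain rfl := Option.some_injective _ hb
          exact hinj i hi j hj hab
        · simp [hj] at hb
      · simp [hi] at ha }

theorem toFun_ofMap {S : Set ℤ} {F : ℤ → ℤ} (hS : ∀ (γ : G m) i, γ • i ∈ S ↔ i ∈ S)
    (hk : (orb m '' S).ncard = k) (hF : ∀ (γ : G m) i, F (γ • i) = γ • F i)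
    (hinj : ∀ i ∈ S, ∀ j ∈ S, Equivalent m (F i) (F j) → Equivalent m i j) (i a : ℤ) :
    (ofMap S F hS hk hF hinj).toFun i = some a ↔ i ∈ S ∧ F i = a := by
  by_cases h : i ∈ S <;> simp [ofMap, h]

end LPP

/-- The data that describe a lifted partial permutation with at most one strand passing each
half-integer in each direction: its domain `Y`, its image `X`, the half-integers that are passed and
the places at which strands are broken. -/
structure Flow (m : ℕ) (X Y : Set ℤ) (u B : ℤ → Prop) : Prop where
  pass_add : ∀ g n, u (g + n * period m) ↔ u g
  broken_add : ∀ g n, B (g + n * period m) ↔ B g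
  pass_succ : ∀ g, B g → u (g + 1)
  exists_end : (∃ g, ¬ u g) ∨ ∃ a, B a
  start_mem : ∀ l, (¬ u l ∧ u (l + 1)) ∨ B l → l ∈ Y
  start_mirror : ∀ l, (¬ u l ∧ u (l + 1)) ∨ B l → ¬ ((¬ u (1 - l) ∧ u (1 - l + 1)) ∨ B (1 - l))
  end_mem : ∀ l, (u l ∧ ¬ u (l + 1)) ∨ B l → l ∈ X
  end_mirror : ∀ l, (u l ∧ ¬ u (l + 1)) ∨ B l → ¬ ((u (1 - l) ∧ ¬ u (1 - l + 1)) ∨ B (1 - l))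
  fixed : ∀ l ∈ Y, ¬ ((¬ u l ∧ u (l + 1)) ∨ B l) →
    ¬ ((¬ u (1 - l) ∧ u (1 - l + 1)) ∨ B (1 - l)) →
      l ∈ X ∧ ¬ ((u l ∧ ¬ u (l + 1)) ∨ B l) ∧ ¬ ((u (1 - l) ∧ ¬ u (1 - l + 1)) ∨ B (1 - l))

namespace Flow

/-- A strand that moves to the right starts at `l`. -/
def Start (u B : ℤ → Prop) (l : ℤ) : Prop := (¬ u l ∧ u (l + 1)) ∨ B l

/-- A strand that moves to the right ends at `l`. -/
def End (u B : ℤ → Prop) (l : ℤ) : Prop := (u l ∧ ¬ u (l + 1)) ∨ B l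

/-- The first end to the right of `l`. -/
def next (u B : ℤ → Prop) (l : ℤ) : ℤ := sInf {a | End u B a ∧ l < a}

open Classical in
/-- The strands that start at each start and end at the next end, and their mirror images. -/
def map (u B : ℤ → Prop) (l : ℤ) : ℤ :=
  if Start u B l then next u B l else if Start u B (1 - l) then 1 - next u B (1 - l) else l

variable {m k : ℕ} {X Y : Set ℤ} {u B : ℤ → Prop}

theorem start_add (H : Flow m X Y u B) (l n : ℤ) :
    Start u B (l + n * period m) ↔ Start u B l := by
  rw [Start, Start, H.pass_add, H.broken_add, add_right_comm, H.pass_add]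

theorem end_add (H : Flow m X Y u B) (l n : ℤ) : End u B (l + n * period m) ↔ End u B l := by
  rw [End, End, H.pass_add, H.broken_add, add_right_comm, H.pass_add]

theorem exists_translate_gt {m : ℕ} (hm : 1 < m) (a l : ℤ) : ∃ n : ℤ, l < a + n * period m := by
  have hp := period_pos hm
  refine ⟨|l - a| + 1, ?_⟩
  have h1 := le_abs_self (l - a)
  have h2 : (|l - a| + 1) * 1 ≤ (|l - a| + 1) * period m :=
    mul_le_mul_of_nonneg_left (by omega) (by positivity)
  omega

theorem exists_translate_lt {m : ℕ} (hm : 1 < m) (a l : ℤ) : ∃ n : ℤ, a + n * period m < l := by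
  obtain ⟨n, hn⟩ := exists_translate_gt hm (-a) (-l)
  exact ⟨-n, by rw [neg_mul]; omega⟩

theorem exists_end_gt (hm : 1 < m) (H : Flow m X Y u B) {l : ℤ} (hl : u (l + 1)) :
    ∃ a, End u B a ∧ l < a := by
  rcases H.exists_end with ⟨g, hg⟩ | ⟨a, ha⟩
  · obtain ⟨n, hn⟩ := exists_translate_gt hm g l
    obtain ⟨a, ⟨ha1, ha2⟩, ha3⟩ := Int.exists_least_of_bdd (P := fun a => ¬ u a ∧ l < a)
      ⟨l, fun z hz => hz.2.le⟩ ⟨g + n * period m, by rwa [H.pass_add], hn⟩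
    have hne : a ≠ l + 1 := fun h => ha1 (h ▸ hl)
    refine ⟨a - 1, Or.inl ⟨?_, by rwa [sub_add_cancel]⟩, by omega⟩
    by_contra hc
    have := ha3 (a - 1) ⟨hc, by omega⟩
    omega
  · obtain ⟨n, hn⟩ := exists_translate_gt hm a l
    exact ⟨_, (H.end_add a n).2 (Or.inr ha), hn⟩

theorem pass_of_start (H : Flow m X Y u B) {l : ℤ} (hl : Start u B l) : u (l + 1) :=
  hl.elim (fun h => h.2) (H.pass_succ l)

theorem next_spec (hm : 1 < m) (H : Flow m X Y u B) {l : ℤ} (hl : Start u B l) :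
    End u B (next u B l) ∧ l < next u B l ∧ ∀ a, End u B a → l < a → next u B l ≤ a := by
  have hb : BddBelow {a | End u B a ∧ l < a} := ⟨l, fun a ha => ha.2.le⟩
  obtain ⟨h1, h2⟩ := Int.csInf_mem (s := {a | End u B a ∧ l < a})
    (H.exists_end_gt hm (H.pass_of_start hl)) hb
  exact ⟨h1, h2, fun a ha hla => csInf_le hb ⟨ha, hla⟩⟩

theorem pass_of_lt_next (hm : 1 < m) (H : Flow m X Y u B) {l : ℤ} (hl : Start u B l) {g : ℤ}
    (h1 : l < g) : g ≤ next u B l → u g := by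
  obtain ⟨-, -, h2⟩ := H.next_spec hm hl
  refine Int.leInduction (m := l + 1) (motive := fun g _ => g ≤ next u B l → u g)
    (fun _ => H.pass_of_start hl) (fun g hg ih h => ?_) g h1
  by_contra hc
  have := h2 g (Or.inl ⟨ih (by omega), hc⟩) (by omega)
  omega

/-- All half-integers up to the next end are passed, and a break would itself be an end, so no start
lies strictly between a start and its next end. -/
theorem next_lt_next (hm : 1 < m) (H : Flow m X Y u B) {l l' : ℤ} (hl : Start u B l)
    (hl' : Start u B l') (h : l < l') : next u B l < next u B l' := by
  obtain ⟨-, h1, h2⟩ := H.next_spec hm hl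
  obtain ⟨-, h3, -⟩ := H.next_spec hm hl'
  suffices next u B l ≤ l' by omega
  by_contra hc
  rcases hl' with h4 | h4
  · exact h4.1 (H.pass_of_lt_next hm hl h (by omega))
  · exact hc (h2 l' (Or.inr h4) h)

theorem next_injective (hm : 1 < m) (H : Flow m X Y u B) {l l' : ℤ} (hl : Start u B l)
    (hl' : Start u B l') (h : next u B l = next u B l') : l = l' := by
  rcases lt_trichotomy l l' with h1 | h1 | h1
  · have := H.next_lt_next hm hl hl' h1; omega
  · exact h1
  · have := H.next_lt_next hm hl' hl h1; omega

theorem exists_start_of_not_pass {a g : ℤ} (ha : ¬ u a) (hag : a < g) (hg : u g) :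
    ∃ l, Start u B l ∧ a ≤ l ∧ l < g := by
  obtain ⟨l, ⟨h1, h2⟩, h3⟩ := Int.exists_greatest_of_bdd (P := fun a => ¬ u a ∧ a < g)
    ⟨g, fun z hz => hz.2.le⟩ ⟨a, ha, hag⟩
  refine ⟨l, Or.inl ⟨h1, ?_⟩, h3 a ⟨ha, hag⟩, h2⟩
  by_contra hc
  have hne : l + 1 ≠ g := fun h => hc (h ▸ hg)
  have := h3 (l + 1) ⟨hc, by omega⟩
  omega

theorem exists_start (hm : 1 < m) (H : Flow m X Y u B) {g : ℤ} (hg : u g) :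
    ∃ l, Start u B l ∧ l < g ∧ g ≤ next u B l := by
  have hex : ∃ l, Start u B l ∧ l < g := by
    rcases H.exists_end with ⟨a, ha⟩ | ⟨a, ha⟩
    · obtain ⟨n, hn⟩ := exists_translate_lt hm a g
      obtain ⟨l, h1, -, h2⟩ := exists_start_of_not_pass (B := B) (mt (H.pass_add a n).1 ha) hn hg
      exact ⟨l, h1, h2⟩
    · obtain ⟨n, hn⟩ := exists_translate_lt hm a g
      exact ⟨_, (H.start_add a n).2 (Or.inr ha), hn⟩
  obtain ⟨l, ⟨h1, h2⟩, h3⟩ := Int.exists_greatest_of_bdd (P := fun l => Start u B l ∧ l < g)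
    ⟨g, fun z hz => hz.2.le⟩ hex
  obtain ⟨h4, h5, -⟩ := H.next_spec hm h1
  refine ⟨l, h1, h2, ?_⟩
  by_contra hc
  rcases h4 with ⟨-, h4⟩ | h4
  · have hne : next u B l + 1 ≠ g := fun h => h4 (h ▸ hg)
    obtain ⟨l', h6, h7, h8⟩ := exists_start_of_not_pass (B := B) h4 (by omega) hg
    have := h3 l' ⟨h6, h8⟩
    omega
  · have := h3 _ ⟨Or.inr h4, by omega⟩
    omega

theorem next_add (hm : 1 < m) (H : Flow m X Y u B) {l : ℤ} (hl : Start u B l) (n : ℤ) :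
    next u B (l + n * period m) = next u B l + n * period m := by
  have key : ∀ l n, Start u B l → next u B (l + n * period m) ≤ next u B l + n * period m := by
    intro l n hl
    obtain ⟨h1, h2, -⟩ := H.next_spec hm hl
    exact (H.next_spec hm ((H.start_add l n).2 hl)).2.2 _ ((H.end_add _ n).2 h1) (by omega)
  have h1 := key l n hl
  have h2 := key (l + n * period m) (-n) ((H.start_add l n).2 hl)
  rw [show l + n * period m + -n * period m = l by ring, neg_mul] at h2
  omega

theorem map_of_start {l : ℤ} (hl : Start u B l) : map u B l = next u B l := if_pos hl

theorem map_of_start_mirror (H : Flow m X Y u B) {l : ℤ} (hl : Start u B (1 - l)) :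
    map u B l = 1 - next u B (1 - l) := by
  have := H.start_mirror _ hl
  rw [sub_sub_cancel] at this
  exact (if_neg this).trans (if_pos hl)

theorem map_of_not {l : ℤ} (hl : ¬ Start u B l) (hl' : ¬ Start u B (1 - l)) : map u B l = l :=
  (if_neg hl).trans (if_neg hl')

theorem map_mirror (H : Flow m X Y u B) (l : ℤ) : map u B (1 - l) = 1 - map u B l := by
  by_cases h1 : Start u B l
  · rw [map_of_start h1, H.map_of_start_mirror (by rwa [sub_sub_cancel]), sub_sub_cancel]
  by_cases h2 : Start u B (1 - l)
  · rw [map_of_start h2, H.map_of_start_mirror h2, sub_sub_cancel]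
  · rw [map_of_not h1 h2, map_of_not h2 (by rwa [sub_sub_cancel])]

theorem map_add (hm : 1 < m) (H : Flow m X Y u B) (l n : ℤ) :
    map u B (l + n * period m) = map u B l + n * period m := by
  have e : 1 - (l + n * period m) = 1 - l + -n * period m := by ring
  by_cases h1 : Start u B l
  · rw [map_of_start h1, map_of_start ((H.start_add l n).2 h1), H.next_add hm h1]
  by_cases h2 : Start u B (1 - l)
  · rw [H.map_of_start_mirror h2, H.map_of_start_mirror (by rwa [e, H.start_add]), e,
      H.next_add hm h2]
    ring
  · rw [map_of_not h1 h2, map_of_not (by rwa [H.start_add]) (by rwa [e, H.start_add])]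

theorem map_smul (hm : 1 < m) (H : Flow m X Y u B) (γ : G m) (l : ℤ) :
    map u B (γ • l) = γ • map u B l := by
  rcases smul_cases γ with ⟨n, hn⟩ | ⟨n, hn⟩
  · rw [hn, hn, H.map_add hm]
  · rw [hn, hn, H.map_add hm, H.map_mirror]

/-- Every element of the domain is, up to mirror symmetry, a start or a fixed point. -/
theorem exists_equivalent (H : Flow m X Y u B) {l : ℤ} (hl : l ∈ Y) :
    ∃ l', Equivalent m l l' ∧ Equivalent m (map u B l) (map u B l') ∧
      (Start u B l' ∨ map u B l' = l' ∧ l' ∈ X ∧ ¬ End u B l' ∧ ¬ End u B (1 - l')) := by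
  by_cases h1 : Start u B l
  · exact ⟨l, Equivalent.refl' _, Equivalent.refl' _, Or.inl h1⟩
  by_cases h2 : Start u B (1 - l)
  · exact ⟨1 - l, equivalent_mirror m l, by rw [H.map_mirror]; exact equivalent_mirror m _, Or.inl h2⟩
  · exact ⟨l, Equivalent.refl' _, Equivalent.refl' _,
      Or.inr ⟨map_of_not h1 h2, H.fixed l hl h1 h2⟩⟩

theorem end_of_equivalent (H : Flow m X Y u B) {a b : ℤ} (h : Equivalent m a b)
    (ha : End u B a) : End u B b ∨ End u B (1 - b) := by
  obtain ⟨n, rfl | rfl⟩ := equivalent_iff.1 h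
  · exact Or.inl ((H.end_add a n).2 ha)
  · refine Or.inr ?_
    rw [show 1 - (1 - a + n * period m) = a + -n * period m by ring, H.end_add]
    exact ha

/-- Up to the mirror every point of the domain is a start or a fixed point. Ends determine starts,
no end is the mirror image of an end up to translation, and fixed points are not ends. -/
theorem map_injective (hm : 1 < m) (H : Flow m X Y u B) : ∀ i ∈ Y, ∀ j ∈ Y,
    Equivalent m (map u B i) (map u B j) → Equivalent m i j := by
  intro i hi j hj h
  obtain ⟨i', h1, h2, h3⟩ := H.exists_equivalent hi
  obtain ⟨j', h4, h5, h6⟩ := H.exists_equivalent hj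
  replace h := (h2.symm.trans h).trans h5
  suffices Equivalent m i' j' from (h1.trans this).trans h4.symm
  rcases h3 with h3 | ⟨h3, -, h7, h8⟩ <;> rcases h6 with h6 | ⟨h6, -, h9, h10⟩
  · rw [map_of_start h3, map_of_start h6] at h
    obtain ⟨n, hn | hn⟩ := equivalent_iff.1 h
    · rw [← H.next_add hm h3] at hn
      rw [H.next_injective hm h6 ((H.start_add _ _).2 h3) hn]
      exact equivalent_add m i' n
    · exfalso
      have h7 := (H.next_spec hm h3).1
      have h8 := (H.next_spec hm h6).1
      rw [hn, H.end_add] at h8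
      exact H.end_mirror _ h7 h8
  · rw [map_of_start h3, h6] at h
    rcases H.end_of_equivalent h (H.next_spec hm h3).1 with h | h
    · exact absurd h h9
    · exact absurd h h10
  · rw [map_of_start h6, h3] at h
    rcases H.end_of_equivalent h.symm (H.next_spec hm h6).1 with h | h
    · exact absurd h h7
    · exact absurd h h8
  · rwa [h3, h6] at h

/-- Joining each start to the next end realizes the flow. The segments cover each passed
half-integer once, since the nearest start before it is the only one whose segment reaches it. -/
theorem exists_lpp (hm : 1 < m) {x y : IdemState m k}
    (H : Flow m (orbitsOf m x.carrier) (orbitsOf m y.carrier) u B) : ∃ f : LPP m k,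
      f.dom = orbitsOf m y.carrier ∧ f.ran = orbitsOf m x.carrier ∧
      (∀ g, u g → (f.up g).ncard = 1) ∧ (∀ g, ¬ u g → (f.up g).ncard = 0) ∧
      ∀ a, B a → u a → f.Broken a := by
  set f : LPP m k := LPP.ofMap (orbitsOf m y.carrier) (map u B) smul_mem_orbitsOf
    (ncard_orb_orbitsOf hm y) (H.map_smul hm) (H.map_injective hm) with hf
  have hto : ∀ i a, f.toFun i = some a ↔ i ∈ orbitsOf m y.carrier ∧ map u B i = a :=
    LPP.toFun_ofMap _ _ _ _
  have hd : f.dom = orbitsOf m y.carrier := by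
    ext i
    constructor
    · rintro ⟨a, ha⟩; exact ((hto _ _).1 ha).1
    · intro h; exact ⟨_, (hto _ _).2 ⟨h, rfl⟩⟩
  have hv : ∀ i ∈ orbitsOf m y.carrier, f.val i = map u B i := fun i hi =>
    LPP.val_of_toFun ((hto _ _).2 ⟨hi, rfl⟩)
  have hsub : f.ran ⊆ orbitsOf m x.carrier := by
    intro a ha
    obtain ⟨i, hi, rfl⟩ := LPP.mem_ran_iff.1 ha
    rw [hd] at hi
    rw [hv i hi]
    obtain ⟨j, h1, h2, h3⟩ := H.exists_equivalent hi
    have h4 : map u B j ∈ orbitsOf m x.carrier := by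
      rcases h3 with h3 | ⟨h3, h5, -⟩
      · rw [map_of_start h3]; exact H.end_mem _ (H.next_spec hm h3).1
      · rwa [h3]
    obtain ⟨γ, hγ⟩ := h2
    rwa [← hγ, smul_mem_orbitsOf] at h4
  -- The image consists of orbits of `x`, and both sides have `k` orbits.
  have hr : f.ran = orbitsOf m x.carrier := by
    refine hsub.antisymm fun a ha => ?_
    have hfin : (orb m '' orbitsOf m x.carrier).Finite := by
      refine (x.carrier.finite_toSet.image (orb m)).subset ?_
      rintro _ ⟨a, ⟨b, hb, hab⟩, rfl⟩
      exact ⟨b, hb, orb_eq_iff.2 hab⟩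
    have := Set.eq_of_subset_of_ncard_le (Set.image_mono hsub)
      (by rw [ncard_orb_orbitsOf hm x, f.orb_ran_ncard]) hfin
    obtain ⟨b, hb, hab⟩ := (this.symm ▸ Set.mem_image_of_mem _ ha : orb m a ∈ orb m '' f.ran)
    exact f.mem_ran_of_equivalent (orb_eq_iff.1 hab) hb
  have hup : ∀ g l, l ∈ f.up g ↔ Start u B l ∧ l < g ∧ g ≤ next u B l := by
    intro g l
    constructor
    · rintro ⟨h1, h2, h3⟩
      rw [hd] at h1
      rw [hv l h1] at h3
      by_cases h4 : Start u B l
      · rw [map_of_start h4] at h3; exact ⟨h4, h2, h3⟩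
      by_cases h5 : Start u B (1 - l)
      · rw [H.map_of_start_mirror h5] at h3
        have := (H.next_spec hm h5).2.1
        omega
      · rw [map_of_not h4 h5] at h3; omega
    · rintro ⟨h1, h2, h3⟩
      have h4 := H.start_mem l h1
      exact ⟨hd ▸ h4, h2, by rwa [hv l h4, map_of_start h1]⟩
  refine ⟨f, hd, hr, fun g hg => ?_, fun g hg => ?_, fun a ha hua => ?_⟩
  · obtain ⟨l, h1, h2, h3⟩ := H.exists_start hm hg
    rw [Set.ncard_eq_one]
    refine ⟨l, Set.eq_singleton_iff_unique_mem.2 ⟨(hup g l).2 ⟨h1, h2, h3⟩, fun l' hl' => ?_⟩⟩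
    obtain ⟨h4, h5, h6⟩ := (hup g l').1 hl'
    have key : ∀ a b, Start u B a → Start u B b → a < b → b < g → g ≤ next u B a → False := by
      intro a b ha hb hab hbg hga
      rcases hb with hb | hb
      · exact hb.1 (H.pass_of_lt_next hm ha hab (by omega))
      · have := (H.next_spec hm ha).2.2 b (Or.inr hb) hab
        omega
    rcases lt_trichotomy l l' with h | h | h
    · exact (key l l' h1 h4 h h5 h3).elim
    · exact h.symm
    · exact (key l' l h4 h1 h h2 h6).elim
  · rw [Set.ncard_eq_zero (f.finite_up hm g), Set.eq_empty_iff_forall_notMem]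
    intro l hl
    obtain ⟨h1, h2, h3⟩ := (hup g l).1 hl
    exact hg (H.pass_of_lt_next hm h1 h2 h3)
  · have hs : Start u B a := Or.inr ha
    have hy := H.start_mem a hs
    obtain ⟨l, h1, h2, h3⟩ := H.exists_start hm hua
    have h4 := (H.next_spec hm h1).2.2 a (Or.inr ha) h2
    have hyl := H.start_mem l h1
    exact ⟨hd ▸ hy, by rw [hv a hy, map_of_start hs]; exact (H.next_spec hm hs).2.1, l,
      hd ▸ hyl, h2, by rw [hv l hyl, map_of_start h1]; omega⟩

end Flow

/-! ### The levels of an admissible triple -/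

section

variable {m k : ℕ}

theorem card_filter_lt_succ (x : Finset ℤ) (j : ℤ) :
    ((x.filter (· < j + 1)).card : ℤ) = (x.filter (· < j)).card + if j ∈ x then 1 else 0 := by
  split_ifs with h
  · have : x.filter (· < j + 1) = insert j (x.filter (· < j)) := by
      ext l
      simp only [Finset.mem_filter, Finset.mem_insert]
      constructor
      · rintro ⟨h1, h2⟩
        rcases lt_or_eq_of_le (Int.lt_add_one_iff.1 h2) with h3 | h3
        · exact Or.inr ⟨h1, h3⟩
        · exact Or.inl h3
      · rintro (rfl | ⟨h1, h2⟩)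
        · exact ⟨h, by omega⟩
        · exact ⟨h1, by omega⟩
    rw [this, Finset.card_insert_of_notMem (by simp)]
    push_cast
    rfl
  · have : x.filter (· < j + 1) = x.filter (· < j) := by
      refine Finset.filter_congr fun l hl => ?_
      have : l ≠ j := fun h' => h (h' ▸ hl)
      omega
    rw [this, add_zero]

theorem countDiff_succ (x y : Finset ℤ) (j : ℤ) :
    countDiff x y (j + 1) = countDiff x y j + (if j ∈ y then 1 else 0) - if j ∈ x then 1 else 0 := by
  rw [countDiff, countDiff, card_filter_lt_succ, card_filter_lt_succ]
  ring

theorem countDiff_one (x y : IdemState m k) : countDiff x.carrier y.carrier 1 = 0 := by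
  have : ∀ x : IdemState m k, x.carrier.filter (· < 1) = ∅ := fun x =>
    Finset.filter_eq_empty_iff.2 fun l hl => by
      have := Finset.mem_Icc.1 (x.subset hl); omega
  simp [countDiff, this]

theorem countDiff_last (x y : IdemState m k) : countDiff x.carrier y.carrier m = 0 := by
  have : ∀ x : IdemState m k, x.carrier.filter (· < (m : ℤ)) = x.carrier := fun x =>
    Finset.filter_eq_self.2 fun l hl => by
      have := Finset.mem_Icc.1 (x.subset hl); omega
  simp [countDiff, this, x.card, y.card]

theorem card_filter_le (x : IdemState m k) (j : ℤ) : (x.carrier.filter (· < j)).card ≤ k :=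
  (Finset.card_filter_le _ _).trans x.card.le

theorem exists_elt_eq (x : IdemState m k) {p : ℤ} (hp : p ∈ x.carrier) : ∃ s, x.elt s = p := by
  rw [← Finset.mem_coe, ← Finset.range_orderEmbOfFin x.carrier x.card] at hp
  exact hp

theorem Interleaved.symm {x y : IdemState m k} (h : Interleaved x y) : Interleaved y x :=
  fun s t hst => by rw [max_comm, min_comm]; exact h s t hst

/-- If `a` elements of `x` and at least `a + 2` of `y` were below `j`, then `x_a < y_{a+1} < j`
(indices from zero) would give one more element of `x` below `j`. -/
theorem Interleaved.card_le {x y : IdemState m k} (h : Interleaved x y) (j : ℤ) :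
    (y.carrier.filter (· < j)).card ≤ (x.carrier.filter (· < j)).card + 1 := by
  by_contra hc
  push Not at hc
  have hk := card_filter_le y j
  set a := (x.carrier.filter (· < j)).card with ha
  have h1 := (y.lt_card_filter_iff ⟨a + 1, by omega⟩ j).1 hc
  have h2 := h ⟨a, by omega⟩ ⟨a + 1, by omega⟩ rfl
  have h3 := (x.lt_card_filter_iff ⟨a, by omega⟩ j).2 (by omega)
  exact lt_irrefl _ h3

theorem Interleaved.card_le_of_mem {x y : IdemState m k} (h : Interleaved x y) {p : ℤ}
    (hx : p ∈ x.carrier) (hy : p ∈ y.carrier) :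
    (y.carrier.filter (· < p)).card ≤ (x.carrier.filter (· < p)).card := by
  obtain ⟨s, rfl⟩ := exists_elt_eq x hx
  obtain ⟨t, ht⟩ := exists_elt_eq y hy
  have h1 := x.lt_card_filter_iff s (x.elt s)
  have h2 := y.lt_card_filter_iff t (x.elt s)
  suffices (t : ℕ) ≤ s by
    by_contra hc
    have hlt : (x.carrier.filter (· < x.elt s)).card < k := by
      have := card_filter_le y (x.elt s); omega
    have h3 := x.lt_card_filter_iff ⟨_, hlt⟩ (x.elt s)
    have h4 : s ≤ ⟨_, hlt⟩ := by
      by_contra hc'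
      exact lt_irrefl _ (h3.2 (x.elt_strictMono (not_le.1 hc')))
    have h5 : (s : ℕ) ≤ (x.carrier.filter (· < x.elt s)).card := h4
    omega
  by_contra hc
  have h3 := h s ⟨s + 1, by omega⟩ rfl
  have h4 : y.elt ⟨s + 1, by omega⟩ ≤ y.elt t := y.elt_strictMono.monotone (Fin.le_def.2 (by
    simp only; omega))
  omega

theorem Interleaved.abs_countDiff_le {x y : IdemState m k} (h : Interleaved x y) (j : ℤ) :
    -1 ≤ countDiff x.carrier y.carrier j ∧ countDiff x.carrier y.carrier j ≤ 1 := by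
  have h1 := h.card_le j
  have h2 := h.symm.card_le j
  rw [countDiff]
  omega

theorem Interleaved.countDiff_eq_zero {x y : IdemState m k} (h : Interleaved x y) {p : ℤ}
    (hx : p ∈ x.carrier) (hy : p ∈ y.carrier) : countDiff x.carrier y.carrier p = 0 := by
  have h1 := h.card_le_of_mem hx hy
  have h2 := h.symm.card_le_of_mem hy hx
  rw [countDiff]
  omega

/-- The numbers of strands that pass the half-integers are zero or one. -/
theorem levels_of_conditions {x y : IdemState m k} {w : Fin m → ℚ} (hw : Compatible x y w)
    (hi : Interleaved x y) (hb : BoundedWeight w) (i : Fin m) :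
    (w i + countDiff x.carrier y.carrier ((i : ℕ) + 1) / 2 = 0 ∨
      w i + countDiff x.carrier y.carrier ((i : ℕ) + 1) / 2 = 1) ∧
    (w i - countDiff x.carrier y.carrier ((i : ℕ) + 1) / 2 = 0 ∨
      w i - countDiff x.carrier y.carrier ((i : ℕ) + 1) / 2 = 1) := by
  obtain ⟨n, hn, he⟩ := hw i
  obtain ⟨h1, h2⟩ := hb i
  obtain ⟨h3, h4⟩ := hi.abs_countDiff_le ((i : ℕ) + 1)
  have hn0 : 0 ≤ n := by
    have : (0 : ℚ) ≤ n := by rw [← hn]; linarith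
    exact_mod_cast this
  have hn2 : n ≤ 2 := by
    have : (n : ℚ) ≤ 2 := by rw [← hn]; linarith
    exact_mod_cast this
  have hwi : w i = n / 2 := by linarith
  have hc : ∃ r, n + countDiff x.carrier y.carrier ((i : ℕ) + 1) = 2 * r := by
    obtain ⟨r, hr⟩ := he
    rw [countDiff]
    exact ⟨r - (x.carrier.filter (· < ((i : ℕ) : ℤ) + 1)).card, by omega⟩
  obtain ⟨r, hr⟩ := hc
  generalize countDiff x.carrier y.carrier ((i : ℕ) + 1) = c at *
  have hcases : (n = 0 ∧ c = 0) ∨ (n = 2 ∧ c = 0) ∨ (n = 1 ∧ c = 1) ∨ (n = 1 ∧ c = -1) := by omega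
  rw [hwi]
  rcases hcases with ⟨rfl, rfl⟩ | ⟨rfl, rfl⟩ | ⟨rfl, rfl⟩ | ⟨rfl, rfl⟩ <;> norm_num

/-- A strand passes `g - 1/2` from the left. -/
def Pass (x y : Finset ℤ) (w : Fin m → ℚ) (g : ℤ) : Prop :=
  ∃ i : Fin m, (∃ n, g = (i : ℕ) + 1 + n * period m ∧ w i + countDiff x y ((i : ℕ) + 1) / 2 = 1) ∨
    ∃ n, 2 - g = (i : ℕ) + 1 + n * period m ∧ w i - countDiff x y ((i : ℕ) + 1) / 2 = 1

theorem pass_add (x y : Finset ℤ) (w : Fin m → ℚ) (g n : ℤ) :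
    Pass x y w (g + n * period m) ↔ Pass x y w g := by
  refine exists_congr fun i => or_congr ⟨?_, ?_⟩ ⟨?_, ?_⟩
  · rintro ⟨a, h1, h2⟩; exact ⟨a - n, by linarith, h2⟩
  · rintro ⟨a, h1, h2⟩; exact ⟨a + n, by linarith, h2⟩
  · rintro ⟨a, h1, h2⟩; exact ⟨a + n, by linarith, h2⟩
  · rintro ⟨a, h1, h2⟩; exact ⟨a - n, by linarith, h2⟩

theorem eq_zero_or_of_bounds {N a n : ℤ} (h : a = n * N) (h1 : -N < a) (h2 : a ≤ N) (hN : 0 < N) :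
    a = 0 ∨ a = N := by
  have h3 : -1 < n := by by_contra hc; nlinarith
  have h4 : n ≤ 1 := by by_contra hc; nlinarith
  have : n = 0 ∨ n = 1 := by omega
  rcases this with rfl | rfl
  · left; rw [h, zero_mul]
  · right; rw [h, one_mul]

/-- The indices represent each half-integer once up to translation and mirror. Only the two walls
equal their mirror images up to translation; there `countDiff` vanishes and the two clauses of
`Pass` agree. -/
theorem pass_index (hm : 1 < m) (x y : IdemState m k) (w : Fin m → ℚ) (i : Fin m) :
    (Pass x.carrier y.carrier w ((i : ℕ) + 1) ↔
      w i + countDiff x.carrier y.carrier ((i : ℕ) + 1) / 2 = 1) ∧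
    (Pass x.carrier y.carrier w (2 - ((i : ℕ) + 1)) ↔
      w i - countDiff x.carrier y.carrier ((i : ℕ) + 1) / 2 = 1) := by
  have hp := period_pos hm
  have hpm : period m = 2 * m - 2 := rfl
  have hi := i.2
  have same : ∀ (j : Fin m) (n : ℤ), ((i : ℕ) : ℤ) + 1 = (j : ℕ) + 1 + n * period m → j = i := by
    intro j n h
    have hj := j.2
    apply Fin.ext
    rcases eq_zero_or_of_bounds (a := ((i : ℕ) : ℤ) - (j : ℕ)) (by linarith) (by omega) (by omega) hp
      with h1 | h1 <;> omega
  have opp : ∀ (j : Fin m) (n : ℤ), 2 - (((i : ℕ) : ℤ) + 1) = (j : ℕ) + 1 + n * period m →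
      j = i ∧ countDiff x.carrier y.carrier ((i : ℕ) + 1) = 0 := by
    intro j n h
    have hj := j.2
    rcases eq_zero_or_of_bounds (a := ((i : ℕ) : ℤ) + (j : ℕ)) (n := -n) (by linarith) (by omega)
      (by omega) hp with h1 | h1
    · refine ⟨Fin.ext (by omega), ?_⟩
      rw [show ((i : ℕ) : ℤ) + 1 = 1 by omega, countDiff_one]
    · refine ⟨Fin.ext (by omega), ?_⟩
      rw [show ((i : ℕ) : ℤ) + 1 = m by omega, countDiff_last]
  constructor
  · constructor
    · rintro ⟨j, ⟨n, h1, h2⟩ | ⟨n, h1, h2⟩⟩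
      · rwa [same j n h1] at h2
      · obtain ⟨rfl, h3⟩ := opp j n h1
        rw [h3] at h2 ⊢
        simpa using h2
    · intro h
      exact ⟨i, Or.inl ⟨0, by ring, h⟩⟩
  · constructor
    · rintro ⟨j, ⟨n, h1, h2⟩ | ⟨n, h1, h2⟩⟩
      · obtain ⟨rfl, h3⟩ := opp j n h1
        rw [h3] at h2 ⊢
        simpa using h2
      · rwa [same j n (by linarith)] at h2
    · intro h
      exact ⟨i, Or.inr ⟨0, by ring, h⟩⟩

/-- The states at which strands can be broken in either direction. -/
def brokenSites (x y : Finset ℤ) (w : Fin m → ℚ) : Finset ℤ :=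
  open Classical in (x ∩ y).filter fun p => Pass x y w p ∧ Pass x y w (p + 1)

end

/-! ### The flow of an admissible triple -/

section

variable {m k : ℕ}

open Classical in
/-- The number of strands that pass `g - 1/2` from the left. -/
def passNum (x y : Finset ℤ) (w : Fin m → ℚ) (g : ℤ) : ℤ := if Pass x y w g then 1 else 0

theorem passNum_add (x y : Finset ℤ) (w : Fin m → ℚ) (g n : ℤ) :
    passNum x y w (g + n * period m) = passNum x y w g := by
  classical exact if_congr (pass_add ..) rfl rfl

/-- The conditions of the theorem under which the homology is one-dimensional. -/
structure Admissible (x y : IdemState m k) (w : Fin m → ℚ) : Prop where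
  compatible : Compatible x y w
  interleaved : Interleaved x y
  boundedWeight : BoundedWeight w
  constantOffStates : ConstantOffStates x y w

theorem Admissible.passNum_index (hm : 1 < m) {x y : IdemState m k} {w : Fin m → ℚ}
    (h : Admissible x y w) (i : Fin m) :
    (passNum x.carrier y.carrier w ((i : ℕ) + 1) : ℚ) =
      w i + countDiff x.carrier y.carrier ((i : ℕ) + 1) / 2 ∧
    (passNum x.carrier y.carrier w (2 - ((i : ℕ) + 1)) : ℚ) =
      w i - countDiff x.carrier y.carrier ((i : ℕ) + 1) / 2 := by
  obtain ⟨h1, h2⟩ := pass_index hm x y w i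
  obtain ⟨h3, h4⟩ := levels_of_conditions h.compatible h.interleaved h.boundedWeight i
  rw [passNum, passNum]
  constructor
  · rcases h3 with h3 | h3
    · rw [if_neg (by rw [h1, h3]; norm_num), h3]; norm_num
    · rw [if_pos (h1.2 h3), h3]; norm_num
  · rcases h4 with h4 | h4
    · rw [if_neg (by rw [h2, h4]; norm_num), h4]; norm_num
    · rw [if_pos (h2.2 h4), h4]; norm_num

theorem Admissible.passNum_site (hm : 1 < m) {x y : IdemState m k} {w : Fin m → ℚ}
    (h : Admissible x y w) {r : ℤ} (h1 : 1 ≤ r) (h2 : r ≤ m - 1) :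
    passNum x.carrier y.carrier w r - passNum x.carrier y.carrier w (2 - r) =
      countDiff x.carrier y.carrier r ∧
    passNum x.carrier y.carrier w (r + 1) - passNum x.carrier y.carrier w (1 - r) =
      countDiff x.carrier y.carrier (r + 1) ∧
    (r ∉ x.carrier → r ∉ y.carrier →
      passNum x.carrier y.carrier w r + passNum x.carrier y.carrier w (2 - r) =
      passNum x.carrier y.carrier w (r + 1) + passNum x.carrier y.carrier w (1 - r)) := by
  obtain ⟨n, rfl⟩ : ∃ n : ℕ, r = n + 1 := ⟨(r - 1).toNat, by omega⟩
  have h3 := h.passNum_index hm ⟨n, by omega⟩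
  have h4 := h.passNum_index hm ⟨n + 1, by omega⟩
  have h5 := h.constantOffStates ⟨n, by omega⟩ ⟨n + 1, by omega⟩ rfl
  simp only [Nat.cast_add, Nat.cast_one] at h3 h4 h5
  rw [show (2 : ℤ) - ((n : ℤ) + 1 + 1) = 1 - ((n : ℤ) + 1) by ring] at h4
  obtain ⟨a1, a2⟩ := h3
  obtain ⟨a3, a4⟩ := h4
  refine ⟨?_, ?_, fun hx hy => ?_⟩
  · have : ((passNum x.carrier y.carrier w (n + 1) - passNum x.carrier y.carrier w (2 - (n + 1)) : ℤ)
        : ℚ) = countDiff x.carrier y.carrier (n + 1) := by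
      push_cast [a1, a2]; ring
    exact_mod_cast this
  · have : ((passNum x.carrier y.carrier w (n + 1 + 1) - passNum x.carrier y.carrier w (1 - (n + 1))
        : ℤ) : ℚ) = countDiff x.carrier y.carrier (n + 1 + 1) := by
      push_cast [a3, a4]; ring
    exact_mod_cast this
  · have : ((passNum x.carrier y.carrier w (n + 1) + passNum x.carrier y.carrier w (2 - (n + 1)) : ℤ)
        : ℚ) = ((passNum x.carrier y.carrier w (n + 1 + 1) +
          passNum x.carrier y.carrier w (1 - (n + 1)) : ℤ) : ℚ) := by
      push_cast [a1, a2, a3, a4]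
      rw [h5 hx hy]
      ring
    exact_mod_cast this

/-- The mirror images of the points at which strands can be broken in either direction, and their
translates. -/
def brokenPlaces (x y : Finset ℤ) (w : Fin m → ℚ) (a : ℤ) : Prop :=
  ∃ n, ∃ p ∈ brokenSites x y w, a = 1 - p + n * period m

theorem brokenPlaces_add (x y : Finset ℤ) (w : Fin m → ℚ) (g n : ℤ) :
    brokenPlaces x y w (g + n * period m) ↔ brokenPlaces x y w g := by
  constructor
  · rintro ⟨a, p, hp, h⟩; exact ⟨a - n, p, hp, by linarith⟩
  · rintro ⟨a, p, hp, h⟩; exact ⟨a + n, p, hp, by linarith⟩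

theorem mem_brokenSites {x y : Finset ℤ} {w : Fin m → ℚ} {p : ℤ} : p ∈ brokenSites x y w ↔
    p ∈ x ∧ p ∈ y ∧ Pass x y w p ∧ Pass x y w (p + 1) := by
  simp [brokenSites, and_assoc]

theorem brokenPlaces_site (hm : 1 < m) {x y : IdemState m k} {w : Fin m → ℚ} {r : ℤ}
    (hr : r ∈ Finset.Icc (1 : ℤ) (m - 1)) : ¬ brokenPlaces x.carrier y.carrier w r ∧
    (brokenPlaces x.carrier y.carrier w (1 - r) ↔ r ∈ brokenSites x.carrier y.carrier w) := by
  have hpm : period m = 2 * (m - 1) := by unfold period; ring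
  constructor
  · rintro ⟨n, p, hp, h⟩
    have hpx := x.subset (mem_brokenSites.1 hp).1
    have he : p = r := eq_of_equivalent_of_mem hm (equivalent_iff.2 ⟨n, Or.inr h⟩) hpx hr
    have : 2 * r = 1 + 2 * (n * (m - 1)) := by
      rw [hpm, he] at h
      linear_combination h
    omega
  · constructor
    · rintro ⟨n, p, hp, h⟩
      have hpx := x.subset (mem_brokenSites.1 hp).1
      have he : p = r := eq_of_equivalent_of_mem hm
        (equivalent_iff.2 ⟨-n, Or.inl (by rw [neg_mul]; omega)⟩) hpx hr
      exact he ▸ hp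
    · intro h
      exact ⟨0, r, h, by ring⟩

/-- A finite check at one point: `a` and `b` record motion to the right just before and just after
it, `a'` and `b'` motion to the left. The hypotheses are conservation, equal flow in both directions
at common points, and constant weight off the states. -/
theorem site_cases {a b a' b' rx ry : Prop} [Decidable a] [Decidable b] [Decidable a']
    [Decidable b'] [Decidable rx] [Decidable ry]
    (h1 : (if b then 1 else 0 : ℤ) - (if b' then 1 else 0) = (if a then 1 else 0) -
      (if a' then 1 else 0) + (if ry then 1 else 0) - if rx then 1 else 0)
    (h2 : rx → ry → (if a then 1 else 0 : ℤ) - (if a' then 1 else 0) = 0)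
    (h3 : ¬ rx → ¬ ry → (if a then 1 else 0 : ℤ) + (if a' then 1 else 0) =
      (if b then 1 else 0) + (if b' then 1 else 0)) :
    let S := ¬ a ∧ b
    let S' := (¬ b' ∧ a') ∨ (rx ∧ ry ∧ a ∧ b)
    let E := a ∧ ¬ b
    let E' := (b' ∧ ¬ a') ∨ (rx ∧ ry ∧ a ∧ b)
    (S → ry ∧ ¬ S') ∧ (S' → ry) ∧ (E → rx ∧ ¬ E') ∧ (E' → rx) ∧
      (ry → ¬ S → ¬ S' → rx ∧ ¬ E ∧ ¬ E') := by
  by_cases a <;> by_cases b <;> by_cases a' <;> by_cases b' <;> by_cases rx <;> by_cases ry <;>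
    simp_all

/-- The requirements are invariant under translation and symmetric under the mirror, so they need
checking only at the points `1, …, m - 1`, where they reduce to `site_cases`. -/
theorem Admissible.flow (hm : 1 < m) {x y : IdemState m k} {w : Fin m → ℚ}
    (h : Admissible x y w)
    (hex : (∃ g, ¬ Pass x.carrier y.carrier w g) ∨ ∃ a, brokenPlaces x.carrier y.carrier w a) :
    Flow m (orbitsOf m x.carrier) (orbitsOf m y.carrier) (Pass x.carrier y.carrier w)
      (brokenPlaces x.carrier y.carrier w) := by
  classical
  set u := Pass x.carrier y.carrier w with hu
  set B := brokenPlaces x.carrier y.carrier w with hB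
  set X := orbitsOf m x.carrier with hX
  set Y := orbitsOf m y.carrier with hY
  have hu_add : ∀ g n, u (g + n * period m) ↔ u g := pass_add _ _ _
  have hB_add : ∀ g n, B (g + n * period m) ↔ B g := brokenPlaces_add _ _ _
  have hS_add : ∀ g n, Flow.Start u B (g + n * period m) ↔ Flow.Start u B g := fun g n => by
    rw [Flow.Start, Flow.Start, hu_add, hB_add, add_right_comm, hu_add]
  have hE_add : ∀ g n, Flow.End u B (g + n * period m) ↔ Flow.End u B g := fun g n => by
    rw [Flow.End, Flow.End, hu_add, hB_add, add_right_comm, hu_add]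
  have site : ∀ r : ℤ, 1 ≤ r → r ≤ m - 1 →
      (Flow.Start u B r → r ∈ Y ∧ ¬ Flow.Start u B (1 - r)) ∧ (Flow.Start u B (1 - r) → r ∈ Y) ∧
      (Flow.End u B r → r ∈ X ∧ ¬ Flow.End u B (1 - r)) ∧ (Flow.End u B (1 - r) → r ∈ X) ∧
      (r ∈ Y → ¬ Flow.Start u B r → ¬ Flow.Start u B (1 - r) →
        r ∈ X ∧ ¬ Flow.End u B r ∧ ¬ Flow.End u B (1 - r)) := by
    intro r h1 h2
    have hr := Finset.mem_Icc.2 ⟨h1, h2⟩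
    obtain ⟨a1, a2, a3⟩ := h.passNum_site hm h1 h2
    rw [countDiff_succ, ← a1] at a2
    have a4 : r ∈ x.carrier → r ∈ y.carrier →
        passNum x.carrier y.carrier w r - passNum x.carrier y.carrier w (2 - r) = 0 := fun hx hy =>
      a1.trans (h.interleaved.countDiff_eq_zero hx hy)
    simp only [passNum] at a2 a3 a4
    obtain ⟨b1, b2⟩ := brokenPlaces_site hm (x := x) (y := y) (w := w) hr
    have key := site_cases (a := u r) (b := u (r + 1)) (a' := u (2 - r)) (b' := u (1 - r))
      (rx := r ∈ x.carrier) (ry := r ∈ y.carrier) a2 a4 a3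
    rw [hX, hY, mem_orbitsOf_iff hm x hr, mem_orbitsOf_iff hm y hr]
    rw [mem_brokenSites] at b2
    have e1 : Flow.Start u B r ↔ ¬ u r ∧ u (r + 1) := or_iff_left b1
    have e2 : Flow.End u B r ↔ u r ∧ ¬ u (r + 1) := or_iff_left b1
    have e3 : Flow.Start u B (1 - r) ↔ (¬ u (1 - r) ∧ u (2 - r)) ∨
        (r ∈ x.carrier ∧ r ∈ y.carrier ∧ u r ∧ u (r + 1)) := by
      rw [Flow.Start, show 1 - r + 1 = 2 - r by ring]
      exact or_congr_right b2
    have e4 : Flow.End u B (1 - r) ↔ (u (1 - r) ∧ ¬ u (2 - r)) ∨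
        (r ∈ x.carrier ∧ r ∈ y.carrier ∧ u r ∧ u (r + 1)) := by
      rw [Flow.End, show 1 - r + 1 = 2 - r by ring]
      exact or_congr_right b2
    rw [e1, e2, e3, e4]
    exact key
  have all : ∀ l, (Flow.Start u B l → l ∈ Y ∧ ¬ Flow.Start u B (1 - l)) ∧
      (Flow.End u B l → l ∈ X ∧ ¬ Flow.End u B (1 - l)) ∧
      (l ∈ Y → ¬ Flow.Start u B l → ¬ Flow.Start u B (1 - l) →
        l ∈ X ∧ ¬ Flow.End u B l ∧ ¬ Flow.End u B (1 - l)) := by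
    intro l
    obtain ⟨γ, h1, h2⟩ := exists_rep hm l
    set r := γ • l with hr
    obtain ⟨s1, s2, s3, s4, s5⟩ := site r h1 h2
    have hXl : l ∈ X ↔ r ∈ X := (smul_mem_orbitsOf γ l).symm
    have hYl : l ∈ Y ↔ r ∈ Y := (smul_mem_orbitsOf γ l).symm
    rw [hXl, hYl]
    rcases smul_cases γ with ⟨n, hn⟩ | ⟨n, hn⟩
    · have e1 : l = r + -n * period m := by rw [hr, hn]; ring
      have e2 : 1 - l = 1 - r + n * period m := by rw [e1]; ring
      rw [e2, e1, hS_add, hS_add, hE_add, hE_add]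
      exact ⟨s1, s3, s5⟩
    · have e1 : l = 1 - r + n * period m := by rw [hr, hn]; ring
      have e2 : 1 - l = r + -n * period m := by rw [e1]; ring
      rw [e2, e1, hS_add, hS_add, hE_add, hE_add]
      exact ⟨fun h => ⟨s2 h, fun h' => (s1 h').2 h⟩, fun h => ⟨s4 h, fun h' => (s3 h').2 h⟩,
        fun h h' h'' => by obtain ⟨a, b, c⟩ := s5 h h'' h'; exact ⟨a, c, b⟩⟩
  refine ⟨hu_add, hB_add, ?_, hex, fun l hl => ((all l).1 hl).1, fun l hl => ((all l).1 hl).2,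
    fun l hl => ((all l).2.1 hl).1, fun l hl => ((all l).2.1 hl).2, fun l => (all l).2.2⟩
  intro g hg
  obtain ⟨n, p, hp, rfl⟩ := hg
  rw [mem_brokenSites] at hp
  obtain ⟨hx, hy, h1, h2⟩ := hp
  have hr := Finset.mem_Icc.1 (x.subset hx)
  obtain ⟨a1, -, -⟩ := h.passNum_site hm hr.1 hr.2
  rw [h.interleaved.countDiff_eq_zero hx hy, passNum, if_pos h1, passNum] at a1
  rw [show 1 - p + n * period m + 1 = 2 - p + n * period m by ring, hu_add]
  by_contra hc
  rw [if_neg hc] at a1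
  omega

end

/-! ### Triples that satisfy the conditions -/

namespace QuoX

variable {m k : ℕ}

theorem level_eq_passNum (hm : 1 < m) {x y : IdemState m k} {w : Fin m → ℚ}
    (h : Admissible x y w) {t : LPP m k ⊕ LPP m k} (ht : t ∈ gens x.carrier y.carrier w) (g : ℤ) :
    level t g = passNum x.carrier y.carrier w g := by
  have key : ∀ i : Fin m,
      level t ((i : ℕ) + 1) = passNum x.carrier y.carrier w ((i : ℕ) + 1) ∧
      level t (2 - ((i : ℕ) + 1)) = passNum x.carrier y.carrier w (2 - ((i : ℕ) + 1)) := by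
    intro i
    obtain ⟨h1, h2⟩ := level_of_mem_gens hm ht i
    obtain ⟨h3, h4⟩ := h.passNum_index hm i
    exact ⟨by exact_mod_cast h1.trans h3.symm, by exact_mod_cast h2.trans h4.symm⟩
  obtain ⟨i, ⟨n, hn⟩ | ⟨n, hn⟩⟩ := LPP.exists_weight_index hm g
  · rw [hn, level_add, passNum_add]
    exact (key i).1
  · rw [show g = (2 - ((i : ℕ) + 1)) + (-n) * period m by linarith, level_add, passNum_add]
    exact (key i).2

/-- At a common point `countDiff` vanishes on both sides, so the levels in the two directions agree
there. Sites can therefore be broken either way. -/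
theorem _root_.PongAlg.Admissible.pass_mirror_iff (hm : 1 < m) {x y : IdemState m k} {w : Fin m → ℚ}
    (h : Admissible x y w) {p : ℤ} (hx : p ∈ x.carrier) (hy : p ∈ y.carrier) :
    (Pass x.carrier y.carrier w (2 - p) ↔ Pass x.carrier y.carrier w p) ∧
    (Pass x.carrier y.carrier w (1 - p) ↔ Pass x.carrier y.carrier w (p + 1)) := by
  have hr := Finset.mem_Icc.1 (x.subset hx)
  obtain ⟨a1, a2, -⟩ := h.passNum_site hm hr.1 hr.2
  rw [countDiff_succ, if_pos hx, if_pos hy, h.interleaved.countDiff_eq_zero hx hy] at a2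
  rw [h.interleaved.countDiff_eq_zero hx hy] at a1
  rw [passNum, passNum] at a1 a2
  constructor
  · split_ifs at a1 with h1 h2 h2 <;> simp_all
  · split_ifs at a2 with h1 h2 h2 <;> simp_all

theorem _root_.PongAlg.Admissible.sites (hm : 1 < m) {x y : IdemState m k} {w : Fin m → ℚ}
    (h : Admissible x y w) :
    Sites x.carrier y.carrier w k (brokenSites x.carrier y.carrier w) := by
  refine ⟨fun t ht g => ?_, fun p hp q hq he => ?_, fun p hp => ?_, fun p hp => ?_,
    fun t ht p hp => ?_, fun t ht p hp => ?_⟩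
  · rw [level_eq_passNum hm h ht, passNum]
    split_ifs <;> norm_num
  · exact eq_of_equivalent_of_mem hm he (x.subset (mem_brokenSites.1 hp).1)
      (x.subset (mem_brokenSites.1 hq).1)
  · exact mem_orbitsOf_self (mem_brokenSites.1 hp).1
  · exact mem_orbitsOf_self (mem_brokenSites.1 hp).2.1
  · rw [level_eq_passNum hm h ht, passNum, if_pos (mem_brokenSites.1 hp).2.2.1]
  · rw [level_eq_passNum hm h ht, passNum, if_pos (mem_brokenSites.1 hp).2.2.2]

/-- In a critical generator the broken strands are those that move to the left at each site. -/
theorem broken_iff_of_openSites_eq_empty (hm : 1 < m) {x y : IdemState m k} {w : Fin m → ℚ}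
    (h : Admissible x y w) {f : LPP m k} (hf : f ∈ LPP.gens x.carrier y.carrier w)
    (ho : openSites (brokenSites x.carrier y.carrier w) (Sum.inl f : LPP m k ⊕ LPP m k) = ∅)
    (a : ℤ) : f.Broken a ↔ brokenPlaces x.carrier y.carrier w a := by
  have hcrit : ∀ p ∈ brokenSites x.carrier y.carrier w, f.Broken (1 - p) := by
    intro p hp
    by_contra hc
    exact Set.notMem_empty p (ho ▸ ⟨hp, hc⟩)
  constructor
  · intro hb
    have hpass : ∀ g, 0 < level (Sum.inl f : LPP m k ⊕ LPP m k) g →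
        Pass x.carrier y.carrier w g := by
      intro g hg
      rw [level_eq_passNum hm h (Or.inl ⟨f, hf, rfl⟩), passNum] at hg
      by_contra hc
      rw [if_neg hc] at hg
      exact lt_irrefl _ hg
    obtain ⟨l1, l2⟩ := level_pos_of_isBroken hm (t := (Sum.inl f : LPP m k ⊕ LPP m k)) hb
    replace l1 := hpass _ l1
    replace l2 := hpass _ l2
    obtain ⟨had, -, q, hq, -, hqa⟩ := id hb
    have har : a ∈ f.ran := LPP.mem_ran_iff.2 ⟨q, hq, hqa⟩
    rw [hf.1] at had
    rw [hf.2.1] at har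
    obtain ⟨γ, h1, h2⟩ := exists_rep hm a
    have hr := Finset.mem_Icc.2 ⟨h1, h2⟩
    rw [← smul_mem_orbitsOf γ, mem_orbitsOf_iff hm _ hr] at had har
    obtain ⟨s1, s2⟩ := h.pass_mirror_iff hm har had
    rcases smul_cases γ with ⟨n, hn⟩ | ⟨n, hn⟩
    · have hs : γ • a ∈ brokenSites x.carrier y.carrier w := by
        refine mem_brokenSites.2 ⟨har, had, ?_, ?_⟩
        · rwa [hn, pass_add]
        · rwa [hn, add_right_comm, pass_add]
      have := hcrit _ hs
      rw [hn] at this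
      exact absurd this (hb.add n).not_mirror
    · refine ⟨n, γ • a, mem_brokenSites.2 ⟨har, had, s1.1 ?_, s2.1 ?_⟩, by rw [hn]; ring⟩
      · rw [hn, show 2 - (1 - a + n * period m) = a + 1 + -n * period m by ring, pass_add]
        exact l2
      · rw [hn, show 1 - (1 - a + n * period m) = a + -n * period m by ring, pass_add]
        exact l1
  · rintro ⟨n, p, hp, rfl⟩
    exact (hcrit p hp).add n

/-- The flow that breaks the left-moving strand at every site gives the unmatched generator, and
flat maps with the same passages and breaks coincide. -/
theorem nonempty_equiv_of_flow (hm : 1 < m) {x y : IdemState m k} {w : Fin m → ℚ}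
    (h : Admissible x y w)
    (hex : (∃ g, ¬ Pass x.carrier y.carrier w g) ∨ ∃ a, brokenPlaces x.carrier y.carrier w a) :
    Nonempty (Homology m k x.carrier y.carrier w ≃ₗ[ZMod 2] ZMod 2) := by
  obtain ⟨f, hd, hr, hu1, hu0, hB⟩ := (h.flow hm hex).exists_lpp hm
  have hup : ∀ g, ((f.up g).ncard : ℤ) = passNum x.carrier y.carrier w g := by
    intro g
    rw [passNum]
    split_ifs with hg
    · rw [hu1 g hg]; rfl
    · rw [hu0 g hg]; rfl
  have hf : f ∈ LPP.gens x.carrier y.carrier w := by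
    refine ⟨hd, hr, funext fun i => ?_⟩
    change f.mult ((i : ℕ) + 1) = w i
    obtain ⟨h1, h2⟩ := h.passNum_index hm i
    rw [← hup] at h1 h2
    push_cast at h1 h2
    rw [LPP.mult_eq hm, h1, h2]
    ring
  have ho : openSites (brokenSites x.carrier y.carrier w) (Sum.inl f : LPP m k ⊕ LPP m k) = ∅ := by
    rw [Set.eq_empty_iff_forall_notMem]
    rintro p ⟨hp, hb⟩
    refine hb (hB _ ⟨0, p, hp, by ring⟩ ?_)
    obtain ⟨hx, hy, -, h2⟩ := mem_brokenSites.1 hp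
    exact (h.pass_mirror_iff hm hx hy).2.2 h2
  have hP := h.sites hm
  refine hP.nonempty_equiv hm (Or.inl ⟨f, hf, rfl⟩) ho ?_
  rintro t (⟨f', hf', rfl⟩ | ⟨b, hb, rfl⟩) ht
  · refine congrArg Sum.inl (LPP.eq_of_flat hm (hP.flat _ (Or.inl ⟨f', hf', rfl⟩)).inl
      (hP.flat _ (Or.inl ⟨f, hf, rfl⟩)).inl (hf'.1.trans hf.1.symm) (fun g => ?_) fun a => ?_)
    · have h1 := level_eq_passNum hm h (t := Sum.inl f') (Or.inl ⟨f', hf', rfl⟩) g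
      rw [← hup] at h1
      simp only [level] at h1
      exact_mod_cast h1
    · rw [broken_iff_of_openSites_eq_empty hm h hf' ht, broken_iff_of_openSites_eq_empty hm h hf ho]
  · exfalso
    -- A multiple of `X` forces every half-integer to be passed. By `hex` there is then a site, and
    -- it is open because a multiple of `X` has no breaks.
    have hall : ∀ g, Pass x.carrier y.carrier w g := by
      intro g
      have h1 := level_eq_passNum hm h (t := Sum.inr b) (Or.inr ⟨b, hb, rfl⟩) g
      by_contra hc
      rw [passNum, if_neg hc] at h1
      simp only [level] at h1
      omega
    rcases hex with ⟨g, hg⟩ | ⟨a, n, p, hp, -⟩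
    · exact hg (hall g)
    · exact Set.notMem_empty p (ht ▸ ⟨hp, fun h => h⟩)

/-- If everything is passed, a point of `x` also lies in `y` and is a site. Without sites both
states are empty, and `X` times the empty permutation is the only generator: the one case in which
the critical generator involves `X`. -/
theorem nonempty_equiv_of_no_flow (hm : 1 < m) {x y : IdemState m k} {w : Fin m → ℚ}
    (h : Admissible x y w) (hu : ∀ g, Pass x.carrier y.carrier w g)
    (hB : ∀ a, ¬ brokenPlaces x.carrier y.carrier w a) :
    Nonempty (Homology m k x.carrier y.carrier w ≃ₗ[ZMod 2] ZMod 2) := by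
  have hnum : ∀ g, passNum x.carrier y.carrier w g = 1 := fun g => if_pos (hu g)
  have hx : x.carrier = ∅ := by
    rw [Finset.eq_empty_iff_forall_notMem]
    intro p hp
    have hr := Finset.mem_Icc.1 (x.subset hp)
    obtain ⟨a1, a2, -⟩ := h.passNum_site hm hr.1 hr.2
    rw [countDiff_succ, ← a1, hnum, hnum, hnum, hnum, if_pos hp] at a2
    have hy : p ∈ y.carrier := by
      by_contra hc
      rw [if_neg hc] at a2
      omega
    exact hB (1 - p) ⟨0, p, mem_brokenSites.2 ⟨hp, hy, hu _, hu _⟩, by ring⟩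
  have hk : k = 0 := by rw [← x.card, hx, Finset.card_empty]
  have hy : y.carrier = ∅ := by rw [← Finset.card_eq_zero, y.card, hk]
  have hdom : ∀ {w' : Fin m → ℚ} {f : LPP m k}, f ∈ LPP.gens x.carrier y.carrier w' →
      ∀ l, l ∉ f.dom := by
    rintro w' f hf l hl
    rw [hf.1, hy] at hl
    obtain ⟨a, ha, -⟩ := hl
    exact Finset.notMem_empty _ ha
  have hw1 : ∀ i, w i = 1 := fun i => by
    obtain ⟨h1, h2⟩ := h.passNum_index hm i
    rw [hnum] at h1 h2
    push_cast at h1 h2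
    linarith
  have hid : LPP.idState hm x ∈ LPP.gens x.carrier y.carrier (w - 1) := by
    refine ⟨by rw [LPP.dom_idState, hx, hy], LPP.ran_idState hm x, funext fun i => ?_⟩
    have hup : ∀ g, (LPP.idState hm x).up g = ∅ := by
      intro g
      rw [Set.eq_empty_iff_forall_notMem]
      rintro l ⟨hl, -⟩
      rw [LPP.dom_idState, hx] at hl
      obtain ⟨a, ha, -⟩ := hl
      exact Finset.notMem_empty _ ha
    change (LPP.idState hm x).mult ((i : ℕ) + 1) = w i - 1
    rw [LPP.mult_eq hm, hup, hup, hw1]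
    simp
  refine (h.sites hm).nonempty_equiv hm (c := Sum.inr (LPP.idState hm x)) (Or.inr ⟨_, hid, rfl⟩)
    ?_ ?_
  · rw [Set.eq_empty_iff_forall_notMem]
    rintro p ⟨hp, -⟩
    exact hB (1 - p) ⟨0, p, hp, by ring⟩
  · rintro t (⟨f, hf, rfl⟩ | ⟨b, hb, rfl⟩) -
    · exfalso
      have h1 := level_eq_passNum hm h (t := Sum.inl f) (Or.inl ⟨f, hf, rfl⟩) 0
      rw [hnum] at h1
      simp only [level] at h1
      obtain ⟨l, hl, -⟩ := (Set.ncard_pos (f.finite_up hm 0)).1 (by omega)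
      exact hdom hf l hl
    · refine congrArg Sum.inr (LPP.ext_val ?_ fun l hl => absurd hl (hdom hb l))
      exact hb.1.trans hid.1.symm

theorem nonempty_equiv_of_admissible (hm : 1 < m) {x y : IdemState m k} {w : Fin m → ℚ}
    (h : Admissible x y w) : Nonempty (Homology m k x.carrier y.carrier w ≃ₗ[ZMod 2] ZMod 2) := by
  by_cases hex : (∃ g, ¬ Pass x.carrier y.carrier w g) ∨ ∃ a, brokenPlaces x.carrier y.carrier w a
  · exact nonempty_equiv_of_flow hm h hex
  · push Not at hex
    exact nonempty_equiv_of_no_flow hm h hex.1 hex.2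

end QuoX

end PongAlg

end

theorem mainTheorem8 (m k : ℕ) (hm : 1 < m) (hk : k < m)
    (x y : PongAlg.IdemState m k) (w : Fin m → ℚ) (hw : PongAlg.Compatible x y w) :
    (¬ (PongAlg.Interleaved x y ∧ PongAlg.BoundedWeight w ∧ PongAlg.ConstantOffStates x y w) →
      Subsingleton (PongAlg.QuoX.Homology m k x.carrier y.carrier w)) ∧
    (PongAlg.Interleaved x y ∧ PongAlg.BoundedWeight w ∧ PongAlg.ConstantOffStates x y w →
      Nonempty (PongAlg.QuoX.Homology m k x.carrier y.carrier w ≃ₗ[ZMod 2] ZMod 2)) := by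
  exact ⟨PongAlg.QuoX.subsingleton_of_not_conditions hm,
    fun h => PongAlg.QuoX.nonempty_equiv_of_admissible hm ⟨hw, h.1, h.2.1, h.2.2⟩⟩
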